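/- Setting. Let $r$ be a natural number, $\bar k=2r+1-k$, let $E_{jk}$ be the $2r\times 2r$ matrix units, and for $1\le i<j\le r$, $1\le k\le r$ put $h_k=E_{kk}-E_{\bar k\bar k}$, $E_{e_i-e_j}=E_{ij}-(-1)^{i+j}E_{\bar j\bar i}$, $E_{e_i+e_j}=E_{i\bar j}-(-1)^{i+j}E_{j\bar i}$, $E_{-\alpha}=E_\alpha^T$ (the Cartan–Weyl basis of $so(2r)$). Let $\Delta_0^+=\{e_i-e_j\}_{i<j}$, $\Delta_1^+=\{e_i+e_j\}_{i<j}$, $J=\sum_k h_k$, and $$P_0=\sum_k h_k\otimes h_k+\sum_{\alpha\in\Delta_0^+}(E_\alpha\otimes E_{-\alpha}+E_{-\alpha}\otimes E_\alpha),\quad P=P_0+\sum_{\alpha\in\Delta_1^+}(E_\alpha\otimes E_{-\alpha}+E_{-\alpha}\otimes E_\alpha),$$ $$\Pi_{0J}=\sum_{\alpha\in\Delta_1^+}(E_\alpha\otimes E_{-\alpha}-E_{-\alpha}\otimes E_\alpha),\qquad r(\lambda)=-\frac{P}{2\lambda}.$$ Let $Q(x)=\sum_{\alpha\in\Delta_1^+}(q_\alpha(x)E_\alpha+p_\alpha(x)E_{-\alpha})$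 with independent complex-valued smooth $q_\alpha,p_\alpha$, and $U(x,\lambda)=Q(x)-\lambda J$. For functionals $F,G$ of $Q$ with square-integrable variational derivatives let $$\{F,G\}=\mathrm i\int\sum_{\alpha\in\Delta_1^+}\Big(\frac{\delta F}{\delta q_\alpha(x)}\frac{\delta G}{\delta p_\alpha(x)}-\frac{\delta F}{\delta p_\alpha(x)}\frac{\delta G}{\delta q_\alpha(x)}\Big)dx,$$ that is, $\{q_\alpha(x),p_\beta(y)\}=\mathrm i\,\delta_{\alpha\beta}\,\delta(x-y)$; the integral is over $[-L,L]$ for $2L$-periodic $Q$, and over $\mathbb R$ for $Q$ in the Schwartz class. Write $\{A\mathop{\otimes}_{'}B\}$ for the array of the brackets $\{A_{ab},B_{cd}\}$, arranged as in $A\otimes B$. Let $T(x,y,\lambda)$ be the fundamental solution of $\mathrm i\,\partial_xT+U(x,\lambda)T=0$, $T(y,y,\lambda)=1$ (it exists for every continuous $Q$), and for $L>0$ let $T_L(\lambda)=T(L,-L,\lambda)$ be the transition matrix from $-L$ to $L$. Let $a_L^+,a_L^-$ be the upper left and lower right $r\times r$ blocks of $T_L$, and $c_L^-,c_L^+$ those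 of $T_L^{-1}$. All brackets asserted below include the assertion that the variational derivatives exist. (1) For all $L>0$, all smooth $2L$-periodic $Q$, all complex $\lambda\ne\mu$ and $-L\le y\le x\le L$, $$\{T(x,y,\lambda)\mathop{\otimes}_{'}T(x,y,\mu)\}=[r(\lambda-\mu),T(x,y,\lambda)\otimes T(x,y,\mu)],$$ in particular $\{T_L(\lambda)\mathop{\otimes}_{'}T_L(\mu)\}=[r(\lambda-\mu),T_L(\lambda)\otimes T_L(\mu)]$. (2) For all $L>0$, all smooth $2L$-periodic $Q$ and all complex $\lambda,\mu$, $\{\det X(\lambda),\det X(\mu)\}=0$ for each of $X=a_L^+,\ c_L^-,\ a_L^-,\ c_L^+$. (3) There are polynomials $\rho_k,\sigma_k,\beta_k,\gamma_k$ ($k\ge1$) in the $q_\alpha,p_\alpha$ and their $x$-derivatives, depending only on $r$, with $\beta_k,\gamma_k$ free of constant term, such that for all $L>0$ and all smooth $2L$-periodic $Q$ the integrals $I_{L,k}=\int_{-L}^L\rho_k\,dx$, $J_{L,k}=\int_{-L}^L\sigma_k\,dx$ and the end-point terms $B_k=\beta_k|_{x=L}$, $C_k=\gamma_k|_{x=L}$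 satisfy $$\ln\big(e^{2\mathrm ir\lambda L}\det a_L^+\big)\sim\sum_{k\ge1}(I_{L,k}+B_k)\lambda^{-k},\qquad -\ln\big(e^{-2\mathrm ir\lambda L}\det c_L^-\big)\sim\sum_{k\ge1}(I_{L,k}-B_k)\lambda^{-k},$$ $$\ln\big(e^{2\mathrm ir\lambda L}\det c_L^+\big)\sim\sum_{k\ge1}(J_{L,k}+C_k)\lambda^{-k},\qquad -\ln\big(e^{-2\mathrm ir\lambda L}\det a_L^-\big)\sim\sum_{k\ge1}(J_{L,k}-C_k)\lambda^{-k}$$ as asymptotic series for $\lambda\to\infty$ in closed sectors $\{\operatorname{Im}\lambda\ge\delta|\lambda|\}$ ($a^+,c^+$), respectively $\{\operatorname{Im}\lambda\le-\delta|\lambda|\}$ ($a^-,c^-$), for every $\delta>0$. (So $B_k=C_k=0$ if $Q$ vanishes to infinite order at $\pm L$.) Moreover $\{I_{L,k},I_{L,p}\}=\{I_{L,k},J_{L,p}\}=\{J_{L,k},J_{L,p}\}=0$ for all $k,p\ge1$. For every Schwartz $Q$ and $k\ge 1$ the limits $I_k=\lim_{L\to\infty}I_{L,k}$ and $J_k=\lim_{L\to\infty}J_{L,k}$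 exist, and as functionals on the Schwartz class they satisfy $\{I_k,I_p\}=\{I_k,J_p\}=\{J_k,J_p\}=0$ for all $k,p\ge1$. (4) Let $Q$ be in the Schwartz class, $\lambda$ real and $E(x,\lambda)=e^{-\mathrm i\lambda Jx}$. The Jost solutions $\psi,\phi$ of $\mathrm i\,\partial_x\Psi+U\Psi=0$ with $\psi E^{-1}\to1$ at $+\infty$ and $\phi E^{-1}\to1$ at $-\infty$ exist, $\phi=\psi T(\lambda)$ with $T(\lambda)$ independent of $x$, and $E(x,\lambda)^{-1}T(x,y,\lambda)E(y,\lambda)\to T(\lambda)$ as $x\to\infty$, $y\to-\infty$. As distributions in the real variables $\lambda,\mu$ (that is, for the matrix elements of $T$ smeared with Schwartz functions of $\lambda$ and of $\mu$), $$\{T(\lambda)\mathop{\otimes}_{'}T(\mu)\}=r_+(\lambda-\mu)\,T(\lambda)\otimes T(\mu)-T(\lambda)\otimes T(\mu)\,r_-(\lambda-\mu),$$ $$r_\pm(\lambda-\mu)=-\frac12\,\mathrm{p.v.}\frac{1}{\lambda-\mu}\,P_0\ \mp\ \frac{\mathrm i\pi}{2}\,\delta(\lambda-\mu)\,\Pi_{0J}.$$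 -/

import Mathlib

open scoped Kronecker ContDiff Topology

noncomputable section

namespace DIII

/-! ### The algebra so(2r) in its typical representation -/

/-- Row and column labels `1, …, 2r`: `Sum.inl k` is the label `k` of the upper block and
`Sum.inr k` the label `r + k` of the lower block. -/
abbrev Idx (r : ℕ) := Fin r ⊕ Fin r

abbrev Mat (r : ℕ) := Matrix (Idx r) (Idx r) ℂ

/-- Matrices acting on the tensor square; `A ⊗ₖ B` has the entry `A a b * B c d` at
position `(a, c), (b, d)`. -/
abbrev Mat2 (r : ℕ) := Matrix (Idx r × Idx r) (Idx r × Idx r) ℂ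

/-- The label `2r + 1 - k` for `k ≤ r`. -/
def bar {r : ℕ} (k : Fin r) : Idx r := Sum.inr k.rev

/-- Pairs `i < j`; they label the roots `e_i - e_j` as well as the roots `e_i + e_j`. -/
abbrev Pairs (r : ℕ) := {p : Fin r × Fin r // p.1 < p.2}

/-- The Cartan generator `h_k`. -/
def cartan {r : ℕ} (k : Fin r) : Mat r :=
  Matrix.single (Sum.inl k) (Sum.inl k) 1 - Matrix.single (bar k) (bar k) 1

/-- The Weyl generator of the root `e_i - e_j`; the one of the opposite root is the transpose. -/
def weylMinus {r : ℕ} (p : Pairs r) : Mat r :=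
  Matrix.single (Sum.inl p.1.1) (Sum.inl p.1.2) 1 -
    (-1 : ℂ) ^ ((p.1.1 : ℕ) + (p.1.2 : ℕ)) • Matrix.single (bar p.1.2) (bar p.1.1) 1

/-- The Weyl generator of the root `e_i + e_j`; the one of the opposite root is the transpose. -/
def weylPlus {r : ℕ} (p : Pairs r) : Mat r :=
  Matrix.single (Sum.inl p.1.1) (bar p.1.2) 1 -
    (-1 : ℂ) ^ ((p.1.1 : ℕ) + (p.1.2 : ℕ)) • Matrix.single (Sum.inl p.1.2) (bar p.1.1) 1

/-- `J = h_1 + … + h_r`. -/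
def J (r : ℕ) : Mat r := ∑ k, cartan k

/-- `∑ h_k ⊗ h_k` plus the sum over the positive roots `e_i - e_j` of
`E_α ⊗ E_{-α} + E_{-α} ⊗ E_α`. -/
def casimirZero (r : ℕ) : Mat2 r :=
  ∑ k : Fin r, cartan k ⊗ₖ cartan k +
    ∑ p : Pairs r, (weylMinus p ⊗ₖ (weylMinus p).transpose +
      (weylMinus p).transpose ⊗ₖ weylMinus p)

/-- The matrix `P`. -/
def casimir (r : ℕ) : Mat2 r :=
  casimirZero r + ∑ p : Pairs r, (weylPlus p ⊗ₖ (weylPlus p).transpose +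
    (weylPlus p).transpose ⊗ₖ weylPlus p)

/-- The matrix `Π_{0J}`, a sum over the roots `e_i + e_j`. -/
def piZeroJ (r : ℕ) : Mat2 r :=
  ∑ p : Pairs r, (weylPlus p ⊗ₖ (weylPlus p).transpose -
    (weylPlus p).transpose ⊗ₖ weylPlus p)

/-- The classical r-matrix `r(z) = -P / (2 z)`. -/
def rMatrix (r : ℕ) (z : ℂ) : Mat2 r := (-(1 / (2 * z))) • casimir r

/-! ### Potentials, phase spaces and the Poisson bracket -/

/-- Labels of the field components: `Sum.inl p` for `q_p`, `Sum.inr p` for `p_p`. -/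
abbrev Coord (r : ℕ) := Pairs r ⊕ Pairs r

abbrev Potential (r : ℕ) := ℝ → Coord r → ℂ

/-- `Q(x)`, the sum of `q_α(x) E_α + p_α(x) E_{-α}` over the roots `α = e_i + e_j`. -/
def Q {r : ℕ} (u : Potential r) (x : ℝ) : Mat r :=
  ∑ p : Pairs r, (u x (Sum.inl p) • weylPlus p + u x (Sum.inr p) • (weylPlus p).transpose)

/-- `U(x, z) = Q(x) - z J`. -/
def U {r : ℕ} (u : Potential r) (z : ℂ) (x : ℝ) : Mat r := Q u x - z • J r

/-- Smooth potentials with `Q(x + 2L) = Q(x)`. -/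
def periodicSpace (r : ℕ) (L : ℝ) : Set (Potential r) :=
  {u | ContDiff ℝ ∞ u ∧ Function.Periodic u (2 * L)}

/-- Smooth potentials on the line that vanish rapidly at both ends. -/
def schwartzSpace (r : ℕ) : Set (Potential r) :=
  {u | ∃ s : SchwartzMap ℝ (Coord r → ℂ), ∀ x, u x = s x}

/-- `g` is the variational derivative of `F` at `u`: the components of `g` are
`δF/δq_α(x)` and `δF/δp_α(x)`. Variations run over `M` and `ν` is the measure on the space
of the `x`. -/
def HasVarDeriv {r : ℕ} (M : Set (Potential r)) (ν : MeasureTheory.Measure ℝ)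
    (F : Potential r → ℂ) (u g : Potential r) : Prop :=
  MeasureTheory.MemLp g 2 ν ∧
    ∀ v ∈ M, HasDerivAt (fun ε : ℂ => F (u + ε • v)) (∫ x, ∑ c, g x c * v x c ∂ν) 0

/-- `F` and `G` have variational derivatives at `u` and `{F, G}(u) = c` for the canonical bracket
`{q_α(x), p_β(y)} = i δ_{αβ} δ(x - y)`. -/
def HasBracket {r : ℕ} (M : Set (Potential r)) (ν : MeasureTheory.Measure ℝ)
    (F G : Potential r → ℂ) (u : Potential r) (c : ℂ) : Prop :=
  ∃ f g : Potential r, HasVarDeriv M ν F u f ∧ HasVarDeriv M ν G u g ∧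
    c = Complex.I * ∫ x, ∑ p : Pairs r,
      (f x (Sum.inl p) * g x (Sum.inr p) - f x (Sum.inr p) * g x (Sum.inl p)) ∂ν

/-- The bracket of functionals of `2L`-periodic potentials. -/
def HasPeriodicBracket {r : ℕ} (L : ℝ) (F G : Potential r → ℂ) (u : Potential r) (c : ℂ) : Prop :=
  HasBracket (periodicSpace r L) (MeasureTheory.volume.restrict (Set.Ioc (-L) L)) F G u c

/-- The bracket of functionals of rapidly vanishing potentials on the line. -/
def HasLineBracket {r : ℕ} (F G : Potential r → ℂ) (u : Potential r) (c : ℂ) : Prop :=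
  HasBracket (schwartzSpace r) MeasureTheory.volume F G u c

/-! ### Fundamental solution, monodromy matrix, scattering matrix -/

/-- `i dΨ/dx + U(x, z) Ψ = 0` on the whole line. -/
def IsSolution {r : ℕ} (u : Potential r) (z : ℂ) (Ψ : ℝ → Mat r) : Prop :=
  ∀ x a b, HasDerivAt (fun t => Ψ t a b) (Complex.I * (U u z x * Ψ x) a b) x

/-- The defining property of `x ↦ T(x, y, z)`. -/
def IsTransition {r : ℕ} (u : Potential r) (z : ℂ) (y : ℝ) (Ψ : ℝ → Mat r) : Prop :=
  IsSolution u z Ψ ∧ Ψ y = 1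

/-- The fundamental solution `T(x, y, z)`. -/
def transition {r : ℕ} (u : Potential r) (x y : ℝ) (z : ℂ) : Mat r :=
  Classical.epsilon (IsTransition u z y) x

/-- The monodromy matrix `T_L(z)`, the transition from `-L` to `L`. -/
def monodromy {r : ℕ} (L : ℝ) (z : ℂ) (u : Potential r) : Mat r := transition u L (-L) z

/-- The blocks `a⁺` and `a⁻` on the diagonal of `T`, and `c⁻` and `c⁺` on that of `T⁻¹`. -/
def aPlus {r : ℕ} (T : Mat r) : Matrix (Fin r) (Fin r) ℂ := T.toBlocks₁₁

def aMinus {r : ℕ} (T : Mat r) : Matrix (Fin r) (Fin r) ℂ := T.toBlocks₂₂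

def cMinus {r : ℕ} (T : Mat r) : Matrix (Fin r) (Fin r) ℂ := (T⁻¹).toBlocks₁₁

def cPlus {r : ℕ} (T : Mat r) : Matrix (Fin r) (Fin r) ℂ := (T⁻¹).toBlocks₂₂

/-- `E(x, z) = exp(-i z J x)`. -/
def E (r : ℕ) (x : ℝ) (z : ℂ) : Mat r := NormedSpace.exp ((-(Complex.I * z * x)) • J r)

/-- The Jost solution `ψ`, normalised at `+∞`. -/
def IsJostRight {r : ℕ} (u : Potential r) (t : ℝ) (Ψ : ℝ → Mat r) : Prop :=
  IsSolution u t Ψ ∧ Filter.Tendsto (fun x => Ψ x * (E r x t)⁻¹) Filter.atTop (𝓝 1)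

/-- The Jost solution `φ`, normalised at `-∞`. -/
def IsJostLeft {r : ℕ} (u : Potential r) (t : ℝ) (Ψ : ℝ → Mat r) : Prop :=
  IsSolution u t Ψ ∧ Filter.Tendsto (fun x => Ψ x * (E r x t)⁻¹) Filter.atBot (𝓝 1)

def jostRight {r : ℕ} (u : Potential r) (t : ℝ) : ℝ → Mat r := Classical.epsilon (IsJostRight u t)

def jostLeft {r : ℕ} (u : Potential r) (t : ℝ) : ℝ → Mat r := Classical.epsilon (IsJostLeft u t)

/-- The scattering matrix `T(t) = ψ(x, t)⁻¹ φ(x, t)` for real `t` (the value does not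
depend on `x`). -/
def scattering {r : ℕ} (u : Potential r) (t : ℝ) : Mat r := (jostRight u t 0)⁻¹ * jostLeft u t 0

/-- The matrix element `T_{ab}` smeared with a test function. -/
def smeared {r : ℕ} (h : SchwartzMap ℝ ℂ) (a b : Idx r) (u : Potential r) : ℂ :=
  ∫ t : ℝ, h t * scattering u t a b

/-! ### The distributions `r_±`

`r_±(s - t) = PV 1/(s - t) • rPV + δ(s - t) • rDelta_±`. -/

def rPV (r : ℕ) : Mat2 r := (-(1 / 2 : ℂ)) • casimirZero r

def rDeltaPlus (r : ℕ) : Mat2 r := (-(Complex.I * Real.pi / 2)) • piZeroJ r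

def rDeltaMinus (r : ℕ) : Mat2 r := (Complex.I * Real.pi / 2) • piZeroJ r

/-- `S` is the principal value of the double integral of `K(s, t) / (s - t)`. -/
def HasPV (K : ℝ → ℝ → ℂ) (S : ℂ) : Prop :=
  Filter.Tendsto
    (fun ε : ℝ => ∫ w in {w : ℝ × ℝ | ε < |w.1 - w.2|}, K w.1 w.2 / ((w.1 : ℂ) - (w.2 : ℂ)))
    (𝓝[>] 0) (𝓝 S)

/-- The pairing of the matrix element `(a, c), (b, d)` of the distribution
`r_+(s - t) T(s) ⊗ T(t) - T(s) ⊗ T(t) r_-(s - t)` with `h(s) k(t)` is `S`. -/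
def HasRPairing {r : ℕ} (T : ℝ → Mat r) (h k : SchwartzMap ℝ ℂ) (a b c d : Idx r) (S : ℂ) : Prop :=
  ∃ S₀ : ℂ,
    HasPV (fun s t => h s * k t *
      (rPV r * (T s ⊗ₖ T t) - (T s ⊗ₖ T t) * rPV r) (a, c) (b, d)) S₀ ∧
    S = S₀ + ∫ t : ℝ, h t * k t *
      (rDeltaPlus r * (T t ⊗ₖ T t) - (T t ⊗ₖ T t) * rDeltaMinus r) (a, c) (b, d)

/-! ### Local functionals and asymptotic series -/

/-- Polynomials in the field components and their `x`-derivatives; the variable `(c, n)` stands for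
the `n`-th derivative of the component `c`. -/
abbrev DiffPoly (r : ℕ) := MvPolynomial (Coord r × ℕ) ℂ

def DiffPoly.evalAt {r : ℕ} (ρ : DiffPoly r) (u : Potential r) (x : ℝ) : ℂ :=
  MvPolynomial.eval (fun c => iteratedDeriv c.2 (fun t => u t c.1) x) ρ

/-- The functional with density `ρ` on `[-L, L]`. -/
def localIntegral {r : ℕ} (ρ : DiffPoly r) (L : ℝ) (u : Potential r) : ℂ :=
  ∫ x in (-L)..L, ρ.evalAt u x

/-- `f(z) ~ ∑_{k ≥ 1} c_k z^{-k}` along the filter `l`. -/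
def HasExpansion (l : Filter ℂ) (f : ℂ → ℂ) (c : ℕ → ℂ) : Prop :=
  ∀ N : ℕ, (fun z => f z - ∑ k ∈ Finset.Icc 1 N, c k / z ^ k) =O[l] (fun z => 1 / z ^ (N + 1))

/-- `z → ∞` in a closed sector inside the open upper half-plane. -/
def upperSector (δ : ℝ) : Filter ℂ :=
  Bornology.cobounded ℂ ⊓ Filter.principal {z | δ * ‖z‖ ≤ z.im}

/-- `z → ∞` in a closed sector inside the open lower half-plane. -/
def lowerSector (δ : ℝ) : Filter ℂ :=
  Bornology.cobounded ℂ ⊓ Filter.principal {z | δ * ‖z‖ ≤ -z.im}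

end DIII

end

open DIII

/-! Everything rests on one identity, `rMatrix_comm_U`: the commutator of r(λ-μ) with U(x,λ)⊗1 +
1⊗U(x,μ) is -Π_{0J}. Indeed P is the split Casimir tensor of so(2r), so it commutes with X⊗1 + 1⊗X
for X in the algebra (`casimir_comm`), while U(λ) - U(μ) = -(λ-μ)J cancels the pole of r and leaves
a multiple of [P, J⊗1] = -2Π_{0J} (`casimir_J`). The Poisson tensor of the fields is Π_{0J} as well
(`sum_gen_mul_sub`). Hence the integrand of the bracket of two transition matrices is the
s-derivative of (T(x,s)⊗T(x,s)) r (T(s,y)⊗T(s,y)), and the bracket is the difference of its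
end-point values (`pairing_transGrad`). That a variational derivative exists follows from variation
of constants with a quadratic remainder (`norm_flow_add_sub_sub_le`).

P is the flip minus a rank-one operator. On one diagonal block the rank-one part drops out, and
contracting the flip with cofactors gives det A · det B twice with opposite signs, so the
determinants commute (`pairing_detGrad`). Since T preserves the invariant bilinear form, det c⁻ =
det a⁻ and det c⁺ = det a⁺ (`det_toBlocks_inv`); therefore σ = ρ and γ = β will do.

For the expansions, a gauge G = 1 + ∑ W_k λ^{-k} with off-diagonal W_k given by a Riccati recursion
block-diagonalises the linear problem (`gauge_equation`). The densities ρ_k are traces of the upper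
block of the new coefficient. Truncating G leaves an error O(λ^{-N}), so for periodic Q the suitably
scaled T_L is G·V·G⁻¹ up to O(λ^{-N}), where only the upper block of V survives. Its determinant is
det V_{11} / det G, and -ln det G is the end-point term (`det_toBlocks_gauge`,
`isBigO_log_det_scaledFlow`).

The involution of the integrals is proved directly, without expanding brackets of logarithms. The
gradient of I_k is i tr(E_α P_k), where the P_k are the coefficients of the projector G e G⁻¹
(`variation_of_gauge`). The Lax equation P_k' = i[Q,P_k] - i[J,P_{k+1}] makes the bracket densities
satisfy ω_{k+1,l} - ω_{k,l+1} = total derivative (`jetEval_omegaPoly_succ`), and the chain ends at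
P_0, which commutes with J. Only the vanishing of integrals of total derivatives matters, so
`IsTame` treats the periodic and the Schwartz case at once.

On the line one passes to the interaction picture, whose coefficient is bounded by ‖Q‖ for every
real λ. Smearing turns the gradients into oscillating integrals of frequency ±2x, which decay like
1/|x| and so lie in L². The bracket over [-N,N] is again a boundary term divided by λ-μ. In it P_0
does not oscillate and gives the principal value, while the other two parts of P carry e^{±2ix(λ-μ)}
at x = ±N and give ±πi δ(λ-μ) as N → ∞ (`tendsto_reg_atTop`, `tendsto_boundaryValue`). -/

noncomputable section
namespace DIII

/-! ### The Casimir tensor -/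

/-- The involution `a ↦ 2r + 1 - a` of the labels. -/
def idxBar {r : ℕ} : Idx r → Idx r := Sum.elim (fun k => Sum.inr k.rev) (fun k => Sum.inl k.rev)

/-- The signs of the antidiagonal matrix that defines the orthogonal group. -/
def eps {r : ℕ} : Idx r → ℂ :=
  Sum.elim (fun k => (-1) ^ (k : ℕ)) (fun k => (-1) ^ (k.rev : ℕ))

@[simp] lemma idxBar_inl {r : ℕ} (k : Fin r) : idxBar (Sum.inl k) = Sum.inr k.rev := rfl
@[simp] lemma idxBar_inr {r : ℕ} (k : Fin r) : idxBar (Sum.inr k) = Sum.inl k.rev := rfl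

@[simp] lemma idxBar_idxBar {r : ℕ} (a : Idx r) : idxBar (idxBar a) = a := by
  rcases a with a | a <;> simp

lemma idxBar_eq_iff {r : ℕ} (a b : Idx r) : idxBar a = b ↔ a = idxBar b :=
  ⟨fun h => by rw [← h, idxBar_idxBar], fun h => by rw [h, idxBar_idxBar]⟩

lemma idxBar_injective {r : ℕ} : Function.Injective (idxBar (r := r)) := fun a b h => by
  rw [← idxBar_idxBar a, h, idxBar_idxBar]

/-- The involution of the labels as an equivalence. -/
def idxBarEquiv (r : ℕ) : Idx r ≃ Idx r := ⟨idxBar, idxBar, idxBar_idxBar, idxBar_idxBar⟩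

@[simp] lemma eps_idxBar {r : ℕ} (a : Idx r) : eps (idxBar a) = eps a := by
  rcases a with a | a <;> simp [eps, -Fin.val_rev]

@[simp] lemma eps_mul_self {r : ℕ} (a : Idx r) : eps a * eps a = 1 := by
  rcases a with a | a <;> simp [eps, ← mul_pow]

/-- The anti-automorphism whose `-1`-eigenspace is the orthogonal algebra. -/
def tilde {r : ℕ} (X : Mat r) : Mat r :=
  Matrix.of fun a b => eps a * eps b * X (idxBar b) (idxBar a)

lemma tilde_apply {r : ℕ} (X : Mat r) (a b : Idx r) :
    tilde X a b = eps a * eps b * X (idxBar b) (idxBar a) := rfl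

lemma tilde_mul {r : ℕ} (X Y : Mat r) : tilde (X * Y) = tilde Y * tilde X := by
  ext a b
  rw [tilde_apply, Matrix.mul_apply, Matrix.mul_apply, Finset.mul_sum,
    ← (idxBarEquiv r).sum_comp]
  refine Finset.sum_congr rfl fun c _ => ?_
  simp only [tilde_apply]
  change _ * (X _ (idxBar c) * Y (idxBar c) _) = _
  linear_combination (-(eps a * eps b * X (idxBar b) (idxBar c) * Y (idxBar c) (idxBar a))) *
    eps_mul_self c

@[simp] lemma tilde_one {r : ℕ} : tilde (1 : Mat r) = 1 := by
  ext a b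
  rw [tilde_apply, Matrix.one_apply, Matrix.one_apply]
  by_cases h : a = b
  · subst h; simp
  · rw [if_neg h, if_neg (fun h' => h (idxBar_injective h').symm), mul_zero]

lemma tilde_sub {r : ℕ} (X Y : Mat r) : tilde (X - Y) = tilde X - tilde Y := by
  ext a b; simp [tilde_apply, mul_sub]

lemma tilde_smul {r : ℕ} (c : ℂ) (X : Mat r) : tilde (c • X) = c • tilde X := by
  ext a b; simp [tilde_apply]; ring

lemma tilde_sum {r : ℕ} {ι : Type*} (s : Finset ι) (X : ι → Mat r) :
    tilde (∑ i ∈ s, X i) = ∑ i ∈ s, tilde (X i) := by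
  ext a b; simp [tilde_apply, Matrix.sum_apply, Finset.mul_sum]

/-- The elements of the orthogonal algebra attached to the matrix units. -/
def soUnit {r : ℕ} (a b : Idx r) : Mat r :=
  Matrix.single a b 1 - (eps a * eps b) • Matrix.single (idxBar b) (idxBar a) 1

lemma soUnit_apply {r : ℕ} (a b x y : Idx r) :
    soUnit a b x y = (if a = x ∧ b = y then 1 else 0) -
      eps a * eps b * (if idxBar b = x ∧ idxBar a = y then 1 else 0) := by
  simp [soUnit, Matrix.single_apply]

lemma soUnit_transpose {r : ℕ} (a b : Idx r) : (soUnit a b).transpose = soUnit b a := by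
  ext x y
  simp only [Matrix.transpose_apply, soUnit_apply, and_comm, mul_comm]

lemma soUnit_idxBar {r : ℕ} (a b : Idx r) :
    soUnit (idxBar b) (idxBar a) = (-(eps a * eps b)) • soUnit a b := by
  ext x y
  simp only [Matrix.smul_apply, soUnit_apply, eps_idxBar, idxBar_idxBar, smul_eq_mul]
  linear_combination (-(eps a * eps a * (if idxBar b = x ∧ idxBar a = y then 1 else 0))) *
    eps_mul_self b - (if idxBar b = x ∧ idxBar a = y then 1 else 0) * eps_mul_self a

lemma cartan_eq_soUnit {r : ℕ} (k : Fin r) : cartan k = soUnit (Sum.inl k) (Sum.inl k) := by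
  simp [cartan, soUnit, bar]

lemma weylMinus_eq_soUnit {r : ℕ} (p : Pairs r) :
    weylMinus p = soUnit (Sum.inl p.1.1) (Sum.inl p.1.2) := by
  simp [weylMinus, soUnit, bar, eps, pow_add]

lemma weylPlus_eq_soUnit {r : ℕ} (p : Pairs r) :
    weylPlus p = soUnit (Sum.inl p.1.1) (bar p.1.2) := by
  simp [weylPlus, soUnit, bar, eps, pow_add, -Fin.val_rev]

lemma tilde_single {r : ℕ} (a b : Idx r) : tilde (Matrix.single a b 1) =
    (eps a * eps b) • Matrix.single (idxBar b) (idxBar a) 1 := by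
  ext x y
  simp only [tilde_apply, Matrix.single_apply, Matrix.smul_apply, smul_eq_mul]
  by_cases h : a = idxBar y ∧ b = idxBar x
  · obtain ⟨rfl, rfl⟩ := h
    simp [mul_comm]
  · rw [if_neg h, if_neg (fun h' => h ⟨((idxBar_eq_iff _ _).1 h'.2), ((idxBar_eq_iff _ _).1 h'.1)⟩)]
    simp

lemma tilde_soUnit {r : ℕ} (a b : Idx r) : tilde (soUnit a b) = -soUnit a b := by
  rw [soUnit, tilde_sub, tilde_smul, tilde_single, tilde_single]
  simp only [eps_idxBar, idxBar_idxBar, smul_smul]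
  rw [show eps a * eps b * (eps b * eps a) = 1 by
    linear_combination eps a * eps a * eps_mul_self b + eps_mul_self a]
  simp

/-- The diagonal together with the pairs i < j and their reversals exhausts the square. This turns a
sum over Cartan and root generators into a double sum over labels. -/
lemma sum_univ_add_sum_pairs {r : ℕ} {M : Type*} [AddCommMonoid M] (f : Fin r → Fin r → M) :
    ∑ k, f k k + ∑ p : Pairs r, (f p.1.1 p.1.2 + f p.1.2 p.1.1) = ∑ i, ∑ j, f i j := by
  have h1 : ∀ g : Fin r × Fin r → M, ∑ p : Pairs r, g p.1 =
      ∑ q ∈ Finset.univ.filter (fun q : Fin r × Fin r => q.1 < q.2), g q := fun g => by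
    rw [← Finset.sum_subtype_eq_sum_filter]
    refine Finset.sum_congr ?_ fun _ _ => rfl
    ext; simp
  rw [h1 (fun q => f q.1 q.2 + f q.2 q.1), Finset.sum_add_distrib, ← Fintype.sum_prod_type',
    ← Finset.sum_filter_add_sum_filter_not Finset.univ (fun q : Fin r × Fin r => q.1 < q.2),
    ← Finset.sum_filter_add_sum_filter_not (Finset.univ.filter (fun q : Fin r × Fin r => ¬ q.1 < q.2))
      (fun q : Fin r × Fin r => q.1 = q.2), add_left_comm]
  congr 2
  · refine Finset.sum_bij (fun k _ => (k, k)) (by simp) (by simp) ?_ (by simp)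
    rintro ⟨a, b⟩ h
    simp only [Finset.mem_filter, Finset.mem_univ, true_and] at h
    exact ⟨a, Finset.mem_univ _, by ext <;> simp [h.2]⟩
  · refine Finset.sum_bij (fun q _ => (q.2, q.1)) ?_ ?_ ?_ (by simp)
    · rintro ⟨a, b⟩ h
      simp at h ⊢
      exact ⟨h.le, h.ne'⟩
    · rintro ⟨a, b⟩ _ ⟨c, d⟩ _ h
      simp at h ⊢
      tauto
    · rintro ⟨a, b⟩ h
      simp at h
      exact ⟨(b, a), by simpa using lt_of_le_of_ne h.1 (Ne.symm h.2), rfl⟩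

/-- Every Cartan and root generator is a `soUnit`, and `soUnit a b` agrees up to sign with the unit
attached to the reflected labels. The sum over all ordered pairs of labels therefore meets each term
of P twice. -/
lemma casimir_eq_sum_soUnit (r : ℕ) :
    (2 : ℂ) • casimir r = ∑ a : Idx r, ∑ b, soUnit a b ⊗ₖ soUnit b a := by
  have hsym : ∀ a b : Idx r, soUnit (idxBar b) (idxBar a) ⊗ₖ soUnit (idxBar a) (idxBar b) =
      soUnit a b ⊗ₖ soUnit b a := fun a b => by
    rw [soUnit_idxBar, soUnit_idxBar, Matrix.smul_kronecker, Matrix.kronecker_smul, smul_smul]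
    rw [show -(eps a * eps b) * -(eps b * eps a) = 1 by
      linear_combination eps a * eps a * eps_mul_self b + eps_mul_self a, one_smul]
  have hz : casimirZero r = ∑ i : Fin r, ∑ j : Fin r,
      soUnit (Sum.inl i) (Sum.inl j) ⊗ₖ soUnit (Sum.inl j) (Sum.inl i) := by
    rw [← sum_univ_add_sum_pairs]
    simp only [casimirZero, cartan_eq_soUnit, weylMinus_eq_soUnit, soUnit_transpose]
  -- The unit with labels k and 2r+1-k vanishes, so the double sum over all i, j has no diagonal
  -- terms, in accordance with roots e_i + e_j only for i < j.
  have hd : ∀ k : Fin r, soUnit (Sum.inl k) (bar k) = 0 := fun k => by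
    ext x y
    simp [soUnit_apply, bar, eps, ← pow_add, ← two_mul, -Fin.val_rev]
  have hs : ∀ i j : Fin r, soUnit (Sum.inl j) (bar i) ⊗ₖ soUnit (bar i) (Sum.inl j) =
      soUnit (Sum.inl i) (bar j) ⊗ₖ soUnit (bar j) (Sum.inl i) := fun i j => by
    simpa [bar] using hsym (Sum.inl i) (bar j)
  have hs' : ∀ i j : Fin r, soUnit (bar i) (Sum.inl j) ⊗ₖ soUnit (Sum.inl j) (bar i) =
      soUnit (bar j) (Sum.inl i) ⊗ₖ soUnit (Sum.inl i) (bar j) := fun i j => by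
    simpa [bar] using hsym (bar j) (Sum.inl i)
  have hp : (2 : ℂ) • ∑ p : Pairs r, (weylPlus p ⊗ₖ (weylPlus p).transpose +
      (weylPlus p).transpose ⊗ₖ weylPlus p) = ∑ i : Fin r, ∑ j : Fin r,
      (soUnit (Sum.inl i) (bar j) ⊗ₖ soUnit (bar j) (Sum.inl i) +
        soUnit (bar j) (Sum.inl i) ⊗ₖ soUnit (Sum.inl i) (bar j)) := by
    rw [← sum_univ_add_sum_pairs]
    simp only [hd, weylPlus_eq_soUnit, soUnit_transpose, Matrix.zero_kronecker,
      Matrix.kronecker_zero, add_zero, Finset.sum_const_zero, zero_add, Finset.smul_sum]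
    refine Finset.sum_congr rfl fun p _ => ?_
    rw [two_smul, hs p.1.1 p.1.2, ← hs' p.1.1 p.1.2]
  rw [casimir, smul_add, hp, hz, two_smul, Fintype.sum_sum_type]
  simp only [Fintype.sum_sum_type, Finset.sum_add_distrib]
  have e1 : ∑ i : Fin r, ∑ j : Fin r, soUnit (Sum.inr i) (Sum.inr j) ⊗ₖ
      soUnit (Sum.inr j) (Sum.inr i) = ∑ i : Fin r, ∑ j : Fin r,
      soUnit (Sum.inl i) (Sum.inl j) ⊗ₖ soUnit (Sum.inl j) (Sum.inl i) := by
    rw [Finset.sum_comm, ← Equiv.sum_comp Fin.revPerm]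
    refine Finset.sum_congr rfl fun i _ => ?_
    rw [← Equiv.sum_comp Fin.revPerm]
    exact Finset.sum_congr rfl fun j _ => hsym (Sum.inl i) (Sum.inl j)
  have e2 : ∑ i : Fin r, ∑ j : Fin r, soUnit (Sum.inl i) (Sum.inr j) ⊗ₖ
      soUnit (Sum.inr j) (Sum.inl i) = ∑ i : Fin r, ∑ j : Fin r,
      soUnit (Sum.inl i) (bar j) ⊗ₖ soUnit (bar j) (Sum.inl i) := by
    refine Finset.sum_congr rfl fun i _ => ?_
    rw [← Equiv.sum_comp Fin.revPerm]
    rfl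
  have e3 : ∑ i : Fin r, ∑ j : Fin r, soUnit (Sum.inr i) (Sum.inl j) ⊗ₖ
      soUnit (Sum.inl j) (Sum.inr i) = ∑ i : Fin r, ∑ j : Fin r,
      soUnit (bar j) (Sum.inl i) ⊗ₖ soUnit (Sum.inl i) (bar j) := by
    rw [Finset.sum_comm]
    refine Finset.sum_congr rfl fun i _ => ?_
    rw [← Equiv.sum_comp Fin.revPerm]
    rfl
  rw [e1, e2, e3]
  abel

/-- Contraction with the units gives g - `tilde` g, which is twice the projection onto the
orthogonal algebra. -/
lemma sum_soUnit_mul {r : ℕ} (g : Idx r → Idx r → ℂ) (a b : Idx r) :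
    ∑ x, ∑ y, soUnit x y a b * g x y = g a b - eps a * eps b * g (idxBar b) (idxBar a) := by
  have h : ∀ x y : Idx r, soUnit x y a b * g x y = (if x = a then if y = b then g x y else 0 else 0)
      - (if x = idxBar b then if y = idxBar a then eps a * eps b * g x y else 0 else 0) := by
    intro x y
    simp only [soUnit_apply, idxBar_eq_iff, sub_mul]
    congr 1
    · rw [← ite_and]; split_ifs <;> simp
    · by_cases h1 : x = idxBar b
      · by_cases h2 : y = idxBar a
        · subst h1 h2; simp [mul_comm]
        · simp [h1, h2]
      · simp [h1]
  simp only [h, Finset.sum_sub_distrib, Finset.sum_ite_irrel, Finset.sum_const_zero,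
    Finset.sum_ite_eq', Finset.mem_univ, if_true]

/-- P is the flip of the two tensor factors minus the rank-one operator built from the invariant
bilinear form. -/
lemma casimir_apply {r : ℕ} (a b c d : Idx r) : casimir r (a, c) (b, d) =
    (if a = d ∧ c = b then 1 else 0) -
      eps a * eps b * (if c = idxBar a ∧ d = idxBar b then 1 else 0) := by
  have h := congrFun (congrFun (casimir_eq_sum_soUnit r) (a, c)) (b, d)
  simp only [Matrix.smul_apply, smul_eq_mul, Matrix.sum_apply, Matrix.kroneckerMap_apply] at h
  rw [sum_soUnit_mul (fun x y => soUnit y x c d)] at h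
  simp only [soUnit_apply, eps_idxBar, idxBar_idxBar] at h
  have e1 : (if b = c ∧ a = d then (1 : ℂ) else 0) = if a = d ∧ c = b then 1 else 0 := by
    simp only [and_comm, eq_comm]
  have e2 : (if idxBar a = c ∧ idxBar b = d then (1 : ℂ) else 0) =
      if c = idxBar a ∧ d = idxBar b then 1 else 0 := by
    simp only [eq_comm]
  rw [e1, e2] at h
  linear_combination h / 2 + (if a = d ∧ c = b then (1 : ℂ) else 0) / 2 *
    (eps b * eps b * eps_mul_self a + eps_mul_self b)

/-- Invariance of the Casimir tensor. The flip commutes with X⊗1 + 1⊗X for any X; the rank-one part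
is killed from both sides because the bilinear form is invariant under the algebra. -/
lemma casimir_comm {r : ℕ} (X : Mat r) (hX : tilde X = -X) :
    casimir r * (X ⊗ₖ 1 + 1 ⊗ₖ X) = (X ⊗ₖ 1 + 1 ⊗ₖ X) * casimir r := by
  have hX' : ∀ a b, eps a * eps b * X (idxBar b) (idxBar a) = -X a b := fun a b =>
    congrFun (congrFun hX a) b
  ext ⟨a, c⟩ ⟨b, d⟩
  simp only [Matrix.mul_apply, Fintype.sum_prod_type, Matrix.add_apply, Matrix.kroneckerMap_apply,
    Matrix.one_apply, casimir_apply, mul_add, add_mul, sub_mul, mul_sub, Finset.sum_add_distrib,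
    Finset.sum_sub_distrib, ite_and]
  simp only [mul_ite, ite_mul, mul_one, one_mul, mul_zero, zero_mul, Finset.sum_ite_irrel,
    Finset.sum_const_zero, Finset.sum_ite_eq', Finset.sum_ite_eq, Finset.mem_univ, if_true]
  have hb : ∀ x y : Idx r, x = idxBar y ↔ y = idxBar x := fun x y =>
    eq_comm.trans (idxBar_eq_iff y x)
  simp only [hb c, hb d, Finset.sum_ite_eq', Finset.mem_univ, if_true, eps_idxBar]
  have h1 := hX' (idxBar b) d
  have h2 := hX' c (idxBar a)
  simp only [eps_idxBar, idxBar_idxBar] at h1 h2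
  -- The cases say whether the rank-one part contributes on the left and on the right of the
  -- commutator.
  by_cases hc : a = idxBar c <;> by_cases hd : b = idxBar d
  all_goals simp only [hc, hd, if_true, if_false, eps_idxBar, idxBar_idxBar] at h1 h2 ⊢
  · linear_combination (-eps c * eps d) * h1 + (eps c * eps d) * h2 +
      X (idxBar d) (idxBar d) * eps c * eps d * eps_mul_self d - X (idxBar c) (idxBar c) * eps c * eps d * eps_mul_self c
  · linear_combination (-eps c * eps b) * h1 + eps c * eps d * X (idxBar d) b * eps_mul_self b
  · linear_combination (eps d * eps a) * h2 - X a (idxBar c) * eps c * eps d * eps_mul_self a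
  · ring

/-- The flip contributes tr(AB), the rank-one part tr(A · `tilde` B). -/
lemma trace_casimir_mul {r : ℕ} (A B : Mat r) :
    (casimir r * (A ⊗ₖ B)).trace = (A * (B - tilde B)).trace := by
  simp only [Matrix.trace, Matrix.diag, Matrix.mul_apply, Fintype.sum_prod_type,
    Matrix.kroneckerMap_apply, casimir_apply, sub_mul, Finset.sum_sub_distrib, ite_and,
    Matrix.sub_apply, tilde_apply, mul_sub]
  simp only [mul_ite, ite_mul, mul_one, one_mul, mul_zero, zero_mul, Finset.sum_ite_irrel,
    Finset.sum_const_zero, Finset.sum_ite_eq', Finset.sum_ite_eq, Finset.mem_univ, if_true]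
  congr 1
  · rw [Finset.sum_comm]
  · rw [Finset.sum_comm]
    exact Finset.sum_congr rfl fun x _ => Finset.sum_congr rfl fun y _ => by ring

/-! ### The grading element -/

/-- The diagonal entries of `J`. -/
def sgn {r : ℕ} : Idx r → ℂ := Sum.elim (fun _ => 1) (fun _ => -1)

lemma J_eq_diagonal (r : ℕ) : J r = Matrix.diagonal sgn := by
  ext a b
  rw [J, Matrix.sum_apply]
  rcases a with a | a <;> rcases b with b | b
  · by_cases h : a = b
    · subst h; simp [cartan, bar, Matrix.single_apply, sgn]
    · simp only [cartan, bar, Matrix.sub_apply, Matrix.single_apply]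
      rw [Finset.sum_eq_zero]
      · simp [h]
      · intro k _
        have : ¬ (k = a ∧ k = b) := fun h' => h (h'.1.symm.trans h'.2)
        simp [this]
  · simp [cartan, bar]
  · simp [cartan, bar]
  · by_cases h : a = b
    · subst h; simp [cartan, bar, Matrix.single_apply, sgn, Fin.rev_eq_iff]
    · simp only [cartan, bar, Matrix.sub_apply, Matrix.single_apply]
      rw [Finset.sum_eq_zero]
      · simp [h]
      · intro k _
        have : ¬ (k.rev = a ∧ k.rev = b) := fun h' => h (h'.1.symm.trans h'.2)
        simp [this]

/-- The upper unipotent half of the off-diagonal part of the Casimir tensor. -/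
def piPlus (r : ℕ) : Mat2 r := ∑ p : Pairs r, weylPlus p ⊗ₖ (weylPlus p).transpose

/-- The lower unipotent half of the off-diagonal part of the Casimir tensor. -/
def piMinus (r : ℕ) : Mat2 r := ∑ p : Pairs r, (weylPlus p).transpose ⊗ₖ weylPlus p

lemma casimir_eq (r : ℕ) : casimir r = casimirZero r + (piPlus r + piMinus r) := by
  rw [casimir, Finset.sum_add_distrib, piPlus, piMinus]

lemma piZeroJ_eq (r : ℕ) : piZeroJ r = piPlus r - piMinus r := by
  rw [piZeroJ, Finset.sum_sub_distrib, piPlus, piMinus]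

lemma weylPlus_apply {r : ℕ} (p : Pairs r) (a b : Idx r) :
    weylPlus p a b = 0 ∨ (sgn a = 1 ∧ sgn b = -1) := by
  rcases a with a | a <;> rcases b with b | b <;>
    simp [weylPlus, sgn, bar, Matrix.single_apply]

lemma weylMinus_apply {r : ℕ} (p : Pairs r) (a b : Idx r) :
    weylMinus p a b = 0 ∨ sgn a = sgn b := by
  rcases a with a | a <;> rcases b with b | b <;>
    simp [weylMinus, sgn, bar, Matrix.single_apply]

lemma cartan_apply {r : ℕ} (k : Fin r) (a b : Idx r) :
    cartan k a b = 0 ∨ sgn a = sgn b := by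
  rcases a with a | a <;> rcases b with b | b <;>
    simp [cartan, sgn, bar, Matrix.single_apply]

lemma casimirZero_apply {r : ℕ} (a b c d : Idx r) :
    casimirZero r (a, c) (b, d) = 0 ∨ (sgn a = sgn b ∧ sgn c = sgn d) := by
  by_contra! h
  refine h.1 ?_
  simp only [casimirZero, Matrix.add_apply, Matrix.sum_apply, Matrix.kroneckerMap_apply,
    Matrix.transpose_apply]
  rw [Finset.sum_eq_zero, Finset.sum_eq_zero, add_zero]
  · intro p _
    have h1 : weylMinus p a b * weylMinus p d c = 0 := by
      rcases weylMinus_apply p a b with h1 | h1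
      · rw [h1, zero_mul]
      · rcases weylMinus_apply p d c with h2 | h2
        · rw [h2, mul_zero]
        · exact absurd h2.symm (h.2 h1)
    have h2 : weylMinus p b a * weylMinus p c d = 0 := by
      rcases weylMinus_apply p b a with h1 | h1
      · rw [h1, zero_mul]
      · rcases weylMinus_apply p c d with h2 | h2
        · rw [h2, mul_zero]
        · exact absurd h2 (h.2 h1.symm)
    rw [h1, h2, add_zero]
  · intro k _
    rcases cartan_apply k a b with h1 | h1
    · rw [h1, zero_mul]
    · rcases cartan_apply k c d with h2 | h2
      · rw [h2, mul_zero]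
      · exact absurd h2 (h.2 h1)

lemma piPlus_apply {r : ℕ} (a b c d : Idx r) : piPlus r (a, c) (b, d) = 0 ∨
    ((sgn a = 1 ∧ sgn b = -1) ∧ (sgn d = 1 ∧ sgn c = -1)) := by
  by_contra! h
  refine h.1 ?_
  simp only [piPlus, Matrix.sum_apply, Matrix.kroneckerMap_apply, Matrix.transpose_apply]
  refine Finset.sum_eq_zero fun p _ => ?_
  rcases weylPlus_apply p a b with h1 | h1
  · rw [h1, zero_mul]
  · rcases weylPlus_apply p d c with h2 | h2
    · rw [h2, mul_zero]
    · exact absurd h2.2 (h.2 h1 h2.1)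

lemma piMinus_apply {r : ℕ} (a b c d : Idx r) : piMinus r (a, c) (b, d) = 0 ∨
    ((sgn b = 1 ∧ sgn a = -1) ∧ (sgn c = 1 ∧ sgn d = -1)) := by
  have h : piMinus r (a, c) (b, d) = piPlus r (b, d) (a, c) := by
    simp only [piPlus, piMinus, Matrix.sum_apply, Matrix.kroneckerMap_apply, Matrix.transpose_apply]
  rw [h]
  exact piPlus_apply b a d c

/-- The commutator with J⊗1 multiplies an entry by a difference of J-weights: 0 on `casimirZero`, -2
on `piPlus` and +2 on `piMinus`. -/
lemma casimir_J {r : ℕ} : casimir r * (J r ⊗ₖ 1) - (J r ⊗ₖ 1) * casimir r =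
    (-2 : ℂ) • piZeroJ r := by
  rw [J_eq_diagonal, ← Matrix.diagonal_one, Matrix.diagonal_kronecker_diagonal]
  ext ⟨a, c⟩ ⟨b, d⟩
  rw [Matrix.sub_apply, Matrix.mul_diagonal, Matrix.diagonal_mul, casimir_eq, piZeroJ_eq]
  simp only [Matrix.add_apply, Matrix.smul_apply, Matrix.sub_apply, smul_eq_mul, mul_one]
  have h0 : casimirZero r (a, c) (b, d) * (sgn b - sgn a) = 0 := by
    rcases casimirZero_apply a b c d with h | h <;> simp [h]
  have h1 : piPlus r (a, c) (b, d) * (sgn b - sgn a + 2) = 0 := by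
    rcases piPlus_apply a b c d with h | h
    · simp [h]
    · rw [h.1.1, h.1.2]; ring
  have h2 : piMinus r (a, c) (b, d) * (sgn b - sgn a - 2) = 0 := by
    rcases piMinus_apply a b c d with h | h
    · simp [h]
    · rw [h.1.1, h.1.2]; ring
  linear_combination h0 + h1 + h2

/-- Its left side is, up to a constant, the Poisson bracket density of two functionals with
gradients tr(E_α A) and tr(E_α B); the right side is the form in which the Lax equation can be
applied. -/
lemma trace_piZeroJ_mul {r : ℕ} (A B : Mat r) : (piZeroJ r * (A ⊗ₖ B)).trace =
    -(1 / 2) * ((J r * A - A * J r) * (B - tilde B)).trace := by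
  have h : piZeroJ r = (-(1 / 2) : ℂ) •
      (casimir r * (J r ⊗ₖ 1) - (J r ⊗ₖ 1) * casimir r) := by
    rw [casimir_J, smul_smul]; norm_num
  rw [h, Matrix.smul_mul, Matrix.trace_smul, smul_eq_mul, sub_mul, Matrix.trace_sub,
    Matrix.mul_assoc, ← Matrix.mul_kronecker_mul, one_mul, Matrix.mul_assoc,
    Matrix.trace_mul_comm (J r ⊗ₖ 1), Matrix.mul_assoc, ← Matrix.mul_kronecker_mul, mul_one,
    trace_casimir_mul, trace_casimir_mul, sub_mul, Matrix.trace_sub]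

/-- The generators that the field components multiply. -/
def gen {r : ℕ} : Coord r → Mat r := Sum.elim (fun p => weylPlus p) (fun p => (weylPlus p).transpose)

@[simp] lemma gen_inl {r : ℕ} (p : Pairs r) : gen (Sum.inl p) = weylPlus p := rfl
@[simp] lemma gen_inr {r : ℕ} (p : Pairs r) : gen (Sum.inr p) = (weylPlus p).transpose := rfl

lemma Q_eq_sum {r : ℕ} (u : Potential r) (x : ℝ) : Q u x = ∑ c, u x c • gen c := by
  rw [Q, Finset.sum_add_distrib, Fintype.sum_sum_type]
  rfl

lemma tilde_gen {r : ℕ} (c : Coord r) : tilde (gen c) = -gen c := by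
  rcases c with p | p
  · rw [gen_inl, weylPlus_eq_soUnit, tilde_soUnit]
  · rw [gen_inr, weylPlus_eq_soUnit, soUnit_transpose, tilde_soUnit]

lemma tilde_Q {r : ℕ} (u : Potential r) (x : ℝ) : tilde (Q u x) = -Q u x := by
  rw [Q_eq_sum, tilde_sum, ← Finset.sum_neg_distrib]
  exact Finset.sum_congr rfl fun c _ => by rw [tilde_smul, tilde_gen, smul_neg]

lemma tilde_J {r : ℕ} : tilde (J r) = -J r := by
  rw [J, tilde_sum, ← Finset.sum_neg_distrib]
  exact Finset.sum_congr rfl fun k _ => by rw [cartan_eq_soUnit, tilde_soUnit]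

lemma tilde_U {r : ℕ} (u : Potential r) (z : ℂ) (x : ℝ) : tilde (U u z x) = -U u z x := by
  rw [U, tilde_sub, tilde_smul, tilde_Q, tilde_J]
  simp only [smul_neg]; abel

/-- Write U(z) = U(w) - (z-w)J. The common part commutes with P by invariance, and the factor z-w of
the rest cancels the pole of r, which leaves half the commutator of P with J⊗1. -/
lemma rMatrix_comm_U {r : ℕ} (u : Potential r) {z w : ℂ} (h : z ≠ w) (x : ℝ) :
    rMatrix r (z - w) * (U u z x ⊗ₖ 1 + 1 ⊗ₖ U u w x) -
      (U u z x ⊗ₖ 1 + 1 ⊗ₖ U u w x) * rMatrix r (z - w) = -piZeroJ r := by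
  have e : U u z x ⊗ₖ 1 + 1 ⊗ₖ U u w x =
      (U u w x ⊗ₖ 1 + 1 ⊗ₖ U u w x) - (z - w) • (J r ⊗ₖ (1 : Mat r)) := by
    have : U u z x = U u w x - (z - w) • J r := by
      simp only [U, sub_smul]; abel
    rw [this, ← Matrix.smul_kronecker]
    ext ⟨a, c⟩ ⟨b, d⟩
    simp; ring
  have hz : z - w ≠ 0 := sub_ne_zero.2 h
  rw [e, rMatrix, mul_sub, sub_mul]
  have : piZeroJ r = (-(1 / 2) : ℂ) •
      (casimir r * (J r ⊗ₖ 1) - (J r ⊗ₖ 1) * casimir r) := by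
    rw [casimir_J, smul_smul]; norm_num
  simp only [this, Matrix.smul_mul, Matrix.mul_smul, casimir_comm _ (tilde_U u w x), smul_smul]
  rw [show (z - w) * -(1 / (2 * (z - w))) = -(1 / 2) by field_simp,
    show -(1 / (2 * (z - w))) * (z - w) = -(1 / 2) by field_simp, smul_sub]
  abel

end DIII
end

noncomputable section
set_option linter.unusedSectionVars false
namespace DIII

/-! ### Linear differential equations in a Banach algebra -/

section Flow

variable {𝔸 : Type*} [NormedRing 𝔸] [NormedAlgebra ℝ 𝔸]

/-- The terms of the Dyson series. -/
def dyson (A : ℝ → 𝔸) (y : ℝ) : ℕ → ℝ → 𝔸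
  | 0 => fun _ => 1
  | n + 1 => fun x => ∫ s in y..x, A s * dyson A y n s

/-- The propagator from `y` to `x` of the equation `Ψ' = A Ψ`. -/
def flow (A : ℝ → 𝔸) (x y : ℝ) : 𝔸 := ∑' n, dyson A y n x

variable [CompleteSpace 𝔸] {A B : ℝ → 𝔸}

lemma continuous_dyson (hA : Continuous A) (y : ℝ) : ∀ n, Continuous (dyson A y n)
  | 0 => continuous_const
  | n + 1 => by
    have h : Continuous fun s => A s * dyson A y n s := hA.mul (continuous_dyson hA y n)
    exact intervalIntegral.continuous_primitive (fun a b => h.intervalIntegrable a b) y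

lemma hasDerivAt_dyson_succ (hA : Continuous A) (y : ℝ) (n : ℕ) (x : ℝ) :
    HasDerivAt (dyson A y (n + 1)) (A x * dyson A y n x) x := by
  have h : Continuous fun s => A s * dyson A y n s := hA.mul (continuous_dyson hA y n)
  exact intervalIntegral.integral_hasDerivAt_right (h.intervalIntegrable _ _)
    (h.stronglyMeasurableAtFilter _ _) h.continuousAt

lemma integral_mul_pow_integral {a : ℝ → ℝ} (ha : Continuous a) (x y : ℝ) (n : ℕ) :
    ∫ s in y..x, a s * ((∫ t in y..s, a t) ^ n / n.factorial) =
      (∫ t in y..x, a t) ^ (n + 1) / (n + 1).factorial := by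
  have hd : ∀ s, HasDerivAt (fun s => ∫ t in y..s, a t) (a s) s := fun s =>
    intervalIntegral.integral_hasDerivAt_right (ha.intervalIntegrable _ _)
      (ha.stronglyMeasurableAtFilter _ _) ha.continuousAt
  have hc : Continuous fun s => ∫ t in y..s, a t :=
    continuous_iff_continuousAt.2 fun s => (hd s).continuousAt
  rw [intervalIntegral.integral_eq_sub_of_hasDerivAt
    (f := fun s => (∫ t in y..s, a t) ^ (n + 1) / (n + 1).factorial)]
  · simp
  · intro s _
    convert! ((hd s).pow (n + 1)).div_const ((n + 1).factorial : ℝ) using 1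
    rw [Nat.factorial_succ]
    have : (n.factorial : ℝ) ≠ 0 := by positivity
    push_cast
    field_simp
  · exact (ha.mul ((hc.pow n).div_const _)).intervalIntegrable _ _

/-- The n-fold iterated integral runs over an ordered simplex, hence the n!. The factor ‖1‖ is kept
because for r = 0 the matrix algebra is the zero ring, where it is not 1. -/
lemma norm_dyson_le_of_le (hA : Continuous A) {y : ℝ} (n : ℕ) {x : ℝ} (hx : y ≤ x) :
    ‖dyson A y n x‖ ≤ ‖(1 : 𝔸)‖ * ((∫ s in y..x, ‖A s‖) ^ n / n.factorial) := by
  induction n generalizing x with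
  | zero => simp [dyson]
  | succ n ih =>
    have hc : Continuous fun s => ∫ t in y..s, ‖A t‖ :=
      intervalIntegral.continuous_primitive (fun a b => hA.norm.intervalIntegrable a b) y
    calc ‖dyson A y (n + 1) x‖
        ≤ ∫ s in y..x, ‖(1 : 𝔸)‖ * (‖A s‖ * ((∫ t in y..s, ‖A t‖) ^ n / n.factorial)) := by
          refine intervalIntegral.norm_integral_le_of_norm_le hx ?_ ?_
          · refine MeasureTheory.ae_of_all _ fun s hs => (norm_mul_le _ _).trans ?_
            calc _ ≤ ‖A s‖ * (‖(1 : 𝔸)‖ * ((∫ t in y..s, ‖A t‖) ^ n / n.factorial)) := by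
                  gcongr; exact ih hs.1.le
              _ = _ := by ring
          · exact (continuous_const.mul
              (hA.norm.mul ((hc.pow n).div_const _))).intervalIntegrable _ _
      _ = _ := by
        rw [intervalIntegral.integral_const_mul, integral_mul_pow_integral hA.norm]

/-- The reflection x ↦ -x exchanges the two orders of the end points, so estimates need a proof only
for y ≤ x. -/
lemma dyson_neg (A : ℝ → 𝔸) (y : ℝ) (n : ℕ) (x : ℝ) :
    dyson (fun s => -A (-s)) (-y) n x = dyson A y n (-x) := by
  induction n generalizing x with
  | zero => rfl
  | succ n ih =>
    simp only [dyson, ih]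
    rw [intervalIntegral.integral_comp_neg (fun s => -A s * dyson A y n s), neg_neg,
      intervalIntegral.integral_symm]
    simp only [neg_mul, intervalIntegral.integral_neg, neg_neg]

lemma norm_dyson_le (hA : Continuous A) (y : ℝ) (n : ℕ) (x : ℝ) :
    ‖dyson A y n x‖ ≤ ‖(1 : 𝔸)‖ * (|∫ s in y..x, ‖A s‖| ^ n / n.factorial) := by
  rcases le_total y x with h | h
  · rw [abs_of_nonneg (intervalIntegral.integral_nonneg h fun _ _ => norm_nonneg _)]
    exact norm_dyson_le_of_le hA n h
  · have := norm_dyson_le_of_le (A := fun s => -A (-s)) (hA.comp continuous_neg).neg n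
      (neg_le_neg h)
    rw [dyson_neg, neg_neg] at this
    simp only [norm_neg] at this
    rw [intervalIntegral.integral_comp_neg (fun s => ‖A s‖), neg_neg, neg_neg] at this
    rwa [intervalIntegral.integral_symm, abs_neg,
      abs_of_nonneg (intervalIntegral.integral_nonneg h fun _ _ => norm_nonneg _)]

lemma summable_dyson (hA : Continuous A) (x y : ℝ) : Summable fun n => dyson A y n x :=
  .of_norm_bounded ((Real.summable_pow_div_factorial _).mul_left _) fun n => norm_dyson_le hA y n x

/-- The propagator is bounded by the exponential of the integral of the coefficient. -/
lemma norm_flow_le (hA : Continuous A) (x y : ℝ) :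
    ‖flow A x y‖ ≤ ‖(1 : 𝔸)‖ * Real.exp |∫ s in y..x, ‖A s‖| := by
  have h := (NormedSpace.expSeries_div_hasSum_exp (|∫ s in y..x, ‖A s‖|)).mul_left ‖(1 : 𝔸)‖
  rw [← Real.exp_eq_exp_ℝ] at h
  exact tsum_of_norm_bounded h fun n => norm_dyson_le hA y n x

@[simp] lemma flow_self (A : ℝ → 𝔸) (y : ℝ) : flow A y y = 1 := by
  rw [flow, tsum_eq_single 0]
  · rfl
  · intro n hn
    obtain ⟨m, rfl⟩ := Nat.exists_eq_succ_of_ne_zero hn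
    simp [dyson]

lemma hasDerivAt_flow (hA : Continuous A) (x y : ℝ) :
    HasDerivAt (fun x => flow A x y) (A x * flow A x y) x := by
  -- The unit margin puts x and y inside an open interval, on which the series can be differentiated
  -- term by term.
  set R := |x - y| + 1 with hR
  obtain ⟨M, hM⟩ := (isCompact_Icc (a := y - R) (b := y + R)).exists_bound_of_continuousOn
    hA.continuousOn
  set a := ∫ s in (y - R)..(y + R), ‖A s‖ with ha
  -- The zeroth Dyson term is constant, and term n+1 has derivative A times term n, so the
  -- derivative series is the original one shifted by one.
  set g' : ℕ → ℝ → 𝔸 := fun n x => Nat.casesOn n 0 fun m => A x * dyson A y m x with hg'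
  set b : ℕ → ℝ := fun n => Nat.casesOn n 0 fun m => M * (‖(1 : 𝔸)‖ * (a ^ m / m.factorial)) with hb
  have hRpos : 0 < R := by positivity
  have hmem : ∀ t ∈ Set.Ioo (y - R) (y + R), |∫ s in y..t, ‖A s‖| ≤ a := by
    intro t ht
    calc |∫ s in y..t, ‖A s‖| ≤ |∫ s in (y - R)..(y + R), ‖A s‖| := by
          refine intervalIntegral.abs_integral_mono_interval ?_ (MeasureTheory.ae_of_all _
            fun _ => norm_nonneg _) (hA.norm.intervalIntegrable _ _)
          exact Set.uIoc_subset_uIoc_of_uIcc_subset_uIcc (Set.uIcc_subset_uIcc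
            (by rw [Set.uIcc_of_le (by linarith)]; constructor <;> linarith)
            (by rw [Set.uIcc_of_le (by linarith)]; exact ⟨ht.1.le, ht.2.le⟩))
      _ = a := abs_of_nonneg
          (intervalIntegral.integral_nonneg (by linarith) fun _ _ => norm_nonneg _)
  have hx : x ∈ Set.Ioo (y - R) (y + R) := by
    have h1 := neg_abs_le (x - y)
    have h2 := le_abs_self (x - y)
    constructor <;> simp only [hR] <;> linarith
  have hM0 : 0 ≤ M := (norm_nonneg _).trans (hM x ⟨hx.1.le, hx.2.le⟩)
  have hsum : Summable b := by
    rw [← summable_nat_add_iff 1]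
    exact ((Real.summable_pow_div_factorial a).mul_left _).mul_left _
  have := hasDerivAt_tsum_of_isPreconnected (g := fun n x => dyson A y n x) (g' := g') hsum
    isOpen_Ioo isPreconnected_Ioo (y₀ := x) (y := x) ?_ ?_ hx (summable_dyson hA x y) hx
  · convert! this using 1
    rw [(Summable.tsum_eq_zero_add (f := fun n => g' n x))]
    · change _ = (0 : 𝔸) + ∑' n, A x * dyson A y n x
      rw [zero_add, flow, (summable_dyson hA x y).tsum_mul_left]
    · rw [← summable_nat_add_iff 1]
      exact (summable_dyson hA x y).mul_left _
  · intro n t _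
    cases n with
    | zero => exact hasDerivAt_const _ _
    | succ n => exact hasDerivAt_dyson_succ hA y n t
  · intro n t ht
    cases n with
    | zero => simp [hg', hb]
    | succ n =>
      refine (norm_mul_le _ _).trans (mul_le_mul (hM t ⟨ht.1.le, ht.2.le⟩) ?_ (norm_nonneg _) hM0)
      refine (norm_dyson_le hA y n t).trans ?_
      gcongr
      exact hmem t ht

lemma continuous_flow_left (hA : Continuous A) (y : ℝ) : Continuous fun x => flow A x y :=
  continuous_iff_continuousAt.2 fun x => (hasDerivAt_flow hA x y).continuousAt

/-- Solutions of a linear equation are determined by their value at one point. -/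
lemma solution_unique (hA : Continuous A) {Φ Ψ : ℝ → 𝔸} {y : ℝ}
    (hΦ : ∀ x, HasDerivAt Φ (A x * Φ x) x) (hΨ : ∀ x, HasDerivAt Ψ (A x * Ψ x) x)
    (h : Φ y = Ψ y) : Φ = Ψ := by
  funext x
  set R := |x - y| + 1 with hR
  obtain ⟨M, hM⟩ := (isCompact_Icc (a := y - R) (b := y + R)).exists_bound_of_continuousOn
    hA.continuousOn
  have hx : x ∈ Set.Ioo (y - R) (y + R) := by
    have h1 := neg_abs_le (x - y)
    have h2 := le_abs_self (x - y)
    constructor <;> simp only [hR] <;> linarith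
  have hRpos : 0 < R := by positivity
  refine ODE_solution_unique_of_mem_Ioo (v := fun t z => A t * z) (s := fun _ => Set.univ)
    (K := M.toNNReal) (t₀ := y) (a := y - R) (b := y + R) ?_ ⟨by linarith, by linarith⟩
    (fun t _ => ⟨hΦ t, trivial⟩) (fun t _ => ⟨hΨ t, trivial⟩) h hx
  intro t ht
  refine LipschitzWith.lipschitzOnWith (LipschitzWith.of_dist_le_mul fun z w => ?_)
  rw [dist_eq_norm, dist_eq_norm, ← mul_sub]
  refine (norm_mul_le _ _).trans ?_
  gcongr
  exact (hM t ⟨ht.1.le, ht.2.le⟩).trans (Real.le_coe_toNNReal M)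

lemma solution_eq_flow_mul (hA : Continuous A) {Ψ : ℝ → 𝔸}
    (hΨ : ∀ x, HasDerivAt Ψ (A x * Ψ x) x) (x y : ℝ) : Ψ x = flow A x y * Ψ y := by
  refine congrFun (solution_unique hA (y := y) hΨ (Ψ := fun x => flow A x y * Ψ y) ?_ (by simp)) x
  intro t
  rw [← mul_assoc]
  exact (hasDerivAt_flow hA t y).mul_const _

lemma flow_mul_flow (hA : Continuous A) (x y z : ℝ) :
    flow A x y * flow A y z = flow A x z :=
  (solution_eq_flow_mul hA (fun t => hasDerivAt_flow hA t z) x y).symm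

lemma flow_mul_flow_self (hA : Continuous A) (x y : ℝ) : flow A x y * flow A y x = 1 := by
  rw [flow_mul_flow hA, flow_self]

/-- The propagator as a unit. -/
def flowUnit (hA : Continuous A) (x y : ℝ) : 𝔸ˣ :=
  ⟨flow A x y, flow A y x, flow_mul_flow_self hA x y, flow_mul_flow_self hA y x⟩

/-- The propagator from y to x is the inverse of the one from x to y, so the equation in the second
argument comes from differentiating inversion. -/
lemma hasDerivAt_flow_right (hA : Continuous A) (x y : ℝ) :
    HasDerivAt (fun y => flow A x y) (-(flow A x y * A y)) y := by
  have h1 : (fun y => flow A x y) = fun y => Ring.inverse (flow A y x) := by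
    funext t
    exact (Ring.inverse_unit (flowUnit hA t x)).symm
  rw [h1]
  have h2 := (hasFDerivAt_ringInverse (𝕜 := ℝ) (flowUnit hA y x)).comp_hasDerivAt y
    (hasDerivAt_flow hA y x)
  convert! h2 using 1
  simp only [_root_.neg_apply, ContinuousLinearMap.mulLeftRight_apply]
  change _ = -(flow A x y * (A y * flow A y x) * flow A x y)
  rw [mul_assoc, mul_assoc, flow_mul_flow_self hA, mul_one]

lemma continuous_flow_right (hA : Continuous A) (x : ℝ) : Continuous fun y => flow A x y :=
  continuous_iff_continuousAt.2 fun y => (hasDerivAt_flow_right hA x y).continuousAt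

/-- Variation of constants. -/
lemma flow_sub_flow (hA : Continuous A) (hB : Continuous B) (x y : ℝ) :
    flow B x y - flow A x y = ∫ s in y..x, flow A x s * (B s - A s) * flow B s y := by
  -- This product interpolates between the propagator of A at s = y and that of B at s = x.
  have hd : ∀ s, HasDerivAt (fun s => flow A x s * flow B s y)
      (flow A x s * (B s - A s) * flow B s y) s := fun s => by
    convert! (hasDerivAt_flow_right hA x s).mul (hasDerivAt_flow hB s y) using 1
    noncomm_ring
  rw [intervalIntegral.integral_eq_sub_of_hasDerivAt (fun s _ => hd s)]
  · simp
  · exact (((continuous_flow_right hA x).mul (hB.sub hA)).mul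
      (continuous_flow_left hB y)).intervalIntegrable _ _

end Flow

end DIII
end

noncomputable section
set_option linter.unusedSectionVars false
namespace DIII
open scoped Matrix.Norms.Operator

/-! ### Calculus of matrices -/

lemma hasDerivAt_matrix {n : Type*} [Fintype n] [DecidableEq n] {Φ : ℝ → Matrix n n ℂ}
    {Φ' : Matrix n n ℂ} {x : ℝ} :
    HasDerivAt Φ Φ' x ↔ ∀ a b, HasDerivAt (fun t => Φ t a b) (Φ' a b) x := by
  constructor
  · intro h a b
    exact ((Matrix.entryLinearMap ℝ ℂ a b).toContinuousLinearMap).hasFDerivAt.comp_hasDerivAt x h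
  · intro h
    have e : ∀ M : Matrix n n ℂ, M = ∑ a, ∑ b, M a b • Matrix.single a b (1 : ℂ) := fun M => by
      conv_lhs => rw [Matrix.matrix_eq_sum_single M]
      simp
    rw [e Φ', show Φ = fun t => ∑ a, ∑ b, Φ t a b • Matrix.single a b (1 : ℂ) from
      funext fun t => e (Φ t)]
    exact HasDerivAt.fun_sum fun a _ => HasDerivAt.fun_sum fun b _ => (h a b).smul_const _

lemma hasDerivAt_kronecker {n : Type*} [Fintype n] [DecidableEq n] {A B : ℝ → Matrix n n ℂ}
    {A' B' : Matrix n n ℂ} {x : ℝ} (hA : HasDerivAt A A' x) (hB : HasDerivAt B B' x) :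
    HasDerivAt (fun t => A t ⊗ₖ B t) (A' ⊗ₖ B x + A x ⊗ₖ B') x := by
  rw [hasDerivAt_matrix] at hA hB ⊢
  exact fun ⟨a, c⟩ ⟨b, d⟩ => (hA a b).mul (hB c d)

lemma intervalIntegral_entry {n : Type*} [Fintype n] [DecidableEq n] {f : ℝ → Matrix n n ℂ}
    (hf : Continuous f) (x y : ℝ) (a b : n) :
    (∫ s in y..x, f s) a b = ∫ s in y..x, f s a b :=
  (((Matrix.entryLinearMap ℝ ℂ a b).toContinuousLinearMap).intervalIntegral_comp_comm
    (hf.intervalIntegrable (μ := MeasureTheory.volume) y x)).symm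

lemma norm_entry_le {n : Type*} [Fintype n] [DecidableEq n] (M : Matrix n n ℂ) (a b : n) :
    ‖M a b‖ ≤ ‖M‖ := by
  rw [Matrix.linfty_opNorm_def]
  have h : ‖M a b‖₊ ≤ Finset.univ.sup fun i => ∑ j, ‖M i j‖₊ :=
    (Finset.single_le_sum (f := fun j => ‖M a j‖₊) (fun _ _ => zero_le) (Finset.mem_univ b)).trans
      (Finset.le_sup (f := fun i => ∑ j, ‖M i j‖₊) (Finset.mem_univ a))
  exact_mod_cast h

/-- Jacobi's formula. With the adjugate in place of the inverse it needs no invertibility; by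
Cramer's rule the trace is the sum over columns of determinants with one column differentiated. -/
lemma hasDerivAt_det {n : Type*} [Fintype n] [DecidableEq n] {𝕜 : Type*}
    [NontriviallyNormedField 𝕜] [NormedAlgebra 𝕜 ℂ] {A : 𝕜 → Matrix n n ℂ}
    {A' : Matrix n n ℂ} {x : 𝕜} (h : ∀ a b, HasDerivAt (fun t => A t a b) (A' a b) x) :
    HasDerivAt (fun t => (A t).det) ((A x).adjugate * A').trace x := by
  have e : ((A x).adjugate * A').trace = ∑ i, ((A x).updateCol i fun k => A' k i).det := by
    refine Finset.sum_congr rfl fun i _ => ?_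
    rw [← Matrix.cramer_apply, Matrix.cramer_eq_adjugate_mulVec]
    rfl
  rw [e]
  simp only [Matrix.det_apply]
  rw [Finset.sum_comm]
  refine HasDerivAt.fun_sum fun σ _ => ?_
  rw [← Finset.smul_sum]
  refine HasDerivAt.fun_const_smul _ ?_
  convert! HasDerivAt.fun_finsetProd (u := Finset.univ) (f := fun i t => A t (σ i) i)
    (f' := fun i => A' (σ i) i) (x := x) (fun i _ => h (σ i) i) using 1
  refine Finset.sum_congr rfl fun i _ => ?_
  rw [← Finset.mul_prod_erase _ _ (Finset.mem_univ i), mul_comm, smul_eq_mul]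
  congr 1
  · refine Finset.prod_congr rfl fun j hj => ?_
    rw [Matrix.updateCol_ne (Finset.ne_of_mem_erase hj)]
  · rw [Matrix.updateCol_self]

/-- All variational derivatives below are complex derivatives in ε obtained from a quadratic
remainder on the unit disc. -/
lemma hasDerivAt_of_quadratic {f : ℂ → ℂ} {D : ℂ} {C : ℝ}
    (h : ∀ ε : ℂ, ‖ε‖ ≤ 1 → ‖f ε - f 0 - ε * D‖ ≤ C * ‖ε‖ ^ 2) : HasDerivAt f D 0 := by
  rw [hasDerivAt_iff_isLittleO]
  have h1 : (fun ε : ℂ => f ε - f 0 - (ε - 0) • D) =O[𝓝 0] fun ε => ‖ε‖ ^ 2 := by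
    refine Asymptotics.IsBigO.of_bound C ?_
    filter_upwards [Metric.closedBall_mem_nhds (0 : ℂ) one_pos] with ε hε
    rw [norm_pow, norm_norm, sub_zero, smul_eq_mul]
    exact h ε (by simpa using hε)
  refine h1.trans_isLittleO ?_
  simp only [sub_zero]
  refine (Asymptotics.isLittleO_norm_pow_id one_lt_two)

section Flow
variable {𝔸 : Type*} [NormedRing 𝔸] [NormedAlgebra ℝ 𝔸] [CompleteSpace 𝔸] {A B : ℝ → 𝔸}

lemma norm_flow_le_of_le (hA : Continuous A) {x y : ℝ} (h : y ≤ x) :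
    ‖flow A x y‖ ≤ ‖(1 : 𝔸)‖ * Real.exp (∫ s in y..x, ‖A s‖) := by
  have := norm_flow_le hA x y
  rwa [abs_of_nonneg (intervalIntegral.integral_nonneg h fun _ _ => norm_nonneg _)] at this

lemma norm_flow_le_of_le_of_le (hA : Continuous A) {x y s t : ℝ} (h1 : y ≤ s) (h2 : s ≤ t)
    (h3 : t ≤ x) : ‖flow A t s‖ ≤ ‖(1 : 𝔸)‖ * Real.exp (∫ s in y..x, ‖A s‖) := by
  refine (norm_flow_le_of_le hA h2).trans ?_
  gcongr
  exact intervalIntegral.integral_mono_interval h1 h2 h3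
    (MeasureTheory.ae_of_all _ fun _ => norm_nonneg _) (hA.norm.intervalIntegrable _ _)

lemma norm_flow_sub_flow_le (hA : Continuous A) (hB : Continuous B) {x y : ℝ} (h : y ≤ x) :
    ‖flow B x y - flow A x y‖ ≤ ‖(1 : 𝔸)‖ ^ 2 * Real.exp (∫ s in y..x, ‖A s‖) *
      Real.exp (∫ s in y..x, ‖B s‖) * ∫ s in y..x, ‖B s - A s‖ := by
  rw [flow_sub_flow hA hB, ← intervalIntegral.integral_const_mul]
  refine intervalIntegral.norm_integral_le_of_norm_le h (MeasureTheory.ae_of_all _ fun s hs => ?_)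
    ((continuous_const.mul (hB.sub hA).norm).intervalIntegrable _ _)
  calc ‖flow A x s * (B s - A s) * flow B s y‖
      ≤ ‖flow A x s‖ * ‖B s - A s‖ * ‖flow B s y‖ :=
        (norm_mul_le _ _).trans (mul_le_mul_of_nonneg_right (norm_mul_le _ _) (norm_nonneg _))
    _ ≤ (‖(1 : 𝔸)‖ * Real.exp (∫ s in y..x, ‖A s‖)) * ‖B s - A s‖ *
        (‖(1 : 𝔸)‖ * Real.exp (∫ s in y..x, ‖B s‖)) := by
        gcongr
        · exact norm_flow_le_of_le_of_le hA hs.1.le hs.2 le_rfl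
        · exact norm_flow_le_of_le_of_le hB le_rfl hs.1.le hs.2
    _ = _ := by ring

lemma integral_norm_add_le (hA : Continuous A) (hB : Continuous B) {x y s t : ℝ} (h1 : y ≤ s)
    (h2 : s ≤ t) (h3 : t ≤ x) : ∫ w in s..t, ‖(A + B) w‖ ≤
      (∫ w in y..x, ‖A w‖) + ∫ w in y..x, ‖B w‖ := by
  have hc : Continuous (A + B) := hA.add hB
  refine (intervalIntegral.integral_mono_interval h1 h2 h3
    (MeasureTheory.ae_of_all _ fun _ => norm_nonneg _) (hc.norm.intervalIntegrable _ _)).trans ?_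
  rw [← intervalIntegral.integral_add (hA.norm.intervalIntegrable _ _)
    (hB.norm.intervalIntegrable _ _)]
  exact intervalIntegral.integral_mono_on (h1.trans (h2.trans h3)) (hc.norm.intervalIntegrable _ _)
    ((hA.norm.add hB.norm).intervalIntegrable _ _) fun w _ => norm_add_le _ _

lemma norm_flow_add_sub_flow_le (hA : Continuous A) (hB : Continuous B) {x y s t : ℝ}
    (h1 : y ≤ s) (h2 : s ≤ t) (h3 : t ≤ x) :
    ‖flow (A + B) t s - flow A t s‖ ≤ ‖(1 : 𝔸)‖ ^ 2 * Real.exp (∫ w in y..x, ‖A w‖) *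
      Real.exp ((∫ w in y..x, ‖A w‖) + ∫ w in y..x, ‖B w‖) * ∫ w in y..x, ‖B w‖ := by
  have hc : Continuous (A + B) := hA.add hB
  refine (norm_flow_sub_flow_le hA hc h2).trans ?_
  have h : ∫ w in s..t, ‖(A + B) w - A w‖ ≤ ∫ w in y..x, ‖B w‖ := by
    simp only [Pi.add_apply, add_sub_cancel_left]
    exact intervalIntegral.integral_mono_interval h1 h2 h3
      (MeasureTheory.ae_of_all _ fun _ => norm_nonneg _) (hB.norm.intervalIntegrable _ _)
  gcongr
  · exact intervalIntegral.integral_nonneg h2 fun _ _ => norm_nonneg _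
  · exact intervalIntegral.integral_mono_interval h1 h2 h3
      (MeasureTheory.ae_of_all _ fun _ => norm_nonneg _) (hA.norm.intervalIntegrable _ _)
  · exact integral_norm_add_le hA hB h1 h2 h3

/-- Variation of constants leaves the remainder ∫ flow A · B · (flow (A+B) - flow A), and the inner
difference is itself of first order in B. -/
lemma norm_flow_add_sub_sub_le (hA : Continuous A) (hB : Continuous B) {x y : ℝ} (h : y ≤ x) :
    ‖flow (A + B) x y - flow A x y - ∫ s in y..x, flow A x s * B s * flow A s y‖ ≤
      ‖(1 : 𝔸)‖ ^ 3 * Real.exp (∫ w in y..x, ‖A w‖) ^ 2 *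
      Real.exp ((∫ w in y..x, ‖A w‖) + ∫ w in y..x, ‖B w‖) * (∫ w in y..x, ‖B w‖) ^ 2 := by
  have hc : Continuous (A + B) := hA.add hB
  rw [flow_sub_flow hA hc, ← intervalIntegral.integral_sub]
  · set a := ∫ w in y..x, ‖A w‖
    set b := ∫ w in y..x, ‖B w‖ with hb
    have e : ‖(1 : 𝔸)‖ ^ 3 * Real.exp a ^ 2 * Real.exp (a + b) * b ^ 2 =
        ∫ s in y..x, (‖(1 : 𝔸)‖ ^ 3 * Real.exp a ^ 2 * Real.exp (a + b) * b) * ‖B s‖ := by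
      rw [intervalIntegral.integral_const_mul, ← hb]; ring
    rw [e]
    refine intervalIntegral.norm_integral_le_of_norm_le h (MeasureTheory.ae_of_all _ fun s hs => ?_)
      ((continuous_const.mul hB.norm).intervalIntegrable _ _)
    rw [Pi.add_apply, add_sub_cancel_left, ← mul_sub]
    calc ‖flow A x s * B s * (flow (A + B) s y - flow A s y)‖
        ≤ ‖flow A x s‖ * ‖B s‖ * ‖flow (A + B) s y - flow A s y‖ :=
          (norm_mul_le _ _).trans (mul_le_mul_of_nonneg_right (norm_mul_le _ _) (norm_nonneg _))
      _ ≤ (‖(1 : 𝔸)‖ * Real.exp a) * ‖B s‖ * (‖(1 : 𝔸)‖ ^ 2 * Real.exp a *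
          Real.exp (a + b) * b) := by
          gcongr
          · exact norm_flow_le_of_le_of_le hA hs.1.le hs.2 le_rfl
          · exact norm_flow_add_sub_flow_le hA hB le_rfl hs.1.le hs.2
      _ = _ := by ring
  · exact (((continuous_flow_right hA x).mul (hc.sub hA)).mul
      (continuous_flow_left hc y)).intervalIntegrable _ _
  · exact (((continuous_flow_right hA x).mul hB).mul
      (continuous_flow_left hA y)).intervalIntegrable _ _

end Flow

/-! ### The fundamental solution -/

/-- The coefficient of the equation `Ψ' = i U Ψ`. -/
def coef {r : ℕ} (u : Potential r) (z : ℂ) (x : ℝ) : Mat r := Complex.I • U u z x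

lemma continuous_Q {r : ℕ} {u : Potential r} (hu : Continuous u) : Continuous (Q u) := by
  rw [show Q u = fun x => ∑ c, u x c • gen c from funext fun x => Q_eq_sum u x]
  exact continuous_finsetSum _ fun c _ => ((continuous_apply c).comp hu).smul continuous_const

lemma continuous_coef {r : ℕ} {u : Potential r} (hu : Continuous u) (z : ℂ) :
    Continuous (coef u z) := by
  have h : Continuous fun x => Q u x - z • J r := (continuous_Q hu).sub continuous_const
  exact h.const_smul Complex.I

lemma isSolution_iff {r : ℕ} {u : Potential r} {z : ℂ} {Ψ : ℝ → Mat r} :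
    IsSolution u z Ψ ↔ ∀ x, HasDerivAt Ψ (coef u z x * Ψ x) x := by
  simp only [IsSolution, hasDerivAt_matrix]
  refine forall_congr' fun x => forall_congr' fun a => forall_congr' fun b => ?_
  rw [coef, Matrix.smul_mul, Matrix.smul_apply, smul_eq_mul]

lemma isTransition_flow {r : ℕ} {u : Potential r} (hu : Continuous u) (z : ℂ) (y : ℝ) :
    IsTransition u z y fun x => flow (coef u z) x y :=
  ⟨isSolution_iff.2 fun x => hasDerivAt_flow (continuous_coef hu z) x y, flow_self _ _⟩

lemma isTransition_transition {r : ℕ} {u : Potential r} (hu : Continuous u) (z : ℂ) (y : ℝ) :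
    IsTransition u z y fun x => transition u x y z :=
  Classical.epsilon_spec (p := IsTransition u z y) ⟨_, isTransition_flow hu z y⟩

/-- `transition` is an unspecified choice among solutions; uniqueness identifies it with the
convergent Dyson series. -/
lemma transition_eq_flow {r : ℕ} {u : Potential r} (hu : Continuous u) (x y : ℝ) (z : ℂ) :
    transition u x y z = flow (coef u z) x y := by
  have h := isTransition_transition hu z y
  have := solution_eq_flow_mul (continuous_coef hu z) (isSolution_iff.1 h.1) x y
  rwa [show transition u y y z = 1 from h.2, mul_one] at this

lemma Q_add_smul {r : ℕ} (u v : Potential r) (ε : ℂ) (x : ℝ) :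
    Q (u + ε • v) x = Q u x + ε • Q v x := by
  simp only [Q_eq_sum, Pi.add_apply, Pi.smul_apply, add_smul, Finset.sum_add_distrib,
    Finset.smul_sum, smul_smul, smul_eq_mul]

lemma coef_add_smul {r : ℕ} (u v : Potential r) (ε z : ℂ) :
    coef (u + ε • v) z = coef u z + fun x => ε • Complex.I • Q v x := by
  funext x
  rw [Pi.add_apply, coef, coef, U, U, Q_add_smul, smul_comm ε, ← smul_add]
  congr 1
  abel

lemma continuous_add_smul {r : ℕ} {u v : Potential r} (hu : Continuous u) (hv : Continuous v)
    (ε : ℂ) : Continuous (u + ε • v) := hu.add (hv.const_smul ε)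

/-- The integrand of the first variation of the transition matrix. -/
def flowVar {r : ℕ} (u : Potential r) (z : ℂ) (x y : ℝ) (X : Mat r) (s : ℝ) : Mat r :=
  flow (coef u z) x s * (Complex.I • X) * flow (coef u z) s y

lemma continuous_flowVar {r : ℕ} {u : Potential r} (hu : Continuous u) (z : ℂ) (x y : ℝ)
    {X : ℝ → Mat r} (hX : Continuous X) : Continuous fun s => flowVar u z x y (X s) s := by
  have h1 : Continuous fun s => Complex.I • X s := hX.const_smul Complex.I
  have h2 := continuous_flow_right (continuous_coef hu z) x
  have h3 := continuous_flow_left (continuous_coef hu z) y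
  exact (h2.mul h1).mul h3

lemma norm_flow_coef_sub_sub_le {r : ℕ} {u v : Potential r} (hu : Continuous u)
    (hv : Continuous v) (z : ℂ) {ε : ℂ} (hε : ‖ε‖ ≤ 1) {x y : ℝ} (h : y ≤ x) (a b : Idx r) :
    ‖flow (coef (u + ε • v) z) x y a b - flow (coef u z) x y a b -
      ε * ∫ s in y..x, flowVar u z x y (Q v s) s a b‖ ≤ ‖(1 : Mat r)‖ ^ 3 *
        Real.exp (∫ w in y..x, ‖coef u z w‖) ^ 2 *
        Real.exp ((∫ w in y..x, ‖coef u z w‖) + ∫ w in y..x, ‖Q v w‖) *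
        (∫ w in y..x, ‖Q v w‖) ^ 2 * ‖ε‖ ^ 2 := by
  have hB : Continuous fun x => ε • Complex.I • Q v x :=
    ((continuous_Q hv).const_smul Complex.I).const_smul ε
  have hV := continuous_flowVar hu z x y (continuous_Q hv)
  have h1 := norm_flow_add_sub_sub_le (continuous_coef hu z) hB h
  have e1 : ∫ w in y..x, ‖ε • Complex.I • Q v w‖ = ‖ε‖ * ∫ w in y..x, ‖Q v w‖ := by
    rw [← intervalIntegral.integral_const_mul]
    simp only [norm_smul, Complex.norm_I, one_mul]
  have e2 : (∫ s in y..x, flow (coef u z) x s * (ε • Complex.I • Q v s) * flow (coef u z) s y) =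
      ∫ s in y..x, ε • flowVar u z x y (Q v s) s := by
    simp only [flowVar, Matrix.mul_smul, Matrix.smul_mul]
  rw [e1, e2, ← coef_add_smul] at h1
  have e3 : (∫ s in y..x, ε • flowVar u z x y (Q v s) s) a b =
      ε * ∫ s in y..x, flowVar u z x y (Q v s) s a b := by
    have hV' : Continuous fun s => ε • flowVar u z x y (Q v s) s := hV.const_smul ε
    rw [← intervalIntegral.integral_const_mul]
    exact intervalIntegral_entry hV' x y a b
  rw [← e3]
  refine (norm_entry_le (flow (coef (u + ε • v) z) x y - flow (coef u z) x y -
    ∫ s in y..x, ε • flowVar u z x y (Q v s) s) a b).trans (h1.trans ?_)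
  clear h1 e1 e2 e3 hV hB
  have hc0 : 0 ≤ ∫ w in y..x, ‖Q v w‖ :=
    intervalIntegral.integral_nonneg h fun _ _ => norm_nonneg _
  rw [mul_pow, mul_comm (‖ε‖ ^ 2), ← mul_assoc]
  gcongr
  -- The restriction ‖ε‖ ≤ 1 makes the exponential factor, and with it the constant, independent of
  -- ε.
  exact mul_le_of_le_one_left hc0 hε

lemma hasDerivAt_transition {r : ℕ} {u v : Potential r} (hu : Continuous u)
    (hv : Continuous v) {x y : ℝ} (h : y ≤ x) (z : ℂ) (a b : Idx r) :
    HasDerivAt (fun ε : ℂ => transition (u + ε • v) x y z a b)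
      (∫ s in y..x, flowVar u z x y (Q v s) s a b) 0 := by
  obtain ⟨C, hC⟩ : ∃ C : ℝ, ∀ ε : ℂ, ‖ε‖ ≤ 1 → ‖flow (coef (u + ε • v) z) x y a b -
      flow (coef u z) x y a b - ε * ∫ s in y..x, flowVar u z x y (Q v s) s a b‖ ≤ C * ‖ε‖ ^ 2 :=
    ⟨_, fun ε hε => norm_flow_coef_sub_sub_le hu hv z hε h a b⟩
  refine hasDerivAt_of_quadratic (C := C) fun ε hε => ?_
  rw [zero_smul, add_zero, transition_eq_flow (continuous_add_smul hu hv ε), transition_eq_flow hu]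
  exact hC ε hε

end DIII
end

noncomputable section
set_option linter.unusedSectionVars false
namespace DIII
open scoped Matrix.Norms.Operator
open MeasureTheory

/-! ### Brackets of transition matrices -/

/-- The canonical pairing of two gradients. -/
def pairing {r : ℕ} (ν : Measure ℝ) (f g : Potential r) : ℂ :=
  Complex.I * ∫ x, ∑ p : Pairs r,
    (f x (Sum.inl p) * g x (Sum.inr p) - f x (Sum.inr p) * g x (Sum.inl p)) ∂ν

lemma HasBracket.of_pairing {r : ℕ} {M : Set (Potential r)} {ν : Measure ℝ}
    {F G : Potential r → ℂ} {u f g : Potential r} (hf : HasVarDeriv M ν F u f)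
    (hg : HasVarDeriv M ν G u g) {c : ℂ} (h : pairing ν f g = c) : HasBracket M ν F G u c :=
  ⟨f, g, hf, hg, h.symm⟩

/-- Antisymmetry of the bracket; it settles equal spectral parameters, where r has its pole. -/
lemma pairing_self {r : ℕ} (ν : Measure ℝ) (f : Potential r) : pairing ν f f = 0 := by
  rw [pairing]
  simp [mul_comm]

lemma memLp_two_apply {r : ℕ} {ν : Measure ℝ} {f : Potential r} (hf : MemLp f 2 ν) (c : Coord r) :
    MemLp (fun x => f x c) 2 ν :=
  hf.continuousLinearMap_comp (ContinuousLinearMap.proj (R := ℝ) (φ := fun _ : Coord r => ℂ) c)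

lemma integrable_pairing {r : ℕ} {ν : Measure ℝ} {f g : Potential r} (hf : MemLp f 2 ν)
    (hg : MemLp g 2 ν) : Integrable (fun x => ∑ p : Pairs r,
      (f x (Sum.inl p) * g x (Sum.inr p) - f x (Sum.inr p) * g x (Sum.inl p))) ν :=
  integrable_finsetSum _ fun _ _ =>
    ((memLp_two_apply hf _).integrable_mul (memLp_two_apply hg _)).sub
      ((memLp_two_apply hf _).integrable_mul (memLp_two_apply hg _))

lemma pairing_sum {r : ℕ} {ν : Measure ℝ} {ι κ : Type*} [Fintype ι] [Fintype κ]
    {f : ι → Potential r} {g : κ → Potential r} (hf : ∀ i, MemLp (f i) 2 ν)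
    (hg : ∀ i, MemLp (g i) 2 ν) (c : ι → ℂ) (d : κ → ℂ) :
    pairing ν (∑ i, c i • f i) (∑ j, d j • g j) =
      ∑ i, ∑ j, c i * d j * pairing ν (f i) (g j) := by
  have hi : ∀ i j, Integrable (fun x => c i * d j * ∑ p : Pairs r,
      (f i x (Sum.inl p) * g j x (Sum.inr p) - f i x (Sum.inr p) * g j x (Sum.inl p))) ν :=
    fun i j => (integrable_pairing (hf i) (hg j)).const_mul _
  have e : ∀ x, ∑ p : Pairs r, ((∑ i, c i • f i) x (Sum.inl p) * (∑ j, d j • g j) x (Sum.inr p) -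
      (∑ i, c i • f i) x (Sum.inr p) * (∑ j, d j • g j) x (Sum.inl p)) =
      ∑ i, ∑ j, c i * d j * ∑ p : Pairs r,
      (f i x (Sum.inl p) * g j x (Sum.inr p) - f i x (Sum.inr p) * g j x (Sum.inl p)) := by
    intro x
    simp only [Finset.sum_apply, Pi.smul_apply, smul_eq_mul, Finset.sum_mul_sum,
      ← Finset.sum_sub_distrib]
    rw [Finset.sum_comm]
    refine Finset.sum_congr rfl fun i _ => ?_
    rw [Finset.sum_comm]
    refine Finset.sum_congr rfl fun j _ => ?_
    rw [Finset.mul_sum]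
    exact Finset.sum_congr rfl fun p _ => by ring
  simp only [pairing, e]
  rw [integral_finsetSum _ fun i _ => integrable_finsetSum _ fun j _ => hi i j, Finset.mul_sum]
  refine Finset.sum_congr rfl fun i _ => ?_
  rw [integral_finsetSum _ fun j _ => hi i j, Finset.mul_sum]
  refine Finset.sum_congr rfl fun j _ => ?_
  rw [integral_const_mul]
  ring

/-- The gradient of a matrix element of `T(x, y, z)`. -/
def transGrad {r : ℕ} (u : Potential r) (z : ℂ) (x y : ℝ) (a b : Idx r) : Potential r :=
  (Set.Ioc y x).indicator fun s c => flowVar u z x y (gen c) s a b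

lemma continuous_entry {n X : Type*} [TopologicalSpace X] [Fintype n] [DecidableEq n]
    {f : X → Matrix n n ℂ} (hf : Continuous f) (a b : n) : Continuous fun x => f x a b :=
  ((Matrix.entryLinearMap ℝ ℂ a b).toContinuousLinearMap).continuous.comp hf

lemma flowVar_Q {r : ℕ} (u v : Potential r) (z : ℂ) (x y s : ℝ) (a b : Idx r) :
    flowVar u z x y (Q v s) s a b = ∑ c, flowVar u z x y (gen c) s a b * v s c := by
  have : flowVar u z x y (Q v s) s = ∑ c, v s c • flowVar u z x y (gen c) s := by
    simp only [flowVar, Q_eq_sum, Finset.smul_sum, Finset.mul_sum, Finset.sum_mul]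
    refine Finset.sum_congr rfl fun c _ => ?_
    rw [smul_comm, Matrix.mul_smul, Matrix.smul_mul]
  rw [this, Matrix.sum_apply]
  exact Finset.sum_congr rfl fun c _ => by rw [Matrix.smul_apply, smul_eq_mul, mul_comm]

lemma memLp_transGrad {r : ℕ} {u : Potential r} (hu : Continuous u) (z : ℂ) (x y L : ℝ)
    (a b : Idx r) : MemLp (transGrad u z x y a b) 2 (volume.restrict (Set.Ioc (-L) L)) := by
  have hc : Continuous fun s (c : Coord r) => flowVar u z x y (gen c) s a b :=
    continuous_pi fun c => continuous_entry (continuous_flowVar hu z x y continuous_const) a b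
  obtain ⟨C, hC⟩ := (isCompact_Icc (a := -L) (b := L)).exists_bound_of_continuousOn hc.continuousOn
  refine MemLp.indicator measurableSet_Ioc (MemLp.of_bound hc.aestronglyMeasurable C ?_)
  exact (ae_restrict_iff' measurableSet_Ioc).2
    (ae_of_all _ fun s hs => hC s (Set.Ioc_subset_Icc_self hs))

lemma integral_transGrad {r : ℕ} (u v : Potential r) (z : ℂ) {x y L : ℝ} (h1 : -L ≤ y)
    (h2 : y ≤ x) (h3 : x ≤ L) (a b : Idx r) :
    ∫ s, ∑ c, transGrad u z x y a b s c * v s c ∂(volume.restrict (Set.Ioc (-L) L)) =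
      ∫ s in y..x, flowVar u z x y (Q v s) s a b := by
  have e : (fun s => ∑ c, transGrad u z x y a b s c * v s c) =
      (Set.Ioc y x).indicator fun s => flowVar u z x y (Q v s) s a b := by
    funext s
    by_cases hs : s ∈ Set.Ioc y x
    · simp only [transGrad, Set.indicator_of_mem hs, flowVar_Q]
    · simp [transGrad, Set.indicator_of_notMem hs]
  rw [e, setIntegral_indicator measurableSet_Ioc, intervalIntegral.integral_of_le h2,
    Set.inter_eq_right.2 (Set.Ioc_subset_Ioc h1 h3)]

lemma continuous_of_mem_periodicSpace {r : ℕ} {L : ℝ} {u : Potential r}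
    (hu : u ∈ periodicSpace r L) : Continuous u := hu.1.continuous

lemma hasVarDeriv_transition {r : ℕ} {u : Potential r} {L : ℝ} (hu : u ∈ periodicSpace r L)
    (z : ℂ) {x y : ℝ} (h1 : -L ≤ y) (h2 : y ≤ x) (h3 : x ≤ L) (a b : Idx r) :
    HasVarDeriv (periodicSpace r L) (volume.restrict (Set.Ioc (-L) L))
      (fun v => transition v x y z a b) u (transGrad u z x y a b) := by
  have hu' := continuous_of_mem_periodicSpace hu
  refine ⟨memLp_transGrad hu' z x y L a b, fun v hv => ?_⟩
  rw [integral_transGrad u v z h1 h2 h3]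
  exact hasDerivAt_transition hu' (continuous_of_mem_periodicSpace hv) h2 z a b

/-- The canonical bracket of two gradients is the tensor Π_{0J} placed between the propagators. The
minus sign is the product of the two factors i. -/
lemma sum_gen_mul_sub {r : ℕ} (X X' Y Y' : Mat r) (a b c d : Idx r) :
    ∑ p : Pairs r, ((X * (Complex.I • gen (Sum.inl p)) * Y) a b *
        (X' * (Complex.I • gen (Sum.inr p)) * Y') c d -
      (X * (Complex.I • gen (Sum.inr p)) * Y) a b *
        (X' * (Complex.I • gen (Sum.inl p)) * Y') c d) =
      -((X ⊗ₖ X') * piZeroJ r * (Y ⊗ₖ Y')) (a, c) (b, d) := by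
  have e : (X ⊗ₖ X') * piZeroJ r * (Y ⊗ₖ Y') = ∑ p : Pairs r,
      ((X * weylPlus p * Y) ⊗ₖ (X' * (weylPlus p).transpose * Y') -
        (X * (weylPlus p).transpose * Y) ⊗ₖ (X' * weylPlus p * Y')) := by
    simp only [piZeroJ, Finset.mul_sum, Finset.sum_mul, mul_sub, sub_mul,
      ← Matrix.mul_kronecker_mul]
  rw [e, Matrix.sum_apply, ← Finset.sum_neg_distrib]
  refine Finset.sum_congr rfl fun p _ => ?_
  simp only [gen_inl, gen_inr, Matrix.mul_smul, Matrix.smul_mul, Matrix.smul_apply, smul_eq_mul,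
    Matrix.sub_apply, Matrix.kroneckerMap_apply]
  linear_combination ((X * weylPlus p * Y) a b * (X' * (weylPlus p).transpose * Y') c d -
        (X * (weylPlus p).transpose * Y) a b * (X' * weylPlus p * Y') c d) * Complex.I_mul_I

lemma hasDerivAt_flow_kronecker {r : ℕ} {u : Potential r} (hu : Continuous u) (z w : ℂ)
    (y s : ℝ) : HasDerivAt (fun s => flow (coef u z) s y ⊗ₖ flow (coef u w) s y)
      ((coef u z s ⊗ₖ 1 + 1 ⊗ₖ coef u w s) * (flow (coef u z) s y ⊗ₖ flow (coef u w) s y)) s := by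
  convert! hasDerivAt_kronecker (hasDerivAt_flow (continuous_coef hu z) s y)
    (hasDerivAt_flow (continuous_coef hu w) s y) using 1
  rw [add_mul, ← Matrix.mul_kronecker_mul, ← Matrix.mul_kronecker_mul, one_mul, one_mul]

lemma hasDerivAt_flow_right_kronecker {r : ℕ} {u : Potential r} (hu : Continuous u) (z w : ℂ)
    (x s : ℝ) : HasDerivAt (fun s => flow (coef u z) x s ⊗ₖ flow (coef u w) x s)
      (-((flow (coef u z) x s ⊗ₖ flow (coef u w) x s) *
        (coef u z s ⊗ₖ 1 + 1 ⊗ₖ coef u w s))) s := by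
  convert! hasDerivAt_kronecker (hasDerivAt_flow_right (continuous_coef hu z) x s)
    (hasDerivAt_flow_right (continuous_coef hu w) x s) using 1
  rw [mul_add, ← Matrix.mul_kronecker_mul, ← Matrix.mul_kronecker_mul, mul_one, mul_one]
  ext ⟨a, c⟩ ⟨b, d⟩
  simp only [Matrix.neg_apply, Matrix.add_apply, Matrix.kroneckerMap_apply]
  ring

/-- Differentiating the propagators on both sides of r produces its commutator with i(U⊗1 + 1⊗U), to
which `rMatrix_comm_U` applies. -/
lemma hasDerivAt_flow_rMatrix_flow {r : ℕ} {u : Potential r} (hu : Continuous u) {z w : ℂ}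
    (h : z ≠ w) (x y s : ℝ) :
    HasDerivAt (fun s => (flow (coef u z) x s ⊗ₖ flow (coef u w) x s) * rMatrix r (z - w) *
        (flow (coef u z) s y ⊗ₖ flow (coef u w) s y))
      ((-Complex.I) • ((flow (coef u z) x s ⊗ₖ flow (coef u w) x s) * piZeroJ r *
        (flow (coef u z) s y ⊗ₖ flow (coef u w) s y))) s := by
  convert! ((hasDerivAt_flow_right_kronecker hu z w x s).mul_const (rMatrix r (z - w))).mul
    (hasDerivAt_flow_kronecker hu z w y s) using 1
  have e : coef u z s ⊗ₖ 1 + 1 ⊗ₖ coef u w s =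
      Complex.I • (U u z s ⊗ₖ 1 + 1 ⊗ₖ U u w s) := by
    rw [coef, coef, Matrix.smul_kronecker, Matrix.kronecker_smul, smul_add]
  have hc := rMatrix_comm_U u h s
  rw [neg_eq_iff_eq_neg.1 hc.symm, e]
  simp only [Matrix.mul_smul, Matrix.smul_mul, neg_smul, mul_neg, neg_mul, smul_neg,
    mul_sub, sub_mul, smul_sub, mul_assoc]
  abel

/-- The integrand of the bracket is an exact derivative. At s = x only r(T⊗T) is left and at s = y
only (T⊗T)r, and their difference is the commutator. -/
lemma pairing_transGrad {r : ℕ} {u : Potential r} (hu : Continuous u) {z w : ℂ} (h : z ≠ w)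
    {x y L : ℝ} (h1 : -L ≤ y) (h2 : y ≤ x) (h3 : x ≤ L) (a b c d : Idx r) :
    pairing (volume.restrict (Set.Ioc (-L) L)) (transGrad u z x y a b) (transGrad u w x y c d) =
      (rMatrix r (z - w) * (flow (coef u z) x y ⊗ₖ flow (coef u w) x y) -
        (flow (coef u z) x y ⊗ₖ flow (coef u w) x y) * rMatrix r (z - w)) (a, c) (b, d) := by
  set K : ℝ → Mat2 r := fun s => (flow (coef u z) x s ⊗ₖ flow (coef u w) x s) * piZeroJ r *
        (flow (coef u z) s y ⊗ₖ flow (coef u w) s y) with hK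
  have e : (fun s => ∑ p : Pairs r, (transGrad u z x y a b s (Sum.inl p) *
      transGrad u w x y c d s (Sum.inr p) - transGrad u z x y a b s (Sum.inr p) *
      transGrad u w x y c d s (Sum.inl p))) =
      (Set.Ioc y x).indicator fun s => -K s (a, c) (b, d) := by
    funext s
    by_cases hs : s ∈ Set.Ioc y x
    · simp only [transGrad, Set.indicator_of_mem hs, flowVar]
      exact sum_gen_mul_sub _ _ _ _ a b c d
    · simp [transGrad, Set.indicator_of_notMem hs]
  rw [pairing, e, setIntegral_indicator measurableSet_Ioc,
    Set.inter_eq_right.2 (Set.Ioc_subset_Ioc h1 h3), ← intervalIntegral.integral_of_le h2,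
    ← intervalIntegral.integral_const_mul]
  have hd := fun s => hasDerivAt_matrix.1 (hasDerivAt_flow_rMatrix_flow hu h x y s) (a, c) (b, d)
  have hKc : Continuous K := by
    have c1 : Continuous fun s => flow (coef u z) x s ⊗ₖ flow (coef u w) x s :=
      continuous_iff_continuousAt.2 fun s => (hasDerivAt_flow_right_kronecker hu z w x s).continuousAt
    have c2 : Continuous fun s => flow (coef u z) s y ⊗ₖ flow (coef u w) s y :=
      continuous_iff_continuousAt.2 fun s => (hasDerivAt_flow_kronecker hu z w y s).continuousAt
    exact (c1.mul continuous_const).mul c2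
  have := intervalIntegral.integral_eq_sub_of_hasDerivAt (a := y) (b := x) (fun s _ => hd s)
    ((((continuous_entry hKc (a, c) (b, d)).const_smul (-Complex.I))).intervalIntegrable _ _)
  convert! this using 1
  · congr 1
    funext s
    simp [hK]
  · rw [flow_self, flow_self, flow_self, flow_self, Matrix.one_kronecker_one, one_mul, mul_one]
    rfl

/-! ### The determinants of the diagonal blocks -/

/-- U takes values in the orthogonal algebra, so the propagator stays in the orthogonal group: the
product has zero derivative. -/
lemma tilde_flow_mul_flow {r : ℕ} {u : Potential r} (hu : Continuous u) (z : ℂ) (x y : ℝ) :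
    tilde (flow (coef u z) x y) * flow (coef u z) x y = 1 := by
  have hd : ∀ x, HasDerivAt (fun x => tilde (flow (coef u z) x y) * flow (coef u z) x y) 0 x := by
    intro x
    have h1 := hasDerivAt_flow (continuous_coef hu z) x y
    have h2 : HasDerivAt (fun x => tilde (flow (coef u z) x y))
        (tilde (coef u z x * flow (coef u z) x y)) x :=
      hasDerivAt_matrix.2 fun a b =>
        (hasDerivAt_matrix.1 h1 (idxBar b) (idxBar a)).const_mul (eps a * eps b)
    convert! h2.mul h1 using 1
    rw [tilde_mul, coef, tilde_smul, tilde_U, smul_neg, mul_neg, neg_mul, mul_assoc,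
      neg_add_cancel]
  have := is_const_of_deriv_eq_zero (fun x => (hd x).differentiableAt) (fun x => (hd x).deriv) x y
  rw [this, flow_self, tilde_one, one_mul]

/-- Here T⁻¹ is `tilde` T, whose diagonal blocks are the opposite blocks of T, transposed, reversed
in both indices and multiplied by signs. Each sign enters the determinant twice. -/
lemma det_toBlocks_inv {r : ℕ} {T : Mat r} (h : tilde T * T = 1) :
    (T⁻¹).toBlocks₁₁.det = T.toBlocks₂₂.det ∧ (T⁻¹).toBlocks₂₂.det = T.toBlocks₁₁.det := by
  rw [Matrix.inv_eq_left_inv h]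
  have hsgn : (∏ i : Fin r, (eps (Sum.inl i : Idx r))) * (∏ i : Fin r, eps (Sum.inl i : Idx r)) = 1 := by
    rw [← Finset.prod_mul_distrib]
    exact Finset.prod_eq_one fun i _ => eps_mul_self _
  have hsgn' : (∏ i : Fin r, (eps (Sum.inr i : Idx r))) * (∏ i : Fin r, eps (Sum.inr i : Idx r)) = 1 := by
    rw [← Finset.prod_mul_distrib]
    exact Finset.prod_eq_one fun i _ => eps_mul_self _
  constructor
  · have e : (tilde T).toBlocks₁₁ = Matrix.of fun i j => eps (Sum.inl i : Idx r) * (Matrix.of fun i j =>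
        eps (Sum.inl j : Idx r) *
          (T.toBlocks₂₂.transpose.submatrix Fin.revPerm Fin.revPerm) i j) i j := by
      ext i j
      simp [Matrix.toBlocks₁₁, Matrix.toBlocks₂₂, tilde_apply, mul_assoc]
    rw [e, Matrix.det_mul_column, Matrix.det_mul_row, Matrix.det_submatrix_equiv_self,
      Matrix.det_transpose, ← mul_assoc, hsgn, one_mul]
  · have e : (tilde T).toBlocks₂₂ = Matrix.of fun i j => eps (Sum.inr i : Idx r) * (Matrix.of fun i j =>
        eps (Sum.inr j : Idx r) *
          (T.toBlocks₁₁.transpose.submatrix Fin.revPerm Fin.revPerm) i j) i j := by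
      ext i j
      simp [Matrix.toBlocks₁₁, Matrix.toBlocks₂₂, tilde_apply, mul_assoc]
    rw [e, Matrix.det_mul_column, Matrix.det_mul_row, Matrix.det_submatrix_equiv_self,
      Matrix.det_transpose, ← mul_assoc, hsgn', one_mul]

lemma det_cMinus_monodromy {r : ℕ} {u : Potential r} (hu : Continuous u) (L : ℝ) (z : ℂ) :
    (cMinus (monodromy L z u)).det = (aMinus (monodromy L z u)).det := by
  rw [monodromy, transition_eq_flow hu]
  exact (det_toBlocks_inv (tilde_flow_mul_flow hu z L (-L))).1

lemma det_cPlus_monodromy {r : ℕ} {u : Potential r} (hu : Continuous u) (L : ℝ) (z : ℂ) :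
    (cPlus (monodromy L z u)).det = (aPlus (monodromy L z u)).det := by
  rw [monodromy, transition_eq_flow hu]
  exact (det_toBlocks_inv (tilde_flow_mul_flow hu z L (-L))).2

/-- The gradient of the determinant of a diagonal block of the monodromy matrix. -/
def detGrad {r : ℕ} (e : Fin r → Idx r) (L : ℝ) (u : Potential r) (z : ℂ) : Potential r :=
  ∑ q : Fin r × Fin r, (((monodromy L z u).submatrix e e).adjugate q.2 q.1) •
    transGrad u z L (-L) (e q.1) (e q.2)

lemma hasVarDeriv_sum {r : ℕ} {M : Set (Potential r)} {ν : Measure ℝ} {ι : Type*} [Fintype ι]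
    {f : ι → Potential r} {F : Potential r → ℂ} {u : Potential r} (c : ι → ℂ)
    (hf : ∀ i, MemLp (f i) 2 ν) (hM : ∀ v ∈ M, MemLp v 2 ν) (h : ∀ v ∈ M,
      HasDerivAt (fun ε : ℂ => F (u + ε • v)) (∑ i, c i * ∫ x, ∑ k, f i x k * v x k ∂ν) 0) :
    HasVarDeriv M ν F u (∑ i, c i • f i) := by
  refine ⟨?_, fun v hv => ?_⟩
  · exact memLp_finsetSum' _ fun i _ => (hf i).const_smul (c i)
  · have e : ∀ x, ∑ k, (∑ i, c i • f i) x k * v x k = ∑ i, c i * ∑ k, f i x k * v x k := by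
      intro x
      simp only [Finset.sum_apply, Pi.smul_apply, smul_eq_mul, Finset.sum_mul, Finset.mul_sum]
      rw [Finset.sum_comm]
      exact Finset.sum_congr rfl fun i _ => Finset.sum_congr rfl fun k _ => by ring
    simp only [e]
    rw [integral_finsetSum]
    · simpa only [integral_const_mul] using h v hv
    · exact fun i _ => (integrable_finsetSum _ fun k _ => (memLp_two_apply (hf i) k).integrable_mul
        (memLp_two_apply (hM v hv) k)).const_mul _

lemma memLp_of_continuous {r : ℕ} {v : Potential r} (hv : Continuous v) (L : ℝ) :
    MemLp v 2 (volume.restrict (Set.Ioc (-L) L)) := by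
  obtain ⟨C, hC⟩ := (isCompact_Icc (a := -L) (b := L)).exists_bound_of_continuousOn hv.continuousOn
  exact MemLp.of_bound hv.aestronglyMeasurable C ((ae_restrict_iff' measurableSet_Ioc).2
    (ae_of_all _ fun s hs => hC s (Set.Ioc_subset_Icc_self hs)))

lemma hasVarDeriv_det {r : ℕ} {u : Potential r} {L : ℝ} (hL : 0 < L) (hu : u ∈ periodicSpace r L)
    (e : Fin r → Idx r) (z : ℂ) :
    HasVarDeriv (periodicSpace r L) (volume.restrict (Set.Ioc (-L) L))
      (fun v => ((monodromy L z v).submatrix e e).det) u (detGrad e L u z) := by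
  have hu' := continuous_of_mem_periodicSpace hu
  refine hasVarDeriv_sum _ (fun q => memLp_transGrad hu' z L (-L) L _ _)
    (fun v hv => memLp_of_continuous (continuous_of_mem_periodicSpace hv) L) fun v hv => ?_
  have hd := hasDerivAt_det (A := fun ε : ℂ => (monodromy L z (u + ε • v)).submatrix e e) (x := 0)
    (A' := Matrix.of fun i j => ∫ s in (-L)..L, flowVar u z L (-L) (Q v s) s (e i) (e j))
    fun i j => hasDerivAt_transition hu' (continuous_of_mem_periodicSpace hv) (by linarith) z _ _
  convert! hd using 1
  rw [Fintype.sum_prod_type, Finset.sum_comm]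
  simp only [Matrix.trace, Matrix.diag, Matrix.mul_apply, zero_smul, add_zero]
  exact Finset.sum_congr rfl fun j _ => Finset.sum_congr rfl fun i _ => by
    rw [integral_transGrad u v z le_rfl (by linarith) le_rfl]
    rfl

/-- The rank-one part of P needs c to be the reflection of a; otherwise only the flip acts. -/
lemma casimir_mul_kronecker_apply {r : ℕ} (A B : Mat r) {a c : Idx r} (h : c ≠ idxBar a)
    (b d : Idx r) : (casimir r * (A ⊗ₖ B)) (a, c) (b, d) = A c b * B a d := by
  simp only [Matrix.mul_apply, Fintype.sum_prod_type, casimir_apply, Matrix.kroneckerMap_apply,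
    h, false_and, if_false, mul_zero, sub_zero, ite_and, ite_mul, one_mul, zero_mul,
    Finset.sum_ite_eq, Finset.mem_univ, if_true]

lemma kronecker_mul_casimir_apply {r : ℕ} (A B : Mat r) {b d : Idx r} (h : d ≠ idxBar b)
    (a c : Idx r) : ((A ⊗ₖ B) * casimir r) (a, c) (b, d) = A a d * B c b := by
  simp only [Matrix.mul_apply, Fintype.sum_prod_type, casimir_apply, Matrix.kroneckerMap_apply,
    h, and_false, if_false, mul_zero, sub_zero, ite_and, mul_ite, mul_one,
    Finset.sum_ite_irrel, Finset.sum_const_zero, Finset.sum_ite_eq', Finset.mem_univ, if_true]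

/-- No two labels of one diagonal block are reflections of each other, which is `he`, so only the
flip in P contributes. Contraction with the cofactors then turns both halves of the commutator into
the same multiple of det A · det B. -/
lemma pairing_detGrad {r : ℕ} {u : Potential r} {L : ℝ} (hL : 0 < L) (hu : Continuous u)
    {e : Fin r → Idx r} (he : ∀ i j, e i ≠ idxBar (e j)) (z w : ℂ) :
    pairing (volume.restrict (Set.Ioc (-L) L)) (detGrad e L u z) (detGrad e L u w) = 0 := by
  -- For z = w the r-matrix formula is not available, but the two gradients coincide.
  rcases eq_or_ne z w with rfl | h
  · exact pairing_self _ _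
  rw [detGrad, detGrad, pairing_sum (fun q => memLp_transGrad hu z L (-L) L _ _)
    (fun q => memLp_transGrad hu w L (-L) L _ _)]
  set A := (monodromy L z u).submatrix e e with hA
  set B := (monodromy L w u).submatrix e e with hB
  have key : ∀ q q' : Fin r × Fin r, pairing (volume.restrict (Set.Ioc (-L) L))
      (transGrad u z L (-L) (e q.1) (e q.2)) (transGrad u w L (-L) (e q'.1) (e q'.2)) =
      -(1 / (2 * (z - w))) * (A q'.1 q.2 * B q.1 q'.2 - A q.1 q'.2 * B q'.1 q.2) := by
    intro q q'
    rw [pairing_transGrad hu h le_rfl (by linarith) le_rfl, rMatrix, Matrix.smul_mul,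
      Matrix.mul_smul, ← smul_sub, Matrix.smul_apply, Matrix.sub_apply,
      casimir_mul_kronecker_apply _ _ (he _ _), kronecker_mul_casimir_apply _ _ (he _ _),
      ← transition_eq_flow hu, ← transition_eq_flow hu]
    rfl
  simp only [key, Fintype.sum_prod_type]
  -- Summing over j and l forms A · adj A and B · adj B; in `h2` the factors come in the other
  -- order. Both products are scalar matrices, so the two sums agree.
  have h1 : ∑ i, ∑ j, ∑ k, ∑ l, A.adjugate j i * B.adjugate l k * (A k j * B i l) =
      ∑ i, ∑ k, (A * A.adjugate) k i * (B * B.adjugate) i k := by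
    simp only [Matrix.mul_apply, Finset.sum_mul_sum]
    refine Finset.sum_congr rfl fun i _ => ?_
    rw [Finset.sum_comm]
    exact Finset.sum_congr rfl fun k _ => Finset.sum_congr rfl fun j _ =>
      Finset.sum_congr rfl fun l _ => by ring
  have h2 : ∑ i, ∑ j, ∑ k, ∑ l, A.adjugate j i * B.adjugate l k * (A i l * B k j) =
      ∑ i, ∑ k, (A.adjugate * A) k i * (B.adjugate * B) i k := by
    simp only [Matrix.mul_apply, Finset.sum_mul_sum]
    rw [Finset.sum_comm]
    have : ∀ j : Fin r, ∑ i, ∑ k, ∑ l, A.adjugate j i * B.adjugate l k * (A i l * B k j) =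
        ∑ l, ∑ i, ∑ k, A.adjugate j i * A i l * (B.adjugate l k * B k j) := fun j => by
      calc _ = ∑ i, ∑ l, ∑ k, A.adjugate j i * B.adjugate l k * (A i l * B k j) :=
            Finset.sum_congr rfl fun i _ => Finset.sum_comm
        _ = _ := by
          rw [Finset.sum_comm]
          exact Finset.sum_congr rfl fun j _ => Finset.sum_congr rfl fun k _ =>
            Finset.sum_congr rfl fun l _ => by ring
    simp only [this]
    rw [Finset.sum_comm]
  simp only [Matrix.mul_adjugate] at h1
  simp only [Matrix.adjugate_mul] at h2
  rw [← h2] at h1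
  calc _ = -(1 / (2 * (z - w))) *
        (∑ i, ∑ j, ∑ k, ∑ l, A.adjugate j i * B.adjugate l k * (A k j * B i l) -
        ∑ i, ∑ j, ∑ k, ∑ l, A.adjugate j i * B.adjugate l k * (A i l * B k j)) := by
        simp only [Finset.mul_sum, ← Finset.sum_sub_distrib]
        refine Finset.sum_congr rfl fun i _ => Finset.sum_congr rfl fun j _ =>
          Finset.sum_congr rfl fun k _ => Finset.sum_congr rfl fun l _ => by ring
    _ = 0 := by rw [h1, sub_self, mul_zero]

/-- Identities between functionals need to hold only for continuous potentials, because u + εv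
remains continuous. -/
lemma HasBracket.congr {r : ℕ} {M : Set (Potential r)} {ν : Measure ℝ} {F G F' G' : Potential r → ℂ}
    {u : Potential r} {c : ℂ} (hu : Continuous u) (hM : ∀ v ∈ M, Continuous v)
    (hF : ∀ v, Continuous v → F v = F' v) (hG : ∀ v, Continuous v → G v = G' v)
    (h : HasBracket M ν F G u c) : HasBracket M ν F' G' u c := by
  obtain ⟨f, g, hf, hg, hc⟩ := h
  refine ⟨f, g, ⟨hf.1, fun v hv => ?_⟩, ⟨hg.1, fun v hv => ?_⟩, hc⟩
  · convert! hf.2 v hv using 2 with ε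
    exact (hF _ (continuous_add_smul hu (hM v hv) ε)).symm
  · convert! hg.2 v hv using 2 with ε
    exact (hG _ (continuous_add_smul hu (hM v hv) ε)).symm

theorem hasPeriodicBracket_transition {r : ℕ} {u : Potential r} {L : ℝ}
    (hu : u ∈ periodicSpace r L) {z w : ℂ} (h : z ≠ w) {x y : ℝ} (h1 : -L ≤ y) (h2 : y ≤ x)
    (h3 : x ≤ L) (a b c d : Idx r) :
    HasPeriodicBracket L (fun v => transition v x y z a b) (fun v => transition v x y w c d) u
      ((rMatrix r (z - w) * (transition u x y z ⊗ₖ transition u x y w) -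
        (transition u x y z ⊗ₖ transition u x y w) * rMatrix r (z - w)) (a, c) (b, d)) := by
  have hu' := continuous_of_mem_periodicSpace hu
  refine HasBracket.of_pairing (hasVarDeriv_transition hu z h1 h2 h3 a b)
    (hasVarDeriv_transition hu w h1 h2 h3 c d) ?_
  rw [pairing_transGrad hu' h h1 h2 h3, transition_eq_flow hu', transition_eq_flow hu']

theorem hasPeriodicBracket_det {r : ℕ} {u : Potential r} {L : ℝ} (hL : 0 < L)
    (hu : u ∈ periodicSpace r L) (z w : ℂ) :
    HasPeriodicBracket L (fun v => (aPlus (monodromy L z v)).det)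
        (fun v => (aPlus (monodromy L w v)).det) u 0 ∧
      HasPeriodicBracket L (fun v => (cMinus (monodromy L z v)).det)
        (fun v => (cMinus (monodromy L w v)).det) u 0 ∧
      HasPeriodicBracket L (fun v => (aMinus (monodromy L z v)).det)
        (fun v => (aMinus (monodromy L w v)).det) u 0 ∧
      HasPeriodicBracket L (fun v => (cPlus (monodromy L z v)).det)
        (fun v => (cPlus (monodromy L w v)).det) u 0 := by
  have hu' := continuous_of_mem_periodicSpace hu
  have h1 : HasPeriodicBracket L (fun v => (aPlus (monodromy L z v)).det)
      (fun v => (aPlus (monodromy L w v)).det) u 0 :=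
    HasBracket.of_pairing (hasVarDeriv_det hL hu Sum.inl z) (hasVarDeriv_det hL hu Sum.inl w)
      (pairing_detGrad hL hu' (fun i j => by simp) z w)
  have h2 : HasPeriodicBracket L (fun v => (aMinus (monodromy L z v)).det)
      (fun v => (aMinus (monodromy L w v)).det) u 0 :=
    HasBracket.of_pairing (hasVarDeriv_det hL hu Sum.inr z) (hasVarDeriv_det hL hu Sum.inr w)
      (pairing_detGrad hL hu' (fun i j => by simp) z w)
  exact ⟨h1, HasBracket.congr hu' (fun v => continuous_of_mem_periodicSpace)
      (fun v hv => (det_cMinus_monodromy hv L z).symm)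
      (fun v hv => (det_cMinus_monodromy hv L w).symm) h2, h2,
    HasBracket.congr hu' (fun v => continuous_of_mem_periodicSpace)
      (fun v hv => (det_cPlus_monodromy hv L z).symm)
      (fun v hv => (det_cPlus_monodromy hv L w).symm) h1⟩

end DIII
end

noncomputable section
set_option linter.unusedSectionVars false
namespace DIII
open Finset.HasAntidiagonal (antidiagonal)

/-! ### Matrices over a differential ring -/

section MatrixDerivation

variable {R : Type*} [CommRing R] [Algebra ℂ R] {n : Type*} [Fintype n] [DecidableEq n]

lemma map_derivation_mul (d : Derivation ℂ R R) (A B : Matrix n n R) :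
    (A * B).map d = A.map d * B + A * B.map d := by
  ext i j
  simp only [Matrix.map_apply, Matrix.mul_apply, map_sum, Derivation.leibniz, smul_eq_mul,
    Matrix.add_apply, ← Finset.sum_add_distrib]
  exact Finset.sum_congr rfl fun k _ => by ring

lemma map_derivation_algebraMap (d : Derivation ℂ R R) (A : Matrix n n ℂ) :
    (A.map (algebraMap ℂ R)).map d = 0 := by
  ext i j; simp

lemma map_derivation_add (d : Derivation ℂ R R) (A B : Matrix n n R) :
    (A + B).map d = A.map d + B.map d := by
  ext i j; simp

lemma map_derivation_sub (d : Derivation ℂ R R) (A B : Matrix n n R) :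
    (A - B).map d = A.map d - B.map d := by
  ext i j; simp

lemma map_derivation_one (d : Derivation ℂ R R) : (1 : Matrix n n R).map d = 0 := by
  ext i j; rw [Matrix.map_apply, Matrix.one_apply]; split_ifs <;> simp

lemma map_derivation_smul (d : Derivation ℂ R R) {s : R} (hs : d s = 0) (A : Matrix n n R) :
    (s • A).map d = s • A.map d := by
  ext i j; simp [hs]

lemma map_derivation_smul_complex (d : Derivation ℂ R R) (s : ℂ) (A : Matrix n n R) :
    (s • A).map d = s • A.map d := by
  ext i j; simp

lemma map_derivation_inv (d : Derivation ℂ R R) {G H : Matrix n n R} (h : G * H = 1)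
    (h' : H * G = 1) : H.map d = -(H * G.map d * H) := by
  have h1 := congrArg (fun M => H * M.map d) h
  simp only [map_derivation_mul, map_derivation_one, mul_zero, mul_add] at h1
  rw [← mul_assoc H G, h', one_mul, ← mul_assoc] at h1
  exact eq_neg_of_add_eq_zero_right h1

lemma trace_map_derivation (d : Derivation ℂ R R) (A : Matrix n n R) :
    (A.map d).trace = d A.trace := by
  simp [Matrix.trace]

variable {d δ : Derivation ℂ R R} {s : R} {U D G H e P : Matrix n n R}

/-- The projector attached to a diagonalising gauge obeys the Lax equation. -/
lemma lax_of_gauge (hG : s • G.map d = U * G - G * D) (h : G * H = 1) (h' : H * G = 1)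
    (he : e.map d = 0) (heD : e * D = D * e) :
    s • (G * e * H).map d = U * (G * e * H) - (G * e * H) * U := by
  rw [map_derivation_mul, map_derivation_mul, he, mul_zero, add_zero, map_derivation_inv d h h',
    smul_add, mul_neg, smul_neg, ← smul_mul_assoc, ← smul_mul_assoc, hG]
  have e1 : s • (G * e * (H * G.map d * H)) = G * e * (H * (s • G.map d) * H) := by
    simp only [mul_smul_comm, smul_mul_assoc]
  rw [e1, hG]
  have e2 : G * e * (H * (U * G - G * D) * H) = G * e * H * U * (G * H) - G * e * (H * G) * D * H := by
    noncomm_ring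
  rw [e2, h, h', mul_one, mul_one, sub_mul, sub_mul, mul_assoc G e D, heD]
  noncomm_ring

/-- The first variation of the density of the integrals of motion. -/
lemma variation_of_gauge (hs' : δ s = 0) (hcomm : (G.map δ).map d = (G.map d).map δ)
    (hG : s • G.map d = U * G - G * D) (h : G * H = 1) (h' : H * G = 1)
    (he : e.map d = 0) (heD : e * D = D * e) :
    (e * D.map δ).trace = (U.map δ * (G * e * H)).trace - s * d (e * H * G.map δ).trace := by
  have h1 := congrArg (fun M => M.map δ) hG
  simp only [map_derivation_smul δ hs', map_derivation_sub, map_derivation_mul] at h1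
  have h2 : G * D.map δ = U.map δ * G + U * G.map δ - G.map δ * D - s • (G.map d).map δ := by
    rw [h1]; abel
  have h3 : D.map δ = H * U.map δ * G + H * U * G.map δ - H * G.map δ * D -
      s • (H * (G.map d).map δ) := by
    have := congrArg (fun M => H * M) h2
    simp only [← mul_assoc, h', one_mul, mul_sub, mul_add, mul_smul_comm] at this
    exact this
  -- The derivative of e H δG reproduces the terms of `h3` with U, D and d(δG). Under the trace only
  -- the term with δU and this derivative remain.
  have h4 : s • (e * H * G.map δ).map d = -(e * H * U * G.map δ) + e * D * H * G.map δ +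
      s • (e * H * (G.map d).map δ) := by
    rw [map_derivation_mul, map_derivation_mul, he, zero_mul, zero_add,
      map_derivation_inv d h h', hcomm, smul_add]
    congr 1
    have e1 : s • (e * -(H * G.map d * H) * G.map δ) = -(e * (H * (s • G.map d) * H) * G.map δ) := by
      simp only [mul_smul_comm, smul_mul_assoc, mul_neg, neg_mul, smul_neg]
    rw [e1, hG]
    have e2 : e * (H * (U * G - G * D) * H) * G.map δ =
        e * H * U * (G * H) * G.map δ - e * (H * G) * D * H * G.map δ := by noncomm_ring
    rw [e2, h, h', mul_one, mul_one]
    abel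
  have h5 := congrArg Matrix.trace h4
  rw [Matrix.trace_smul, trace_map_derivation, smul_eq_mul, Matrix.trace_add, Matrix.trace_add,
    Matrix.trace_neg] at h5
  rw [h5, h3, mul_sub, mul_sub, mul_add, Matrix.trace_sub, Matrix.trace_sub, Matrix.trace_add]
  have e1 : (e * (H * U.map δ * G)).trace = (U.map δ * (G * e * H)).trace := by
    rw [show e * (H * U.map δ * G) = (e * H * U.map δ) * G by noncomm_ring, Matrix.trace_mul_comm,
      show G * (e * H * U.map δ) = (G * e * H) * U.map δ by noncomm_ring, Matrix.trace_mul_comm]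
  have e2 : (e * (H * G.map δ * D)).trace = (e * D * H * G.map δ).trace := by
    rw [show e * (H * G.map δ * D) = (e * H * G.map δ) * D by noncomm_ring, Matrix.trace_mul_comm,
      show D * (e * H * G.map δ) = (D * e) * H * G.map δ by noncomm_ring, heD]
  rw [e1, e2, mul_smul_comm]
  simp only [← mul_assoc]
  ring

end MatrixDerivation

/-! ### The formal diagonalisation -/

section Formal

variable {S S' : Type*} [CommRing S] [Algebra ℂ S] [CommRing S'] [Algebra ℂ S'] {r : ℕ}

/-- Matrices with entries in a ring of functions or of formal objects. -/
abbrev MatOver (r : ℕ) (S : Type*) := Matrix (Idx r) (Idx r) S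

/-- `J` with entries in an algebra. -/
def JOver (r : ℕ) (S : Type*) [CommRing S] [Algebra ℂ S] : MatOver r S :=
  (J r).map (algebraMap ℂ S)

/-- The projector on the upper block. -/
def upProj (r : ℕ) : Mat r := Matrix.diagonal (Sum.elim 1 0)

/-- The projector on the upper block, with entries in an algebra. -/
def upOver (r : ℕ) (S : Type*) [CommRing S] [Algebra ℂ S] : MatOver r S :=
  (upProj r).map (algebraMap ℂ S)

/-- The coefficients of the formal solution of the Riccati equation
`W' = iQ - 2iλJW - iWQW` in powers of `1/λ`. -/
def riccati (d : Derivation ℂ S S) (Q : MatOver r S) : ℕ → MatOver r S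
  | 0 => 0
  | k + 1 => (1 / 2 : ℂ) • (JOver r S * ((if k = 0 then Q else 0) +
      Complex.I • (riccati d Q k).map d -
        ∑ j : Fin (k + 1), riccati d Q j * Q * riccati d Q (k - j)))
  decreasing_by all_goals omega

lemma riccati_zero (d : Derivation ℂ S S) (Q : MatOver r S) : riccati d Q 0 = 0 := by
  rw [riccati]

lemma sum_fin_eq_antidiagonal {M : Type*} [AddCommMonoid M] (f : ℕ → ℕ → M) (k : ℕ) :
    ∑ j : Fin (k + 1), f j (k - j) = ∑ q ∈ antidiagonal k, f q.1 q.2 := by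
  rw [Finset.Nat.sum_antidiagonal_eq_sum_range_succ f, Finset.sum_range]

lemma riccati_succ (d : Derivation ℂ S S) (Q : MatOver r S) (k : ℕ) :
    riccati d Q (k + 1) = (1 / 2 : ℂ) • (JOver r S * ((if k = 0 then Q else 0) +
      Complex.I • (riccati d Q k).map d -
        ∑ q ∈ antidiagonal k, riccati d Q q.1 * Q * riccati d Q q.2)) := by
  rw [riccati, sum_fin_eq_antidiagonal fun i j => riccati d Q i * Q * riccati d Q j]

lemma JOver_mul_self : JOver r S * JOver r S = 1 := by
  rw [JOver, ← Matrix.map_mul, J_eq_diagonal, Matrix.diagonal_mul_diagonal]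
  have : (Matrix.diagonal fun i : Idx r => sgn i * sgn i) = (1 : Mat r) := by
    rw [← Matrix.diagonal_one]
    congr 1
    funext i
    rcases i with i | i <;> simp [sgn]
  rw [this]
  simp

/-- The recursion is universal, so homomorphisms that respect the derivations carry it along. This
serves to set all fields to zero and to embed the fields into a doubled set. -/
lemma map_riccati {d : Derivation ℂ S S} {d' : Derivation ℂ S' S'} (f : S →ₐ[ℂ] S')
    (hf : ∀ x, f (d x) = d' (f x)) (Q : MatOver r S) (k : ℕ) :
    (riccati d Q k).map f = riccati d' (Q.map f) k := by
  induction k using Nat.strong_induction_on with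
  | _ k ih =>
    rcases k with _ | k
    · rw [riccati_zero, riccati_zero]; simp
    · rw [riccati_succ, riccati_succ]
      have hJ : (JOver r S).map f = JOver r S' := by
        rw [JOver, Matrix.map_map]
        congr 1
        funext x
        simp
      have hd : ((riccati d Q k).map d).map f = (riccati d' (Q.map f) k).map d' := by
        rw [← ih k (by omega), Matrix.map_map, Matrix.map_map]
        congr 1
        funext x
        exact hf x
      have hs : (∑ q ∈ antidiagonal k, riccati d Q q.1 * Q * riccati d Q q.2).map f =
          ∑ q ∈ antidiagonal k, riccati d' (Q.map f) q.1 * Q.map f * riccati d' (Q.map f) q.2 := by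
        rw [← AlgHom.mapMatrix_apply, map_sum]
        refine Finset.sum_congr rfl fun q hq => ?_
        have := Finset.HasAntidiagonal.mem_antidiagonal.1 hq
        rw [map_mul, map_mul]
        simp only [AlgHom.mapMatrix_apply]
        rw [ih q.1 (by omega), ih q.2 (by omega)]
      rw [← AlgHom.mapMatrix_apply, map_smul, map_mul, map_sub, map_add, map_smul]
      simp only [AlgHom.mapMatrix_apply, hJ, hd, hs]
      congr 4
      split_ifs
      · rfl
      · simp

/-- The derivation of the ring of power series that acts on the coefficients. -/
def seriesD (d : Derivation ℂ S S) : Derivation ℂ (PowerSeries S) (PowerSeries S) :=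
  Derivation.mk'
    { toFun := fun f => PowerSeries.mk fun n => d (PowerSeries.coeff n f)
      map_add' := fun f g => by ext n; simp
      map_smul' := fun c f => by ext n; simp }
    fun f g => by
      ext n
      simp only [LinearMap.coe_mk, AddHom.coe_mk, PowerSeries.coeff_mk, PowerSeries.coeff_mul,
        map_sum, Derivation.leibniz, smul_eq_mul, map_add, Finset.sum_add_distrib]
      congr 1
      rw [← Finset.Nat.sum_antidiagonal_swap]
      rfl

@[simp] lemma coeff_seriesD (d : Derivation ℂ S S) (f : PowerSeries S) (n : ℕ) :
    PowerSeries.coeff n (seriesD d f) = d (PowerSeries.coeff n f) := by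
  simp [seriesD]

lemma seriesD_X (d : Derivation ℂ S S) : seriesD d PowerSeries.X = 0 := by
  ext n
  rw [coeff_seriesD, PowerSeries.coeff_X]
  split_ifs <;> simp

/-- The formal gauge `1 + ∑ W_k s^k`. -/
def gauge (d : Derivation ℂ S S) (Q : MatOver r S) : MatOver r (PowerSeries S) :=
  1 + Matrix.of fun a b => PowerSeries.mk fun k => riccati d Q k a b

lemma constantCoeff_det_gauge (d : Derivation ℂ S S) (Q : MatOver r S) :
    PowerSeries.constantCoeff (gauge d Q).det = 1 := by
  rw [RingHom.map_det]
  have : (PowerSeries.constantCoeff (R := S)).mapMatrix (gauge d Q) = 1 := by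
    ext a b
    by_cases h : a = b <;> simp [gauge, riccati_zero, Matrix.one_apply, h]
  rw [this, Matrix.det_one]

lemma isUnit_det_gauge (d : Derivation ℂ S S) (Q : MatOver r S) : IsUnit (gauge d Q).det := by
  rw [PowerSeries.isUnit_iff_constantCoeff, constantCoeff_det_gauge]
  exact isUnit_one

/-- The formal projector on the decaying directions. -/
def gaugeProj (d : Derivation ℂ S S) (Q : MatOver r S) : MatOver r (PowerSeries S) :=
  gauge d Q * upOver r (PowerSeries S) * (gauge d Q)⁻¹

/-- A coefficient matrix of a matrix of power series. -/
def matCoeff (k : ℕ) (M : MatOver r (PowerSeries S)) : MatOver r S := M.map (PowerSeries.coeff k)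

lemma matCoeff_ext {M N : MatOver r (PowerSeries S)} (h : ∀ k, matCoeff k M = matCoeff k N) :
    M = N := by
  ext a b k
  exact congrFun (congrFun (h k) a) b

lemma matCoeff_mul (k : ℕ) (M N : MatOver r (PowerSeries S)) :
    matCoeff k (M * N) = ∑ q ∈ antidiagonal k, matCoeff q.1 M * matCoeff q.2 N := by
  ext a b
  simp only [matCoeff, Matrix.map_apply, Matrix.mul_apply, map_sum, PowerSeries.coeff_mul,
    Matrix.sum_apply]
  rw [Finset.sum_comm]

lemma matCoeff_add (k : ℕ) (M N : MatOver r (PowerSeries S)) :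
    matCoeff k (M + N) = matCoeff k M + matCoeff k N := by ext; simp [matCoeff]

lemma matCoeff_sub (k : ℕ) (M N : MatOver r (PowerSeries S)) :
    matCoeff k (M - N) = matCoeff k M - matCoeff k N := by ext; simp [matCoeff]

lemma matCoeff_smul (k : ℕ) (c : ℂ) (M : MatOver r (PowerSeries S)) :
    matCoeff k (c • M) = c • matCoeff k M := by ext; simp [matCoeff]

/-- A matrix of constants as a matrix of power series. -/
def constMat (M : MatOver r S) : MatOver r (PowerSeries S) := M.map PowerSeries.C

lemma matCoeff_constMat_mul (k : ℕ) (M : MatOver r S) (N : MatOver r (PowerSeries S)) :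
    matCoeff k (constMat M * N) = M * matCoeff k N := by
  ext a b
  simp [matCoeff, constMat, Matrix.mul_apply]

lemma matCoeff_mul_constMat (k : ℕ) (M : MatOver r S) (N : MatOver r (PowerSeries S)) :
    matCoeff k (N * constMat M) = matCoeff k N * M := by
  ext a b
  simp [matCoeff, constMat, Matrix.mul_apply]

lemma matCoeff_zero_X_smul (M : MatOver r (PowerSeries S)) :
    matCoeff 0 ((PowerSeries.X : PowerSeries S) • M) = 0 := by
  ext a b; simp [matCoeff]

lemma matCoeff_succ_X_smul (k : ℕ) (M : MatOver r (PowerSeries S)) :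
    matCoeff (k + 1) ((PowerSeries.X : PowerSeries S) • M) = matCoeff k M := by
  ext a b; simp [matCoeff, PowerSeries.coeff_succ_X_mul]

lemma JOver_powerSeries : JOver r (PowerSeries S) = constMat (JOver r S) := by
  ext a b; simp [JOver, constMat, PowerSeries.algebraMap_apply]

lemma upOver_powerSeries : upOver r (PowerSeries S) = constMat (upOver r S) := by
  ext a b; simp [upOver, constMat, PowerSeries.algebraMap_apply]

lemma matCoeff_seriesD (d : Derivation ℂ S S) (k : ℕ) (M : MatOver r (PowerSeries S)) :
    matCoeff k (M.map (seriesD d)) = (matCoeff k M).map d := by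
  ext a b; simp [matCoeff]

/-- The formal series `∑ W_k s^k`. -/
def riccatiSeries (d : Derivation ℂ S S) (Q : MatOver r S) : MatOver r (PowerSeries S) :=
  Matrix.of fun a b => PowerSeries.mk fun k => riccati d Q k a b

lemma gauge_eq (d : Derivation ℂ S S) (Q : MatOver r S) : gauge d Q = 1 + riccatiSeries d Q := rfl

lemma matCoeff_riccatiSeries (d : Derivation ℂ S S) (Q : MatOver r S) (k : ℕ) :
    matCoeff k (riccatiSeries d Q) = riccati d Q k := by
  ext a b; simp [matCoeff, riccatiSeries]

/-- `Q` is off-diagonal with respect to the two blocks. -/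
def IsOffDiag (Q : MatOver r S) : Prop := JOver r S * Q = -(Q * JOver r S)

/-- Anticommutation with J survives differentiation, multiplication by J, and products of three
off-diagonal factors. -/
lemma isOffDiag_riccati (d : Derivation ℂ S S) {Q : MatOver r S} (hQ : IsOffDiag Q) (k : ℕ) :
    IsOffDiag (riccati d Q k) := by
  induction k using Nat.strong_induction_on with
  | _ k ih =>
    rcases k with _ | k
    · rw [riccati_zero, IsOffDiag]; simp
    · have h : ∀ M : MatOver r S, IsOffDiag M → IsOffDiag ((1 / 2 : ℂ) • (JOver r S * M)) := by
        intro M hM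
        rw [IsOffDiag] at hM ⊢
        rw [mul_smul_comm, smul_mul_assoc, ← smul_neg, mul_assoc, hM, mul_neg]
      have hadd : ∀ M N : MatOver r S, IsOffDiag M → IsOffDiag N → IsOffDiag (M + N) := by
        intro M N hM hN
        rw [IsOffDiag] at *
        rw [mul_add, add_mul, hM, hN]; abel
      have hneg : ∀ M : MatOver r S, IsOffDiag M → IsOffDiag (-M) := by
        intro M hM
        rw [IsOffDiag] at *
        rw [mul_neg, neg_mul, hM]
      rw [riccati_succ, sub_eq_add_neg]
      refine h _ (hadd _ _ (hadd _ _ ?_ ?_) (hneg _ ?_))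
      · split_ifs
        · exact hQ
        · simp [IsOffDiag]
      · have h1 := congrArg (fun M => M.map d) (ih k (by omega))
        simp only [map_derivation_mul] at h1
        rw [show (-(riccati d Q k * JOver r S)).map d = -((riccati d Q k * JOver r S).map d) by
          ext; simp, map_derivation_mul] at h1
        rw [show (JOver r S).map d = 0 from map_derivation_algebraMap d _] at h1
        simp only [zero_mul, zero_add, mul_zero, add_zero] at h1
        rw [IsOffDiag, mul_smul_comm, h1, smul_mul_assoc, smul_neg]
      · refine Finset.sum_induction _ _ hadd (by simp [IsOffDiag]) fun q hq => ?_
        have := Finset.HasAntidiagonal.mem_antidiagonal.1 hq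
        have h1 := ih q.1 (by omega)
        have h2 := ih q.2 (by omega)
        rw [IsOffDiag] at hQ h1 h2 ⊢
        rw [← mul_assoc, ← mul_assoc, h1, neg_mul, neg_mul, mul_assoc _ _ Q, hQ, mul_neg, neg_mul,
          neg_neg, mul_assoc, mul_assoc, h2]
        noncomm_ring

/-- The recursion multiplied by 2iJ, with J² = 1: this is the coefficient of λ^{-k} in the Riccati
equation. -/
lemma two_I_J_riccati_succ (d : Derivation ℂ S S) (Q : MatOver r S) (k : ℕ) :
    (2 * Complex.I) • (JOver r S * riccati d Q (k + 1)) =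
      Complex.I • (if k = 0 then Q else 0) - (riccati d Q k).map d -
        Complex.I • ∑ q ∈ antidiagonal k, riccati d Q q.1 * Q * riccati d Q q.2 := by
  rw [riccati_succ, mul_smul_comm, ← mul_assoc, JOver_mul_self, one_mul, smul_smul,
    show 2 * Complex.I * (1 / 2) = Complex.I by ring, smul_sub, smul_add, smul_smul,
    Complex.I_mul_I, neg_one_smul, ← sub_eq_add_neg]

/-- The coefficient of the linear problem, multiplied by `s = 1/λ`. -/
def formalU (Q : MatOver r S) : MatOver r (PowerSeries S) :=
  Complex.I • ((PowerSeries.X : PowerSeries S) • constMat Q - JOver r (PowerSeries S))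

/-- The coefficient of the diagonalised linear problem, multiplied by `s = 1/λ`. -/
def formalD (d : Derivation ℂ S S) (Q : MatOver r S) : MatOver r (PowerSeries S) :=
  Complex.I • ((PowerSeries.X : PowerSeries S) • (constMat Q * riccatiSeries d Q) -
    JOver r (PowerSeries S))

lemma JOver_mul_riccatiSeries (d : Derivation ℂ S S) {Q : MatOver r S} (hQ : IsOffDiag Q) :
    JOver r (PowerSeries S) * riccatiSeries d Q = -(riccatiSeries d Q * JOver r (PowerSeries S)) := by
  refine matCoeff_ext fun k => ?_
  rw [JOver_powerSeries, matCoeff_constMat_mul, ← neg_mul, matCoeff_mul_constMat,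
    show matCoeff k (-riccatiSeries d Q) = -matCoeff k (riccatiSeries d Q) by ext; simp [matCoeff],
    matCoeff_riccatiSeries, isOffDiag_riccati d hQ k, neg_mul]

/-- Here X stands for 1/λ. The block-diagonal part of UG is absorbed by the choice of `formalD`;
what remains is off-diagonal and is the Riccati equation, compared coefficient by coefficient. -/
lemma gauge_equation (d : Derivation ℂ S S) {Q : MatOver r S} (hQ : IsOffDiag Q) :
    (PowerSeries.X : PowerSeries S) • (gauge d Q).map (seriesD d) =
      formalU Q * gauge d Q - gauge d Q * formalD d Q := by
  set W := riccatiSeries d Q with hW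
  have h0 : formalU Q * gauge d Q - gauge d Q * formalD d Q =
      (PowerSeries.X : PowerSeries S) • (Complex.I • constMat Q - Complex.I • (W * constMat Q * W)) -
        (2 * Complex.I) • (JOver r (PowerSeries S) * W) := by
    rw [gauge_eq, formalU, formalD, ← hW]
    have h1 := JOver_mul_riccatiSeries d hQ
    rw [← hW] at h1
    have h2 : W * JOver r (PowerSeries S) = -(JOver r (PowerSeries S) * W) := by rw [h1, neg_neg]
    simp only [mul_add, add_mul, mul_one, one_mul, mul_sub, sub_mul, smul_mul_assoc,
      mul_smul_comm, h2, smul_sub, smul_add, smul_neg, mul_assoc, two_mul, add_smul,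
      smul_comm Complex.I (PowerSeries.X : PowerSeries S)]
    abel
  rw [h0, gauge_eq, map_derivation_add, map_derivation_one, zero_add, ← hW]
  refine matCoeff_ext fun k => ?_
  rcases k with _ | k
  · rw [matCoeff_zero_X_smul, matCoeff_sub, matCoeff_zero_X_smul, matCoeff_smul, JOver_powerSeries,
      matCoeff_constMat_mul, hW, matCoeff_riccatiSeries, riccati_zero]
    simp
  · rw [matCoeff_succ_X_smul, matCoeff_sub, matCoeff_succ_X_smul, matCoeff_smul, JOver_powerSeries,
      matCoeff_constMat_mul, hW, matCoeff_seriesD, matCoeff_riccatiSeries, matCoeff_riccatiSeries,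
      two_I_J_riccati_succ, matCoeff_sub, matCoeff_smul, matCoeff_smul, matCoeff_mul]
    have h1 : matCoeff k (constMat Q) = if k = 0 then Q else 0 := by
      ext a b
      rcases k with _ | k <;> simp [matCoeff, constMat]
    simp only [matCoeff_mul_constMat, matCoeff_riccatiSeries, h1]
    abel

end Formal
end DIII
end

/-! ### The formal projector, its Lax equation and the variation of the densities -/

noncomputable section
set_option linter.unusedSectionVars false
namespace DIII
open Finset.HasAntidiagonal (antidiagonal)

section Formal

variable {S S' : Type*} [CommRing S] [Algebra ℂ S] [CommRing S'] [Algebra ℂ S'] {r : ℕ}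

lemma upProj_eq (r : ℕ) : upProj r = (1 / 2 : ℂ) • (1 + J r) := by
  rw [upProj, J_eq_diagonal, ← Matrix.diagonal_one, Matrix.diagonal_add, ← Matrix.diagonal_smul]
  congr 1
  funext i
  rcases i with i | i <;> simp [sgn]; norm_num

lemma upOver_eq : upOver r S = (1 / 2 : ℂ) • (1 + JOver r S) := by
  rw [upOver, upProj_eq, JOver]
  ext a b
  rw [Matrix.smul_apply, Matrix.map_apply, Matrix.smul_apply, smul_eq_mul, map_mul,
    Algebra.smul_def, Matrix.add_apply, Matrix.add_apply, Matrix.map_apply, map_add]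
  congr 2
  rw [Matrix.one_apply, Matrix.one_apply]
  split_ifs <;> simp

/-- A product of two off-diagonal matrices such as Q and W is block-diagonal, so the diagonalised
coefficient commutes with the block projector. -/
lemma upOver_mul_formalD (d : Derivation ℂ S S) {Q : MatOver r S} (hQ : IsOffDiag Q) :
    upOver r (PowerSeries S) * formalD d Q = formalD d Q * upOver r (PowerSeries S) := by
  have h1 := JOver_mul_riccatiSeries d hQ
  have h2 : JOver r (PowerSeries S) * constMat Q = -(constMat Q * JOver r (PowerSeries S)) := by
    rw [JOver_powerSeries]
    refine matCoeff_ext fun k => ?_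
    have hC : ∀ k, matCoeff k (constMat Q) = if k = 0 then Q else 0 := fun k => by
      ext a b
      rcases k with _ | k <;> simp [matCoeff, constMat]
    rw [matCoeff_constMat_mul, ← neg_mul, matCoeff_mul_constMat,
      show matCoeff k (-constMat Q) = -matCoeff k (constMat Q) by ext; simp [matCoeff], hC]
    split_ifs
    · rw [hQ, neg_mul]
    · simp
  have h3 : JOver r (PowerSeries S) * (constMat Q * riccatiSeries d Q) =
      constMat Q * riccatiSeries d Q * JOver r (PowerSeries S) := by
    rw [← mul_assoc, h2, neg_mul, mul_assoc, h1, mul_neg, neg_neg, mul_assoc]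
  rw [upOver_eq, formalD]
  simp only [smul_mul_assoc, mul_smul_comm, mul_sub, sub_mul, mul_add, add_mul, one_mul, mul_one, h3,
    smul_add, smul_sub, smul_comm (1 / 2 : ℂ) Complex.I,
    smul_comm (1 / 2 : ℂ) (PowerSeries.X : PowerSeries S)]
  abel

lemma gaugeProj_lax (d : Derivation ℂ S S) {Q : MatOver r S} (hQ : IsOffDiag Q) :
    (PowerSeries.X : PowerSeries S) • (gaugeProj d Q).map (seriesD d) =
      formalU Q * gaugeProj d Q - gaugeProj d Q * formalU Q :=
  lax_of_gauge (gauge_equation d hQ) (Matrix.mul_nonsing_inv _ (isUnit_det_gauge d Q))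
    (Matrix.nonsing_inv_mul _ (isUnit_det_gauge d Q)) (map_derivation_algebraMap _ _)
    (upOver_mul_formalD d hQ)

/-- The coefficients of the formal projector. -/
def projCoeff (d : Derivation ℂ S S) (Q : MatOver r S) (k : ℕ) : MatOver r S :=
  matCoeff k (gaugeProj d Q)

/-- The coefficient of X^{k+1} in the Lax equation. Since Q carries one power of X and J none,
P_{k+1} enters only through its commutator with J; this recursion is behind the involution of the
integrals. -/
lemma map_projCoeff (d : Derivation ℂ S S) {Q : MatOver r S} (hQ : IsOffDiag Q) (k : ℕ) :
    (projCoeff d Q k).map d = Complex.I • (Q * projCoeff d Q k - projCoeff d Q k * Q) -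
      Complex.I • (JOver r S * projCoeff d Q (k + 1) - projCoeff d Q (k + 1) * JOver r S) := by
  have h := congrArg (matCoeff (k + 1)) (gaugeProj_lax d hQ)
  rw [matCoeff_succ_X_smul, matCoeff_seriesD] at h
  rw [projCoeff, h, formalU, JOver_powerSeries]
  simp only [smul_mul_assoc, mul_smul_comm, matCoeff_sub, matCoeff_smul, sub_mul, mul_sub,
    matCoeff_succ_X_smul, matCoeff_constMat_mul, matCoeff_mul_constMat, smul_sub]
  simp only [projCoeff]
  abel

lemma projCoeff_zero (d : Derivation ℂ S S) (Q : MatOver r S) :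
    projCoeff d Q 0 = upOver r S := by
  have hm : ∀ M : MatOver r (PowerSeries S), matCoeff 0 M =
      (PowerSeries.constantCoeff (R := S)).mapMatrix M := fun M => by
    ext a b; simp [matCoeff]
  have h1 : matCoeff 0 (gauge d Q) = 1 := by
    rw [gauge_eq, matCoeff_add, matCoeff_riccatiSeries, riccati_zero, add_zero, hm, map_one]
  have h2 : matCoeff 0 (gauge d Q)⁻¹ = 1 := by
    have := congrArg (matCoeff 0) (Matrix.mul_nonsing_inv _ (isUnit_det_gauge d Q))
    rw [hm, hm, map_mul, map_one, ← hm, ← hm, h1, one_mul] at this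
    exact this
  rw [projCoeff, gaugeProj, hm, map_mul, map_mul, ← hm, ← hm, ← hm, h1, h2, one_mul, mul_one]
  rw [upOver_powerSeries]
  ext a b
  simp [matCoeff, constMat]

lemma map_gauge {d : Derivation ℂ S S} {d' : Derivation ℂ S' S'} (f : S →ₐ[ℂ] S')
    (hf : ∀ x, f (d x) = d' (f x)) (Q : MatOver r S) :
    (PowerSeries.map (f : S →+* S')).mapMatrix (gauge d Q) = gauge d' (Q.map f) := by
  rw [gauge_eq, map_add, map_one, gauge_eq]
  congr 1
  ext a b k
  rw [RingHom.mapMatrix_apply, Matrix.map_apply, PowerSeries.coeff_map]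
  simp only [riccatiSeries, Matrix.of_apply, PowerSeries.coeff_mk, ← map_riccati f hf]
  rfl

lemma map_matCoeff_projCoeff {d : Derivation ℂ S S} {d' : Derivation ℂ S' S'} (f : S →ₐ[ℂ] S')
    (hf : ∀ x, f (d x) = d' (f x)) (Q : MatOver r S) (k : ℕ) :
    (projCoeff d Q k).map f = projCoeff d' (Q.map f) k := by
  have h1 : (PowerSeries.map (f : S →+* S')).mapMatrix (gaugeProj d Q) =
      gaugeProj d' (Q.map f) := by
    have h2 := congrArg (PowerSeries.map (f : S →+* S')).mapMatrix
      (Matrix.nonsing_inv_mul _ (isUnit_det_gauge d Q))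
    rw [map_mul, map_one, map_gauge f hf] at h2
    rw [gaugeProj, map_mul, map_mul, map_gauge f hf, gaugeProj, Matrix.inv_eq_left_inv h2]
    congr 2
    ext a b k
    simp [upOver, PowerSeries.algebraMap_apply]
  rw [projCoeff, projCoeff, ← h1]
  ext a b
  simp [matCoeff]

/-- The densities of the integrals of motion. -/
def density (d : Derivation ℂ S S) (Q : MatOver r S) (k : ℕ) : S :=
  (Complex.I • (upOver r S * (Q * riccati d Q k))).trace

/-- The coefficients of the flux in the first variation of the densities. -/
def fluxCoeff (d δ : Derivation ℂ S S) (Q : MatOver r S) (k : ℕ) : S :=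
  PowerSeries.coeff k (upOver r (PowerSeries S) * (gauge d Q)⁻¹ *
    (gauge d Q).map (seriesD δ)).trace

/-- The coefficient of X^{k+1} in `variation_of_gauge`. The variation of U is i X δQ, so one power
of X is common to all terms, and the gradient of the density is the projector up to a total
derivative. -/
lemma variation_density (d δ : Derivation ℂ S S) (hc : ∀ x, d (δ x) = δ (d x)) {Q : MatOver r S}
    (hQ : IsOffDiag Q) (k : ℕ) : δ (density d Q k) =
      (Complex.I • (Q.map δ * projCoeff d Q k)).trace - d (fluxCoeff d δ Q k) := by
  have h := variation_of_gauge (d := seriesD d) (δ := seriesD δ) (seriesD_X δ) (by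
      ext a b n; simp [hc]) (gauge_equation d hQ)
    (Matrix.mul_nonsing_inv _ (isUnit_det_gauge d Q))
    (Matrix.nonsing_inv_mul _ (isUnit_det_gauge d Q)) (map_derivation_algebraMap _ (upProj r))
    (upOver_mul_formalD d hQ)
  have hJ : (JOver r (PowerSeries S)).map (seriesD δ) = 0 := map_derivation_algebraMap _ _
  have hU : (formalU Q).map (seriesD δ) =
      Complex.I • ((PowerSeries.X : PowerSeries S) • constMat (Q.map δ)) := by
    rw [formalU, map_derivation_smul_complex, map_derivation_sub,
      map_derivation_smul _ (seriesD_X δ), hJ, sub_zero]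
    congr 2
    ext a b n
    by_cases hn : n = 0 <;> simp [constMat, PowerSeries.coeff_C, hn]
  have hD : (formalD d Q).map (seriesD δ) = Complex.I • ((PowerSeries.X : PowerSeries S) •
      (constMat Q * riccatiSeries d Q).map (seriesD δ)) := by
    rw [formalD, map_derivation_smul_complex, map_derivation_sub,
      map_derivation_smul _ (seriesD_X δ), hJ, sub_zero]
  rw [hU, hD] at h
  change (upOver r (PowerSeries S) * _).trace = (_ * gaugeProj d Q).trace -
    _ * seriesD d (upOver r (PowerSeries S) * _ * _).trace at h
  have h' := congrArg (PowerSeries.coeff (k + 1)) h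
  have ht : ∀ (n : ℕ) (M : MatOver r (PowerSeries S)), PowerSeries.coeff n M.trace =
      (matCoeff n M).trace := fun n M => by simp [Matrix.trace, matCoeff]
  rw [ht, map_sub, ht, PowerSeries.coeff_succ_X_mul, coeff_seriesD] at h'
  simp only [smul_mul_assoc, mul_smul_comm, matCoeff_smul, matCoeff_succ_X_smul,
    matCoeff_constMat_mul] at h'
  rw [upOver_powerSeries, matCoeff_constMat_mul, matCoeff_seriesD, matCoeff_constMat_mul,
    matCoeff_riccatiSeries, ← upOver_powerSeries] at h'
  rw [fluxCoeff, density, ← trace_map_derivation, map_derivation_smul_complex, map_derivation_mul,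
    upOver, map_derivation_algebraMap, zero_mul, zero_add]
  exact h'

/-- The coefficients of `-ln Δ`, for a power series with constant term `1`. -/
def negLogCoeff (Δ : PowerSeries S) (k : ℕ) : S :=
  -- Integration of the logarithmic derivative Δ'/Δ. For k = 0 the division by zero gives 0, which
  -- is the right value since Δ has constant term 1.
  -((1 / (k : ℂ)) • PowerSeries.coeff (k - 1)
    (PowerSeries.derivative S Δ * PowerSeries.invOfUnit Δ 1))

lemma map_negLogCoeff (f : S →ₐ[ℂ] S') {Δ : PowerSeries S}
    (hΔ : PowerSeries.constantCoeff Δ = 1) (k : ℕ) :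
    f (negLogCoeff Δ k) = negLogCoeff (PowerSeries.map (f : S →+* S') Δ) k := by
  have hΔ' : PowerSeries.constantCoeff (PowerSeries.map (f : S →+* S') Δ) = 1 := by
    rw [← PowerSeries.coeff_zero_eq_constantCoeff_apply, PowerSeries.coeff_map,
      PowerSeries.coeff_zero_eq_constantCoeff_apply, hΔ, map_one]
  have h1 := congrArg (PowerSeries.map (f : S →+* S')) (PowerSeries.invOfUnit_mul Δ 1 hΔ)
  have h2 := PowerSeries.mul_invOfUnit (PowerSeries.map (f : S →+* S') Δ) 1 hΔ'
  rw [map_mul, map_one] at h1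
  have h3 := left_inv_eq_right_inv h1 h2
  have h4 : PowerSeries.map (f : S →+* S') (PowerSeries.derivative S Δ) =
      PowerSeries.derivative S' (PowerSeries.map (f : S →+* S') Δ) := by
    ext n
    simp [PowerSeries.coeff_derivative]
  rw [negLogCoeff, negLogCoeff, map_neg, map_smul, ← h3, ← h4, ← map_mul, PowerSeries.coeff_map]
  rfl

lemma map_density {d : Derivation ℂ S S} {d' : Derivation ℂ S' S'} (f : S →ₐ[ℂ] S')
    (hf : ∀ x, f (d x) = d' (f x)) (Q : MatOver r S) (k : ℕ) :
    f (density d Q k) = density d' (Q.map f) k := by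
  rw [density, density, ← map_riccati f hf, Matrix.trace_smul, Matrix.trace_smul, map_smul]
  congr 1
  rw [show f (upOver r S * (Q * riccati d Q k)).trace =
    (f.mapMatrix (upOver r S * (Q * riccati d Q k))).trace from (AddMonoidHom.map_trace f _)]
  rw [map_mul, map_mul]
  congr 2
  ext a b
  simp [upOver]

end Formal
end DIII
end

noncomputable section
set_option linter.unusedSectionVars false
namespace DIII

/-! ### Differential polynomials -/

section DifferentialPolynomials

variable {κ : Type*} {r : ℕ}

/-- The total derivative of differential polynomials. -/
def totalD (κ : Type*) :
    Derivation ℂ (MvPolynomial (κ × ℕ) ℂ) (MvPolynomial (κ × ℕ) ℂ) :=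
  MvPolynomial.mkDerivation ℂ fun c => MvPolynomial.X (c.1, c.2 + 1)

@[simp] lemma totalD_X (c : κ × ℕ) :
    totalD κ (MvPolynomial.X c) = MvPolynomial.X (c.1, c.2 + 1) :=
  MvPolynomial.mkDerivation_X _ _ _

/-- The value of differential polynomials on the jet of `w` at `x`. -/
def jetEval (w : ℝ → κ → ℂ) (x : ℝ) : MvPolynomial (κ × ℕ) ℂ →ₐ[ℂ] ℂ :=
  MvPolynomial.aeval fun c => iteratedDeriv c.2 (fun t => w t c.1) x

@[simp] lemma jetEval_X (w : ℝ → κ → ℂ) (x : ℝ) (c : κ × ℕ) :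
    jetEval w x (MvPolynomial.X c) = iteratedDeriv c.2 (fun t => w t c.1) x :=
  MvPolynomial.aeval_X _ _

lemma jetEval_C (w : ℝ → κ → ℂ) (x : ℝ) (z : ℂ) : jetEval w x (MvPolynomial.C z) = z := by
  rw [jetEval, MvPolynomial.aeval_C]; rfl

lemma evalAt_eq (ρ : DiffPoly r) (u : Potential r) (x : ℝ) : ρ.evalAt u x = jetEval u x ρ := by
  rw [DiffPoly.evalAt, jetEval, MvPolynomial.aeval_eq_eval]

lemma hasDerivAt_jetEval {w : ℝ → κ → ℂ} (hw : ∀ c, ContDiff ℝ ∞ fun t => w t c)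
    (p : MvPolynomial (κ × ℕ) ℂ) (x : ℝ) :
    HasDerivAt (fun y => jetEval w y p) (jetEval w x (totalD κ p)) x := by
  induction p using MvPolynomial.induction_on with
  | C z => simpa [jetEval_C, MvPolynomial.derivation_C, totalD] using hasDerivAt_const x z
  | add p q hp hq =>
    simp only [map_add]
    exact hp.add hq
  | mul_X p c hp =>
    have h1 : HasDerivAt (fun y => iteratedDeriv c.2 (fun t => w t c.1) y)
        (iteratedDeriv (c.2 + 1) (fun t => w t c.1) x) x := by
      rw [iteratedDeriv_succ]
      exact (((hw c.1).differentiable_iteratedDeriv c.2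
        (by exact_mod_cast ENat.natCast_lt_top c.2)) x).hasDerivAt
    have h2 := hp.mul h1
    simp only [map_mul, Derivation.leibniz, totalD_X, map_add, smul_eq_mul, jetEval_X]
    have h3 : jetEval w x p * iteratedDeriv (c.2 + 1) (fun t => w t c.1) x +
        iteratedDeriv c.2 (fun t => w t c.1) x * jetEval w x (totalD κ p) =
        jetEval w x (totalD κ p) * iteratedDeriv c.2 (fun t => w t c.1) x +
        jetEval w x p * iteratedDeriv (c.2 + 1) (fun t => w t c.1) x := by ring
    rw [h3]
    exact h2

lemma continuous_jetEval {w : ℝ → κ → ℂ} (hw : ∀ c, ContDiff ℝ ∞ fun t => w t c)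
    (p : MvPolynomial (κ × ℕ) ℂ) : Continuous fun y => jetEval w y p :=
  continuous_iff_continuousAt.2 fun x => (hasDerivAt_jetEval hw p x).continuousAt

lemma jetEval_periodic {w : ℝ → κ → ℂ} {T : ℝ} (hw : Function.Periodic w T)
    (p : MvPolynomial (κ × ℕ) ℂ) : Function.Periodic (fun y => jetEval w y p) T := by
  intro x
  have h : ∀ c : κ × ℕ, iteratedDeriv c.2 (fun t => w t c.1) (x + T) =
      iteratedDeriv c.2 (fun t => w t c.1) x := fun c => by
    have := congrFun (iteratedDeriv_comp_add_const c.2 (fun t => w t c.1) T) x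
    rw [← this]
    simp only [hw _]
  simp only [jetEval, h]

/-- The inclusion of the differential polynomials of the first of two sets of fields. -/
def inlPoly (κ : Type*) : MvPolynomial (κ × ℕ) ℂ →ₐ[ℂ] MvPolynomial ((κ ⊕ κ) × ℕ) ℂ :=
  MvPolynomial.rename (Prod.map Sum.inl id)

lemma inlPoly_totalD (p : MvPolynomial (κ × ℕ) ℂ) :
    inlPoly κ (totalD κ p) = totalD (κ ⊕ κ) (inlPoly κ p) := by
  induction p using MvPolynomial.induction_on with
  | C z => simp [inlPoly, totalD, MvPolynomial.derivation_C]
  | add p q hp hq => simp [hp, hq]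
  | mul_X p c hp =>
    simp only [map_mul, Derivation.leibniz, totalD_X, map_add, smul_eq_mul, hp]
    simp [inlPoly]

/-- The first variation, as a derivation that replaces the first set of fields by the second. -/
def variationD (κ : Type*) :
    Derivation ℂ (MvPolynomial ((κ ⊕ κ) × ℕ) ℂ) (MvPolynomial ((κ ⊕ κ) × ℕ) ℂ) :=
  MvPolynomial.mkDerivation ℂ fun c =>
    Sum.elim (fun k => MvPolynomial.X (Sum.inr k, c.2)) (fun _ => 0) c.1

/-- Two derivations commute once they do so on the generators; there one raises the order of the
derivative and the other replaces u by v. -/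
lemma totalD_variationD (p : MvPolynomial ((κ ⊕ κ) × ℕ) ℂ) :
    totalD (κ ⊕ κ) (variationD κ p) = variationD κ (totalD (κ ⊕ κ) p) := by
  induction p using MvPolynomial.induction_on with
  | C z => simp [totalD, variationD, MvPolynomial.derivation_C]
  | add p q hp hq => simp [hp, hq]
  | mul_X p c hp =>
    simp only [Derivation.leibniz, totalD_X, map_add, smul_eq_mul, hp]
    have : totalD (κ ⊕ κ) (variationD κ (MvPolynomial.X c)) =
        variationD κ (MvPolynomial.X (c.1, c.2 + 1)) := by
      rcases c with ⟨c | c, n⟩ <;> simp [variationD, MvPolynomial.mkDerivation_X]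
    rw [this]
    ring

/-- Substitution of `u + ε v` for `u`. -/
def perturb (κ : Type*) :
    MvPolynomial (κ × ℕ) ℂ →ₐ[ℂ] Polynomial (MvPolynomial ((κ ⊕ κ) × ℕ) ℂ) :=
  MvPolynomial.aeval fun c => Polynomial.C (MvPolynomial.X (Sum.inl c.1, c.2)) +
    Polynomial.X * Polynomial.C (MvPolynomial.X (Sum.inr c.1, c.2))

lemma coeff_zero_perturb (p : MvPolynomial (κ × ℕ) ℂ) : (perturb κ p).coeff 0 = inlPoly κ p := by
  induction p using MvPolynomial.induction_on with
  | C z =>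
    rw [perturb, MvPolynomial.aeval_C, inlPoly, MvPolynomial.rename_C,
      Polynomial.algebraMap_apply, Polynomial.coeff_C_zero]
    rfl
  | add p q hp hq => simp [hp, hq]
  | mul_X p c hp =>
    rw [map_mul, Polynomial.mul_coeff_zero, hp, map_mul]
    congr 1
    simp [perturb, inlPoly, Prod.map]

lemma coeff_one_perturb (p : MvPolynomial (κ × ℕ) ℂ) :
    (perturb κ p).coeff 1 = variationD κ (inlPoly κ p) := by
  induction p using MvPolynomial.induction_on with
  | C z =>
    rw [perturb, MvPolynomial.aeval_C, inlPoly, MvPolynomial.rename_C, variationD,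
      MvPolynomial.derivation_C, Polynomial.algebraMap_apply, Polynomial.coeff_C]
    simp
  | add p q hp hq => simp [hp, hq]
  | mul_X p c hp =>
    rw [map_mul, Polynomial.mul_coeff_one, hp, map_mul, coeff_zero_perturb, Derivation.leibniz]
    have h0 : (perturb κ (MvPolynomial.X c)).coeff 0 = MvPolynomial.X (Sum.inl c.1, c.2) := by
      simp [perturb]
    have h1 : (perturb κ (MvPolynomial.X c)).coeff 1 = MvPolynomial.X (Sum.inr c.1, c.2) := by
      simp [perturb, Polynomial.coeff_C]
    rw [h0, h1]
    simp only [inlPoly, variationD, MvPolynomial.mkDerivation_X, MvPolynomial.rename_X, Prod.map,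
      smul_eq_mul, Sum.elim_inl, id]
    ring

/-- Two sets of fields as one. -/
def pairFields (u v : ℝ → κ → ℂ) (x : ℝ) : κ ⊕ κ → ℂ := Sum.elim (u x) (v x)

lemma contDiff_pairFields {u v : ℝ → κ → ℂ} (hu : ∀ c, ContDiff ℝ ∞ fun t => u t c)
    (hv : ∀ c, ContDiff ℝ ∞ fun t => v t c) (c : κ ⊕ κ) :
    ContDiff ℝ ∞ fun t => pairFields u v t c := by
  rcases c with c | c
  · exact hu c
  · exact hv c

lemma jetEval_inlPoly (u v : ℝ → κ → ℂ) (x : ℝ) (p : MvPolynomial (κ × ℕ) ℂ) :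
    jetEval (pairFields u v) x (inlPoly κ p) = jetEval u x p := by
  rw [jetEval, inlPoly, MvPolynomial.aeval_rename]
  rfl

/-- The value at u + εv is a polynomial in ε. Differentiation in ε therefore passes through the
integral without any domination argument. -/
lemma jetEval_add_smul {u v : ℝ → κ → ℂ} (hu : ∀ c, ContDiff ℝ ∞ fun t => u t c)
    (hv : ∀ c, ContDiff ℝ ∞ fun t => v t c) (ε : ℂ) (x : ℝ) (p : MvPolynomial (κ × ℕ) ℂ) :
    jetEval (u + ε • v) x p = ∑ j ∈ Finset.range ((perturb κ p).natDegree + 1),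
      ε ^ j * jetEval (pairFields u v) x ((perturb κ p).coeff j) := by
  have h : jetEval (u + ε • v) x p =
      Polynomial.eval₂ (jetEval (pairFields u v) x : MvPolynomial ((κ ⊕ κ) × ℕ) ℂ →+* ℂ) ε
        (perturb κ p) := by
    induction p using MvPolynomial.induction_on with
    | C z =>
      rw [jetEval_C, perturb, MvPolynomial.aeval_C, Polynomial.algebraMap_apply,
        Polynomial.eval₂_C]
      exact (jetEval_C (pairFields u v) x z).symm
    | add p q hp hq => rw [map_add, map_add, hp, hq, Polynomial.eval₂_add]
    | mul_X p c hp =>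
      rw [map_mul, map_mul, hp, Polynomial.eval₂_mul]
      congr 1
      rw [perturb, MvPolynomial.aeval_X, Polynomial.eval₂_add, Polynomial.eval₂_mul,
        Polynomial.eval₂_C, Polynomial.eval₂_C, Polynomial.eval₂_X, jetEval_X]
      simp only [RingHom.coe_coe, jetEval_X]
      change iteratedDeriv c.2 (fun t => u t c.1 + ε • v t c.1) x = _
      have h2 : ContDiffAt ℝ c.2 (fun t => v t c.1) x :=
        ((hv c.1).of_le (by exact_mod_cast le_top)).contDiffAt
      have h1 : ContDiffAt ℝ c.2 (fun t => u t c.1) x :=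
        ((hu c.1).of_le (by exact_mod_cast le_top)).contDiffAt
      rw [show (fun t => u t c.1 + ε • v t c.1) = (fun t => u t c.1) + ε • fun t => v t c.1 from rfl,
        iteratedDeriv_add h1 (show ContDiffAt ℝ c.2 (ε • fun t => v t c.1) x from h2.const_smul ε)]
      congr 1
      exact iteratedDeriv_const_smul_field ε fun t => v t c.1
  rw [h, Polynomial.eval₂_eq_sum_range]
  exact Finset.sum_congr rfl fun j _ => mul_comm _ _

/-- The generic potential, with entries in the ring of differential polynomials. -/
def formalQ (r : ℕ) : MatOver r (DiffPoly r) :=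
  ∑ c : Coord r, (MvPolynomial.X (c, 0) : DiffPoly r) • (gen c).map (algebraMap ℂ (DiffPoly r))

/-- A nonzero entry of a generator joins opposite eigenvalues of J. -/
lemma gen_comm_J (c : Coord r) : J r * gen c = -(gen c * J r) := by
  have hs : ∀ a b : Idx r, gen c a b = 0 ∨ sgn a + sgn b = 0 := fun a b => by
    rcases c with p | p
    · rcases weylPlus_apply p a b with h | ⟨h1, h2⟩
      · exact Or.inl h
      · exact Or.inr (by rw [h1, h2]; ring)
    · rcases weylPlus_apply p b a with h | ⟨h1, h2⟩
      · exact Or.inl h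
      · exact Or.inr (by rw [h1, h2]; ring)
  ext a b
  rw [J_eq_diagonal, Matrix.neg_apply, Matrix.diagonal_mul, Matrix.mul_diagonal]
  rcases hs a b with h | h
  · rw [h]; ring
  · linear_combination (gen c a b) * h

lemma isOffDiag_formalQ (r : ℕ) : IsOffDiag (formalQ r) := by
  rw [IsOffDiag, formalQ, Finset.mul_sum, Finset.sum_mul, ← Finset.sum_neg_distrib]
  refine Finset.sum_congr rfl fun c _ => ?_
  rw [mul_smul_comm, smul_mul_assoc, ← smul_neg, JOver, ← Matrix.map_mul, gen_comm_J]
  congr 1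
  rw [show (-(gen c * J r)).map (algebraMap ℂ (DiffPoly r)) =
    -((gen c * J r).map (algebraMap ℂ (DiffPoly r))) by
      ext a b : 2
      simp only [Matrix.map_apply, Matrix.neg_apply, map_neg], Matrix.map_mul]

lemma map_formalQ (u : Potential r) (x : ℝ) : (formalQ r).map (jetEval u x) = Q u x := by
  rw [Q_eq_sum, formalQ, ← AlgHom.mapMatrix_apply, map_sum]
  refine Finset.sum_congr rfl fun c _ => ?_
  ext a b
  simp

lemma map_variationD_formalQ (u v : Potential r) (x : ℝ) :
    ((((formalQ r).map (inlPoly (Coord r))).map (variationD (Coord r))).map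
      (jetEval (pairFields u v) x)) = Q v x := by
  rw [Q_eq_sum, formalQ]
  ext a b
  simp only [Matrix.map_apply, Matrix.sum_apply, map_sum]
  refine Finset.sum_congr rfl fun c _ => ?_
  simp [inlPoly, variationD, MvPolynomial.mkDerivation_X, pairFields, mul_comm]

end DifferentialPolynomials
end DIII
end

noncomputable section
set_option linter.unusedSectionVars false
namespace DIII
open MeasureTheory

/-! ### Integrals of differential polynomials -/

section Tame

variable {κ : Type*} {r : ℕ}

/-- Fields whose differential polynomials without constant term are bounded and integrable and
integrate to zero when they are total derivatives. -/
structure IsTame (ν : Measure ℝ) (w : ℝ → κ → ℂ) : Prop where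
  contDiff : ∀ c, ContDiff ℝ ∞ fun t => w t c
  bounded : ∀ p : MvPolynomial (κ × ℕ) ℂ, ∃ C, ∀ x, ‖jetEval w x p‖ ≤ C
  integrable : ∀ p : MvPolynomial (κ × ℕ) ℂ, MvPolynomial.constantCoeff p = 0 →
    Integrable (fun x => jetEval w x p) ν
  integral_totalD : ∀ p : MvPolynomial (κ × ℕ) ℂ, ∫ x, jetEval w x (totalD κ p) ∂ν = 0

/-- Substitution of zero for all fields. -/
def vacuum (κ : Type*) : MvPolynomial (κ × ℕ) ℂ →ₐ[ℂ] ℂ := MvPolynomial.aeval 0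

lemma vacuum_apply (p : MvPolynomial (κ × ℕ) ℂ) : vacuum κ p = MvPolynomial.constantCoeff p :=
  MvPolynomial.aeval_zero p

/-- Zero fields have zero derivatives, so the evaluation respects the total derivative and the zero
derivation of ℂ; naturality of the recursion then applies to it. -/
lemma vacuum_totalD (p : MvPolynomial (κ × ℕ) ℂ) :
    vacuum κ (totalD κ p) = (0 : Derivation ℂ ℂ ℂ) (vacuum κ p) := by
  rw [Derivation.zero_apply]
  induction p using MvPolynomial.induction_on with
  | C z => simp [totalD, MvPolynomial.derivation_C]
  | add p q hp hq => simp [hp, hq]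
  | mul_X p c hp => simp [Derivation.leibniz, vacuum]

lemma constantCoeff_totalD (p : MvPolynomial (κ × ℕ) ℂ) :
    MvPolynomial.constantCoeff (totalD κ p) = 0 := by
  rw [← vacuum_apply, vacuum_totalD, Derivation.zero_apply]

/-- The square of a polynomial without constant term again has no constant term and is therefore
integrable. -/
lemma IsTame.memLp {ν : Measure ℝ} {w : ℝ → κ → ℂ} (hw : IsTame ν w)
    {p : MvPolynomial (κ × ℕ) ℂ} (hp : MvPolynomial.constantCoeff p = 0) :
    MemLp (fun x => jetEval w x p) 2 ν := by
  have hm := (continuous_jetEval hw.contDiff p).aestronglyMeasurable (μ := ν)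
  rw [memLp_two_iff_integrable_sq_norm hm]
  have : Integrable (fun x => jetEval w x (p * p)) ν := hw.integrable _ (by rw [map_mul, hp, zero_mul])
  refine this.norm.congr (ae_of_all _ fun x => ?_)
  simp only [map_mul, norm_mul, sq]

lemma isTame_periodic {L : ℝ} (hL : 0 < L) {w : ℝ → κ → ℂ}
    (hw : ∀ c, ContDiff ℝ ∞ fun t => w t c) (hp : Function.Periodic w (2 * L)) :
    IsTame (volume.restrict (Set.Ioc (-L) L)) w where
  contDiff := hw
  bounded p := by
    obtain ⟨C, hC⟩ := (isCompact_Icc (a := 0) (b := 2 * L)).exists_bound_of_continuousOn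
      (continuous_jetEval hw p).continuousOn
    refine ⟨C, fun x => ?_⟩
    obtain ⟨y, hy, hxy⟩ := (jetEval_periodic hp p).exists_mem_Ico₀ (by linarith) x
    have hxy' : jetEval w x p = jetEval w y p := hxy
    rw [hxy']
    exact hC y ⟨hy.1, hy.2.le⟩
  integrable p _ := ((continuous_jetEval hw p).integrableOn_Icc).mono_set Set.Ioc_subset_Icc_self
  integral_totalD p := by
    rw [← intervalIntegral.integral_of_le (by linarith),
      intervalIntegral.integral_eq_sub_of_hasDerivAt (fun x _ => hasDerivAt_jetEval hw p x)
        ((continuous_jetEval hw _).intervalIntegrable _ _), sub_eq_zero]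
    have := jetEval_periodic hp p (-L)
    simpa [show -L + 2 * L = L by ring] using this

/-- The components of the fields are Schwartz functions. -/
def IsRapid (w : ℝ → κ → ℂ) : Prop := ∀ c, ∃ s : SchwartzMap ℝ ℂ, ∀ x, w x c = s x

lemma IsRapid.iteratedDeriv {w : ℝ → κ → ℂ} (hw : IsRapid w) (c : κ × ℕ) :
    ∃ s : SchwartzMap ℝ ℂ, ∀ x, iteratedDeriv c.2 (fun t => w t c.1) x = s x := by
  obtain ⟨c, n⟩ := c
  induction n with
  | zero => simpa using hw c
  | succ n ih =>
    obtain ⟨s, hs⟩ := ih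
    refine ⟨SchwartzMap.derivCLM ℂ ℂ s, fun x => ?_⟩
    rw [iteratedDeriv_succ, SchwartzMap.derivCLM_apply]
    congr 1
    exact funext hs

/-- In the induction a new factor is a Schwartz function times something bounded. The constant term
is thus the only obstacle to integrability and the limit at infinity. -/
lemma isRapid_estimate {w : ℝ → κ → ℂ} (hw : IsRapid w) (hs : ∀ c, ContDiff ℝ ∞ fun t => w t c)
    (p : MvPolynomial (κ × ℕ) ℂ) :
    (∃ C, ∀ x, ‖jetEval w x p‖ ≤ C) ∧
      Integrable (fun x => jetEval w x p - MvPolynomial.constantCoeff p) volume ∧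
      Filter.Tendsto (fun x => jetEval w x p) (Filter.cocompact ℝ)
        (𝓝 (MvPolynomial.constantCoeff p)) := by
  induction p using MvPolynomial.induction_on with
  | C z =>
    simp only [jetEval_C, MvPolynomial.constantCoeff_C, sub_self]
    exact ⟨⟨‖z‖, fun _ => le_rfl⟩, integrable_zero _ _ _, tendsto_const_nhds⟩
  | add p q hp hq =>
    obtain ⟨⟨C, hC⟩, hp2, hp3⟩ := hp
    obtain ⟨⟨D, hD⟩, hq2, hq3⟩ := hq
    simp only [map_add]
    refine ⟨⟨C + D, fun x => norm_add_le_of_le (hC x) (hD x)⟩, ?_, hp3.add hq3⟩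
    refine (hp2.add hq2).congr (ae_of_all _ fun x => ?_)
    simp only [Pi.add_apply]
    ring
  | mul_X p c hp =>
    obtain ⟨⟨C, hC⟩, hp2, hp3⟩ := hp
    obtain ⟨s, hsc⟩ := hw.iteratedDeriv c
    simp only [map_mul, MvPolynomial.constantCoeff_X, mul_zero, sub_zero, jetEval_X, hsc]
    refine ⟨?_, ?_, ?_⟩
    · obtain ⟨D, hD⟩ := s.decay' 0 0
      refine ⟨C * D, fun x => ?_⟩
      rw [norm_mul]
      have h1 : ‖s x‖ ≤ D := by
        have h0 := hD x
        rw [pow_zero, one_mul, norm_iteratedFDeriv_zero] at h0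
        exact h0
      exact mul_le_mul (hC x) h1 (norm_nonneg _) ((norm_nonneg _).trans (hC 0))
    · exact s.integrable.bdd_mul (c := C)
        (continuous_jetEval hs p).aestronglyMeasurable (ae_of_all _ hC)
    · have := hp3.mul s.toZeroAtInfty.zero_at_infty'
      rw [mul_zero] at this
      exact this

lemma isTame_rapid {w : ℝ → κ → ℂ} (hw : IsRapid w) : IsTame volume w := by
  have hs : ∀ c, ContDiff ℝ ∞ fun t => w t c := fun c => by
    obtain ⟨s, h⟩ := hw c
    simp only [h]
    exact s.smooth'
  have hi : ∀ p : MvPolynomial (κ × ℕ) ℂ, MvPolynomial.constantCoeff p = 0 →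
      Integrable (fun x => jetEval w x p) volume := fun p hp => by
    simpa [hp] using (isRapid_estimate hw hs p).2.1
  refine ⟨hs, fun p => (isRapid_estimate hw hs p).1, hi, fun p => ?_⟩
  have h := (isRapid_estimate hw hs p).2.2
  rw [cocompact_eq_atBot_atTop, Filter.tendsto_sup] at h
  rw [integral_of_hasDerivAt_of_tendsto (fun x => hasDerivAt_jetEval hs p x)
    (hi _ (constantCoeff_totalD p)) h.1 h.2, sub_self]

lemma hasDerivAt_integral_jetEval {ν : Measure ℝ} {u v : ℝ → κ → ℂ} (hu : IsTame ν u)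
    (h : IsTame ν (pairFields u v)) {p : MvPolynomial (κ × ℕ) ℂ}
    (hp : MvPolynomial.constantCoeff p = 0) :
    HasDerivAt (fun ε : ℂ => ∫ x, jetEval (u + ε • v) x p ∂ν)
      (∫ x, jetEval (pairFields u v) x (variationD κ (inlPoly κ p)) ∂ν) 0 := by
  have hv : ∀ c, ContDiff ℝ ∞ fun t => v t c := fun c => h.contDiff (Sum.inr c)
  -- Substituting u + εv creates no constant terms, so each coefficient in ε is integrable.
  have hc : ∀ j, MvPolynomial.constantCoeff ((perturb κ p).coeff j) = 0 := by
    have e : Polynomial.mapRingHom (MvPolynomial.constantCoeff (R := ℂ) (σ := (κ ⊕ κ) × ℕ))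
        (perturb κ p) = Polynomial.C (MvPolynomial.constantCoeff p) := by
      clear hp
      induction p using MvPolynomial.induction_on with
      | C z => 
        rw [perturb, MvPolynomial.aeval_C, Polynomial.algebraMap_apply]
        simp
      | add p q hp hq => simp only [map_add, hp, hq]
      | mul_X p c hp => simp [perturb]
    intro j
    have := congrArg (fun q => Polynomial.coeff q j) e
    simpa [hp] using this
  set n := (perturb κ p).natDegree + 1 with hn
  have e : (fun ε : ℂ => ∫ x, jetEval (u + ε • v) x p ∂ν) = fun ε => ∑ j ∈ Finset.range n,
      ε ^ j * ∫ x, jetEval (pairFields u v) x ((perturb κ p).coeff j) ∂ν := by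
    funext ε
    simp only [jetEval_add_smul hu.contDiff hv]
    rw [integral_finsetSum _ fun j _ => (h.integrable _ (hc j)).const_mul _]
    exact Finset.sum_congr rfl fun j _ => integral_const_mul _ _
  rw [e, ← coeff_one_perturb]
  have hd : HasDerivAt (fun ε : ℂ => ∑ j ∈ Finset.range n,
      ε ^ j * ∫ x, jetEval (pairFields u v) x ((perturb κ p).coeff j) ∂ν)
      (∑ j ∈ Finset.range n, (j : ℂ) * 0 ^ (j - 1) *
        ∫ x, jetEval (pairFields u v) x ((perturb κ p).coeff j) ∂ν) 0 :=
    HasDerivAt.fun_sum fun j _ => (hasDerivAt_pow j (0 : ℂ)).mul_const _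
  convert hd using 1
  rcases Nat.lt_or_ge 1 n with h1 | h1
  · rw [Finset.sum_eq_single_of_mem 1 (Finset.mem_range.2 h1) fun j _ hj => ?_]
    · simp
    · rcases j with _ | _ | j
      · simp
      · exact absurd rfl hj
      · simp
  -- If the polynomial does not depend on ε, both sides vanish.
  · have h0 : (perturb κ p).coeff 1 = 0 :=
      Polynomial.coeff_eq_zero_of_natDegree_lt (by omega)
    have hn1 : n = 1 := by omega
    rw [h0, hn1]
    simp

end Tame

/-! ### The integrals of motion -/

section Integrals

variable {r : ℕ}

/-- The densities of the integrals of motion as differential polynomials. -/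
def rhoPoly (r k : ℕ) : DiffPoly r := density (totalD (Coord r)) (formalQ r) k

/-- The end-point terms as differential polynomials. -/
def betaPoly (r k : ℕ) : DiffPoly r := negLogCoeff (gauge (totalD (Coord r)) (formalQ r)).det k

lemma formalQ_map_vacuum (r : ℕ) : (formalQ r).map (vacuum (Coord r)) = 0 := by
  ext a b
  simp only [formalQ, Matrix.map_apply, Matrix.sum_apply, map_sum]
  refine Finset.sum_eq_zero fun c _ => ?_
  simp [vacuum]

lemma riccati_vacuum {S : Type*} [CommRing S] [Algebra ℂ S] (d : Derivation ℂ S S) (k : ℕ) :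
    riccati d (0 : MatOver r S) k = 0 := by
  induction k with
  | zero => exact riccati_zero _ _
  | succ k ih => 
    rw [riccati_succ, ih]
    simp

lemma constantCoeff_rhoPoly (r k : ℕ) : MvPolynomial.constantCoeff (rhoPoly r k) = 0 := by
  rw [← vacuum_apply, rhoPoly, map_density _ vacuum_totalD, formalQ_map_vacuum]
  simp [density]

/-- For zero fields all W_k vanish, the gauge is 1, and so is its determinant. -/
lemma constantCoeff_betaPoly (r k : ℕ) : MvPolynomial.constantCoeff (betaPoly r k) = 0 := by
  rw [← vacuum_apply, betaPoly, map_negLogCoeff _ (constantCoeff_det_gauge _ _)]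
  have h : PowerSeries.map (vacuum (Coord r) : DiffPoly r →+* ℂ)
      (gauge (totalD (Coord r)) (formalQ r)).det = 1 := by
    rw [RingHom.map_det, map_gauge _ vacuum_totalD, formalQ_map_vacuum]
    have : gauge (0 : Derivation ℂ ℂ ℂ) (0 : MatOver r ℂ) = 1 := by
      rw [gauge]
      ext a b k
      simp [riccati_vacuum]
    rw [this, Matrix.det_one]
  rw [h, negLogCoeff]
  simp

/-- The projector coefficients of the generic potential. -/
def projPoly (r k : ℕ) : MatOver r (DiffPoly r) := projCoeff (totalD (Coord r)) (formalQ r) k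

/-- The projector coefficients of a potential. -/
def projVal (u : Potential r) (k : ℕ) (x : ℝ) : Mat r := (projPoly r k).map (jetEval u x)

lemma JOver_complex : JOver r ℂ = J r := by ext; simp [JOver]

/-- For zero fields the recursion of the Lax equation reduces to [J, P_{k+1}] = 0, and P_0 is the
block projector. -/
lemma projPoly_vacuum_comm (r k : ℕ) : J r * (projPoly r k).map (vacuum (Coord r)) =
    (projPoly r k).map (vacuum (Coord r)) * J r := by
  rw [projPoly, map_matCoeff_projCoeff _ vacuum_totalD, formalQ_map_vacuum]
  rcases k with _ | k
  · rw [projCoeff_zero, upOver_eq, JOver_complex]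
    simp [mul_add, add_mul]
  · have h := map_projCoeff (0 : Derivation ℂ ℂ ℂ) (Q := (0 : MatOver r ℂ)) (by simp [IsOffDiag]) k
    rw [zero_mul, mul_zero, sub_zero, smul_zero, zero_sub, JOver_complex] at h
    have h0 : ((projCoeff (0 : Derivation ℂ ℂ ℂ) (0 : MatOver r ℂ) k).map
        ⇑(0 : Derivation ℂ ℂ ℂ)) = 0 := by ext; simp
    rw [h0, eq_comm, neg_eq_zero, smul_eq_zero_iff_right Complex.I_ne_zero] at h
    exact sub_eq_zero.1 h

lemma hasDerivAt_projVal {u : Potential r} (hu : ∀ c, ContDiff ℝ ∞ fun t => u t c) (k : ℕ) (x : ℝ)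
    (a b : Idx r) : HasDerivAt (fun x => projVal u k x a b)
      ((Complex.I • (Q u x * projVal u k x - projVal u k x * Q u x) -
        Complex.I • (J r * projVal u (k + 1) x - projVal u (k + 1) x * J r)) a b) x := by
  have h := hasDerivAt_jetEval hu (projPoly r k a b) x
  have h2 := congrArg (fun M => M.map (jetEval u x))
    (map_projCoeff (totalD (Coord r)) (isOffDiag_formalQ r) k)
  have hJ : (JOver r (DiffPoly r)).map (jetEval u x) = J r := by
    ext a b; simp [JOver]
  simp only [← AlgHom.mapMatrix_apply, map_sub, map_smul, map_mul] at h2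
  simp only [AlgHom.mapMatrix_apply, map_formalQ, hJ] at h2
  have h3 := congrFun (congrFun h2 a) b
  simp only [projVal, projPoly]
  rw [← h3]
  exact h

/-- The gradients of the integrals of motion as differential polynomials. -/
def gradPoly (k : ℕ) (c : Coord r) : DiffPoly r :=
  Complex.I • ((gen c).map (algebraMap ℂ (DiffPoly r)) * projPoly r k).trace

/-- The gradients of the integrals of motion. -/
def integralGrad (u : Potential r) (k : ℕ) : Potential r := fun x c => jetEval u x (gradPoly k c)

lemma map_gradPoly (f : DiffPoly r →ₐ[ℂ] ℂ) (k : ℕ) (c : Coord r) :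
    f (gradPoly k c) = Complex.I * (gen c * (projPoly r k).map f).trace := by
  rw [gradPoly, map_smul, smul_eq_mul]
  congr 1
  rw [show f ((gen c).map (algebraMap ℂ (DiffPoly r)) * projPoly r k).trace =
    (f.mapMatrix ((gen c).map (algebraMap ℂ (DiffPoly r)) * projPoly r k)).trace from
      (AddMonoidHom.map_trace f _), map_mul]
  congr 2
  ext a b
  simp

lemma integralGrad_apply (u : Potential r) (k : ℕ) (x : ℝ) (c : Coord r) :
    integralGrad u k x c = Complex.I * (gen c * projVal u k x).trace :=
  map_gradPoly _ _ _

/-- Inserting J² = 1 and moving one J around the trace changes the sign, because P commutes with J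
for zero fields while the generator anticommutes with it. Without a constant term the gradients are
square-integrable. -/
lemma constantCoeff_gradPoly (k : ℕ) (c : Coord r) :
    MvPolynomial.constantCoeff (gradPoly k c) = 0 := by
  rw [← vacuum_apply, map_gradPoly]
  set P := (projPoly r k).map (vacuum (Coord r)) with hP
  have h1 : J r * P = P * J r := projPoly_vacuum_comm r k
  have hJ : J r * J r = 1 := by rw [← JOver_complex, JOver_mul_self]
  have h2 : (gen c * P).trace = -(gen c * P).trace := by
    calc (gen c * P).trace = (gen c * P * (J r * J r)).trace := by rw [hJ, mul_one]
      _ = (gen c * (P * J r) * J r).trace := by simp only [mul_assoc]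
      _ = (gen c * (J r * P) * J r).trace := by rw [h1]
      _ = (J r * (gen c * (J r * P))).trace := Matrix.trace_mul_comm _ _
      _ = -(gen c * P).trace := by
        rw [← mul_assoc, gen_comm_J, neg_mul, Matrix.trace_neg, mul_assoc, ← mul_assoc (J r) (J r),
          hJ, one_mul]
  rw [self_eq_neg.1 h2, mul_zero]

lemma variation_rhoPoly (u v : Potential r) (k : ℕ) : ∃ q, ∀ x,
    jetEval (pairFields u v) x (variationD (Coord r) (inlPoly (Coord r) (rhoPoly r k))) =
      ∑ c, integralGrad u k x c * v x c -
        jetEval (pairFields u v) x (totalD (Coord r ⊕ Coord r) q) := by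
  have hQ : IsOffDiag ((formalQ r).map (inlPoly (Coord r))) := by
    have h := congrArg (fun M => M.map (inlPoly (Coord r))) (isOffDiag_formalQ r)
    simp only [← AlgHom.mapMatrix_apply, map_mul, map_neg] at h
    simp only [AlgHom.mapMatrix_apply] at h
    have hJ : (JOver r (DiffPoly r)).map (inlPoly (Coord r)) = JOver r _ := by
      ext a b : 2
      simp only [JOver, Matrix.map_apply, AlgHom.commutes]
    rw [hJ] at h
    exact h
  -- The variation takes place in the ring of the doubled fields (u, v), where δ replaces u by v;
  -- the flux is a polynomial in both.
  refine ⟨fluxCoeff (totalD _) (variationD _) ((formalQ r).map (inlPoly (Coord r))) k, fun x => ?_⟩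
  rw [rhoPoly, map_density _ inlPoly_totalD, variation_density _ _ totalD_variationD hQ, map_sub]
  congr 1
  rw [Matrix.trace_smul, map_smul,
    show ∀ M : MatOver r _, jetEval (pairFields u v) x M.trace =
      ((jetEval (pairFields u v) x).mapMatrix M).trace from fun M => AddMonoidHom.map_trace _ _,
    map_mul, AlgHom.mapMatrix_apply, AlgHom.mapMatrix_apply, map_variationD_formalQ,
    ← map_matCoeff_projCoeff _ inlPoly_totalD, Matrix.map_map]
  have e : (projCoeff (totalD (Coord r)) (formalQ r) k).map
      (⇑(jetEval (pairFields u v) x) ∘ ⇑(inlPoly (Coord r))) = projVal u k x := by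
    ext a b
    simp only [Matrix.map_apply, Function.comp_apply, jetEval_inlPoly, projVal, projPoly]
  rw [e, Q_eq_sum, Finset.sum_mul, Matrix.trace_sum, Finset.smul_sum]
  refine Finset.sum_congr rfl fun c _ => ?_
  rw [integralGrad_apply, smul_mul_assoc, Matrix.trace_smul, smul_eq_mul, smul_eq_mul]
  ring

/-- The flux integrates to zero, so the projector coefficients alone give the variational
derivative. -/
lemma hasVarDeriv_rhoPoly {M : Set (Potential r)} {ν : Measure ℝ} {u : Potential r}
    (hu : IsTame ν u) (hM : ∀ v ∈ M, IsTame ν (pairFields u v)) (k : ℕ) :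
    HasVarDeriv M ν (fun v => ∫ x, jetEval v x (rhoPoly r k) ∂ν) u (integralGrad u k) := by
  have hg : ∀ c, MemLp (fun x => integralGrad u k x c) 2 ν := fun c =>
    hu.memLp (constantCoeff_gradPoly k c)
  refine ⟨memLp_pi_iff.2 hg, fun v hv => ?_⟩
  have h := hasDerivAt_integral_jetEval hu (hM v hv) (constantCoeff_rhoPoly r k)
  obtain ⟨q, hq⟩ := variation_rhoPoly u v k
  simp only [hq] at h
  have hv2 : ∀ c, MemLp (fun x => v x c) 2 ν := fun c => by
    have := (hM v hv).memLp (p := MvPolynomial.X (Sum.inr c, 0)) (by simp)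
    simpa [pairFields] using this
  have hi : Integrable (fun x => ∑ c, integralGrad u k x c * v x c) ν :=
    integrable_finsetSum _ fun c _ => (hg c).integrable_mul (hv2 c)
  rw [integral_sub hi ((hM v hv).integrable _ (constantCoeff_totalD q)), (hM v hv).integral_totalD, sub_zero] at h
  exact h

/-- The involution of matrices with polynomial entries. -/
def tildeOver (M : MatOver r (DiffPoly r)) : MatOver r (DiffPoly r) :=
  Matrix.of fun a b => (eps a * eps b) • M (idxBar b) (idxBar a)

lemma map_tildeOver (f : DiffPoly r →ₐ[ℂ] ℂ) (M : MatOver r (DiffPoly r)) :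
    (tildeOver M).map f = tilde (M.map f) := by
  ext a b
  simp [tildeOver, tilde_apply]

/-- The bracket density of two integrals of motion. -/
def omegaPoly (r k l : ℕ) : DiffPoly r :=
  ((JOver r (DiffPoly r) * projPoly r k - projPoly r k * JOver r (DiffPoly r)) *
    (projPoly r l - tildeOver (projPoly r l))).trace

lemma map_trace_algHom {S : Type*} [CommRing S] [Algebra ℂ S] (f : S →ₐ[ℂ] ℂ) (M : MatOver r S) :
    f M.trace = (M.map f).trace := AddMonoidHom.map_trace f M

lemma map_omegaPoly (f : DiffPoly r →ₐ[ℂ] ℂ) (k l : ℕ) : f (omegaPoly r k l) =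
    ((J r * (projPoly r k).map f - (projPoly r k).map f * J r) *
      ((projPoly r l).map f - tilde ((projPoly r l).map f))).trace := by
  have hJ : (JOver r (DiffPoly r)).map f = J r := by
    ext a b; simp [JOver]
  rw [omegaPoly, map_trace_algHom]
  simp only [← AlgHom.mapMatrix_apply, map_sub, map_mul]
  simp only [AlgHom.mapMatrix_apply, map_tildeOver, hJ]

lemma constantCoeff_omegaPoly (k l : ℕ) : MvPolynomial.constantCoeff (omegaPoly r k l) = 0 := by
  rw [← vacuum_apply, map_omegaPoly, projPoly_vacuum_comm, sub_self, zero_mul, Matrix.trace_zero]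

/-- The Lenard argument. In the derivative of tr(P_k (P_l - `tilde` P_l)) the commutators with Q
cancel under the trace, since `tilde` reverses products and changes the sign of Q. The commutators
with J contain P_{k+1} and P_{l+1} and form the stated difference. -/
lemma jetEval_omegaPoly_succ {u : Potential r} (hu : ∀ c, ContDiff ℝ ∞ fun t => u t c) (k l : ℕ) :
    ∃ q, ∀ x, jetEval u x (omegaPoly r (k + 1) l) - jetEval u x (omegaPoly r k (l + 1)) =
      jetEval u x (totalD (Coord r) q) := by
  set q : DiffPoly r := (projPoly r k * (projPoly r l - tildeOver (projPoly r l))).trace with hq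
  refine ⟨Complex.I • q, fun x => ?_⟩
  have hval : ∀ y, jetEval u y q =
      (projVal u k y * (projVal u l y - tilde (projVal u l y))).trace := fun y => by
    rw [hq, map_trace_algHom]
    simp only [← AlgHom.mapMatrix_apply, map_sub, map_mul]
    simp only [AlgHom.mapMatrix_apply, map_tildeOver]
    rfl
  have h1 := hasDerivAt_jetEval hu q x
  simp only [hval] at h1
  set dP : ℕ → Mat r := fun k =>
    Complex.I • (Q u x * projVal u k x - projVal u k x * Q u x) -
        Complex.I • (J r * projVal u (k + 1) x - projVal u (k + 1) x * J r) with hdP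
  have hP : ∀ k a b, HasDerivAt (fun x => projVal u k x a b) (dP k a b) x := fun k a b =>
    hasDerivAt_projVal hu k x a b
  have hT : ∀ a b, HasDerivAt (fun x => (projVal u l x - tilde (projVal u l x)) a b)
      ((dP l - tilde (dP l)) a b) x := fun a b =>
    (hP l a b).sub ((hP l _ _).const_mul _)
  have h2 : HasDerivAt (fun y => (projVal u k y * (projVal u l y - tilde (projVal u l y))).trace)
      ((dP k * (projVal u l x - tilde (projVal u l x)) +
        projVal u k x * (dP l - tilde (dP l))).trace) x := by
    simp only [Matrix.trace, Matrix.diag, Matrix.add_apply, Matrix.mul_apply,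
      ← Finset.sum_add_distrib]
    exact HasDerivAt.fun_sum fun a _ => HasDerivAt.fun_sum fun b _ => (hP k a b).mul (hT b a)
  have h3 := h1.unique h2
  rw [Derivation.map_smul, map_smul, h3, map_omegaPoly, map_omegaPoly]
  change _ - _ = Complex.I * _
  have ht : tilde (dP l) = Complex.I • (Q u x * tilde (projVal u l x) - tilde (projVal u l x) * Q u x) -
      Complex.I • (J r * tilde (projVal u (l + 1) x) - tilde (projVal u (l + 1) x) * J r) := by
    simp only [hdP, tilde_sub, tilde_smul, tilde_mul, tilde_Q, tilde_J]
    congr 2 <;> noncomm_ring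
  rw [ht]
  simp only [hdP]
  change ((J r * projVal u (k + 1) x - projVal u (k + 1) x * J r) *
      (projVal u l x - tilde (projVal u l x))).trace - ((J r * projVal u k x - projVal u k x * J r) *
      (projVal u (l + 1) x - tilde (projVal u (l + 1) x))).trace = _
  generalize projVal u (k + 1) x = A'
  generalize projVal u k x = A
  -- With N = P_l - `tilde` P_l and N' likewise for l+1, everything becomes polynomial in A, A', B,
  -- B', N, N', and B, B' drop out by linearity.
  have e1 : tilde (projVal u l x) = projVal u l x - (projVal u l x - tilde (projVal u l x)) := by abel
  have e2 : tilde (projVal u (l + 1) x) = projVal u (l + 1) x -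
    (projVal u (l + 1) x - tilde (projVal u (l + 1) x)) := by abel
  generalize projVal u l x - tilde (projVal u l x) = N at *
  generalize projVal u (l + 1) x - tilde (projVal u (l + 1) x) = N' at *
  rw [e1, e2]
  generalize projVal u l x = B
  generalize projVal u (l + 1) x = B'
  have e3 : (Complex.I • (Q u x * A - A * Q u x) - Complex.I • (J r * A' - A' * J r)) * N +
      A * (Complex.I • (Q u x * B - B * Q u x) - Complex.I • (J r * B' - B' * J r) -
        (Complex.I • (Q u x * (B - N) - (B - N) * Q u x) -
          Complex.I • (J r * (B' - N') - (B' - N') * J r))) =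
      Complex.I • ((Q u x * (A * N) - (A * N) * Q u x) - (J r * A' - A' * J r) * N -
        (A * J r * N' - A * N' * J r)) := by
    simp only [smul_mul_assoc, mul_smul_comm, sub_mul, mul_sub, smul_sub, mul_assoc]
    abel
  rw [e3, Matrix.trace_smul, smul_eq_mul, ← mul_assoc, Complex.I_mul_I]
  simp only [Matrix.trace_sub, sub_mul]
  rw [Matrix.trace_mul_comm (Q u x), Matrix.trace_mul_comm (A * N') (J r), ← mul_assoc (J r) A N']
  ring

/-- Total derivatives integrate to zero, so an index can be shifted from k to l until k = 0, where
P_0 is the block projector and commutes with J. -/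
lemma integral_omegaPoly {ν : Measure ℝ} {u : Potential r} (hu : IsTame ν u) (k l : ℕ) :
    ∫ x, jetEval u x (omegaPoly r k l) ∂ν = 0 := by
  induction k generalizing l with
  | zero =>
    have h : ∀ x, jetEval u x (omegaPoly r 0 l) = 0 := fun x => by
      rw [map_omegaPoly, projPoly, projCoeff_zero]
      have : (upOver r (DiffPoly r)).map (jetEval u x) = upProj r := by
        ext; simp [upOver]
      rw [this, upProj_eq]
      simp [mul_add, add_mul]
    simp [h]
  | succ k ih =>
    obtain ⟨q, hq⟩ := jetEval_omegaPoly_succ hu.contDiff k l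
    have h := integral_sub (hu.integrable _ (constantCoeff_omegaPoly (k + 1) l))
      (hu.integrable _ (constantCoeff_omegaPoly k (l + 1)))
    simp only [hq] at h
    rw [hu.integral_totalD, ih, sub_zero] at h
    exact h.symm

/-- By `trace_piZeroJ_mul` the bracket density of two gradients i tr(E_α P) is half of `omegaPoly`.
-/
lemma pairing_integralGrad {ν : Measure ℝ} {u : Potential r} (hu : IsTame ν u) (k l : ℕ) :
    pairing ν (integralGrad u k) (integralGrad u l) = 0 := by
  have h : ∀ x, ∑ p : Pairs r, (integralGrad u k x (Sum.inl p) * integralGrad u l x (Sum.inr p) -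
      integralGrad u k x (Sum.inr p) * integralGrad u l x (Sum.inl p)) =
      (1 / 2) * jetEval u x (omegaPoly r k l) := fun x => by
    rw [map_omegaPoly]
    have h0 := trace_piZeroJ_mul (projVal u k x) (projVal u l x)
    simp only [projVal] at h0
    rw [neg_mul, ← neg_eq_iff_eq_neg] at h0
    rw [← h0, piZeroJ, Finset.sum_mul,
      Matrix.trace_sum, ← Finset.sum_neg_distrib]
    refine Finset.sum_congr rfl fun p _ => ?_
    rw [sub_mul, ← Matrix.mul_kronecker_mul, ← Matrix.mul_kronecker_mul, Matrix.trace_sub,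
      Matrix.trace_kronecker, Matrix.trace_kronecker]
    simp only [integralGrad_apply, gen_inl, gen_inr, projVal]
    linear_combination ((weylPlus p * (projPoly r k).map (jetEval u x)).trace *
      ((weylPlus p).transpose * (projPoly r l).map (jetEval u x)).trace -
      ((weylPlus p).transpose * (projPoly r k).map (jetEval u x)).trace *
      (weylPlus p * (projPoly r l).map (jetEval u x)).trace) * Complex.I_mul_I
  rw [pairing]
  simp only [h]
  rw [integral_const_mul, integral_omegaPoly hu, mul_zero, mul_zero]

lemma contDiff_apply_of_contDiff {u : Potential r} (hu : ContDiff ℝ ∞ u) (c : Coord r) :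
    ContDiff ℝ ∞ fun t => u t c := (contDiff_pi.1 hu) c

lemma isTame_of_mem_periodicSpace {L : ℝ} (hL : 0 < L) {u : Potential r}
    (hu : u ∈ periodicSpace r L) : IsTame (volume.restrict (Set.Ioc (-L) L)) u :=
  isTame_periodic hL (contDiff_apply_of_contDiff hu.1) hu.2

lemma isTame_pair_of_mem_periodicSpace {L : ℝ} (hL : 0 < L) {u v : Potential r}
    (hu : u ∈ periodicSpace r L) (hv : v ∈ periodicSpace r L) :
    IsTame (volume.restrict (Set.Ioc (-L) L)) (pairFields u v) :=
  isTame_periodic hL (contDiff_pairFields (contDiff_apply_of_contDiff hu.1)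
    (contDiff_apply_of_contDiff hv.1)) fun x => by simp only [pairFields, hu.2 x, hv.2 x]

lemma isRapid_of_mem_schwartzSpace {u : Potential r} (hu : u ∈ schwartzSpace r) : IsRapid u := by
  obtain ⟨s, hs⟩ := hu
  intro c
  refine ⟨s.postcompCLM (ContinuousLinearMap.proj (R := ℝ) (φ := fun _ : Coord r => ℂ) c),
    fun x => ?_⟩
  rw [SchwartzMap.postcompCLM_apply, hs]
  rfl

lemma isTame_pair_of_mem_schwartzSpace {u v : Potential r}
    (hu : u ∈ schwartzSpace r) (hv : v ∈ schwartzSpace r) : IsTame volume (pairFields u v) :=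
  isTame_rapid fun c => by
    rcases c with c | c
    · exact isRapid_of_mem_schwartzSpace hu c
    · exact isRapid_of_mem_schwartzSpace hv c

theorem hasPeriodicBracket_localIntegral {L : ℝ} (hL : 0 < L) {u : Potential r}
    (hu : u ∈ periodicSpace r L) (k l : ℕ) :
    HasPeriodicBracket L (localIntegral (rhoPoly r k) L) (localIntegral (rhoPoly r l) L) u 0 := by
  have e : ∀ k, localIntegral (rhoPoly r k) L = fun v =>
      ∫ x, jetEval v x (rhoPoly r k) ∂(volume.restrict (Set.Ioc (-L) L)) := fun k => by
    funext v
    simp only [localIntegral, evalAt_eq]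
    exact intervalIntegral.integral_of_le (by linarith)
  rw [e, e]
  have ht := isTame_of_mem_periodicSpace hL hu
  exact HasBracket.of_pairing
    (hasVarDeriv_rhoPoly ht (fun v hv => isTame_pair_of_mem_periodicSpace hL hu hv) k)
    (hasVarDeriv_rhoPoly ht (fun v hv => isTame_pair_of_mem_periodicSpace hL hu hv) l)
    (pairing_integralGrad ht k l)

/-- The integrals of motion on the line. -/
def lineIntegral (r k : ℕ) (u : Potential r) : ℂ := ∫ x, jetEval u x (rhoPoly r k)

theorem tendsto_localIntegral {u : Potential r} (hu : u ∈ schwartzSpace r) (k : ℕ) :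
    Filter.Tendsto (fun L : ℝ => localIntegral (rhoPoly r k) L u) Filter.atTop
      (𝓝 (lineIntegral r k u)) := by
  simp only [localIntegral, evalAt_eq]
  exact intervalIntegral_tendsto_integral
    ((isTame_rapid (isRapid_of_mem_schwartzSpace hu)).integrable _ (constantCoeff_rhoPoly r k))
    Filter.tendsto_neg_atTop_atBot Filter.tendsto_id

theorem hasLineBracket_lineIntegral {u : Potential r} (hu : u ∈ schwartzSpace r) (k l : ℕ) :
    HasLineBracket (lineIntegral r k) (lineIntegral r l) u 0 := by
  have ht := isTame_rapid (isRapid_of_mem_schwartzSpace hu)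
  exact HasBracket.of_pairing
    (hasVarDeriv_rhoPoly ht (fun v hv => isTame_pair_of_mem_schwartzSpace hu hv) k)
    (hasVarDeriv_rhoPoly ht (fun v hv => isTame_pair_of_mem_schwartzSpace hu hv) l)
    (pairing_integralGrad ht k l)

end Integrals
end DIII
end

noncomputable section
set_option linter.unusedSectionVars false
namespace DIII
open MeasureTheory
open Finset.HasAntidiagonal (antidiagonal)
open scoped Matrix.Norms.Operator

/-! ### The truncated gauge -/

section Gauge

variable {r : ℕ}

lemma norm_le_of_entry_le {n : Type*} [Fintype n] [DecidableEq n] {M : Matrix n n ℂ} {C : ℝ}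
    (hC : 0 ≤ C) (h : ∀ a b, ‖M a b‖ ≤ C) : ‖M‖ ≤ Fintype.card n * C := by
  lift C to NNReal using hC
  rw [Matrix.linfty_opNorm_def]
  have h1 : (Finset.univ.sup fun i => ∑ j, ‖M i j‖₊) ≤ Fintype.card n * C := by
    refine Finset.sup_le fun i _ => ?_
    refine (Finset.sum_le_card_nsmul Finset.univ (fun j => ‖M i j‖₊) C fun j _ => h i j).trans_eq ?_
    rw [nsmul_eq_mul, Finset.card_univ]
  exact_mod_cast h1

lemma IsTame.exists_norm_map_le {ν : Measure ℝ} {u : Potential r} (hu : IsTame ν u)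
    (M : MatOver r (DiffPoly r)) : ∃ C, 0 ≤ C ∧ ∀ x, ‖M.map (jetEval u x)‖ ≤ C := by
  choose C hC using fun a b => hu.bounded (M a b)
  have h0 : ∀ a b, 0 ≤ C a b := fun a b => (norm_nonneg _).trans (hC a b 0)
  refine ⟨Fintype.card (Idx r) * ∑ a, ∑ b, C a b,
    mul_nonneg (Nat.cast_nonneg _) (Finset.sum_nonneg fun a _ => Finset.sum_nonneg fun b _ => h0 a b),
    fun x => norm_le_of_entry_le
    (Finset.sum_nonneg fun a _ => Finset.sum_nonneg fun b _ => h0 a b) fun a b => ?_⟩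
  refine (hC a b x).trans ?_
  exact (Finset.single_le_sum (f := fun b => C a b) (fun b _ => h0 a b) (Finset.mem_univ b)).trans
    (Finset.single_le_sum (f := fun a => ∑ b, C a b)
      (fun a _ => Finset.sum_nonneg fun b _ => h0 a b) (Finset.mem_univ a))

/-- The coefficients of the gauge. -/
def gaugeW (u : Potential r) (k : ℕ) (x : ℝ) : Mat r :=
  (riccati (totalD (Coord r)) (formalQ r) k).map (jetEval u x)

/-- The derivatives of the coefficients of the gauge. -/
def gaugeW' (u : Potential r) (k : ℕ) (x : ℝ) : Mat r :=
  ((riccati (totalD (Coord r)) (formalQ r) k).map (totalD (Coord r))).map (jetEval u x)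

lemma hasDerivAt_gaugeW {u : Potential r} (hu : ∀ c, ContDiff ℝ ∞ fun t => u t c) (k : ℕ) (x : ℝ) :
    HasDerivAt (gaugeW u k) (gaugeW' u k x) x :=
  hasDerivAt_matrix.2 fun _ _ => hasDerivAt_jetEval hu _ x

lemma continuous_map_jetEval {u : Potential r} (hu : ∀ c, ContDiff ℝ ∞ fun t => u t c)
    (M : MatOver r (DiffPoly r)) : Continuous fun x => M.map (jetEval u x) :=
  continuous_iff_continuousAt.2 fun x => (hasDerivAt_matrix.2 fun a b =>
    hasDerivAt_jetEval hu (M a b) x : HasDerivAt (fun x => M.map (jetEval u x))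
      ((M.map (totalD (Coord r))).map (jetEval u x)) x).continuousAt

lemma JOver_map (f : DiffPoly r →ₐ[ℂ] ℂ) : (JOver r (DiffPoly r)).map f = J r := by
  ext a b; simp [JOver]

lemma J_mul_gaugeW (u : Potential r) (k : ℕ) (x : ℝ) :
    J r * gaugeW u k x = -(gaugeW u k x * J r) := by
  have h := congrArg (jetEval u x).mapMatrix
    (isOffDiag_riccati (totalD (Coord r)) (isOffDiag_formalQ r) k)
  rw [map_mul, map_neg, map_mul] at h
  simp only [AlgHom.mapMatrix_apply, JOver_map] at h
  exact h

lemma J_mul_Q (u : Potential r) (x : ℝ) : J r * Q u x = -(Q u x * J r) := by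
  rw [Q_eq_sum, Finset.mul_sum, Finset.sum_mul, ← Finset.sum_neg_distrib]
  refine Finset.sum_congr rfl fun c _ => ?_
  rw [mul_smul_comm, gen_comm_J, smul_mul_assoc, smul_neg]

lemma gaugeW_zero (u : Potential r) (x : ℝ) : gaugeW u 0 x = 0 := by
  rw [gaugeW, riccati_zero]; ext; simp

lemma two_I_J_gaugeW_succ (u : Potential r) (k : ℕ) (x : ℝ) :
    (2 * Complex.I) • (J r * gaugeW u (k + 1) x) =
      Complex.I • (if k = 0 then Q u x else 0) - gaugeW' u k x -
        Complex.I • ∑ q ∈ antidiagonal k, gaugeW u q.1 x * Q u x * gaugeW u q.2 x := by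
  have h := congrArg (jetEval u x).mapMatrix
    (two_I_J_riccati_succ (totalD (Coord r)) (formalQ r) k)
  rw [map_smul, map_mul, map_sub, map_sub, map_smul, map_smul, map_sum] at h
  simp only [map_mul, AlgHom.mapMatrix_apply, JOver_map, map_formalQ] at h
  have h0 : (if k = 0 then formalQ r else 0).map (jetEval u x) = if k = 0 then Q u x else 0 := by
    split_ifs
    · exact map_formalQ u x
    · ext; simp
  rw [h0] at h
  exact h

/-- The truncated gauge minus one. -/
def gaugeSum (u : Potential r) (N : ℕ) (s : ℂ) (x : ℝ) : Mat r :=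
  ∑ k ∈ Finset.range (N + 1), s ^ k • gaugeW u k x

/-- The failure of the truncated gauge to diagonalise the linear problem. -/
def gaugeErr (u : Potential r) (N : ℕ) (z : ℂ) (x : ℝ) : Mat r :=
  ∑ k ∈ Finset.range (N + 1), z⁻¹ ^ k • gaugeW' u k x -
    coef u z x * (1 + gaugeSum u N z⁻¹ x) + (1 + gaugeSum u N z⁻¹ x) *
      (Complex.I • (Q u x * gaugeSum u N z⁻¹ x) - (Complex.I * z) • J r)

/-- Cutting the square of index pairs along i + j = N separates the terms that the recursion cancels
from those of order at least N. -/
lemma sum_range_mul_sum_range {M : Type*} [AddCommGroup M] (f : ℕ → ℕ → M) (N : ℕ) :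
    ∑ i ∈ Finset.range (N + 1), ∑ j ∈ Finset.range (N + 1), f i j =
      ∑ k ∈ Finset.range N, ∑ q ∈ antidiagonal k, f q.1 q.2 +
      ∑ q ∈ (Finset.range (N + 1) ×ˢ Finset.range (N + 1)).filter (fun q => N ≤ q.1 + q.2),
        f q.1 q.2 := by
  rw [← Finset.sum_product', ← Finset.sum_filter_add_sum_filter_not _ (fun q => N ≤ q.1 + q.2),
    add_comm]
  congr 1
  rw [Finset.sum_sigma']
  symm
  refine Finset.sum_bij' (fun a _ => a.2) (fun q _ => ⟨q.1 + q.2, q⟩) ?_ ?_ ?_ ?_ ?_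
  · rintro ⟨k, q⟩ h
    simp only [Finset.mem_sigma, Finset.mem_range, Finset.HasAntidiagonal.mem_antidiagonal] at h
    simp only [Finset.mem_filter, Finset.mem_product, Finset.mem_range]
    omega
  · rintro q h
    simp only [Finset.mem_filter, Finset.mem_product, Finset.mem_range] at h
    simp only [Finset.mem_sigma, Finset.mem_range, Finset.HasAntidiagonal.mem_antidiagonal, and_true]
    omega
  · rintro ⟨k, q⟩ h
    simp only [Finset.mem_sigma, Finset.mem_range, Finset.HasAntidiagonal.mem_antidiagonal] at h
    obtain ⟨_, rfl⟩ := h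
    rfl
  · intros; rfl
  · intros; rfl

lemma J_mul_gaugeSum (u : Potential r) (N : ℕ) (s : ℂ) (x : ℝ) :
    J r * gaugeSum u N s x = -(gaugeSum u N s x * J r) := by
  rw [gaugeSum, Finset.mul_sum, Finset.sum_mul, ← Finset.sum_neg_distrib]
  exact Finset.sum_congr rfl fun k _ => by
    rw [mul_smul_comm, J_mul_gaugeW, smul_mul_assoc, smul_neg]

/-- The recursion cancels all orders of 1/z below N. What remains is the derivative of W_N and the
products W_i Q W_j with i + j ≥ N. -/
lemma gaugeErr_eq (u : Potential r) {N : ℕ} (hN : 1 ≤ N) {z : ℂ} (hz : z ≠ 0) (x : ℝ) :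
    gaugeErr u N z x = z⁻¹ ^ N • gaugeW' u N x + Complex.I •
      ∑ q ∈ (Finset.range (N + 1) ×ˢ Finset.range (N + 1)).filter (fun q => N ≤ q.1 + q.2),
        z⁻¹ ^ (q.1 + q.2) • (gaugeW u q.1 x * Q u x * gaugeW u q.2 x) := by
  -- The recursion summed over k < N; the factor z lowers the power of W_{k+1} by one, and W_0 = 0
  -- contributes nothing.
  have h1 : (2 * Complex.I * z) • (J r * gaugeSum u N z⁻¹ x) =
      Complex.I • Q u x - ∑ k ∈ Finset.range N, z⁻¹ ^ k • gaugeW' u k x - Complex.I •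
        ∑ k ∈ Finset.range N, ∑ q ∈ antidiagonal k,
          z⁻¹ ^ (q.1 + q.2) • (gaugeW u q.1 x * Q u x * gaugeW u q.2 x) := by
    have h2 : ∀ k, (2 * Complex.I * z) • (z⁻¹ ^ (k + 1) • (J r * gaugeW u (k + 1) x)) =
        z⁻¹ ^ k • (Complex.I • (if k = 0 then Q u x else 0) - gaugeW' u k x -
        Complex.I • ∑ q ∈ antidiagonal k, gaugeW u q.1 x * Q u x * gaugeW u q.2 x) := fun k => by
      rw [← two_I_J_gaugeW_succ, smul_smul, smul_smul]
      congr 1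
      rw [pow_succ]
      field_simp
    rw [gaugeSum, Finset.sum_range_succ', gaugeW_zero, smul_zero, add_zero, Finset.mul_sum,
      Finset.smul_sum]
    simp only [mul_smul_comm, h2, smul_sub, Finset.sum_sub_distrib]
    congr 1
    · congr 1
      rw [Finset.sum_eq_single_of_mem 0 (Finset.mem_range.2 hN)]
      · simp
      · intro k _ hk
        simp [hk]
    · rw [Finset.smul_sum]
      refine Finset.sum_congr rfl fun k _ => ?_
      rw [smul_comm, Finset.smul_sum]
      congr 1
      refine Finset.sum_congr rfl fun q hq => ?_
      rw [Finset.HasAntidiagonal.mem_antidiagonal.1 hq]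
  have h2 : gaugeSum u N z⁻¹ x * Q u x * gaugeSum u N z⁻¹ x =
      ∑ i ∈ Finset.range (N + 1), ∑ j ∈ Finset.range (N + 1),
        z⁻¹ ^ (i + j) • (gaugeW u i x * Q u x * gaugeW u j x) := by
    simp only [gaugeSum, Finset.sum_mul, Finset.mul_sum]
    rw [Finset.sum_comm]
    refine Finset.sum_congr rfl fun i _ => Finset.sum_congr rfl fun j _ => ?_
    rw [smul_mul_assoc, smul_mul_assoc, mul_smul_comm, smul_smul, pow_add]
  rw [sum_range_mul_sum_range fun i j => z⁻¹ ^ (i + j) • (gaugeW u i x * Q u x * gaugeW u j x)] at h2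
  have h3 : gaugeErr u N z x = ∑ k ∈ Finset.range (N + 1), z⁻¹ ^ k • gaugeW' u k x -
      Complex.I • Q u x + (2 * Complex.I * z) • (J r * gaugeSum u N z⁻¹ x) +
      Complex.I • (gaugeSum u N z⁻¹ x * Q u x * gaugeSum u N z⁻¹ x) := by
    have hJ := J_mul_gaugeSum u N z⁻¹ x
    have hJ' : gaugeSum u N z⁻¹ x * J r = -(J r * gaugeSum u N z⁻¹ x) := by rw [hJ, neg_neg]
    rw [gaugeErr, coef, U]
    simp only [smul_sub, smul_add, mul_add, add_mul, sub_mul, mul_sub, mul_one, one_mul,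
      smul_mul_assoc, mul_smul_comm, hJ', smul_neg, mul_assoc, smul_smul, two_mul, add_smul]
    abel
  rw [h3, h2, h1, Finset.sum_range_succ, smul_add]
  abel

lemma IsTame.exists_norm_gaugeErr_le {ν : Measure ℝ} {u : Potential r} (hu : IsTame ν u) {N : ℕ}
    (hN : 1 ≤ N) : ∃ C, 0 ≤ C ∧ ∀ z : ℂ, 1 ≤ ‖z‖ → ∀ x, ‖gaugeErr u N z x‖ ≤ C * ‖z‖⁻¹ ^ N := by
  obtain ⟨C, hC0, hC⟩ := hu.exists_norm_map_le ((riccati (totalD (Coord r)) (formalQ r) N).map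
    (totalD (Coord r)))
  choose D hD0 hD using fun q : ℕ × ℕ => hu.exists_norm_map_le
    (riccati (totalD (Coord r)) (formalQ r) q.1 * formalQ r *
      riccati (totalD (Coord r)) (formalQ r) q.2)
  set F := (Finset.range (N + 1) ×ˢ Finset.range (N + 1)).filter (fun q => N ≤ q.1 + q.2) with hF
  refine ⟨C + ∑ q ∈ F, D q, add_nonneg hC0 (Finset.sum_nonneg fun q _ => hD0 q), fun z hz x => ?_⟩
  have hz0 : z ≠ 0 := norm_pos_iff.1 (by linarith)
  have hs : ‖z⁻¹‖ ≤ 1 := by rw [norm_inv]; exact inv_le_one_of_one_le₀ hz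
  have hD' : ∀ q, ‖gaugeW u q.1 x * Q u x * gaugeW u q.2 x‖ ≤ D q := fun q => by
    have := hD q x
    rw [← AlgHom.mapMatrix_apply, map_mul, map_mul] at this
    simp only [AlgHom.mapMatrix_apply, map_formalQ] at this
    exact this
  rw [gaugeErr_eq u hN hz0, add_mul, ← norm_inv]
  refine norm_add_le_of_le ?_ ?_
  · rw [norm_smul, norm_pow, mul_comm]
    exact mul_le_mul_of_nonneg_right (hC x) (by positivity)
  · rw [norm_smul, Complex.norm_I, one_mul, Finset.sum_mul]
    refine norm_sum_le_of_le _ fun q hq => ?_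
    rw [norm_smul, norm_pow, mul_comm]
    exact mul_le_mul (hD' q) (pow_le_pow_of_le_one (norm_nonneg _) hs (Finset.mem_filter.1 hq).2)
      (by positivity) (hD0 q)

/-! ### Estimates of the propagators -/

/-- Grönwall's inequality in both directions: f(t)e^{-Kt} decreases and f(t)e^{Kt} increases. -/
lemma le_exp_mul_of_abs_deriv_le {f f' : ℝ → ℝ} {K : ℝ} (hf : ∀ t, HasDerivAt f (f' t) t)
    (h : ∀ t, |f' t| ≤ K * f t) (x y : ℝ) : f x ≤ Real.exp (K * |x - y|) * f y := by
  rcases le_total y x with hxy | hxy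
  · have hg : ∀ t, HasDerivAt (fun t => f t * Real.exp (-(K * t)))
        (f' t * Real.exp (-(K * t)) + f t * (Real.exp (-(K * t)) * -(K * 1))) t := fun t =>
      (hf t).mul ((((hasDerivAt_id t).const_mul K).neg).exp)
    have ha : Antitone fun t => f t * Real.exp (-(K * t)) :=
      antitone_of_hasDerivAt_nonpos hg fun t => by
        have := (le_abs_self _).trans (h t)
        have h2 := Real.exp_pos (-(K * t))
        simp only [Pi.zero_apply]
        nlinarith
    have := ha hxy
    simp only at this
    rw [abs_of_nonneg (by linarith)]
    have h3 := mul_le_mul_of_nonneg_right this (Real.exp_pos (K * x)).le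
    rw [mul_assoc, ← Real.exp_add, mul_assoc, ← Real.exp_add] at h3
    simp only [neg_add_cancel, Real.exp_zero, mul_one] at h3
    rw [mul_comm, mul_sub, sub_eq_neg_add]
    exact h3
  · have hg : ∀ t, HasDerivAt (fun t => f t * Real.exp (K * t))
        (f' t * Real.exp (K * t) + f t * (Real.exp (K * t) * (K * 1))) t := fun t =>
      (hf t).mul ((((hasDerivAt_id t).const_mul K)).exp)
    have ha : Monotone fun t => f t * Real.exp (K * t) :=
      monotone_of_hasDerivAt_nonneg hg fun t => by
        have := (neg_abs_le (f' t))
        have h1 := h t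
        have h2 := Real.exp_pos (K * t)
        simp only [Pi.zero_apply]
        nlinarith
    have := ha hxy
    simp only at this
    rw [abs_of_nonpos (by linarith)]
    have h3 := mul_le_mul_of_nonneg_right this (Real.exp_pos (-(K * x))).le
    rw [mul_assoc, ← Real.exp_add, mul_assoc, ← Real.exp_add] at h3
    simp only [add_neg_cancel, Real.exp_zero, mul_one] at h3
    rw [mul_comm, show K * -(x - y) = K * y + -(K * x) by ring]
    exact h3

/-- The columns of the propagator grow at most with the exponent `|Im z|`. -/
lemma norm_flow_coef_entry_le {u : Potential r} (hu : Continuous u) {β : ℝ}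
    (hβ : ∀ x a b, ‖Q u x a b‖ ≤ β) (z : ℂ) (x y : ℝ) (a b : Idx r) :
    ‖flow (coef u z) x y a b‖ ≤
      Real.exp (((Fintype.card (Idx r) : ℝ) * β + |z.im|) * |x - y|) := by
  set n : ℝ := (Fintype.card (Idx r) : ℝ) with hn
  have hβ0 : 0 ≤ β := (norm_nonneg _).trans (hβ 0 a a)
  set X : ℝ → Idx r → ℂ := fun t i => flow (coef u z) t y i b with hX
  have hd : ∀ t i, HasDerivAt (fun t => X t i)
      (Complex.I * ∑ j, Q u t i j * X t j - Complex.I * z * sgn i * X t i) t := fun t i => by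
    have h := hasDerivAt_matrix.1 (hasDerivAt_flow (continuous_coef hu z) t y) i b
    convert! h using 1
    rw [coef, U, J_eq_diagonal, Matrix.smul_mul, Matrix.smul_apply, Matrix.sub_mul,
      Matrix.sub_apply, Matrix.smul_mul, Matrix.smul_apply, Matrix.diagonal_mul, Matrix.mul_apply]
    simp only [smul_eq_mul, hX]
    ring
  -- The squared length of a column is used because its derivative sees only real parts, so that z
  -- enters through Im z alone. The general bound of the propagator would involve |z|.
  set f : ℝ → ℝ := fun t => ∑ i, Complex.normSq (X t i) with hf
  set f' : ℝ → ℝ := fun t => ∑ i, 2 * ((starRingEnd ℂ) (X t i) *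
    (Complex.I * ∑ j, Q u t i j * X t j - Complex.I * z * sgn i * X t i)).re with hf'
  have hfd : ∀ t, HasDerivAt f (f' t) t := fun t => by
    refine HasDerivAt.fun_sum fun i _ => ?_
    have h1 := (hd t i).norm_sq
    simp only [Complex.inner, ← Complex.normSq_eq_norm_sq] at h1
    convert! h1 using 1
    rw [mul_comm ((starRingEnd ℂ) (X t i))]
  have hbd : ∀ t, |f' t| ≤ 2 * (n * β + |z.im|) * f t := fun t => by
    have hS : ∀ i, ‖∑ j, Q u t i j * X t j‖ ≤ β * ∑ j, ‖X t j‖ := fun i => by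
      rw [Finset.mul_sum]
      refine norm_sum_le_of_le _ fun j _ => ?_
      rw [norm_mul]
      exact mul_le_mul_of_nonneg_right (hβ t i j) (norm_nonneg _)
    have hi : ∀ i, |2 * ((starRingEnd ℂ) (X t i) *
        (Complex.I * ∑ j, Q u t i j * X t j - Complex.I * z * sgn i * X t i)).re| ≤
        2 * (‖X t i‖ * (β * ∑ j, ‖X t j‖) + |z.im| * Complex.normSq (X t i)) := fun i => by
      have e : (starRingEnd ℂ) (X t i) *
          (Complex.I * ∑ j, Q u t i j * X t j - Complex.I * z * sgn i * X t i) =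
          (starRingEnd ℂ) (X t i) * (Complex.I * ∑ j, Q u t i j * X t j) -
          Complex.normSq (X t i) * (Complex.I * z * sgn i) := by
        rw [← Complex.mul_conj]; ring
      have e2 : |(Complex.I * z * sgn i).re| = |z.im| := by
        rcases i with i | i <;> simp [sgn]
      rw [e, abs_mul, abs_two, Complex.sub_re, Complex.re_ofReal_mul]
      refine mul_le_mul_of_nonneg_left ((abs_sub _ _).trans (add_le_add ?_ ?_)) zero_le_two
      · refine (Complex.abs_re_le_norm _).trans ?_
        rw [norm_mul, norm_mul, RCLike.norm_conj, Complex.norm_I, one_mul]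
        exact mul_le_mul_of_nonneg_left (hS i) (norm_nonneg _)
      · rw [abs_mul, e2, abs_of_nonneg (Complex.normSq_nonneg _), mul_comm]
    refine (Finset.abs_sum_le_sum_abs _ _).trans ((Finset.sum_le_sum fun i _ => hi i).trans ?_)
    rw [← Finset.mul_sum, Finset.sum_add_distrib, ← Finset.sum_mul, ← Finset.mul_sum]
    -- Cauchy–Schwarz; this is where the number of labels enters the exponent.
    have h4 : (∑ i, ‖X t i‖) ^ 2 ≤ n * f t := by
      have := sq_sum_le_card_mul_sum_sq (s := Finset.univ) (f := fun i => ‖X t i‖)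
      simpa only [hf, Complex.normSq_eq_norm_sq, Finset.card_univ] using this
    have h5 := mul_le_mul_of_nonneg_left h4 hβ0
    change 2 * (_ + |z.im| * f t) ≤ _
    linarith
  have h := le_exp_mul_of_abs_deriv_le hfd hbd x y
  have h1 : f y = 1 := by
    simp only [hf, hX, flow_self, Matrix.one_apply]
    simp [apply_ite]
  rw [h1, mul_one] at h
  have h2 : ‖X x a‖ ^ 2 ≤ Real.exp ((n * β + |z.im|) * |x - y|) ^ 2 := by
    rw [← Real.exp_nat_mul, ← Complex.normSq_eq_norm_sq]
    refine (Finset.single_le_sum (f := fun i => Complex.normSq (X x i))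
      (fun i _ => Complex.normSq_nonneg _) (Finset.mem_univ a)).trans (h.trans_eq ?_)
    congr 1
    push_cast
    ring
  exact le_of_sq_le_sq h2 (Real.exp_pos _).le

end Gauge
end DIII
end

noncomputable section
set_option linter.unusedSectionVars false
namespace DIII
open MeasureTheory
open scoped Matrix.Norms.Operator

/-! ### Comparison with the diagonalised problem -/

section Comparison

variable {r : ℕ}

/-- The regular part of the coefficient of the diagonalised problem. -/
def diagCoef (u : Potential r) (N : ℕ) (s : ℂ) (x : ℝ) : Mat r :=
  Complex.I • (Q u x * gaugeSum u N s x)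

lemma continuous_gaugeSum {u : Potential r} (hu : ∀ c, ContDiff ℝ ∞ fun t => u t c) (N : ℕ) (s : ℂ) :
    Continuous (gaugeSum u N s) :=
  continuous_finsetSum _ fun k _ => (continuous_map_jetEval hu _).const_smul (s ^ k)

lemma continuous_of_contDiff {u : Potential r} (hu : ∀ c, ContDiff ℝ ∞ fun t => u t c) :
    Continuous u := continuous_pi fun c => (hu c).continuous

lemma continuous_diagCoef {u : Potential r} (hu : ∀ c, ContDiff ℝ ∞ fun t => u t c) (N : ℕ) (s : ℂ) :
    Continuous (diagCoef u N s) :=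
  ((continuous_Q (continuous_of_contDiff hu)).mul (continuous_gaugeSum hu N s)).const_smul Complex.I

lemma J_mul_diagCoef (u : Potential r) (N : ℕ) (s : ℂ) (x : ℝ) :
    J r * diagCoef u N s x = diagCoef u N s x * J r := by
  rw [diagCoef, mul_smul_comm, smul_mul_assoc, ← mul_assoc, J_mul_Q, neg_mul, mul_assoc,
    J_mul_gaugeSum, mul_neg, neg_neg, mul_assoc]

lemma commute_flow {𝔸 : Type*} [NormedRing 𝔸] [NormedAlgebra ℝ 𝔸] [CompleteSpace 𝔸] {A : ℝ → 𝔸}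
    (hA : Continuous A) {j : 𝔸} (hj : ∀ x, j * A x = A x * j) (x y : ℝ) :
    j * flow A x y = flow A x y * j := by
  have h := solution_eq_flow_mul hA (Ψ := fun x => j * flow A x y) (fun t => by
    rw [← mul_assoc, ← hj, mul_assoc]
    exact (hasDerivAt_flow hA t y).const_mul j) x y
  simpa using h

/-- The propagator of the diagonalised problem, with the oscillation of the upper block removed. -/
def diagFlow (u : Potential r) (N : ℕ) (z : ℂ) (x y : ℝ) : Mat r :=
  (upProj r + Complex.exp (2 * Complex.I * z * (x - y)) • (1 - upProj r)) *
    flow (diagCoef u N z⁻¹) x y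

/-- The propagator of the linear problem, with the oscillation of the upper block removed. -/
def scaledFlow (u : Potential r) (z : ℂ) (x y : ℝ) : Mat r :=
  Complex.exp (Complex.I * z * (x - y)) • flow (coef u z) x y

lemma hasDerivAt_cexp_mul (c : ℂ) (y t : ℝ) :
    HasDerivAt (fun t : ℝ => Complex.exp (c * (t - y))) (c * Complex.exp (c * (t - y))) t := by
  have h : HasDerivAt (fun t : ℝ => c * ((t : ℂ) - y)) c t := by
    simpa using ((Complex.ofRealCLM.hasDerivAt (x := t)).sub_const (y : ℂ)).const_mul c
  simpa [mul_comm] using h.cexp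

lemma upProj_mul_upProj (r : ℕ) : upProj r * upProj r = upProj r := by
  rw [upProj, Matrix.diagonal_mul_diagonal]
  congr 1
  funext i
  rcases i with i | i <;> simp

lemma J_eq_upProj (r : ℕ) : J r = (2 : ℂ) • upProj r - 1 := by
  rw [upProj_eq, smul_smul]; norm_num

lemma hasDerivAt_diagFlow {u : Potential r} (hu : ∀ c, ContDiff ℝ ∞ fun t => u t c) (N : ℕ) (z : ℂ)
    (y t : ℝ) : HasDerivAt (fun t => diagFlow u N z t y)
      ((diagCoef u N z⁻¹ t - (Complex.I * z) • J r + (Complex.I * z) • 1) * diagFlow u N z t y) t := by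
  have h1 := ((hasDerivAt_cexp_mul (2 * Complex.I * z) y t).smul_const (1 - upProj r)).const_add
    (upProj r)
  have h2 := h1.mul (hasDerivAt_flow (continuous_diagCoef hu N z⁻¹) t y)
  convert! h2 using 1
  rw [diagFlow]
  have hc : upProj r * diagCoef u N z⁻¹ t = diagCoef u N z⁻¹ t * upProj r := by
    rw [upProj_eq, smul_mul_assoc, mul_smul_comm, add_mul, mul_add, J_mul_diagCoef, one_mul, mul_one]
  rw [J_eq_upProj]
  simp only [← mul_assoc]
  rw [← add_mul]
  congr 1
  simp only [mul_add, add_mul, sub_mul, mul_sub, mul_one, one_mul, smul_mul_assoc, mul_smul_comm,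
    upProj_mul_upProj, smul_sub, hc, smul_smul]
  module

lemma hasDerivAt_scaledFlow {u : Potential r} (hu : Continuous u) (z : ℂ) (x t : ℝ) :
    HasDerivAt (fun t => scaledFlow u z x t)
      (-(scaledFlow u z x t * (coef u z t + (Complex.I * z) • 1))) t := by
  have h0 : HasDerivAt (fun t : ℝ => Complex.exp (Complex.I * z * (x - t)))
      (-(Complex.I * z) * Complex.exp (Complex.I * z * (x - t))) t := by
    have := hasDerivAt_cexp_mul (-(Complex.I * z)) x t
    simpa only [show ∀ t : ℝ, -(Complex.I * z) * ((t : ℂ) - x) = Complex.I * z * (x - t) from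
      fun t => by ring] using this
  have h1 := h0.smul (hasDerivAt_flow_right (continuous_coef hu z) x t)
  convert! h1 using 1
  rw [scaledFlow, mul_add, smul_mul_assoc, mul_smul_comm, mul_one, smul_smul, neg_add, smul_neg,
    neg_mul, neg_smul]

lemma hasDerivAt_gaugeSum {u : Potential r} (hu : ∀ c, ContDiff ℝ ∞ fun t => u t c) (N : ℕ) (s : ℂ)
    (t : ℝ) : HasDerivAt (gaugeSum u N s)
      (∑ k ∈ Finset.range (N + 1), s ^ k • gaugeW' u k t) t :=
  HasDerivAt.fun_sum fun k _ => (hasDerivAt_gaugeW hu k t).const_smul (s ^ k)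

/-- If the truncated gauge were exact, this product would not depend on t; its derivative is the
error of the gauge between the two propagators. -/
lemma hasDerivAt_scaledFlow_mul {u : Potential r} (hu : ∀ c, ContDiff ℝ ∞ fun t => u t c) (N : ℕ)
    (z : ℂ) (x y t : ℝ) : HasDerivAt
      (fun t => scaledFlow u z x t * (1 + gaugeSum u N z⁻¹ t) * diagFlow u N z t y)
      (scaledFlow u z x t * gaugeErr u N z t * diagFlow u N z t y) t := by
  have h := ((hasDerivAt_scaledFlow (continuous_of_contDiff hu) z x t).mul
    ((hasDerivAt_gaugeSum hu N z⁻¹ t).const_add 1)).mul (hasDerivAt_diagFlow hu N z y t)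
  convert! h using 1
  rw [gaugeErr]
  have e : Complex.I • (Q u t * gaugeSum u N z⁻¹ t) = diagCoef u N z⁻¹ t := rfl
  rw [e, Pi.mul_apply]
  generalize 1 + gaugeSum u N z⁻¹ t = G
  simp only [mul_add, add_mul, sub_mul, mul_sub, neg_mul, mul_smul_comm, smul_mul_assoc, mul_one,
    one_mul, mul_assoc]
  abel

lemma continuous_gaugeErr {u : Potential r} (hu : ∀ c, ContDiff ℝ ∞ fun t => u t c) (N : ℕ) (z : ℂ) :
    Continuous (gaugeErr u N z) := by
  have h1 : Continuous fun x => ∑ k ∈ Finset.range (N + 1), z⁻¹ ^ k • gaugeW' u k x :=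
    continuous_finsetSum _ fun k _ => (continuous_map_jetEval hu _).const_smul (z⁻¹ ^ k)
  have h2 := continuous_coef (continuous_of_contDiff hu) z
  have h3 : Continuous fun x => 1 + gaugeSum u N z⁻¹ x :=
    continuous_const.add (continuous_gaugeSum hu N z⁻¹)
  have h4 := continuous_diagCoef hu N z⁻¹
  exact (h1.sub (h2.mul h3)).add (h3.mul (h4.sub continuous_const))

lemma gauge_diagFlow_sub {u : Potential r} (hu : ∀ c, ContDiff ℝ ∞ fun t => u t c) (N : ℕ)
    (z : ℂ) (x y : ℝ) : (1 + gaugeSum u N z⁻¹ x) * diagFlow u N z x y -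
      scaledFlow u z x y * (1 + gaugeSum u N z⁻¹ y) =
      ∫ t in y..x, scaledFlow u z x t * gaugeErr u N z t * diagFlow u N z t y := by
  have hc : Continuous fun t => scaledFlow u z x t * gaugeErr u N z t * diagFlow u N z t y :=
    ((continuous_iff_continuousAt.2 fun t =>
      (hasDerivAt_scaledFlow (continuous_of_contDiff hu) z x t).continuousAt).mul
      (continuous_gaugeErr hu N z)).mul (continuous_iff_continuousAt.2 fun t =>
      (hasDerivAt_diagFlow hu N z y t).continuousAt)
  rw [intervalIntegral.integral_eq_sub_of_hasDerivAt
    (fun t _ => hasDerivAt_scaledFlow_mul hu N z x y t) (hc.intervalIntegrable _ _)]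
  have h1 : scaledFlow u z x x = 1 := by simp [scaledFlow]
  have h2 : diagFlow u N z y y = 1 := by simp [diagFlow]
  rw [h1, h2, one_mul, mul_one]

lemma IsTame.exists_norm_diagCoef_le {ν : Measure ℝ} {u : Potential r} (hu : IsTame ν u) (N : ℕ) :
    ∃ C, 0 ≤ C ∧ ∀ s : ℂ, ‖s‖ ≤ 1 → ∀ x, ‖diagCoef u N s x‖ ≤ C := by
  choose D hD0 hD using fun k : ℕ => hu.exists_norm_map_le
    (formalQ r * riccati (totalD (Coord r)) (formalQ r) k)
  refine ⟨∑ k ∈ Finset.range (N + 1), D k, Finset.sum_nonneg fun k _ => hD0 k, fun s hs x => ?_⟩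
  rw [diagCoef, norm_smul, Complex.norm_I, one_mul, gaugeSum, Finset.mul_sum]
  refine norm_sum_le_of_le _ fun k _ => ?_
  rw [mul_smul_comm, norm_smul, norm_pow]
  have h := hD k x
  rw [← AlgHom.mapMatrix_apply, map_mul] at h
  simp only [AlgHom.mapMatrix_apply, map_formalQ] at h
  exact (mul_le_of_le_one_left (norm_nonneg _) (pow_le_one₀ (norm_nonneg _) hs)).trans h

lemma IsTame.exists_norm_flow_diagCoef_le {ν : Measure ℝ} {u : Potential r} (hu : IsTame ν u)
    (N : ℕ) (x y : ℝ) : ∃ C, 0 ≤ C ∧ ∀ s : ℂ, ‖s‖ ≤ 1 → ∀ t ∈ Set.uIcc y x,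
      ‖flow (diagCoef u N s) t y‖ ≤ C := by
  obtain ⟨C, hC0, hC⟩ := hu.exists_norm_diagCoef_le N
  refine ⟨‖(1 : Mat r)‖ * Real.exp (C * |x - y|), by positivity, fun s hs t ht => ?_⟩
  refine (norm_flow_le (continuous_diagCoef hu.contDiff N s) t y).trans ?_
  gcongr
  have h1 := intervalIntegral.norm_integral_le_of_norm_le_const (a := y) (b := t) (C := C)
    (f := fun w => ‖diagCoef u N s w‖) fun w _ => by rw [norm_norm]; exact hC s hs w
  rw [Real.norm_eq_abs] at h1
  exact h1.trans (mul_le_mul_of_nonneg_left (Set.abs_sub_left_of_mem_uIcc ht) hC0)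

/-- When Im z · (x-y) ≥ 0 the scaling factor e^{iz(x-t)} offsets the growth of the propagator and
e^{2iz(t-y)} is at most 1, so only the error of the gauge counts. The sign condition covers T_L in
the upper half-plane and its inverse in the lower one. -/
lemma IsTame.exists_norm_gauge_diagFlow_sub_le {ν : Measure ℝ} {u : Potential r} (hu : IsTame ν u)
    {N : ℕ} (hN : 1 ≤ N) (x y : ℝ) : ∃ C, ∀ z : ℂ, 1 ≤ ‖z‖ → 0 ≤ z.im * (x - y) →
      ‖(1 + gaugeSum u N z⁻¹ x) * diagFlow u N z x y -
        scaledFlow u z x y * (1 + gaugeSum u N z⁻¹ y)‖ ≤ C * ‖z‖⁻¹ ^ N := by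
  obtain ⟨C₁, h10, h1⟩ := hu.exists_norm_gaugeErr_le hN
  obtain ⟨C₂, h20, h2⟩ := hu.exists_norm_flow_diagCoef_le N x y
  obtain ⟨β, hβ0, hβ⟩ := hu.exists_norm_map_le (formalQ r)
  simp only [map_formalQ] at hβ
  set n : ℝ := (Fintype.card (Idx r) : ℝ) with hn
  set C₃ := n * Real.exp (n * β * |x - y|) with hC₃
  have h30 : 0 ≤ C₃ := by positivity
  refine ⟨C₃ * C₁ * ((‖upProj r‖ + ‖1 - upProj r‖) * C₂) * |x - y|, fun z hz him => ?_⟩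
  have hs : ‖z⁻¹‖ ≤ 1 := by rw [norm_inv]; exact inv_le_one_of_one_le₀ hz
  -- The sign condition passes from the whole interval to both of its parts at t, for either order
  -- of x and y.
  have hmem : ∀ t ∈ Set.uIoc y x, 0 ≤ z.im * (x - t) ∧ 0 ≤ z.im * (t - y) ∧ |x - t| ≤ |x - y| := by
    intro t ht
    have ht' : t ∈ Set.uIcc y x := Set.uIoc_subset_uIcc ht
    rcases le_total y x with hxy | hxy
    · rw [Set.uIcc_of_le hxy] at ht'
      rcases eq_or_lt_of_le hxy with rfl | hlt
      · have : t = y := le_antisymm ht'.2 ht'.1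
        subst this
        simp
      · have : 0 ≤ z.im := by
          by_contra! h
          nlinarith [mul_neg_of_neg_of_pos h (sub_pos.2 hlt)]
        refine ⟨mul_nonneg this (by linarith [ht'.2]), mul_nonneg this (by linarith [ht'.1]), ?_⟩
        rw [abs_of_nonneg (by linarith [ht'.2]), abs_of_nonneg (by linarith)]
        linarith [ht'.1]
    · rw [Set.uIcc_of_ge hxy] at ht'
      rcases eq_or_lt_of_le hxy with rfl | hlt
      · have : t = x := le_antisymm ht'.2 ht'.1
        subst this
        simp
      · have : z.im ≤ 0 := by
          by_contra! h
          nlinarith [mul_neg_of_pos_of_neg h (sub_neg.2 hlt)]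
        refine ⟨mul_nonneg_of_nonpos_of_nonpos this (by linarith [ht'.1]),
          mul_nonneg_of_nonpos_of_nonpos this (by linarith [ht'.2]), ?_⟩
        rw [abs_of_nonpos (by linarith [ht'.1]), abs_of_nonpos (by linarith)]
        linarith [ht'.2]
  rw [gauge_diagFlow_sub hu.contDiff]
  have hb : ∀ t ∈ Set.uIoc y x, ‖scaledFlow u z x t * gaugeErr u N z t * diagFlow u N z t y‖ ≤
      C₃ * (C₁ * ‖z‖⁻¹ ^ N) * ((‖upProj r‖ + ‖1 - upProj r‖) * C₂) := by
    intro t ht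
    obtain ⟨ht1, ht2, ht3⟩ := hmem t ht
    have b1 : ‖scaledFlow u z x t‖ ≤ C₃ := by
      refine norm_le_of_entry_le (Real.exp_pos _).le fun a b => ?_
      rw [scaledFlow, Matrix.smul_apply, norm_smul, Complex.norm_exp]
      have := norm_flow_coef_entry_le (continuous_of_contDiff hu.contDiff)
        (fun x a b => (norm_entry_le _ a b).trans (hβ x)) z x t a b
      refine (mul_le_mul_of_nonneg_left this (Real.exp_pos _).le).trans ?_
      rw [← Real.exp_add]
      refine Real.exp_le_exp.2 ?_
      have e1 : (Complex.I * z * (x - t)).re = -(z.im * (x - t)) := by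
        simp
      have e2 : |z.im| * |x - t| = z.im * (x - t) := by rw [← abs_mul, abs_of_nonneg ht1]
      rw [e1, add_mul, e2]
      have := mul_le_mul_of_nonneg_left ht3 (mul_nonneg (Nat.cast_nonneg (α := ℝ)
        (Fintype.card (Idx r))) hβ0)
      linarith
    have b2 : ‖diagFlow u N z t y‖ ≤ (‖upProj r‖ + ‖1 - upProj r‖) * C₂ := by
      rw [diagFlow]
      refine (norm_mul_le _ _).trans (mul_le_mul ?_ (h2 _ hs t (Set.uIoc_subset_uIcc ht))
        (norm_nonneg _) (by positivity))
      refine norm_add_le_of_le le_rfl ?_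
      rw [norm_smul]
      refine mul_le_of_le_one_left (norm_nonneg _) ?_
      rw [Complex.norm_exp]
      refine Real.exp_le_one_iff.2 ?_
      have e1 : (2 * Complex.I * z * (t - y)).re = -(2 * (z.im * (t - y))) := by
        simp
        ring
      rw [e1]
      linarith
    exact (norm_mul_le _ _).trans (mul_le_mul ((norm_mul_le _ _).trans
      (mul_le_mul b1 (h1 z hz t) (norm_nonneg _) h30)) b2 (norm_nonneg _) (by positivity))
  refine (intervalIntegral.norm_integral_le_of_norm_le_const hb).trans_eq ?_
  ring

/-! ### The determinant of the diagonal block -/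

/-- The value of the density of the truncated expansion. -/
lemma trace_diagCoef_toBlocks (u : Potential r) (N : ℕ) (s : ℂ) (x : ℝ) :
    (diagCoef u N s x).toBlocks₁₁.trace =
      ∑ k ∈ Finset.range (N + 1), s ^ k * jetEval u x (rhoPoly r k) := by
  have h : ∀ M : Mat r, M.toBlocks₁₁.trace = (upProj r * M).trace := fun M => by
    simp [Matrix.trace, upProj, Matrix.diagonal_mul, Matrix.toBlocks₁₁]
  rw [h, diagCoef, gaugeSum, Finset.mul_sum, Finset.smul_sum, Finset.mul_sum, Matrix.trace_sum]
  refine Finset.sum_congr rfl fun k _ => ?_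
  have e1 : (upProj r * Complex.I • (Q u x * s ^ k • gaugeW u k x)).trace =
      s ^ k * (Complex.I * (upProj r * (Q u x * gaugeW u k x)).trace) := by
    simp only [mul_smul_comm, Matrix.trace_smul, smul_eq_mul]
    ring
  rw [e1, rhoPoly, density, Matrix.trace_smul, map_smul, map_trace_algHom]
  simp only [← AlgHom.mapMatrix_apply, map_mul]
  simp only [AlgHom.mapMatrix_apply, map_formalQ]
  have e : (upOver r (DiffPoly r)).map (jetEval u x) = upProj r := by
    ext a b
    simp [upOver]
  rw [e]
  rfl

/-- Liouville's formula for the upper block: the coefficient commutes with J, so the block obeys a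
closed equation and its determinant is the exponential of the integrated trace, the sum of the
densities. -/
lemma det_flow_diagCoef {u : Potential r} (hu : ∀ c, ContDiff ℝ ∞ fun t => u t c) (N : ℕ) (s : ℂ)
    (x y : ℝ) : (flow (diagCoef u N s) x y).toBlocks₁₁.det =
      Complex.exp (∑ k ∈ Finset.range (N + 1), s ^ k * ∫ t in y..x, jetEval u t (rhoPoly r k)) := by
  set q : ℝ → ℂ := fun t => ∑ k ∈ Finset.range (N + 1), s ^ k * jetEval u t (rhoPoly r k) with hq
  have hqc : Continuous q := continuous_finsetSum _ fun k _ =>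
    continuous_const.mul (continuous_jetEval hu _)
  set A := diagCoef u N s with hA
  have h12 : ∀ t, (A t).toBlocks₁₂ = 0 := fun t => by
    have h := J_mul_diagCoef u N s t
    ext i j
    have h2 := congrFun (congrFun h (Sum.inl i)) (Sum.inr j)
    rw [J_eq_diagonal, Matrix.diagonal_mul, Matrix.mul_diagonal] at h2
    simp only [sgn, Sum.elim_inl, Sum.elim_inr] at h2
    change A t (Sum.inl i) (Sum.inr j) = 0
    rw [hA]
    linear_combination h2 / 2
  have hd : ∀ t, HasDerivAt (fun t => (flow A t y).toBlocks₁₁.det)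
      (q t * (flow A t y).toBlocks₁₁.det) t := fun t => by
    have h1 := hasDerivAt_flow (continuous_diagCoef hu N s) t y
    have h2 := hasDerivAt_det (A := fun t => (flow A t y).toBlocks₁₁)
      (A' := (A t * flow A t y).toBlocks₁₁) (x := t)
      fun i j => hasDerivAt_matrix.1 h1 (Sum.inl i) (Sum.inl j)
    convert! h2 using 1
    have h3 : (A t * flow A t y).toBlocks₁₁ = (A t).toBlocks₁₁ * (flow A t y).toBlocks₁₁ := by
      have e := congrArg Matrix.toBlocks₁₁ (Matrix.fromBlocks_multiply (A t).toBlocks₁₁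
        (A t).toBlocks₁₂ (A t).toBlocks₂₁ (A t).toBlocks₂₂ (flow A t y).toBlocks₁₁
        (flow A t y).toBlocks₁₂ (flow A t y).toBlocks₂₁ (flow A t y).toBlocks₂₂)
      rw [Matrix.fromBlocks_toBlocks, Matrix.fromBlocks_toBlocks, Matrix.toBlocks_fromBlocks₁₁,
        h12, zero_mul, add_zero] at e
      exact e
    rw [h3, Matrix.trace_mul_comm, mul_assoc, Matrix.mul_adjugate, mul_smul_comm, mul_one,
      Matrix.trace_smul, smul_eq_mul, mul_comm, hA, trace_diagCoef_toBlocks]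
  have hi : ∀ t, HasDerivAt (fun t => ∫ w in y..t, q w) (q t) t := fun t =>
    intervalIntegral.integral_hasDerivAt_right (hqc.intervalIntegrable _ _)
      (hqc.stronglyMeasurableAtFilter _ _) hqc.continuousAt
  have hconst : ∀ t, HasDerivAt (fun t => (flow A t y).toBlocks₁₁.det *
      Complex.exp (-∫ w in y..t, q w)) 0 t := fun t => by
    convert! (hd t).mul (hi t).neg.cexp using 1
    ring
  have h := is_const_of_deriv_eq_zero (fun t => (hconst t).differentiableAt)
    (fun t => (hconst t).deriv) x y
  have h11 : (1 : Mat r).toBlocks₁₁ = 1 := by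
    ext i j; simp [Matrix.toBlocks₁₁, Matrix.one_apply]
  simp only [flow_self, intervalIntegral.integral_same, neg_zero, Complex.exp_zero, mul_one, h11,
    Matrix.det_one] at h
  have h2 : ∫ w in y..x, q w =
      ∑ k ∈ Finset.range (N + 1), s ^ k * ∫ t in y..x, jetEval u t (rhoPoly r k) := by
    have hk : ∀ k ∈ Finset.range (N + 1), IntervalIntegrable
        (fun t => s ^ k * jetEval u t (rhoPoly r k)) volume y x := fun k _ =>
      (continuous_const.mul (continuous_jetEval hu _)).intervalIntegrable _ _
    rw [hq]
    simp only
    rw [intervalIntegral.integral_finsetSum hk]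
    exact Finset.sum_congr rfl fun k _ => intervalIntegral.integral_const_mul _ _
  rw [← h2]
  rw [Complex.exp_neg, mul_inv_eq_one₀ (Complex.exp_ne_zero _)] at h
  exact h

end Comparison
end DIII
end

noncomputable section
set_option linter.unusedSectionVars false
namespace DIII
open MeasureTheory Asymptotics Filter
open scoped Matrix.Norms.Operator

/-! ### The logarithm of a truncated determinant -/

section PowerSeriesLog

variable {n : Type*} [Fintype n] [DecidableEq n]

/-- The determinant of `1 + ∑ W_k s^k` as a power series. -/
def seriesDet (W : ℕ → Matrix n n ℂ) : PowerSeries ℂ :=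
  (1 + Matrix.of fun a b => PowerSeries.mk fun k => W k a b).det

/-- The determinant of the truncation of `1 + ∑ W_k s^k` as a polynomial. -/
def truncDet (W : ℕ → Matrix n n ℂ) (N : ℕ) : Polynomial ℂ :=
  (1 + ∑ k ∈ Finset.range (N + 1), (Polynomial.X ^ k : Polynomial ℂ) • (W k).map Polynomial.C).det

lemma eval_truncDet (W : ℕ → Matrix n n ℂ) (N : ℕ) (s : ℂ) :
    (truncDet W N).eval s = (1 + ∑ k ∈ Finset.range (N + 1), s ^ k • W k).det := by
  rw [truncDet, ← Polynomial.coe_evalRingHom, RingHom.map_det]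
  congr 1
  rw [map_add, map_one, map_sum]
  congr 1
  refine Finset.sum_congr rfl fun k _ => ?_
  ext a b
  simp only [RingHom.mapMatrix_apply, Matrix.map_apply, Matrix.smul_apply, smul_eq_mul,
    Polynomial.eval_mul, Polynomial.coe_evalRingHom, Polynomial.eval_pow, Polynomial.eval_X, Polynomial.eval_C]

/-- The determinant is a polynomial in the entries and commutes with reduction modulo X^{N+1}, where
the truncated matrix and the full one coincide. -/
lemma coeff_truncDet (W : ℕ → Matrix n n ℂ) (N : ℕ) {k : ℕ} (hk : k ≤ N) :
    (truncDet W N).coeff k = PowerSeries.coeff k (seriesDet W) := by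
  have h : (Ideal.Quotient.mk (Ideal.span {(PowerSeries.X : PowerSeries ℂ) ^ (N + 1)}))
      (Polynomial.coeToPowerSeries.ringHom (truncDet W N)) =
      (Ideal.Quotient.mk (Ideal.span {(PowerSeries.X : PowerSeries ℂ) ^ (N + 1)})) (seriesDet W) := by
    rw [truncDet, seriesDet, RingHom.map_det, RingHom.map_det, RingHom.map_det]
    congr 1
    ext a b
    rw [RingHom.mapMatrix_apply, RingHom.mapMatrix_apply, RingHom.mapMatrix_apply, Matrix.map_apply,
      Matrix.map_apply, Matrix.map_apply, Ideal.Quotient.eq, Ideal.mem_span_singleton,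
      PowerSeries.X_pow_dvd_iff]
    intro m hm
    rw [map_sub, sub_eq_zero, Matrix.add_apply, Matrix.add_apply, map_add, map_add, map_add]
    congr 1
    · rw [Matrix.one_apply, Matrix.one_apply]
      split_ifs <;> simp
    · rw [Matrix.sum_apply]
      simp only [Polynomial.coeToPowerSeries.ringHom_apply, Polynomial.coeff_coe,
        Polynomial.finsetSum_coeff, Matrix.smul_apply, Matrix.map_apply, smul_eq_mul,
        Polynomial.coeff_mul_C, Polynomial.coeff_X_pow, Matrix.of_apply, PowerSeries.coeff_mk]
      rw [Finset.sum_eq_single_of_mem m (Finset.mem_range.2 hm)]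
      · simp
      · intro j _ hj
        simp [hj.symm]
  rw [Ideal.Quotient.eq, Ideal.mem_span_singleton, PowerSeries.X_pow_dvd_iff] at h
  have := h k (by omega)
  rw [map_sub, sub_eq_zero] at this
  simpa using this

/-- The polynomial of the first coefficients of `-ln Δ`. -/
def truncLog (Δ : PowerSeries ℂ) (N : ℕ) : Polynomial ℂ :=
  ∑ k ∈ Finset.range (N + 1), Polynomial.C (negLogCoeff Δ k) * Polynomial.X ^ k

lemma constantCoeff_seriesDet {W : ℕ → Matrix n n ℂ} (hW : W 0 = 0) :
    PowerSeries.constantCoeff (seriesDet W) = 1 := by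
  rw [seriesDet, RingHom.map_det]
  have : (PowerSeries.constantCoeff (R := ℂ)).mapMatrix
      (1 + Matrix.of fun a b => PowerSeries.mk fun k => W k a b) = 1 := by
    ext a b
    by_cases h : a = b <;> simp [hW, Matrix.one_apply, h]
  rw [this, Matrix.det_one]

/-- With p the truncated determinant and b the truncation of -ln Δ, both p'/p and -b' agree with
Δ'/Δ through order N-1, so p' + p b' has no lower terms. -/
lemma X_pow_dvd_derivative_truncDet {W : ℕ → Matrix n n ℂ} (hW : W 0 = 0) (N : ℕ) :
    (Polynomial.X : Polynomial ℂ) ^ N ∣ Polynomial.derivative (truncDet W N) +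
      truncDet W N * Polynomial.derivative (truncLog (seriesDet W) N) := by
  set Δ := seriesDet W with hΔ
  rw [Polynomial.X_pow_dvd_iff]
  intro j hj
  have h1 : ∀ i < N, (Polynomial.derivative (truncLog Δ N)).coeff i =
      -PowerSeries.coeff i (PowerSeries.derivative ℂ Δ * PowerSeries.invOfUnit Δ 1) := by
    intro i hi
    rw [Polynomial.coeff_derivative, truncLog, Polynomial.finsetSum_coeff,
      Finset.sum_eq_single_of_mem (i + 1) (Finset.mem_range.2 (by omega))]
    · rw [Polynomial.coeff_C_mul, Polynomial.coeff_X_pow, if_pos rfl, mul_one, negLogCoeff,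
        Nat.add_sub_cancel, smul_eq_mul]
      have : ((i : ℂ) + 1) ≠ 0 := by exact_mod_cast Nat.succ_ne_zero i
      push_cast
      field_simp
    · intro k _ hk
      rw [Polynomial.coeff_C_mul, Polynomial.coeff_X_pow, if_neg hk.symm, mul_zero]
  have h2 : Δ * (PowerSeries.derivative ℂ Δ * PowerSeries.invOfUnit Δ 1) =
      PowerSeries.derivative ℂ Δ := by
    rw [mul_left_comm, PowerSeries.mul_invOfUnit Δ 1 (constantCoeff_seriesDet hW), mul_one]
  rw [Polynomial.coeff_add, Polynomial.coeff_derivative, coeff_truncDet W N (by omega),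
    Polynomial.coeff_mul, ← PowerSeries.coeff_derivative, ← h2, PowerSeries.coeff_mul,
    ← Finset.sum_add_distrib]
  refine Finset.sum_eq_zero fun q hq => ?_
  have := Finset.HasAntidiagonal.mem_antidiagonal.1 hq
  rw [coeff_truncDet W N (by omega), h1 _ (by omega)]
  ring

/-- The function p e^b equals 1 at the origin and has derivative divisible by s^N, so the mean value
inequality on the disc of radius ‖s‖ applies. -/
lemma exists_norm_truncDet_mul_exp_sub_le {W : ℕ → Matrix n n ℂ} (hW : W 0 = 0) (N : ℕ) :
    ∃ C, ∀ s : ℂ, ‖s‖ ≤ 1 →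
      ‖(truncDet W N).eval s * Complex.exp ((truncLog (seriesDet W) N).eval s) - 1‖ ≤
        C * ‖s‖ ^ N := by
  obtain ⟨h, hh⟩ := X_pow_dvd_derivative_truncDet hW N
  set p := truncDet W N with hp
  set b := truncLog (seriesDet W) N with hb
  have hc : Continuous fun s : ℂ => h.eval s * Complex.exp (b.eval s) := by fun_prop
  obtain ⟨C, hC⟩ := (isCompact_closedBall (0 : ℂ) 1).exists_bound_of_continuousOn hc.continuousOn
  have hC0 : 0 ≤ C := (norm_nonneg _).trans (hC 0 (by simp))
  refine ⟨C, fun s hs => ?_⟩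
  have hd : ∀ w : ℂ, HasDerivAt (fun w => p.eval w * Complex.exp (b.eval w))
      (w ^ N * (h.eval w * Complex.exp (b.eval w))) w := fun w => by
    convert! (p.hasDerivAt w).mul (b.hasDerivAt w).cexp using 1
    have := congrArg (Polynomial.eval w) hh
    simp only [Polynomial.eval_add, Polynomial.eval_mul, Polynomial.eval_pow, Polynomial.eval_X]
      at this
    linear_combination (-Complex.exp (b.eval w)) * this
  have hmv := (convex_closedBall (0 : ℂ) ‖s‖).norm_image_sub_le_of_norm_hasDerivWithin_le
    (C := C * ‖s‖ ^ N) (fun w _ => (hd w).hasDerivWithinAt) (fun w hw => by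
      have hw' : ‖w‖ ≤ ‖s‖ := by simpa using hw
      rw [norm_mul, norm_pow, mul_comm]
      exact mul_le_mul (hC w (by simpa using hw'.trans hs)) (pow_le_pow_left₀ (norm_nonneg _) hw' N)
        (by positivity) hC0) (x := 0) (y := s) (by simp) (by simp)
  have h0 : p.eval 0 * Complex.exp (b.eval 0) = 1 := by
    have e1 : p.eval 0 = 1 := by
      rw [← Polynomial.coeff_zero_eq_eval_zero, hp, coeff_truncDet W N (Nat.zero_le _)]
      simpa using constantCoeff_seriesDet hW
    have e2 : b.eval 0 = 0 := by
      rw [← Polynomial.coeff_zero_eq_eval_zero, hb, truncLog, Polynomial.finsetSum_coeff]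
      refine Finset.sum_eq_zero fun k _ => ?_
      rcases k with _ | k
      · simp [negLogCoeff]
      · simp
    rw [e1, e2]; simp
  rw [h0, sub_zero] at hmv
  refine hmv.trans ?_
  -- The mean value inequality gives order N+1; order N is enough and ‖s‖ ≤ 1 drops the extra
  -- factor.
  exact mul_le_of_le_one_right (by positivity) hs

end PowerSeriesLog

/-! ### Asymptotic expansions -/

section Asymptotic

variable {l : Filter ℂ}

lemma isBigO_prod_sub_prod {ι : Type*} (t : Finset ι) {f g : ι → ℂ → ℂ} {h : ℂ → ℂ}
    (hf : ∀ i, f i =O[l] fun _ => (1 : ℂ)) (hg : ∀ i, g i =O[l] fun _ => (1 : ℂ))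
    (hfg : ∀ i, (fun z => f i z - g i z) =O[l] h) :
    (fun z => ∏ i ∈ t, f i z - ∏ i ∈ t, g i z) =O[l] h := by
  classical
  induction t using Finset.induction_on with
  | empty => simp [isBigO_zero]
  | insert i t hi ih =>
    have hg' : (fun z => ∏ i ∈ t, g i z) =O[l] fun _ => (1 : ℂ) := by
      have := IsBigO.finsetProd (s := t) (f := g) (g := fun _ _ => (1 : ℂ)) fun i _ => hg i
      simpa using this
    have h0 := (hf i).mul ih
    have h1 := (hfg i).mul hg'
    simp only [one_mul, mul_one] at h0 h1
    replace h1 := h0.add h1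
    refine h1.congr_left fun z => ?_
    rw [Finset.prod_insert hi, Finset.prod_insert hi]
    ring

lemma isBigO_det_sub_det {n : Type*} [Fintype n] [DecidableEq n] {A B : ℂ → Matrix n n ℂ} {h : ℂ → ℂ}
    (hA : ∀ a b, (fun z => A z a b) =O[l] fun _ => (1 : ℂ))
    (hB : ∀ a b, (fun z => B z a b) =O[l] fun _ => (1 : ℂ))
    (hAB : ∀ a b, (fun z => A z a b - B z a b) =O[l] h) :
    (fun z => (A z).det - (B z).det) =O[l] h := by
  simp only [Matrix.det_apply, ← Finset.sum_sub_distrib, ← smul_sub]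
  refine IsBigO.fun_sum fun σ _ => ?_
  have := isBigO_prod_sub_prod Finset.univ (f := fun i z => A z (σ i) i)
    (g := fun i z => B z (σ i) i) (fun i => hA _ _) (fun i => hB _ _) fun i => hAB _ _
  rcases Int.units_eq_one_or (Equiv.Perm.sign σ) with h | h <;> rw [h]
  · simpa using this
  · simpa using this.neg_left

/-- The branch of the logarithm is not an issue: f = e^{log w + q} with log w and q tending to 0, so
the imaginary part eventually lies in (-π, π] and log f is exactly log w + q. -/
lemma isBigO_log_sub {f q g : ℂ → ℂ} (hq : Tendsto q l (𝓝 0)) (hg : Tendsto g l (𝓝 0))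
    (h : (fun z => f z * Complex.exp (-q z) - 1) =O[l] g) :
    (fun z => Complex.log (f z) - q z) =O[l] g := by
  set w : ℂ → ℂ := fun z => f z * Complex.exp (-q z) with hw
  have hw1 : Tendsto w l (𝓝 1) := by
    have := (h.trans_tendsto hg).add_const 1
    simpa using this
  have hlog : Tendsto (fun z => Complex.log (w z)) l (𝓝 0) := by
    have := (continuousAt_clog (x := 1) Complex.one_mem_slitPlane).tendsto.comp hw1
    simpa [Complex.log_one, Function.comp_def] using this
  have hO : (fun z => Complex.log (w z)) =O[l] fun z => w z - 1 := by
    have := (Complex.hasDerivAt_log Complex.one_mem_slitPlane).isBigO_sub.comp_tendsto hw1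
    simpa [Function.comp_def, Complex.log_one] using this
  have him : Tendsto (fun z => (Complex.log (w z) + q z).im) l (𝓝 0) := by
    have := (Complex.continuous_im.tendsto _).comp (hlog.add hq)
    simpa [Function.comp_def] using this
  refine IsBigO.congr' (hO.trans h) ?_ EventuallyEq.rfl
  filter_upwards [him.eventually (Ioo_mem_nhds (neg_lt_zero.2 Real.pi_pos) Real.pi_pos),
    hw1.eventually_ne one_ne_zero] with z hz hz0
  have : f z = Complex.exp (Complex.log (w z) + q z) := by
    rw [Complex.exp_add, Complex.exp_log hz0, hw]
    simp only
    rw [mul_assoc, ← Complex.exp_add, neg_add_cancel, Complex.exp_zero, mul_one]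
  rw [this, Complex.log_exp hz.1 hz.2.le]
  ring

lemma tendsto_inv_of_le_cobounded (hl : l ≤ Bornology.cobounded ℂ) :
    Tendsto (fun z : ℂ => z⁻¹) l (𝓝 0) := (tendsto_inv₀_cobounded (α := ℂ)).mono_left hl

variable {r : ℕ}

lemma tendsto_gaugeSum (hl : l ≤ Bornology.cobounded ℂ) (u : Potential r) (N : ℕ) (x : ℝ) :
    Tendsto (fun z => 1 + gaugeSum u N z⁻¹ x) l (𝓝 1) := by
  have h : ∀ k ∈ Finset.range (N + 1), Tendsto (fun z : ℂ => z⁻¹ ^ k • gaugeW u k x) l (𝓝 0) := by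
    intro k _
    rcases k with _ | k
    · simp [gaugeW_zero, tendsto_const_nhds]
    · have h1 := ((tendsto_inv_of_le_cobounded hl).pow (k + 1)).smul_const (gaugeW u (k + 1) x)
      simpa using h1
  have h2 := (tendsto_finsetSum _ h).const_add (1 : Mat r)
  simpa [gaugeSum] using h2

lemma tendsto_inv_matrix {n : Type*} [Fintype n] [DecidableEq n] {G : ℂ → Matrix n n ℂ}
    (h : Tendsto G l (𝓝 1)) : Tendsto (fun z => (G z).det) l (𝓝 1) ∧
      Tendsto (fun z => (G z)⁻¹) l (𝓝 1) := by
  have h1 : Tendsto (fun z => (G z).det) l (𝓝 1) := by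
    have := ((continuous_id.matrix_det (n := n) (R := ℂ)).tendsto 1).comp h
    simpa [Function.comp_def] using this
  refine ⟨h1, ?_⟩
  have h2 : Tendsto (fun z => (G z).adjugate) l (𝓝 1) := by
    have := ((continuous_id.matrix_adjugate (n := n) (R := ℂ)).tendsto 1).comp h
    simpa [Function.comp_def] using this
  have h3 := (h1.inv₀ one_ne_zero).smul h2
  simpa [Matrix.inv_def] using h3

/-- The transition matrix in terms of the gauge. -/
lemma isBigO_scaledFlow_sub {ν : Measure ℝ} {u : Potential r} (hu : IsTame ν u) {N : ℕ}
    (hN : 1 ≤ N) {x y : ℝ} (hxy : ∀ k, gaugeW u k x = gaugeW u k y)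
    (hl : l ≤ Bornology.cobounded ℂ) {c : ℝ} (hc : 0 < c)
    (him : ∀ᶠ z in l, c * ‖z‖ ≤ z.im * (x - y)) :
    (fun z => scaledFlow u z x y - (1 + gaugeSum u N z⁻¹ x) *
      (upProj r * flow (diagCoef u N z⁻¹) x y) * (1 + gaugeSum u N z⁻¹ x)⁻¹) =O[l]
      fun z => z⁻¹ ^ N := by
  obtain ⟨C, hC⟩ := hu.exists_norm_gauge_diagFlow_sub_le hN x y
  obtain ⟨D, hD0, hD⟩ := hu.exists_norm_flow_diagCoef_le N x y
  have hnorm : Tendsto (fun z : ℂ => ‖z‖) l atTop := tendsto_norm_cobounded_atTop.mono_left hl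
  have hG := tendsto_gaugeSum hl u N x
  obtain ⟨hdet, hinv⟩ := tendsto_inv_matrix hG
  set G : ℂ → Mat r := fun z => 1 + gaugeSum u N z⁻¹ x with hGdef
  -- Periodicity enters here: the gauge is the same at both ends, so the transition matrix is a
  -- conjugation by a single G.
  have hGy : ∀ z, 1 + gaugeSum u N z⁻¹ y = G z := fun z => by
    simp only [hGdef, gaugeSum, hxy]
  have h1 : (fun z => G z * diagFlow u N z x y - scaledFlow u z x y * G z) =O[l]
      fun z => z⁻¹ ^ N := by
    refine IsBigO.of_bound C ?_
    filter_upwards [hnorm.eventually_ge_atTop 1, him] with z hz hz2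
    have := hC z hz ((by positivity : (0 : ℝ) ≤ c * ‖z‖).trans hz2)
    rw [hGy] at this
    rwa [norm_pow, norm_inv]
  -- In the sector Im z · (x-y) ≥ c|z|, so the lower block is exponentially small against every
  -- power of 1/z.
  have h2 : (fun z : ℂ => Complex.exp (2 * Complex.I * z * (x - y))) =O[l] fun z => z⁻¹ ^ N := by
    have h3 : Tendsto (fun z : ℂ => ‖z‖ ^ N * Real.exp (-(2 * c * ‖z‖))) l (𝓝 0) := by
      have h5 : Tendsto (fun z : ℂ => 2 * c * ‖z‖) l atTop :=
        hnorm.const_mul_atTop (by positivity)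
      have h4 := ((Real.tendsto_pow_mul_exp_neg_atTop_nhds_zero N).comp h5).const_mul
        ((2 * c) ^ N)⁻¹
      rw [mul_zero] at h4
      refine h4.congr fun z => ?_
      simp only [Function.comp_apply, mul_pow]
      field_simp
    refine IsBigO.of_bound 1 ?_
    filter_upwards [h3.eventually (gt_mem_nhds one_pos), him, hnorm.eventually_ge_atTop 1]
      with z hz hz2 hz1
    have hz0 : 0 < ‖z‖ := by linarith
    rw [Complex.norm_exp, one_mul, norm_pow, norm_inv, inv_pow, ← one_div, le_div_iff₀ (by positivity)]
    have e1 : (2 * Complex.I * z * (x - y)).re = -(2 * (z.im * (x - y))) := by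
      simp; ring
    rw [e1, mul_comm]
    refine le_trans (mul_le_mul_of_nonneg_left (Real.exp_le_exp.2 ?_) (by positivity)) hz.le
    linarith
  have h4 : (fun z => flow (diagCoef u N z⁻¹) x y) =O[l] fun _ => (1 : ℂ) := by
    refine IsBigO.of_bound D ?_
    filter_upwards [hnorm.eventually_ge_atTop 1] with z hz
    rw [norm_one, mul_one]
    exact hD z⁻¹ (by rw [norm_inv]; exact inv_le_one_of_one_le₀ hz) x Set.right_mem_uIcc
  have hG1 : G =O[l] fun _ => (1 : ℂ) := hG.isBigO_one ℂ
  have h5 : (fun z => G z * ((1 - upProj r) * flow (diagCoef u N z⁻¹) x y)) =O[l]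
      fun _ => (1 : ℂ) := by
    have := hG1.mul ((isBigO_const_const (1 - upProj r) one_ne_zero l).mul h4)
    simpa using this
  have h6 : (fun z => G z * diagFlow u N z x y -
      G z * (upProj r * flow (diagCoef u N z⁻¹) x y)) =O[l] fun z => z⁻¹ ^ N := by
    have := h2.smul h5
    simp only [smul_eq_mul, mul_one] at this
    refine this.congr_left fun z => ?_
    rw [diagFlow, add_mul (upProj r), mul_add (G z), add_sub_cancel_left, smul_mul_assoc,
      mul_smul_comm]
  have h7 := ((h6.sub h1).mul (hinv.isBigO_one ℂ))
  simp only [mul_one] at h7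
  refine h7.congr' ?_ EventuallyEq.rfl
  filter_upwards [hdet.eventually_ne one_ne_zero] with z hz
  have hGG : G z * (G z)⁻¹ = 1 := Matrix.mul_nonsing_inv _ (isUnit_iff_ne_zero.2 hz)
  rw [sub_sub_sub_cancel_left, sub_mul, mul_assoc (scaledFlow u z x y), hGG, mul_one]

lemma toBlocks_mul {A B : Mat r} : (A * B).toBlocks₁₁ =
    A.toBlocks₁₁ * B.toBlocks₁₁ + A.toBlocks₁₂ * B.toBlocks₂₁ := by
  have e := congrArg Matrix.toBlocks₁₁ (Matrix.fromBlocks_multiply A.toBlocks₁₁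
    A.toBlocks₁₂ A.toBlocks₂₁ A.toBlocks₂₂ B.toBlocks₁₁ B.toBlocks₁₂ B.toBlocks₂₁ B.toBlocks₂₂)
  rwa [Matrix.fromBlocks_toBlocks, Matrix.fromBlocks_toBlocks, Matrix.toBlocks_fromBlocks₁₁] at e

lemma toBlocks_of_J_comm {A : Mat r} (h : J r * A = A * J r) : A.toBlocks₁₂ = 0 := by
  ext i j
  have h2 := congrFun (congrFun h (Sum.inl i)) (Sum.inr j)
  rw [J_eq_diagonal, Matrix.diagonal_mul, Matrix.mul_diagonal] at h2
  simp only [sgn, Sum.elim_inl, Sum.elim_inr] at h2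
  change A (Sum.inl i) (Sum.inr j) = 0
  linear_combination h2 / 2

lemma toBlocks_of_J_anticomm {A : Mat r} (h : J r * A = -(A * J r)) :
    A.toBlocks₁₁ = 0 ∧ A.toBlocks₂₂ = 0 := by
  constructor
  · ext i j
    have h2 := congrFun (congrFun h (Sum.inl i)) (Sum.inl j)
    rw [J_eq_diagonal, Matrix.neg_apply, Matrix.diagonal_mul, Matrix.mul_diagonal] at h2
    simp only [sgn, Sum.elim_inl] at h2
    change A (Sum.inl i) (Sum.inl j) = 0
    linear_combination h2 / 2
  · ext i j
    have h2 := congrFun (congrFun h (Sum.inr i)) (Sum.inr j)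
    rw [J_eq_diagonal, Matrix.neg_apply, Matrix.diagonal_mul, Matrix.mul_diagonal] at h2
    simp only [sgn, Sum.elim_inr] at h2
    change A (Sum.inr i) (Sum.inr j) = 0
    linear_combination -h2 / 2

/-- The projector leaves V_{11} (G⁻¹)_{11}, and by Jacobi's complementary minor formula det
(G⁻¹)_{11} = det G_{22} / det G with G_{22} = 1. The factor 1 / det G is the source of the end-point
terms. -/
lemma det_toBlocks_gauge {W v : Mat r} (hW : J r * W = -(W * J r)) (hv : J r * v = v * J r)
    (hdet : (1 + W).det ≠ 0) : ((1 + W) * (upProj r * v) * (1 + W)⁻¹).toBlocks₁₁.det =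
      v.toBlocks₁₁.det * ((1 + W).det)⁻¹ := by
  set G := 1 + W with hG
  have hGG : G * G⁻¹ = 1 := Matrix.mul_nonsing_inv _ (isUnit_iff_ne_zero.2 hdet)
  have h1 : (1 : Mat r).toBlocks₁₁ = 1 ∧ (1 : Mat r).toBlocks₂₂ = 1 ∧ (1 : Mat r).toBlocks₁₂ = 0 ∧
      (1 : Mat r).toBlocks₂₁ = 0 := by
    rw [← Matrix.fromBlocks_one]
    exact ⟨rfl, rfl, rfl, rfl⟩
  have hadd : ∀ A B : Mat r, (A + B).toBlocks₁₁ = A.toBlocks₁₁ + B.toBlocks₁₁ ∧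
      (A + B).toBlocks₂₂ = A.toBlocks₂₂ + B.toBlocks₂₂ := fun A B => ⟨rfl, rfl⟩
  have hG11 : G.toBlocks₁₁ = 1 := by
    rw [hG, (hadd _ _).1, h1.1, (toBlocks_of_J_anticomm hW).1, add_zero]
  have hG22 : G.toBlocks₂₂ = 1 := by
    rw [hG, (hadd _ _).2, h1.2.1, (toBlocks_of_J_anticomm hW).2, add_zero]
  have hup : upProj r = Matrix.fromBlocks 1 0 0 0 := by
    rw [upProj]
    ext a b
    rcases a with a | a <;> rcases b with b | b <;> simp [Matrix.diagonal_apply, Matrix.one_apply]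
  have hcomm : upProj r * v = v * upProj r := by
    rw [upProj_eq, smul_mul_assoc, mul_smul_comm, add_mul, mul_add, hv, one_mul, mul_one]
  have hu1 : (upProj r).toBlocks₁₁ = 1 ∧ (upProj r).toBlocks₁₂ = 0 ∧ (upProj r).toBlocks₂₁ = 0 := by
    rw [hup]; exact ⟨rfl, rfl, rfl⟩
  have hv12 := toBlocks_of_J_comm hv
  have e1 : (G * (upProj r * v) * G⁻¹).toBlocks₁₁ = v.toBlocks₁₁ * (G⁻¹).toBlocks₁₁ := by
    have e2 : G * (upProj r * v) * G⁻¹ = (G * upProj r) * (v * G⁻¹) := by simp only [mul_assoc]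
    have e3 : (G * upProj r).toBlocks₁₁ = 1 := by
      rw [toBlocks_mul, hG11, hu1.1, hu1.2.2, mul_zero, add_zero, mul_one]
    have e4 : (G * upProj r).toBlocks₁₂ = 0 := by
      ext i j
      change (G * upProj r) (Sum.inl i) (Sum.inr j) = 0
      rw [upProj, Matrix.mul_diagonal]
      simp
    rw [e2, toBlocks_mul, e3, e4, zero_mul, add_zero, one_mul, toBlocks_mul, hv12, zero_mul,
      add_zero]
  -- The first block column of G⁻¹, completed by the second column of the identity, is mapped by G
  -- to a unipotent triangular matrix.
  have e2 : G * Matrix.fromBlocks (G⁻¹).toBlocks₁₁ 0 (G⁻¹).toBlocks₂₁ 1 =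
      Matrix.fromBlocks 1 G.toBlocks₁₂ 0 1 := by
    have h5 : Matrix.fromBlocks G.toBlocks₁₁ G.toBlocks₁₂ G.toBlocks₂₁ G.toBlocks₂₂ *
        Matrix.fromBlocks (G⁻¹).toBlocks₁₁ (G⁻¹).toBlocks₁₂ (G⁻¹).toBlocks₂₁ (G⁻¹).toBlocks₂₂ =
        Matrix.fromBlocks 1 0 0 1 := by
      rw [Matrix.fromBlocks_toBlocks, Matrix.fromBlocks_toBlocks, hGG, Matrix.fromBlocks_one]
    rw [Matrix.fromBlocks_multiply, Matrix.fromBlocks_inj] at h5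
    rw [show G * Matrix.fromBlocks (G⁻¹).toBlocks₁₁ 0 (G⁻¹).toBlocks₂₁ 1 =
      Matrix.fromBlocks G.toBlocks₁₁ G.toBlocks₁₂ G.toBlocks₂₁ G.toBlocks₂₂ *
        Matrix.fromBlocks (G⁻¹).toBlocks₁₁ 0 (G⁻¹).toBlocks₂₁ 1 by rw [Matrix.fromBlocks_toBlocks]]
    rw [Matrix.fromBlocks_multiply, h5.1, h5.2.2.1, hG22]
    simp
  have e3 := congrArg Matrix.det e2
  rw [Matrix.det_mul, Matrix.det_fromBlocks_zero₁₂, Matrix.det_fromBlocks_zero₂₁, Matrix.det_one,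
    mul_one, mul_one] at e3
  rw [e1, Matrix.det_mul, eq_inv_of_mul_eq_one_right e3]

end Asymptotic
end DIII
end

/-! ### Expansions of the logarithms of the block determinants -/

noncomputable section
set_option linter.unusedSectionVars false
namespace DIII
open MeasureTheory Asymptotics Filter
open scoped Matrix.Norms.Operator

variable {r : ℕ} {l : Filter ℂ}

lemma map_det_gauge_formalQ (u : Potential r) (x : ℝ) :
    PowerSeries.map (jetEval u x : DiffPoly r →+* ℂ) (gauge (totalD (Coord r)) (formalQ r)).det =
      seriesDet fun k => gaugeW u k x := by
  rw [RingHom.map_det, seriesDet, gauge, map_add, map_one]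
  congr 2

lemma jetEval_betaPoly (u : Potential r) (x : ℝ) (k : ℕ) :
    jetEval u x (betaPoly r k) = negLogCoeff (seriesDet fun k => gaugeW u k x) k := by
  rw [betaPoly, map_negLogCoeff _ (constantCoeff_det_gauge _ _), map_det_gauge_formalQ]

lemma inv_flow {A : ℝ → Mat r} (hA : Continuous A) (x y : ℝ) : (flow A x y)⁻¹ = flow A y x :=
  Matrix.inv_eq_right_inv (flow_mul_flow_self hA x y)

/-- The conjugated form of the transition matrix splits its determinant into the exponential of the
integrated densities and 1 / det G; the latter is expanded through the truncated power series of -ln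
det G. -/
lemma isBigO_log_det_scaledFlow {ν : Measure ℝ} {u : Potential r} (hu : IsTame ν u) {N : ℕ}
    (hN : 1 ≤ N) {x y : ℝ} (hxy : ∀ k, gaugeW u k x = gaugeW u k y)
    (hl : l ≤ Bornology.cobounded ℂ) {c : ℝ} (hc : 0 < c)
    (him : ∀ᶠ z in l, c * ‖z‖ ≤ z.im * (x - y)) (h0 : ∀ t, jetEval u t (rhoPoly r 0) = 0) :
    (fun z => Complex.log (scaledFlow u z x y).toBlocks₁₁.det - ∑ k ∈ Finset.range (N + 1),
      z⁻¹ ^ k * ((∫ t in y..x, jetEval u t (rhoPoly r k)) + jetEval u x (betaPoly r k))) =O[l]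
      fun z => z⁻¹ ^ N := by
  have hz := tendsto_inv_of_le_cobounded hl
  have hnorm : Tendsto (fun z : ℂ => ‖z‖) l atTop := tendsto_norm_cobounded_atTop.mono_left hl
  set G : ℂ → Mat r := fun z => 1 + gaugeSum u N z⁻¹ x with hG
  have hGt := tendsto_gaugeSum hl u N x
  obtain ⟨hdet, hinv⟩ := tendsto_inv_matrix hGt
  set V : ℂ → Mat r := fun z => flow (diagCoef u N z⁻¹) x y with hV
  set A : ℕ → ℂ := fun k => ∫ t in y..x, jetEval u t (rhoPoly r k) with hA
  set B : ℕ → ℂ := fun k => jetEval u x (betaPoly r k) with hB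
  have hzN : (fun z : ℂ => z⁻¹ ^ N) =O[l] fun _ => (1 : ℂ) := by
    simpa using (hz.isBigO_one ℂ).pow N
  have hAB : ∀ (F : ℕ → ℂ), F 0 = 0 →
      Tendsto (fun z : ℂ => ∑ k ∈ Finset.range (N + 1), z⁻¹ ^ k * F k) l (𝓝 0) := by
    intro F hF
    rw [← Finset.sum_const_zero (s := Finset.range (N + 1)) (M := ℂ)]
    refine tendsto_finsetSum _ fun k _ => ?_
    rcases k with _ | k
    · simp [hF, tendsto_const_nhds]
    · simpa using (hz.pow (k + 1)).mul_const (F (k + 1))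
  have hA0 : A 0 = 0 := by simp [hA, h0]
  have hB0 : B 0 = 0 := by simp [hB, jetEval_betaPoly, negLogCoeff]
  have hqA := hAB A hA0
  have hqB := hAB B hB0
  have hVb : V =O[l] fun _ => (1 : ℂ) := by
    obtain ⟨D, hD0, hD⟩ := hu.exists_norm_flow_diagCoef_le N x y
    refine IsBigO.of_bound D ?_
    filter_upwards [hnorm.eventually_ge_atTop 1] with z hz
    rw [norm_one, mul_one]
    exact hD z⁻¹ (by rw [norm_inv]; exact inv_le_one_of_one_le₀ hz) x Set.right_mem_uIcc
  set R : ℂ → Mat r := fun z => G z * (upProj r * V z) * (G z)⁻¹ with hR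
  have hRb : R =O[l] fun _ => (1 : ℂ) := by
    have := ((hGt.isBigO_one ℂ).mul ((isBigO_const_const (upProj r) one_ne_zero l).mul hVb)).mul
      (hinv.isBigO_one ℂ)
    simpa using this
  have hSR := isBigO_scaledFlow_sub hu hN hxy hl hc him
  have hSb : (fun z => scaledFlow u z x y) =O[l] fun _ => (1 : ℂ) := by
    refine ((hSR.trans hzN).add hRb).congr_left fun z => ?_
    exact sub_add_cancel _ _
  have hentry : ∀ (M : ℂ → Mat r) (g : ℂ → ℂ), M =O[l] g → ∀ a b : Idx r,
      (fun z => M z a b) =O[l] g := fun M g h a b =>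
    (IsBigO.of_bound 1 (Eventually.of_forall fun z => by
      rw [one_mul]; exact norm_entry_le (M z) a b)).trans h
  have hdetO := isBigO_det_sub_det (A := fun z => (scaledFlow u z x y).toBlocks₁₁)
    (B := fun z => (R z).toBlocks₁₁) (h := fun z => z⁻¹ ^ N)
    (fun a b => hentry _ _ hSb _ _) (fun a b => hentry _ _ hRb _ _)
    (fun a b => hentry _ _ hSR _ _)
  obtain ⟨C, hC⟩ := exists_norm_truncDet_mul_exp_sub_le (W := fun k => gaugeW u k x)
    (gaugeW_zero u x) N
  -- Here B is the expansion of -ln det G, so p tends to 1 with error z^{-N}, and 1/p is what the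
  -- determinant of the conjugated block leaves after division by the predicted exponential.
  set p : ℂ → ℂ := fun z => (G z).det *
    Complex.exp (∑ k ∈ Finset.range (N + 1), z⁻¹ ^ k * B k) with hp
  have hpO : (fun z => p z - 1) =O[l] fun z => z⁻¹ ^ N := by
    refine IsBigO.of_bound C ?_
    filter_upwards [hnorm.eventually_ge_atTop 1] with z hz
    have := hC z⁻¹ (by rw [norm_inv]; exact inv_le_one_of_one_le₀ hz)
    rw [norm_pow]
    refine le_of_eq_of_le ?_ this
    rw [eval_truncDet, truncLog, Polynomial.eval_finsetSum]
    simp only [hp, hG, gaugeSum, hB, jetEval_betaPoly, Polynomial.eval_mul, Polynomial.eval_C,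
      Polynomial.eval_pow, Polynomial.eval_X, mul_comm (negLogCoeff _ _)]
  have hNt : Tendsto (fun z : ℂ => z⁻¹ ^ N) l (𝓝 0) := by
    have := hz.pow N
    rwa [zero_pow (by omega)] at this
  have hp1 : Tendsto p l (𝓝 1) := by
    have := (hpO.trans_tendsto hNt).add_const 1
    simpa using this
  refine isBigO_log_sub (q := fun z => ∑ k ∈ Finset.range (N + 1), z⁻¹ ^ k * (A k + B k))
    (hAB (fun k => A k + B k) (by simp [hA0, hB0])) hNt ?_
  have hqAB := hAB (fun k => A k + B k) (by simp [hA0, hB0])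
  have e1 : (fun z => Complex.exp (-∑ k ∈ Finset.range (N + 1), z⁻¹ ^ k * (A k + B k))) =O[l]
      fun _ => (1 : ℂ) := by
    have := (Complex.continuous_exp.tendsto _).comp hqAB.neg
    exact this.isBigO_one ℂ
  have e2 := hdetO.mul e1
  simp only [mul_one] at e2
  have e3 : (fun z => (p z)⁻¹ - 1) =O[l] fun z => z⁻¹ ^ N := by
    have := hpO.neg_left.mul ((hp1.inv₀ one_ne_zero).isBigO_one ℂ)
    simp only [mul_one] at this
    refine this.congr' ?_ EventuallyEq.rfl
    filter_upwards [hp1.eventually_ne one_ne_zero] with z hz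
    field_simp
    ring
  refine (e2.add e3).congr' ?_ EventuallyEq.rfl
  filter_upwards [hdet.eventually_ne one_ne_zero] with z hz
  have e4 : (R z).toBlocks₁₁.det =
      Complex.exp (∑ k ∈ Finset.range (N + 1), z⁻¹ ^ k * A k) * ((G z).det)⁻¹ := by
    have := det_toBlocks_gauge (W := gaugeSum u N z⁻¹ x) (v := V z) (J_mul_gaugeSum u N z⁻¹ x)
      (commute_flow (continuous_diagCoef hu.contDiff N z⁻¹) (J_mul_diagCoef u N z⁻¹) x y) hz
    rw [hR]
    simp only
    rw [this, hV]
    simp only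
    rw [det_flow_diagCoef hu.contDiff]
  have e5 : (p z)⁻¹ = (R z).toBlocks₁₁.det *
      Complex.exp (-∑ k ∈ Finset.range (N + 1), z⁻¹ ^ k * (A k + B k)) := by
    rw [e4]
    simp only [hp, mul_add, Finset.sum_add_distrib, neg_add, Complex.exp_add, mul_inv,
      Complex.exp_neg]
    have := Complex.exp_ne_zero (∑ k ∈ Finset.range (N + 1), z⁻¹ ^ k * A k)
    field_simp
  rw [e5]
  ring

/-- The sums up to N come with an error of the order of their own last term. Using N+1 and
discarding its last term gives the sharper remainder demanded by `HasExpansion`. -/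
lemma hasExpansion_of_isBigO {f : ℂ → ℂ} {c : ℕ → ℂ} (h0 : c 0 = 0)
    (h : ∀ N, 1 ≤ N → (fun z => f z - ∑ k ∈ Finset.range (N + 1), z⁻¹ ^ k * c k) =O[l]
      fun z => z⁻¹ ^ N) : HasExpansion l f c := by
  intro N
  have h1 := h (N + 1) (by omega)
  have h2 : (fun z : ℂ => z⁻¹ ^ (N + 1) * c (N + 1)) =O[l] fun z => z⁻¹ ^ (N + 1) := by
    simpa [mul_comm] using (isBigO_refl (fun z : ℂ => z⁻¹ ^ (N + 1)) l).const_mul_left (c (N + 1))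
  refine (h1.add h2).congr (fun z => ?_) fun z => by rw [inv_pow, one_div]
  rw [Finset.sum_range_succ, Finset.sum_range_succ', h0, Finset.range_eq_Ico,
    Finset.sum_Ico_add' (fun k => z⁻¹ ^ k * c k) 0 N 1]
  have : ∑ k ∈ Finset.Icc 1 N, c k / z ^ k = ∑ k ∈ Finset.Ico (0 + 1) (N + 1), z⁻¹ ^ k * c k := by
    refine Finset.sum_congr (by ext; simp) fun k _ => ?_
    rw [inv_pow, div_eq_mul_inv, mul_comm]
  rw [this]
  ring

lemma rhoPoly_zero (u : Potential r) (t : ℝ) : jetEval u t (rhoPoly r 0) = 0 := by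
  have := trace_diagCoef_toBlocks u 0 1 t
  simp only [zero_add, Finset.range_one, Finset.sum_singleton, pow_zero, one_mul] at this
  rw [← this, diagCoef, gaugeSum]
  simp only [zero_add, Finset.range_one, Finset.sum_singleton, gaugeW_zero, smul_zero, mul_zero]
  exact Matrix.trace_zero _ _

lemma betaPoly_zero (r : ℕ) : betaPoly r 0 = 0 := by simp [betaPoly, negLogCoeff]

section Periodic

variable {L : ℝ} {u : Potential r}

lemma gaugeW_endpoints (hu : u ∈ periodicSpace r L) (k : ℕ) :
    gaugeW u k L = gaugeW u k (-L) := by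
  ext a b
  have := (jetEval_periodic (w := u) hu.2 (riccati (totalD (Coord r)) (formalQ r) k a b)) (-L)
  rw [show -L + 2 * L = L by ring] at this
  exact this

lemma det_smul_toBlocks (c : ℂ) (M : Mat r) : (c • M).toBlocks₁₁.det = c ^ r * M.toBlocks₁₁.det := by
  have : (c • M).toBlocks₁₁ = c • M.toBlocks₁₁ := rfl
  rw [this, Matrix.det_smul, Fintype.card_fin]

lemma hasExpansion_aPlus (hL : 0 < L) (hu : u ∈ periodicSpace r L) {δ : ℝ} (hδ : 0 < δ) :
    HasExpansion (upperSector δ)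
      (fun z => Complex.log
        (Complex.exp (2 * Complex.I * r * z * L) * (aPlus (monodromy L z u)).det))
      (fun k => localIntegral (rhoPoly r k) L u + (betaPoly r k).evalAt u L) := by
  have hT := isTame_of_mem_periodicSpace hL hu
  have hl : upperSector δ ≤ Bornology.cobounded ℂ := inf_le_left
  refine hasExpansion_of_isBigO ?_ fun N hN => ?_
  · simp only [localIntegral, evalAt_eq, rhoPoly_zero, betaPoly_zero, map_zero,
      intervalIntegral.integral_zero, add_zero]
  have him : ∀ᶠ z in upperSector δ, 2 * L * δ * ‖z‖ ≤ z.im * (L - -L) := by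
    have : ∀ᶠ z in upperSector δ, z ∈ {z : ℂ | δ * ‖z‖ ≤ z.im} :=
      (inf_le_right : upperSector δ ≤ _) (mem_principal_self _)
    filter_upwards [this] with z hz
    have hz' : δ * ‖z‖ ≤ z.im := hz
    nlinarith
  refine (isBigO_log_det_scaledFlow hT hN (gaugeW_endpoints hu) hl
    (by positivity : 0 < 2 * L * δ) him (rhoPoly_zero u)).congr_left fun z => ?_
  simp only [localIntegral, evalAt_eq]
  congr 2
  rw [scaledFlow, det_smul_toBlocks, aPlus, monodromy, transition_eq_flow hu.1.continuous,
    ← Complex.exp_nat_mul]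
  congr 2
  push_cast
  ring

/-- The inverse of T_L is the propagator from L to -L. The estimate is applied with the end points
exchanged, which asks for Im z < 0; the exchange and the outer minus restore the integral but
reverse the sign of the end-point term. -/
lemma hasExpansion_cMinus (hL : 0 < L) (hu : u ∈ periodicSpace r L) {δ : ℝ} (hδ : 0 < δ) :
    HasExpansion (lowerSector δ)
      (fun z => -Complex.log
        (Complex.exp (-(2 * Complex.I * r * z * L)) * (cMinus (monodromy L z u)).det))
      (fun k => localIntegral (rhoPoly r k) L u - (betaPoly r k).evalAt u L) := by
  have hT := isTame_of_mem_periodicSpace hL hu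
  have hl : lowerSector δ ≤ Bornology.cobounded ℂ := inf_le_left
  refine hasExpansion_of_isBigO ?_ fun N hN => ?_
  · simp only [localIntegral, evalAt_eq, rhoPoly_zero, betaPoly_zero, map_zero,
      intervalIntegral.integral_zero, sub_zero]
  have him : ∀ᶠ z in lowerSector δ, 2 * L * δ * ‖z‖ ≤ z.im * (-L - L) := by
    have : ∀ᶠ z in lowerSector δ, z ∈ {z : ℂ | δ * ‖z‖ ≤ -z.im} :=
      (inf_le_right : lowerSector δ ≤ _) (mem_principal_self _)
    filter_upwards [this] with z hz
    have hz' : δ * ‖z‖ ≤ -z.im := hz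
    nlinarith
  refine (isBigO_log_det_scaledFlow hT hN (fun k => (gaugeW_endpoints hu k).symm) hl
    (by positivity : 0 < 2 * L * δ) him (rhoPoly_zero u)).neg_left.congr_left fun z => ?_
  have hper : ∀ k, jetEval u (-L) (betaPoly r k) = jetEval u L (betaPoly r k) := fun k => by
    have := (jetEval_periodic (w := u) hu.2 (betaPoly r k)) (-L)
    rw [show -L + 2 * L = L by ring] at this
    exact this.symm
  simp only [localIntegral, evalAt_eq, hper]
  rw [neg_sub', ← Finset.sum_neg_distrib]
  congr 1
  · congr 2
    rw [scaledFlow, det_smul_toBlocks, cMinus, monodromy, transition_eq_flow hu.1.continuous,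
      ← Complex.exp_nat_mul, inv_flow (continuous_coef hu.1.continuous z)]
    congr 2
    push_cast
    ring
  · refine Finset.sum_congr rfl fun k _ => ?_
    rw [intervalIntegral.integral_symm]
    ring

/-- Orthogonality of T_L makes this determinant equal to that of a⁺, so the same densities and
end-point terms serve. -/
lemma hasExpansion_cPlus (hL : 0 < L) (hu : u ∈ periodicSpace r L) {δ : ℝ} (hδ : 0 < δ) :
    HasExpansion (upperSector δ)
      (fun z => Complex.log
        (Complex.exp (2 * Complex.I * r * z * L) * (cPlus (monodromy L z u)).det))
      (fun k => localIntegral (rhoPoly r k) L u + (betaPoly r k).evalAt u L) := by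
  simp only [det_cPlus_monodromy hu.1.continuous]
  exact hasExpansion_aPlus hL hu hδ

lemma hasExpansion_aMinus (hL : 0 < L) (hu : u ∈ periodicSpace r L) {δ : ℝ} (hδ : 0 < δ) :
    HasExpansion (lowerSector δ)
      (fun z => -Complex.log
        (Complex.exp (-(2 * Complex.I * r * z * L)) * (aMinus (monodromy L z u)).det))
      (fun k => localIntegral (rhoPoly r k) L u - (betaPoly r k).evalAt u L) := by
  simp only [← det_cMinus_monodromy hu.1.continuous]
  exact hasExpansion_cMinus hL hu hδ

end Periodic
end DIII
end

noncomputable section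
set_option linter.unusedSectionVars false
namespace DIII
open MeasureTheory Filter

/-! ### Propagators on the whole line -/

section LineFlow

variable {𝔸 : Type*} [NormedRing 𝔸] [NormedAlgebra ℝ 𝔸] [CompleteSpace 𝔸] {A B : ℝ → 𝔸}

/-- The propagator from `y` to `+∞`. -/
def flowTop (A : ℝ → 𝔸) (y : ℝ) : 𝔸 := limUnder atTop fun x => flow A x y

/-- The propagator from `-∞` to `x`. -/
def flowBot (A : ℝ → 𝔸) (x : ℝ) : 𝔸 := limUnder atBot fun y => flow A x y

/-- The propagator from `-∞` to `+∞`. -/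
def flowLine (A : ℝ → 𝔸) : 𝔸 := flowTop A 0 * flowBot A 0

/-- The bound of the propagators of an integrable coefficient. -/
def flowBound (A : ℝ → 𝔸) : ℝ := ‖(1 : 𝔸)‖ * Real.exp (∫ x, ‖A x‖)

lemma flowBound_nonneg (A : ℝ → 𝔸) : 0 ≤ flowBound A := by unfold flowBound; positivity

lemma abs_intervalIntegral_le_integral {f : ℝ → ℝ} (hf : Integrable f) (h0 : ∀ x, 0 ≤ f x) (x y : ℝ) :
    |∫ s in y..x, f s| ≤ ∫ s, f s := by
  have := intervalIntegral.norm_integral_le_integral_norm_uIoc (f := f) (a := y) (b := x)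
    (μ := volume)
  refine this.trans ?_
  simp only [Real.norm_of_nonneg (h0 _)]
  exact setIntegral_le_integral hf (ae_of_all _ h0)

lemma norm_flow_le_flowBound (hA : Continuous A) (hi : Integrable A) (x y : ℝ) :
    ‖flow A x y‖ ≤ flowBound A := by
  refine (norm_flow_le hA x y).trans ?_
  unfold flowBound
  gcongr
  exact abs_intervalIntegral_le_integral hi.norm (fun _ => norm_nonneg _) x y

lemma integrable_mul_of_bounded {f g : ℝ → 𝔸} (hf : Continuous f) (hg : Continuous g)
    (hi : Integrable g) {C : ℝ} (h : ∀ x, ‖f x‖ ≤ C) :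
    Integrable (fun x => f x * g x) ∧ Integrable (fun x => g x * f x) := by
  constructor
  · refine (hi.norm.const_mul C).mono' (hf.mul hg).aestronglyMeasurable (ae_of_all _ fun x => ?_)
    exact (norm_mul_le _ _).trans (mul_le_mul_of_nonneg_right (h x) (norm_nonneg _))
  · refine (hi.norm.const_mul C).mono' (hg.mul hf).aestronglyMeasurable (ae_of_all _ fun x => ?_)
    refine (norm_mul_le _ _).trans ?_
    rw [mul_comm]
    exact mul_le_mul_of_nonneg_right (h x) (norm_nonneg _)

/-- The propagators are uniformly bounded when A is integrable, so the derivative A · flow is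
integrable and the limit exists. -/
lemma tendsto_flowTop (hA : Continuous A) (hi : Integrable A) (y : ℝ) :
    Tendsto (fun x => flow A x y) atTop (𝓝 (flowTop A y)) :=
  tendsto_limUnder_of_hasDerivAt_of_integrableOn_Ioi (a := 0) (fun x _ => hasDerivAt_flow hA x y)
    (integrable_mul_of_bounded (continuous_flow_left hA y) hA hi
      fun x => norm_flow_le_flowBound hA hi x y).2.integrableOn

lemma tendsto_flowBot (hA : Continuous A) (hi : Integrable A) (x : ℝ) :
    Tendsto (fun y => flow A x y) atBot (𝓝 (flowBot A x)) :=
  tendsto_limUnder_of_hasDerivAt_of_integrableOn_Iic (a := 0)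
    (fun y _ => hasDerivAt_flow_right hA x y)
    (integrable_mul_of_bounded (continuous_flow_right hA x) hA hi
      fun y => norm_flow_le_flowBound hA hi x y).1.neg.integrableOn

lemma flowTop_mul_flow (hA : Continuous A) (hi : Integrable A) (x y : ℝ) :
    flowTop A x * flow A x y = flowTop A y := by
  refine tendsto_nhds_unique ((tendsto_flowTop hA hi x).mul_const _) ?_
  simpa only [flow_mul_flow hA] using tendsto_flowTop hA hi y

lemma flow_mul_flowBot (hA : Continuous A) (hi : Integrable A) (x y : ℝ) :
    flow A x y * flowBot A y = flowBot A x := by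
  refine tendsto_nhds_unique ((tendsto_flowBot hA hi y).const_mul _) ?_
  simpa only [flow_mul_flow hA] using tendsto_flowBot hA hi x

lemma norm_flowTop_le (hA : Continuous A) (hi : Integrable A) (y : ℝ) :
    ‖flowTop A y‖ ≤ flowBound A :=
  le_of_tendsto (tendsto_flowTop hA hi y).norm
    (Eventually.of_forall fun x => norm_flow_le_flowBound hA hi x y)

lemma norm_flowBot_le (hA : Continuous A) (hi : Integrable A) (x : ℝ) :
    ‖flowBot A x‖ ≤ flowBound A :=
  le_of_tendsto (tendsto_flowBot hA hi x).norm
    (Eventually.of_forall fun y => norm_flow_le_flowBound hA hi x y)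

lemma hasDerivAt_flowTop (hA : Continuous A) (hi : Integrable A) (y : ℝ) :
    HasDerivAt (flowTop A) (-(flowTop A y * A y)) y := by
  have h : flowTop A = fun y => flowTop A 0 * flow A 0 y :=
    funext fun y => (flowTop_mul_flow hA hi 0 y).symm
  have := (hasDerivAt_flow_right hA 0 y).const_mul (flowTop A 0)
  rw [← h] at this
  convert! this using 1
  rw [mul_neg, ← mul_assoc, flowTop_mul_flow hA hi]

lemma hasDerivAt_flowBot (hA : Continuous A) (hi : Integrable A) (x : ℝ) :
    HasDerivAt (flowBot A) (A x * flowBot A x) x := by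
  have h : flowBot A = fun x => flow A x 0 * flowBot A 0 :=
    funext fun x => (flow_mul_flowBot hA hi x 0).symm
  have := (hasDerivAt_flow hA x 0).mul_const (flowBot A 0)
  rw [← h] at this
  convert! this using 1
  rw [mul_assoc, flow_mul_flowBot hA hi]

lemma continuous_flowTop (hA : Continuous A) (hi : Integrable A) : Continuous (flowTop A) :=
  continuous_iff_continuousAt.2 fun y => (hasDerivAt_flowTop hA hi y).continuousAt

lemma continuous_flowBot (hA : Continuous A) (hi : Integrable A) : Continuous (flowBot A) :=
  continuous_iff_continuousAt.2 fun x => (hasDerivAt_flowBot hA hi x).continuousAt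

/-- The inverse of the propagator from `0` to `+∞`. -/
lemma exists_flowTop_inv (hA : Continuous A) (hi : Integrable A) :
    ∃ M, Tendsto (fun y => flow A 0 y) atTop (𝓝 M) ∧ flowTop A 0 * M = 1 ∧ M * flowTop A 0 = 1 := by
  have h := tendsto_limUnder_of_hasDerivAt_of_integrableOn_Ioi (a := 0)
    (fun y _ => hasDerivAt_flow_right hA 0 y)
    (integrable_mul_of_bounded (continuous_flow_right hA 0) hA hi
      fun y => norm_flow_le_flowBound hA hi 0 y).1.neg.integrableOn
  refine ⟨_, h, tendsto_nhds_unique ((tendsto_flowTop hA hi 0).mul h) ?_,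
    tendsto_nhds_unique (h.mul (tendsto_flowTop hA hi 0)) ?_⟩ <;>
  simp only [flow_mul_flow_self hA, tendsto_const_nhds]

lemma exists_flowBot_inv (hA : Continuous A) (hi : Integrable A) :
    ∃ M, Tendsto (fun x => flow A x 0) atBot (𝓝 M) ∧ M * flowBot A 0 = 1 := by
  have h := tendsto_limUnder_of_hasDerivAt_of_integrableOn_Iic (a := 0)
    (fun x _ => hasDerivAt_flow hA x 0)
    (integrable_mul_of_bounded (continuous_flow_left hA 0) hA hi
      fun x => norm_flow_le_flowBound hA hi x 0).2.integrableOn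
  refine ⟨_, h, tendsto_nhds_unique (h.mul (tendsto_flowBot hA hi 0)) ?_⟩
  simp only [flow_mul_flow_self hA, tendsto_const_nhds]

lemma tendsto_flowTop_atTop (hA : Continuous A) (hi : Integrable A) :
    Tendsto (flowTop A) atTop (𝓝 1) := by
  obtain ⟨M, hM, h1, -⟩ := exists_flowTop_inv hA hi
  rw [← h1]
  refine (hM.const_mul (flowTop A 0)).congr fun y => flowTop_mul_flow hA hi 0 y

lemma tendsto_flowBot_atBot (hA : Continuous A) (hi : Integrable A) :
    Tendsto (flowBot A) atBot (𝓝 1) := by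
  obtain ⟨M, hM, h1⟩ := exists_flowBot_inv hA hi
  rw [← h1]
  refine (hM.mul_const (flowBot A 0)).congr fun x => flow_mul_flowBot hA hi x 0

lemma tendsto_flowTop_atBot (hA : Continuous A) (hi : Integrable A) :
    Tendsto (flowTop A) atBot (𝓝 (flowLine A)) :=
  ((tendsto_flowBot hA hi 0).const_mul (flowTop A 0)).congr fun y => flowTop_mul_flow hA hi 0 y

lemma tendsto_flowBot_atTop (hA : Continuous A) (hi : Integrable A) :
    Tendsto (flowBot A) atTop (𝓝 (flowLine A)) :=
  ((tendsto_flowTop hA hi 0).mul_const (flowBot A 0)).congr fun x => flow_mul_flowBot hA hi x 0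

lemma tendsto_flowLine (hA : Continuous A) (hi : Integrable A) :
    Tendsto (fun p : ℝ × ℝ => flow A p.1 p.2) (atTop ×ˢ atBot) (𝓝 (flowLine A)) := by
  refine (((tendsto_flowTop hA hi 0).comp tendsto_fst).mul
    ((tendsto_flowBot hA hi 0).comp tendsto_snd)).congr fun p => ?_
  exact flow_mul_flow hA _ _ _

lemma norm_flow_sub_flow_le_line (hA : Continuous A) (hiA : Integrable A) (hB : Continuous B)
    (hiB : Integrable B) {x y : ℝ} (h : y ≤ x) :
    ‖flow B x y - flow A x y‖ ≤ flowBound A * flowBound B * ∫ s, ‖B s - A s‖ := by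
  have hAi : ∫ s in y..x, ‖A s‖ ≤ ∫ s, ‖A s‖ := (le_abs_self _).trans
    (abs_intervalIntegral_le_integral hiA.norm (fun _ => norm_nonneg _) x y)
  have hBi : ∫ s in y..x, ‖B s‖ ≤ ∫ s, ‖B s‖ := (le_abs_self _).trans
    (abs_intervalIntegral_le_integral hiB.norm (fun _ => norm_nonneg _) x y)
  have hd : ∫ s in y..x, ‖B s - A s‖ ≤ ∫ s, ‖B s - A s‖ := (le_abs_self _).trans
    (abs_intervalIntegral_le_integral (hiB.sub hiA).norm (fun _ => norm_nonneg _) x y)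
  have h0 : 0 ≤ ∫ s in y..x, ‖B s - A s‖ :=
    intervalIntegral.integral_nonneg h fun _ _ => norm_nonneg _
  refine (norm_flow_sub_flow_le hA hB h).trans ?_
  rw [flowBound, flowBound]
  calc _ ≤ ‖(1 : 𝔸)‖ ^ 2 * Real.exp (∫ s, ‖A s‖) * Real.exp (∫ s, ‖B s‖) *
        ∫ s, ‖B s - A s‖ := by gcongr
    _ = _ := by ring

lemma norm_flowTop_sub_le (hA : Continuous A) (hiA : Integrable A) (hB : Continuous B)
    (hiB : Integrable B) (y : ℝ) :
    ‖flowTop B y - flowTop A y‖ ≤ flowBound A * flowBound B * ∫ s, ‖B s - A s‖ :=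
  le_of_tendsto ((tendsto_flowTop hB hiB y).sub (tendsto_flowTop hA hiA y)).norm
    ((eventually_ge_atTop y).mono fun _ h => norm_flow_sub_flow_le_line hA hiA hB hiB h)

lemma norm_flowBot_sub_le (hA : Continuous A) (hiA : Integrable A) (hB : Continuous B)
    (hiB : Integrable B) (x : ℝ) :
    ‖flowBot B x - flowBot A x‖ ≤ flowBound A * flowBound B * ∫ s, ‖B s - A s‖ :=
  le_of_tendsto ((tendsto_flowBot hB hiB x).sub (tendsto_flowBot hA hiA x)).norm
    ((eventually_le_atBot x).mono fun _ h => norm_flow_sub_flow_le_line hA hiA hB hiB h)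

/-- The first variation of the propagator on the line. -/
lemma norm_flowLine_add_sub_sub_le (hA : Continuous A) (hiA : Integrable A) (hB : Continuous B)
    (hiB : Integrable B) :
    ‖flowLine (A + B) - flowLine A - ∫ s, flowTop A s * B s * flowBot A s‖ ≤
      ‖(1 : 𝔸)‖ ^ 3 * Real.exp (∫ w, ‖A w‖) ^ 2 *
      Real.exp ((∫ w, ‖A w‖) + ∫ w, ‖B w‖) * (∫ w, ‖B w‖) ^ 2 := by
  have hAB : Continuous (A + B) := hA.add hB
  -- The estimate is the one on [-n, n] with a constant that no longer depends on n; the three terms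
  -- converge as n → ∞, the integral by dominated convergence.
  have ht : Tendsto (fun n : ℕ => ((n : ℝ), -(n : ℝ))) atTop (atTop ×ˢ atBot) :=
    tendsto_natCast_atTop_atTop.prodMk (tendsto_neg_atTop_atBot.comp tendsto_natCast_atTop_atTop)
  have h1 := (tendsto_flowLine hAB (hiA.add hiB)).comp ht
  have h2 := (tendsto_flowLine hA hiA).comp ht
  have h3 : Tendsto (fun n : ℕ => ∫ s in (-(n : ℝ))..n, flow A n s * B s * flow A s (-n)) atTop
      (𝓝 (∫ s, flowTop A s * B s * flowBot A s)) := by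
    have e : ∀ n : ℕ, ∫ s in (-(n : ℝ))..n, flow A n s * B s * flow A s (-n) =
        ∫ s, (Set.Ioc (-(n : ℝ)) n).indicator (fun s => flow A n s * B s * flow A s (-n)) s := by
      intro n
      rw [integral_indicator measurableSet_Ioc, intervalIntegral.integral_of_le]
      linarith [n.cast_nonneg (α := ℝ)]
    simp only [e]
    refine tendsto_integral_of_dominated_convergence
      (fun s => flowBound A * ‖B s‖ * flowBound A) (fun n => ?_)
      ((hiB.norm.const_mul _).mul_const _) (fun n => ae_of_all _ fun s => ?_)
      (ae_of_all _ fun s => ?_)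
    · exact (((continuous_flow_right hA _).mul hB).mul
        (continuous_flow_left hA _)).aestronglyMeasurable.indicator measurableSet_Ioc
    · refine (norm_indicator_le_norm_self _ s).trans ((norm_mul_le _ _).trans ?_)
      gcongr
      · exact mul_nonneg (flowBound_nonneg A) (norm_nonneg _)
      · exact (norm_mul_le _ _).trans (mul_le_mul_of_nonneg_right
          (norm_flow_le_flowBound hA hiA _ _) (norm_nonneg _))
      · exact norm_flow_le_flowBound hA hiA _ _
    · have h4 := (((tendsto_flowTop hA hiA s).comp tendsto_natCast_atTop_atTop).mul_const (B s)).mul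
        ((tendsto_flowBot hA hiA s).comp
          (tendsto_neg_atTop_atBot.comp tendsto_natCast_atTop_atTop))
      refine h4.congr' ?_
      filter_upwards [(tendsto_natCast_atTop_atTop (R := ℝ)).eventually_gt_atTop |s|] with n hn
      have := abs_lt.1 hn
      rw [Set.indicator_of_mem (show s ∈ Set.Ioc (-(n : ℝ)) n from ⟨this.1, this.2.le⟩)]
      rfl
  refine le_of_tendsto ((h1.sub h2).sub h3).norm (Eventually.of_forall fun n => ?_)
  have hn : -(n : ℝ) ≤ n := by linarith [n.cast_nonneg (α := ℝ)]
  have hAi : ∫ s in (-(n : ℝ))..n, ‖A s‖ ≤ ∫ s, ‖A s‖ := (le_abs_self _).trans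
    (abs_intervalIntegral_le_integral hiA.norm (fun _ => norm_nonneg _) _ _)
  have hBi : ∫ s in (-(n : ℝ))..n, ‖B s‖ ≤ ∫ s, ‖B s‖ := (le_abs_self _).trans
    (abs_intervalIntegral_le_integral hiB.norm (fun _ => norm_nonneg _) _ _)
  have h0 : 0 ≤ ∫ s in (-(n : ℝ))..n, ‖B s‖ :=
    intervalIntegral.integral_nonneg hn fun _ _ => norm_nonneg _
  refine (norm_flow_add_sub_sub_le hA hB hn).trans ?_
  gcongr

end LineFlow

attribute [irreducible] flowTop flowBot flowLine
end DIII
end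

noncomputable section
set_option linter.unusedSectionVars false
namespace DIII
open MeasureTheory Filter
open scoped Matrix.Norms.Operator

variable {r : ℕ}

/-- Integrability of functions on the line with values in a normed space. -/
abbrev LineIntegrable {V : Type*} [NormedAddCommGroup V] (f : ℝ → V) : Prop := Integrable f

lemma lineIntegrable_of_norm_le {V : Type*} [NormedAddCommGroup V] {f : ℝ → V} (hf : Continuous f)
    {g : ℝ → ℝ} (hg : Integrable g) (h : ∀ x, ‖f x‖ ≤ g x) : LineIntegrable f :=
  hg.mono' hf.aestronglyMeasurable (ae_of_all _ h)

/-! ### The Jost solutions and the scattering matrix -/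

/-- The free solution `E(x, t)` for real `t`. -/
def phase (r : ℕ) (x t : ℝ) : Mat r :=
  Matrix.diagonal fun a => Complex.exp (-(Complex.I * t * x) * sgn a)

lemma E_eq_phase (x t : ℝ) : E r x t = phase r x t := by
  rw [E, J_eq_diagonal, ← Matrix.diagonal_smul, Matrix.exp_diagonal, phase]
  congr 1
  funext a
  rw [Pi.coe_exp, ← Complex.exp_eq_exp_ℂ, Pi.smul_apply, smul_eq_mul]

lemma phase_mul_phase_neg (x t : ℝ) : phase r x t * phase r x (-t) = 1 := by
  rw [phase, phase, Matrix.diagonal_mul_diagonal, ← Matrix.diagonal_one]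
  congr 1
  funext a
  rw [← Complex.exp_add, ← Complex.exp_zero]
  congr 1
  push_cast
  ring

lemma phase_neg_mul_phase (x t : ℝ) : phase r x (-t) * phase r x t = 1 := by
  simpa using phase_mul_phase_neg (r := r) x (-t)

lemma inv_E (x t : ℝ) : (E r x t)⁻¹ = phase r x (-t) := by
  rw [E_eq_phase]
  exact Matrix.inv_eq_right_inv (phase_mul_phase_neg x t)

lemma phase_zero_left (t : ℝ) : phase r 0 t = 1 := by simp [phase]

lemma norm_diagonal_le {n : Type*} [Fintype n] [DecidableEq n] {v : n → ℂ} {C : ℝ} (hC : 0 ≤ C)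
    (h : ∀ a, ‖v a‖ ≤ C) : ‖Matrix.diagonal v‖ ≤ C := by
  rw [Matrix.linfty_opNorm_diagonal]
  exact (pi_norm_le_iff_of_nonneg hC).2 h

lemma sgn_eq (a : Idx r) : sgn a = 1 ∨ sgn a = -1 := by
  rcases a with a | a <;> simp [sgn]

lemma norm_exp_sgn (x t : ℝ) (a : Idx r) :
    ‖Complex.exp (-(Complex.I * t * x) * sgn a)‖ = 1 := by
  rw [Complex.norm_exp]
  rcases sgn_eq a with h | h <;> simp [h]

lemma norm_phase_le (x t : ℝ) : ‖phase r x t‖ ≤ 1 :=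
  norm_diagonal_le zero_le_one fun a => (norm_exp_sgn x t a).le

lemma norm_phase_sub_le (x t s : ℝ) : ‖phase r x t - phase r x s‖ ≤ |x| * |t - s| := by
  have h : phase r x t - phase r x s = Matrix.diagonal fun a =>
      Complex.exp (-(Complex.I * t * x) * sgn a) - Complex.exp (-(Complex.I * s * x) * sgn a) := by
    rw [phase, phase, Matrix.diagonal_sub]
  rw [h]
  refine norm_diagonal_le (by positivity) fun a => ?_
  have e : Complex.exp (-(Complex.I * t * x) * sgn a) -
      Complex.exp (-(Complex.I * s * x) * sgn a) = Complex.exp (-(Complex.I * s * x) * sgn a) *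
        (Complex.exp (-(Complex.I * (t - s : ℝ) * x) * sgn a) - 1) := by
    rw [mul_sub, ← Complex.exp_add, mul_one]
    congr 2
    push_cast
    ring
  rw [e, norm_mul, norm_exp_sgn, one_mul]
  rcases sgn_eq a with h | h
  · have := Real.norm_exp_I_mul_ofReal_sub_one_le (x := -((t - s) * x))
    rw [h, mul_one]
    convert! this using 1
    · congr 3; push_cast; ring
    · rw [norm_neg, norm_mul, mul_comm]; rfl
  · have := Real.norm_exp_I_mul_ofReal_sub_one_le (x := (t - s) * x)
    rw [h]
    convert! this using 1
    · congr 3; push_cast; ring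
    · rw [norm_mul, mul_comm]; rfl

lemma J_mul_phase (x t : ℝ) : J r * phase r x t = phase r x t * J r := by
  rw [J_eq_diagonal, phase, Matrix.diagonal_mul_diagonal, Matrix.diagonal_mul_diagonal]
  simp only [mul_comm]

lemma hasDerivAt_phase (x t : ℝ) :
    HasDerivAt (fun x => phase r x t) (-((Complex.I * t) • (J r * phase r x t))) x := by
  refine hasDerivAt_matrix.2 fun a b => ?_
  rw [J_eq_diagonal, phase, Matrix.diagonal_mul_diagonal]
  by_cases h : a = b
  · subst h
    simp only [phase, Matrix.neg_apply, Matrix.smul_apply, Matrix.diagonal_apply_eq, smul_eq_mul]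
    have h1 : HasDerivAt (fun x : ℝ => -(Complex.I * t * (x : ℂ)) * sgn a)
        (-(Complex.I * t * 1) * sgn a) x :=
      (((hasDerivAt_id x).ofReal_comp.const_mul (Complex.I * t)).neg).mul_const _
    convert! h1.cexp using 1
    ring
  · simp only [phase, Matrix.neg_apply, Matrix.smul_apply, Matrix.diagonal_apply_ne _ h, smul_zero,
      neg_zero]
    exact hasDerivAt_const x 0

lemma continuous_phase (t : ℝ) : Continuous fun x => phase r x t :=
  continuous_iff_continuousAt.2 fun x => (hasDerivAt_phase x t).continuousAt

/-- The coefficient of the linear problem in the interaction picture. -/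
def rotCoef (u : Potential r) (t x : ℝ) : Mat r :=
  phase r x (-t) * (Complex.I • Q u x) * phase r x t

lemma continuous_rotCoef {u : Potential r} (hu : Continuous u) (t : ℝ) :
    Continuous (rotCoef u t) := by
  have h : Continuous fun x => Complex.I • Q u x := (continuous_Q hu).const_smul Complex.I
  exact ((continuous_phase (-t)).mul h).mul (continuous_phase t)

lemma norm_mul_phase_le (M : Mat r) (x t s : ℝ) :
    ‖phase r x t * M * phase r x s‖ ≤ ‖M‖ := by
  calc _ ≤ ‖phase r x t‖ * ‖M‖ * ‖phase r x s‖ :=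
        (norm_mul_le _ _).trans (mul_le_mul_of_nonneg_right (norm_mul_le _ _) (norm_nonneg _))
    _ ≤ 1 * ‖M‖ * 1 := by
        gcongr
        · exact norm_phase_le x t
        · exact norm_phase_le x s
    _ = ‖M‖ := by ring

lemma norm_I_smul (M : Mat r) : ‖Complex.I • M‖ = ‖M‖ := by
  rw [norm_smul, Complex.norm_I, one_mul]

lemma norm_rotCoef_le (u : Potential r) (t x : ℝ) : ‖rotCoef u t x‖ ≤ ‖Q u x‖ :=
  (norm_mul_phase_le _ x (-t) t).trans_eq (norm_I_smul _)

/-- Differentiating the phases in t costs a factor |x|; this is why `Decays` asks for integrability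
of x Q. -/
lemma norm_rotCoef_sub_le (u : Potential r) (t s x : ℝ) :
    ‖rotCoef u t x - rotCoef u s x‖ ≤ 2 * |t - s| * (|x| * ‖Q u x‖) := by
  have e : rotCoef u t x - rotCoef u s x =
      (phase r x (-t) - phase r x (-s)) * (Complex.I • Q u x) * phase r x t +
        phase r x (-s) * (Complex.I • Q u x) * (phase r x t - phase r x s) := by
    rw [rotCoef, rotCoef, sub_mul, sub_mul, mul_sub, sub_add_sub_cancel]
  have h1 := norm_phase_sub_le (r := r) x (-t) (-s)
  have h2 := norm_phase_sub_le (r := r) x t s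
  rw [show -t - -s = -(t - s) by ring, abs_neg] at h1
  rw [e]
  refine (norm_add_le _ _).trans ?_
  calc _ ≤ (|x| * |t - s|) * ‖Q u x‖ * 1 + 1 * ‖Q u x‖ * (|x| * |t - s|) := by
        refine add_le_add ?_ ?_
        · refine (norm_mul_le _ _).trans (mul_le_mul ((norm_mul_le _ _).trans ?_)
            (norm_phase_le x t) (norm_nonneg _) (by positivity))
          rw [norm_I_smul]
          gcongr
        · refine (norm_mul_le _ _).trans (mul_le_mul ((norm_mul_le _ _).trans ?_)
            h2 (norm_nonneg _) (by positivity))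
          rw [norm_I_smul]
          gcongr
          exact norm_phase_le x (-s)
    _ = _ := by ring

/-- Continuous potentials such that `Q` and `x Q` are integrable. -/
structure Decays (u : Potential r) : Prop where
  continuous : Continuous u
  integrable : LineIntegrable (Q u)
  integrable_mul : Integrable fun x => |x| * ‖Q u x‖

lemma norm_Q_le (r : ℕ) : ∃ C, 0 ≤ C ∧ ∀ (u : Potential r) (x : ℝ), ‖Q u x‖ ≤ C * ‖u x‖ := by
  refine ⟨∑ c : Coord r, ‖(gen c : Mat r)‖, Finset.sum_nonneg fun _ _ => norm_nonneg _,
    fun u x => ?_⟩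
  rw [Q_eq_sum, Finset.sum_mul]
  refine norm_sum_le_of_le _ fun c _ => ?_
  rw [norm_smul, mul_comm]
  exact mul_le_mul_of_nonneg_left (norm_le_pi_norm (u x) c) (norm_nonneg _)

lemma decays_of_mem_schwartzSpace {u : Potential r} (hu : u ∈ schwartzSpace r) : Decays u := by
  obtain ⟨s, hs⟩ := hu
  have hus : u = s := funext hs
  obtain ⟨C, hC0, hC⟩ := norm_Q_le r
  have hc : Continuous u := by rw [hus]; exact s.continuous
  have hQ := continuous_Q hc
  refine ⟨hc, ?_, ?_⟩
  · refine lineIntegrable_of_norm_le hQ (s.integrable.norm.const_mul C) fun x => ?_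
    rw [← hs]; exact hC u x
  · have := (s.integrable_pow_mul volume 1).const_mul C
    refine this.mono' (continuous_abs.mul hQ.norm).aestronglyMeasurable (ae_of_all _ fun x => ?_)
    rw [pow_one, Real.norm_of_nonneg (by positivity), ← hs, Real.norm_eq_abs, mul_left_comm]
    exact mul_le_mul_of_nonneg_left (hC u x) (abs_nonneg _)

lemma Decays.integrable_rotCoef {u : Potential r} (hu : Decays u) (t : ℝ) :
    LineIntegrable (rotCoef u t) :=
  lineIntegrable_of_norm_le (continuous_rotCoef hu.continuous t) hu.integrable.norm
    fun x => norm_rotCoef_le u t x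

/-- `T(x, y, t)` in the interaction picture. -/
lemma flow_coef_eq {u : Potential r} (hu : Continuous u) (t x y : ℝ) :
    flow (coef u t) x y = phase r x t * flow (rotCoef u t) x y * phase r y (-t) := by
  have h := solution_eq_flow_mul (continuous_coef hu t)
    (Ψ := fun x => phase r x t * flow (rotCoef u t) x y * phase r y (-t)) (fun x => ?_) x y
  · rw [flow_self, mul_one, phase_mul_phase_neg, mul_one] at h
    exact h.symm
  · have := ((hasDerivAt_phase x t).mul (hasDerivAt_flow (continuous_rotCoef hu t) x y)).mul_const
      (phase r y (-t))
    convert! this using 1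
    have e : phase r x t * rotCoef u t x = (Complex.I • Q u x) * phase r x t := by
      rw [rotCoef, ← mul_assoc, ← mul_assoc, phase_mul_phase_neg, one_mul]
    rw [← mul_assoc (phase r x t), e, coef, U, smul_sub, smul_smul]
    simp only [sub_mul, add_mul, neg_mul, smul_mul_assoc, mul_assoc]
    abel

/-- Conjugation by the phases fixes the identity and does not increase norms, so convergence to 1
can be read in the interaction picture. -/
lemma tendsto_conj_phase {l : Filter ℝ} {X : ℝ → Mat r} {t : ℝ} :
    Tendsto (fun x => phase r x t * X x * phase r x (-t)) l (𝓝 1) ↔ Tendsto X l (𝓝 1) := by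
  have key : ∀ (X : ℝ → Mat r) (t : ℝ), Tendsto X l (𝓝 1) →
      Tendsto (fun x => phase r x t * X x * phase r x (-t)) l (𝓝 1) := by
    intro X t h
    replace h := tendsto_iff_norm_sub_tendsto_zero.1 h
    refine tendsto_iff_norm_sub_tendsto_zero.2 (squeeze_zero (fun _ => norm_nonneg _) (fun x => ?_) h)
    refine le_trans (le_of_eq ?_) (norm_mul_phase_le (X x - 1) x t (-t))
    rw [mul_sub, sub_mul, mul_one, phase_mul_phase_neg]
  refine ⟨fun h => ?_, key X t⟩
  have := key _ (-t) h
  refine this.congr fun x => ?_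
  rw [neg_neg]
  calc _ = (phase r x (-t) * phase r x t) * X x * (phase r x (-t) * phase r x t) := by
        simp only [mul_assoc]
    _ = X x := by rw [phase_neg_mul_phase, one_mul, mul_one]

section Jost

variable {u : Potential r}

lemma solution_mul_inv_E (hu : Continuous u) {t : ℝ} {Ψ : ℝ → Mat r} (h : IsSolution u t Ψ) (x : ℝ) :
    Ψ x * (E r x t)⁻¹ = phase r x t * (flow (rotCoef u t) x 0 * Ψ 0) * phase r x (-t) := by
  rw [solution_eq_flow_mul (continuous_coef hu t) (isSolution_iff.1 h) x 0, flow_coef_eq hu,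
    phase_zero_left, mul_one, inv_E]
  simp only [mul_assoc]

lemma isSolution_flow_mul (hu : Continuous u) (t : ℝ) (M : Mat r) :
    IsSolution u t fun x => flow (coef u t) x 0 * M :=
  isSolution_iff.2 fun x => by
    have := (hasDerivAt_flow (continuous_coef hu t) x 0).mul_const M
    rwa [mul_assoc] at this

/-- In the interaction picture the solution is the propagator applied to Ψ(0), and its limit at +∞
is `flowTop` at 0 times Ψ(0). -/
lemma isJostRight_iff (hu : Decays u) {t : ℝ} {Ψ : ℝ → Mat r} (h : IsSolution u t Ψ) :
    IsJostRight u t Ψ ↔ flowTop (rotCoef u t) 0 * Ψ 0 = 1 := by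
  have ht := (tendsto_flowTop (continuous_rotCoef hu.continuous t) (hu.integrable_rotCoef t)
    0).mul_const (Ψ 0)
  rw [IsJostRight, and_iff_right h]
  simp only [solution_mul_inv_E hu.continuous h]
  rw [tendsto_conj_phase]
  exact ⟨fun h => tendsto_nhds_unique ht h, fun h => h ▸ ht⟩

lemma isJostLeft_iff (hu : Decays u) {t : ℝ} {Ψ : ℝ → Mat r} (h : IsSolution u t Ψ) :
    IsJostLeft u t Ψ ↔ Ψ 0 = flowBot (rotCoef u t) 0 := by
  obtain ⟨M, hM, h1⟩ := exists_flowBot_inv (continuous_rotCoef hu.continuous t)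
    (hu.integrable_rotCoef t)
  have h2 := _root_.mul_eq_one_comm.1 h1
  have ht := hM.mul_const (Ψ 0)
  rw [IsJostLeft, and_iff_right h]
  simp only [solution_mul_inv_E hu.continuous h]
  rw [tendsto_conj_phase]
  constructor
  · intro h
    have h3 := tendsto_nhds_unique ht h
    rw [← mul_one (flowBot _ 0), ← h3, ← mul_assoc, h2, one_mul]
  · intro h
    rw [h, h1] at ht
    rw [h]
    exact ht

lemma isJostRight_jostRight (hu : Decays u) (t : ℝ) : IsJostRight u t (jostRight u t) := by
  obtain ⟨M, -, h1, -⟩ := exists_flowTop_inv (continuous_rotCoef hu.continuous t)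
    (hu.integrable_rotCoef t)
  refine Classical.epsilon_spec (p := IsJostRight u t) ⟨fun x => flow (coef u t) x 0 * M, ?_⟩
  rw [isJostRight_iff hu (isSolution_flow_mul hu.continuous t M), flow_self, one_mul, h1]

lemma isJostLeft_jostLeft (hu : Decays u) (t : ℝ) : IsJostLeft u t (jostLeft u t) := by
  refine Classical.epsilon_spec (p := IsJostLeft u t)
    ⟨fun x => flow (coef u t) x 0 * flowBot (rotCoef u t) 0, ?_⟩
  rw [isJostLeft_iff hu (isSolution_flow_mul hu.continuous t _), flow_self, one_mul]

lemma flowTop_mul_jostRight (hu : Decays u) (t : ℝ) :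
    flowTop (rotCoef u t) 0 * jostRight u t 0 = 1 :=
  (isJostRight_iff hu (isJostRight_jostRight hu t).1).1 (isJostRight_jostRight hu t)

/-- The right Jost solution at 0 is inverse to `flowTop` and the left one equals `flowBot`, whatever
choice was made in their definitions. -/
lemma scattering_eq (hu : Decays u) (t : ℝ) : scattering u t = flowLine (rotCoef u t) := by
  rw [scattering, (isJostLeft_iff hu (isJostLeft_jostLeft hu t).1).1 (isJostLeft_jostLeft hu t),
    Matrix.inv_eq_left_inv (flowTop_mul_jostRight hu t), flowLine]

lemma jostLeft_eq (hu : Decays u) (t x : ℝ) :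
    jostLeft u t x = jostRight u t x * scattering u t := by
  have h1 := solution_eq_flow_mul (continuous_coef hu.continuous t)
    (isSolution_iff.1 (isJostLeft_jostLeft hu t).1) x 0
  have h2 := solution_eq_flow_mul (continuous_coef hu.continuous t)
    (isSolution_iff.1 (isJostRight_jostRight hu t).1) x 0
  have h3 := _root_.mul_eq_one_comm.1 (flowTop_mul_jostRight hu t)
  rw [h1, h2, scattering, Matrix.inv_eq_left_inv (flowTop_mul_jostRight hu t), mul_assoc,
    ← mul_assoc (jostRight u t 0), h3, one_mul]

/-- The outer phases are exactly the change to the interaction picture, where the propagator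
converges in both end points at once. -/
lemma tendsto_transition (hu : Decays u) (t : ℝ) : Tendsto
    (fun xy : ℝ × ℝ => (E r xy.1 t)⁻¹ * transition u xy.1 xy.2 t * E r xy.2 t)
    (atTop ×ˢ atBot) (𝓝 (scattering u t)) := by
  rw [scattering_eq hu]
  refine (tendsto_flowLine (continuous_rotCoef hu.continuous t)
    (hu.integrable_rotCoef t)).congr fun p => ?_
  rw [transition_eq_flow hu.continuous, flow_coef_eq hu.continuous, inv_E, E_eq_phase]
  calc _ = (phase r p.1 (-t) * phase r p.1 t) * flow (rotCoef u t) p.1 p.2 *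
        (phase r p.2 (-t) * phase r p.2 t) := by
        rw [phase_neg_mul_phase, phase_neg_mul_phase, one_mul, mul_one]
    _ = _ := by simp only [mul_assoc]

end Jost
end DIII
end

noncomputable section
set_option linter.unusedSectionVars false
namespace DIII
open MeasureTheory Filter

/-! ### A class of test functions -/

/-- Continuous functions bounded by `M / (1 + t²)` with a local Lipschitz constant of the same
kind. -/
structure IsTest (M : ℝ) (f : ℝ → ℂ) : Prop where
  continuous : Continuous f
  bound : ∀ t, ‖f t‖ ≤ M * (1 + t ^ 2)⁻¹
  lip : ∀ s t, |s - t| ≤ 1 → ‖f s - f t‖ ≤ M * |s - t| * (1 + t ^ 2)⁻¹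

namespace IsTest

variable {M N : ℝ} {f g : ℝ → ℂ}

lemma nonneg (hf : IsTest M f) : 0 ≤ M := by
  have := (norm_nonneg _).trans (hf.bound 0)
  simpa using this

lemma mono (hf : IsTest M f) (h : M ≤ N) : IsTest N f where
  continuous := hf.continuous
  bound t := (hf.bound t).trans (by gcongr)
  lip s t hst := (hf.lip s t hst).trans (by gcongr)

lemma integrable (hf : IsTest M f) : Integrable f :=
  (integrable_inv_one_add_sq.const_mul M).mono' hf.continuous.aestronglyMeasurable
    (ae_of_all _ hf.bound)

lemma add (hf : IsTest M f) (hg : IsTest N g) : IsTest (M + N) fun t => f t + g t where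
  continuous := hf.continuous.add hg.continuous
  bound t := (norm_add_le _ _).trans ((add_le_add (hf.bound t) (hg.bound t)).trans_eq (by ring))
  lip s t hst := by
    rw [show f s + g s - (f t + g t) = (f s - f t) + (g s - g t) by ring]
    exact (norm_add_le _ _).trans
      ((add_le_add (hf.lip s t hst) (hg.lip s t hst)).trans_eq (by ring))

lemma zero : IsTest 0 fun _ => 0 where
  continuous := continuous_const
  bound t := by simp
  lip s t _ := by simp

lemma sum {ι : Type*} {s : Finset ι} {M : ι → ℝ} {f : ι → ℝ → ℂ}
    (h : ∀ i ∈ s, IsTest (M i) (f i)) : IsTest (∑ i ∈ s, M i) fun t => ∑ i ∈ s, f i t := by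
  classical
  induction s using Finset.induction_on with
  | empty => simpa using zero
  | insert i s hi ih =>
    simp only [Finset.sum_insert hi]
    exact (h i (Finset.mem_insert_self i s)).add
      (ih fun j hj => h j (Finset.mem_insert_of_mem hj))

lemma mul_lipschitz (hf : IsTest M f) {B D : ℝ} (hD : 0 ≤ D) (hg : Continuous g)
    (hB : ∀ t, ‖g t‖ ≤ B) (hL : ∀ s t, ‖g s - g t‖ ≤ D * |s - t|) :
    IsTest (M * (B + D)) fun t => f t * g t where
  continuous := hf.continuous.mul hg
  bound t := by
    have hM := hf.nonneg
    have hB0 : 0 ≤ B := (norm_nonneg _).trans (hB 0)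
    rw [norm_mul]
    calc _ ≤ (M * (1 + t ^ 2)⁻¹) * B := by gcongr; exacts [hf.bound t, hB t]
      _ = M * B * (1 + t ^ 2)⁻¹ := by ring
      _ ≤ _ := by gcongr; linarith
  lip s t hst := by
    have hM := hf.nonneg
    have hB0 : 0 ≤ B := (norm_nonneg _).trans (hB 0)
    rw [show f s * g s - f t * g t = (f s - f t) * g s + f t * (g s - g t) by ring]
    refine (norm_add_le _ _).trans ?_
    rw [norm_mul, norm_mul]
    calc _ ≤ (M * |s - t| * (1 + t ^ 2)⁻¹) * B + (M * (1 + t ^ 2)⁻¹) * (D * |s - t|) := by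
          gcongr
          exacts [hf.lip s t hst, hB s, hf.bound t, hL s t]
      _ = _ := by ring

lemma const_mul (hf : IsTest M f) (c : ℂ) : IsTest (M * ‖c‖) fun t => c * f t := by
  have := hf.mul_lipschitz (g := fun _ => c) le_rfl continuous_const (fun _ => le_rfl)
    (fun s t => by simp)
  simpa [mul_comm c] using this

/-- The decay of the Fourier transform. -/
lemma norm_integral_exp_sq_le (hf : IsTest M f) (m : ℝ) :
    ‖∫ t : ℝ, Complex.exp (Complex.I * (m * t)) * f t‖ ^ 2 * (1 + m ^ 2) ≤ (20 * M) ^ 2 := by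
  have hM := hf.nonneg
  have hn : ∀ t : ℝ, ‖Complex.exp (Complex.I * (m * t))‖ = 1 := fun t => by
    rw [Complex.norm_exp]; simp
  have hce : Continuous fun t : ℝ => Complex.exp (Complex.I * (m * t)) := by fun_prop
  have hint : ∀ g : ℝ → ℂ, Continuous g → Integrable g →
      Integrable fun t : ℝ => Complex.exp (Complex.I * (m * t)) * g t := fun g hc hg =>
    hg.norm.mono' (hce.mul hc).aestronglyMeasurable
      (ae_of_all _ fun t => by rw [norm_mul, hn, one_mul])
  have hpi := Real.pi_pos
  have hpi4 : Real.pi < 3.15 := Real.pi_lt_d2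
  set I := ∫ t : ℝ, Complex.exp (Complex.I * (m * t)) * f t with hI
  -- For |m| < π the trivial bound πM is enough. The threshold makes the shift π/m at most 1, as the
  -- local Lipschitz bound requires.
  rcases lt_or_ge |m| Real.pi with hm | hm
  · have h1 : ‖I‖ ≤ M * Real.pi := by
      calc ‖I‖ ≤ ∫ t : ℝ, M * (1 + t ^ 2)⁻¹ := by
            refine norm_integral_le_of_norm_le (integrable_inv_one_add_sq.const_mul M)
              (ae_of_all _ fun t => ?_)
            rw [norm_mul, hn, one_mul]
            exact hf.bound t
        _ = M * Real.pi := by rw [integral_const_mul, integral_univ_inv_one_add_sq]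
    have h2 : m ^ 2 ≤ Real.pi ^ 2 := by rw [← sq_abs m]; gcongr
    calc _ ≤ (M * Real.pi) ^ 2 * (1 + Real.pi ^ 2) := by gcongr
      _ ≤ (M * 3.15) ^ 2 * (1 + 3.15 ^ 2) := by gcongr
      _ ≤ _ := by nlinarith [sq_nonneg M]
  · have hm0 : m ≠ 0 := by rintro rfl; simp at hm; linarith
    -- This shift reverses the sign of the exponential, so twice the integral involves f(t) -
    -- f(t+δ), which is of size |δ|.
    set δ := Real.pi / m with hδ
    have hδ1 : |δ| ≤ 1 := by
      rw [hδ, abs_div, abs_of_pos hpi]; exact div_le_one_of_le₀ hm (abs_nonneg _)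
    have e1 : I = -∫ t : ℝ, Complex.exp (Complex.I * (m * t)) * f (t + δ) := by
      rw [hI, ← integral_add_right_eq_self _ δ, ← integral_neg]
      congr 1
      funext t
      have : Complex.exp (Complex.I * (m * ((t + δ : ℝ) : ℂ))) =
          -Complex.exp (Complex.I * (m * t)) := by
        rw [show Complex.I * (m * ((t + δ : ℝ) : ℂ)) =
          Complex.I * (m * t) + Real.pi * Complex.I by
            have : (m : ℂ) ≠ 0 := by exact_mod_cast hm0
            rw [hδ]; push_cast; field_simp, Complex.exp_add, Complex.exp_pi_mul_I, mul_neg_one]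
      rw [this, neg_mul]
    have e2 : 2 * I = ∫ t : ℝ, Complex.exp (Complex.I * (m * t)) * (f t - f (t + δ)) := by
      have h1 := hint f hf.continuous hf.integrable
      have h2 := hint (fun t => f (t + δ)) (hf.continuous.comp (continuous_add_const δ))
        (hf.integrable.comp_add_right δ)
      simp only [mul_sub]
      rw [integral_sub h1 h2, ← hI]
      linear_combination e1
    have h1 : ‖2 * I‖ ≤ M * |δ| * Real.pi := by
      rw [e2]
      calc _ ≤ ∫ t : ℝ, M * |δ| * (1 + t ^ 2)⁻¹ := by
            refine norm_integral_le_of_norm_le (integrable_inv_one_add_sq.const_mul _)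
              (ae_of_all _ fun t => ?_)
            rw [norm_mul, hn, one_mul, norm_sub_rev]
            have := hf.lip (t + δ) t (by simpa using hδ1)
            simpa using this
        _ = _ := by rw [integral_const_mul, integral_univ_inv_one_add_sq]
    rw [norm_mul, hδ, abs_div, abs_of_pos hpi, Complex.norm_ofNat] at h1
    have hmp : 0 < |m| := abs_pos.2 hm0
    have h2 : ‖I‖ * |m| ≤ 5 * M := by
      have h3 := mul_le_mul_of_nonneg_right h1 hmp.le
      rw [show M * (Real.pi / |m|) * Real.pi * |m| = M * Real.pi ^ 2 by field_simp] at h3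
      nlinarith [mul_le_mul_of_nonneg_left (show Real.pi ^ 2 ≤ 10 by nlinarith) hM]
    have h4 : 1 + m ^ 2 ≤ 2 * |m| ^ 2 := by
      have : 1 ≤ |m| := by linarith [Real.pi_gt_three]
      rw [← sq_abs m]; nlinarith
    calc _ ≤ ‖I‖ ^ 2 * (2 * |m| ^ 2) := by gcongr
      _ = 2 * (‖I‖ * |m|) ^ 2 := by ring
      _ ≤ 2 * (5 * M) ^ 2 := by gcongr
      _ ≤ _ := by nlinarith [sq_nonneg M]

end IsTest

lemma schwartz_norm_le (h : SchwartzMap ℝ ℂ) : ∃ C, 0 ≤ C ∧ ∀ t, ‖h t‖ ≤ C * (1 + t ^ 2)⁻¹ := by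
  obtain ⟨C, hC0, hC⟩ := h.decay 0 0
  obtain ⟨D, hD0, hD⟩ := h.decay 2 0
  refine ⟨C + D, by positivity, fun t => ?_⟩
  have h1 := hC t
  have h2 := hD t
  simp only [norm_iteratedFDeriv_zero, pow_zero, one_mul, Real.norm_eq_abs, sq_abs] at h1 h2
  rw [← div_eq_mul_inv, le_div_iff₀ (by positivity)]
  linarith

/-- The mean value inequality with the decay of the derivative. -/
lemma exists_isTest_schwartz (h : SchwartzMap ℝ ℂ) : ∃ M, IsTest M h := by
  obtain ⟨C, hC0, hC⟩ := schwartz_norm_le h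
  obtain ⟨D, hD0, hD⟩ := schwartz_norm_le (SchwartzMap.derivCLM ℝ ℂ h)
  refine ⟨C + 3 * D, h.continuous, fun t => (hC t).trans (by gcongr; linarith), fun s t hst => ?_⟩
  have key := (convex_uIcc t s).norm_image_sub_le_of_norm_hasDerivWithin_le (f := h)
    (f' := deriv h) (C := 3 * D * (1 + t ^ 2)⁻¹)
    (fun ξ _ => (h.differentiableAt.hasDerivAt).hasDerivWithinAt) (fun ξ hξ => ?_)
    Set.left_mem_uIcc Set.right_mem_uIcc
  · refine key.trans ?_
    rw [Real.norm_eq_abs]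
    calc _ = 3 * D * |s - t| * (1 + t ^ 2)⁻¹ := by ring
      _ ≤ _ := by gcongr; linarith
  · have h1 := hD ξ
    rw [SchwartzMap.derivCLM_apply] at h1
    refine h1.trans ?_
    have h2 : |ξ - t| ≤ 1 := (Set.abs_sub_left_of_mem_uIcc hξ).trans hst
    -- Within distance 1 the weight changes by a factor of at most 3, hence 3D in the constant.
    have h3 : 1 + t ^ 2 ≤ 3 * (1 + ξ ^ 2) := by
      have := abs_le.1 h2
      nlinarith [sq_nonneg (ξ + t), sq_nonneg (2 * ξ - t)]
    rw [← div_eq_mul_inv, ← div_eq_mul_inv, div_le_div_iff₀ (by positivity) (by positivity)]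
    nlinarith

/-! ### The kernels of the scattering matrix -/

section Kernels

open scoped Matrix.Norms.Operator

variable {r : ℕ} {u : Potential r}

/-- A bound of the propagators in the interaction picture for all spectral parameters. -/
lemma Decays.exists_flowBound_le (hu : Decays u) : ∃ C, 0 ≤ C ∧ ∀ t, flowBound (rotCoef u t) ≤ C := by
  refine ⟨‖(1 : Mat r)‖ * Real.exp (∫ x, ‖Q u x‖), by positivity, fun t => ?_⟩
  have h : ∫ x, ‖rotCoef u t x‖ ≤ ∫ x, ‖Q u x‖ :=
    integral_mono (hu.integrable_rotCoef t).norm hu.integrable.norm fun x => norm_rotCoef_le u t x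
  exact mul_le_mul_of_nonneg_left (Real.exp_le_exp.2 h) (norm_nonneg _)

lemma Decays.integral_norm_rotCoef_sub_le (hu : Decays u) (t s : ℝ) :
    ∫ x, ‖rotCoef u t x - rotCoef u s x‖ ≤ 2 * (∫ x, |x| * ‖Q u x‖) * |t - s| := by
  have : 2 * (∫ x, |x| * ‖Q u x‖) * |t - s| = ∫ x, 2 * |t - s| * (|x| * ‖Q u x‖) := by
    rw [integral_const_mul]; ring
  rw [this]
  exact integral_mono ((hu.integrable_rotCoef t).sub (hu.integrable_rotCoef s)).norm
    (hu.integrable_mul.const_mul _) fun x => norm_rotCoef_sub_le u t s x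

/-- The coefficient in the interaction picture is bounded by ‖Q‖ for every t and is Lipschitz in t
with the integrable constant 2|x|‖Q‖. Hence the propagators are bounded and Lipschitz in t,
uniformly in x. -/
lemma Decays.exists_bound_lipschitz (hu : Decays u) : ∃ K, 0 ≤ K ∧
    (∀ t x, ‖flowTop (rotCoef u t) x‖ ≤ K ∧ ‖flowBot (rotCoef u t) x‖ ≤ K) ∧
    (∀ t s x, ‖flowTop (rotCoef u t) x - flowTop (rotCoef u s) x‖ ≤ K * |t - s| ∧
      ‖flowBot (rotCoef u t) x - flowBot (rotCoef u s) x‖ ≤ K * |t - s|) := by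
  obtain ⟨C, hC0, hC⟩ := hu.exists_flowBound_le
  set D := 2 * ∫ x, |x| * ‖Q u x‖ with hD
  have hD0 : 0 ≤ D := mul_nonneg zero_le_two (integral_nonneg fun x => by positivity)
  have hc := continuous_rotCoef hu.continuous
  have hi := hu.integrable_rotCoef
  have key : ∀ t s, flowBound (rotCoef u s) * flowBound (rotCoef u t) *
      ∫ x, ‖rotCoef u t x - rotCoef u s x‖ ≤ (C + C * C * D) * |t - s| := fun t s => by
    have h1 := mul_le_mul (hC s) (hC t) (flowBound_nonneg (rotCoef u t)) hC0
    refine (mul_le_mul h1 (hu.integral_norm_rotCoef_sub_le t s)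
      (integral_nonneg fun _ => norm_nonneg _) (mul_nonneg hC0 hC0)).trans ?_
    rw [← mul_assoc]
    exact mul_le_mul_of_nonneg_right (le_add_of_nonneg_left hC0) (abs_nonneg _)
  have hCD : C ≤ C + C * C * D := by nlinarith [mul_nonneg (mul_nonneg hC0 hC0) hD0]
  exact ⟨C + C * C * D, hC0.trans hCD,
    fun t x => ⟨(norm_flowTop_le (hc t) (hi t) x).trans ((hC t).trans hCD),
      (norm_flowBot_le (hc t) (hi t) x).trans ((hC t).trans hCD)⟩,
    fun t s x => ⟨(norm_flowTop_sub_le (hc s) (hi s) (hc t) (hi t) x).trans (key t s),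
      (norm_flowBot_sub_le (hc s) (hi s) (hc t) (hi t) x).trans (key t s)⟩⟩

lemma continuous_of_continuous_lipschitz {V : Type*} [NormedAddCommGroup V] {f : ℝ → ℝ → V} {K : ℝ}
    (h1 : ∀ t, Continuous (f t)) (h2 : ∀ t s x, ‖f t x - f s x‖ ≤ K * |t - s|) :
    Continuous fun p : ℝ × ℝ => f p.1 p.2 := by
  refine continuous_prod_of_continuous_lipschitzWith (f := fun p : ℝ × ℝ => f p.1 p.2) K.toNNReal
    h1 fun x => LipschitzWith.of_dist_le_mul fun t s => ?_
  rw [dist_eq_norm, Real.dist_eq]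
  exact (h2 t s x).trans (mul_le_mul_of_nonneg_right (Real.le_coe_toNNReal K) (abs_nonneg _))

lemma Decays.continuous_flowTop (hu : Decays u) :
    Continuous fun p : ℝ × ℝ => flowTop (rotCoef u p.1) p.2 := by
  obtain ⟨K, -, -, h⟩ := hu.exists_bound_lipschitz
  exact continuous_of_continuous_lipschitz (f := fun t x => flowTop (rotCoef u t) x)
    (fun t => DIII.continuous_flowTop (continuous_rotCoef hu.continuous t) (hu.integrable_rotCoef t))
    fun t s x => (h t s x).1

lemma Decays.continuous_flowBot (hu : Decays u) :
    Continuous fun p : ℝ × ℝ => flowBot (rotCoef u p.1) p.2 := by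
  obtain ⟨K, -, -, h⟩ := hu.exists_bound_lipschitz
  exact continuous_of_continuous_lipschitz (f := fun t x => flowBot (rotCoef u t) x)
    (fun t => DIII.continuous_flowBot (continuous_rotCoef hu.continuous t) (hu.integrable_rotCoef t))
    fun t s x => (h t s x).2

/-- The products of matrix elements of the propagators from `x` to `+∞` and from `-∞` to `x`, with
a test function. -/
def elemKernel (h : ℝ → ℂ) (u : Potential r) (x : ℝ) (a b c d : Idx r) (t : ℝ) : ℂ :=
  h t * (flowTop (rotCoef u t) x a b * flowBot (rotCoef u t) x c d)

lemma IsTest.mul_entries {h : ℝ → ℂ} {M : ℝ} (hh : IsTest M h) {L R : ℝ → Mat r} {K : ℝ}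
    (hK0 : 0 ≤ K) (hLc : Continuous L) (hRc : Continuous R) (hL : ∀ t, ‖L t‖ ≤ K)
    (hR : ∀ t, ‖R t‖ ≤ K) (hLl : ∀ s t, ‖L s - L t‖ ≤ K * |s - t|)
    (hRl : ∀ s t, ‖R s - R t‖ ≤ K * |s - t|) (a b c d : Idx r) :
    IsTest (M * (K * K + (K * K + K * K))) fun t => h t * (L t a b * R t c d) := by
  refine hh.mul_lipschitz (by positivity) ((continuous_entry hLc a b).mul (continuous_entry hRc c d))
    (fun t => ?_) fun s t => ?_
  · rw [norm_mul]
    exact mul_le_mul ((norm_entry_le _ a b).trans (hL t))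
      ((norm_entry_le _ c d).trans (hR t)) (norm_nonneg _) hK0
  · have h1 : ‖L s a b - L t a b‖ ≤ K * |s - t| := (norm_entry_le (L s - L t) a b).trans (hLl s t)
    have h2 : ‖R s c d - R t c d‖ ≤ K * |s - t| := (norm_entry_le (R s - R t) c d).trans (hRl s t)
    have h3 := (norm_entry_le _ a b).trans (hL t)
    have h4 := (norm_entry_le _ c d).trans (hR s)
    rw [show L s a b * R s c d - L t a b * R t c d =
      (L s a b - L t a b) * R s c d + L t a b * (R s c d - R t c d) by ring]
    refine (norm_add_le _ _).trans ?_
    rw [norm_mul, norm_mul]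
    calc _ ≤ (K * |s - t|) * K + K * (K * |s - t|) := by gcongr
      _ = _ := by ring

lemma Decays.exists_isTest_elemKernel (hu : Decays u) {h : ℝ → ℂ} {M : ℝ} (hh : IsTest M h) :
    ∃ N, ∀ x a b c d, IsTest N (elemKernel h u x a b c d) := by
  obtain ⟨K, hK0, hK, hL⟩ := hu.exists_bound_lipschitz
  exact ⟨_, fun x a b c d => hh.mul_entries hK0
    (hu.continuous_flowTop.comp (Continuous.prodMk_left x))
    (hu.continuous_flowBot.comp (Continuous.prodMk_left x)) (fun t => (hK t x).1)
    (fun t => (hK t x).2) (fun s t => (hL s t x).1) (fun s t => (hL s t x).2) a b c d⟩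

end Kernels
end DIII
end

noncomputable section
set_option linter.unusedSectionVars false
namespace DIII
open MeasureTheory Filter
open scoped Matrix.Norms.Operator

variable {r : ℕ} {u : Potential r}

/-! ### The variational derivative of the smeared scattering matrix -/

/-- The inverse of the right Jost solution. -/
def jostInv (u : Potential r) (t x : ℝ) : Mat r := flowTop (rotCoef u t) x * phase r x (-t)

/-- The left Jost solution. -/
def jostSol (u : Potential r) (t x : ℝ) : Mat r := phase r x t * flowBot (rotCoef u t) x

/-- The gradient of a matrix element of the smeared scattering matrix. -/
def smearedGrad (h : ℝ → ℂ) (u : Potential r) (a b : Idx r) : Potential r := fun x c =>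
  ∫ t, h t * (jostInv u t x * (Complex.I • gen c) * jostSol u t x) a b

/-- The sign of the rotation of the generator. -/
def genSign : Coord r → ℝ := Sum.elim (fun _ => 1) (fun _ => -1)

/-- A generator has weight ±2 under J, so the free evolution multiplies it by e^{±2ixt}. This
oscillation in t makes the smeared gradients decay in x. -/
lemma phase_gen_phase (c : Coord r) (x t : ℝ) : phase r x (-t) * gen c * phase r x t =
    Complex.exp (Complex.I * ((2 * genSign c * x : ℝ) * t)) • gen c := by
  ext a b
  rw [phase, phase, Matrix.mul_diagonal, Matrix.diagonal_mul, Matrix.smul_apply, smul_eq_mul,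
    mul_right_comm, ← Complex.exp_add]
  rcases c with p | p
  · rw [gen_inl]
    rcases weylPlus_apply p a b with h | ⟨h1, h2⟩
    · rw [h, mul_zero, mul_zero]
    · congr 2
      rw [h1, h2, genSign, Sum.elim_inl]
      push_cast
      ring
  · rw [gen_inr, Matrix.transpose_apply]
    rcases weylPlus_apply p b a with h | ⟨h1, h2⟩
    · rw [h, mul_zero, mul_zero]
    · congr 2
      rw [h1, h2, genSign, Sum.elim_inr]
      push_cast
      ring

lemma mul_mul_apply_eq_sum {n : Type*} [Fintype n] (L X R : Matrix n n ℂ) (a b : n) :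
    (L * X * R) a b = ∑ q : n × n, X q.1 q.2 * (L a q.1 * R q.2 b) := by
  simp only [Matrix.mul_apply, Finset.sum_mul, Fintype.sum_prod_type]
  rw [Finset.sum_comm]
  exact Finset.sum_congr rfl fun i _ => Finset.sum_congr rfl fun j _ => by ring

lemma jost_gen_jost (u : Potential r) (t x : ℝ) (c : Coord r) :
    jostInv u t x * (Complex.I • gen c) * jostSol u t x =
      Complex.exp (Complex.I * ((2 * genSign c * x : ℝ) * t)) •
        (flowTop (rotCoef u t) x * (Complex.I • gen c) * flowBot (rotCoef u t) x) := by
  have h := phase_gen_phase c x t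
  calc _ = flowTop (rotCoef u t) x * (Complex.I • (phase r x (-t) * gen c * phase r x t)) *
        flowBot (rotCoef u t) x := by
        rw [jostInv, jostSol]
        simp only [Matrix.mul_smul, Matrix.smul_mul, mul_assoc]
    _ = _ := by
        rw [h, smul_comm, Matrix.mul_smul, Matrix.smul_mul]

/-- The amplitude of the oscillating integral for the gradient. -/
def gradAmplitude (h : ℝ → ℂ) (u : Potential r) (a b : Idx r) (x : ℝ) (c : Coord r) (t : ℝ) : ℂ :=
  ∑ q : Idx r × Idx r, (Complex.I • gen c) q.1 q.2 * elemKernel h u x a q.1 q.2 b t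

lemma smeared_integrand_eq (h : ℝ → ℂ) (u : Potential r) (a b : Idx r) (x : ℝ) (c : Coord r) (t : ℝ) :
    h t * (jostInv u t x * (Complex.I • gen c) * jostSol u t x) a b =
      Complex.exp (Complex.I * ((2 * genSign c * x : ℝ) * t)) * gradAmplitude h u a b x c t := by
  rw [jost_gen_jost, Matrix.smul_apply, smul_eq_mul, mul_left_comm, mul_mul_apply_eq_sum,
    gradAmplitude, Finset.mul_sum]
  congr 1
  exact Finset.sum_congr rfl fun q _ => by rw [elemKernel]; ring

lemma Decays.exists_isTest_gradAmplitude (hu : Decays u) {h : ℝ → ℂ} {M : ℝ} (hh : IsTest M h)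
    (a b : Idx r) : ∃ N, ∀ x c, IsTest N (gradAmplitude h u a b x c) := by
  obtain ⟨N, hN⟩ := hu.exists_isTest_elemKernel hh
  have h0 : 0 ≤ N := (hN 0 a a a a).nonneg
  refine ⟨∑ c : Coord r, ∑ q : Idx r × Idx r, N * ‖(Complex.I • (gen c : Mat r)) q.1 q.2‖,
    fun x c => ?_⟩
  have h1 := IsTest.sum (s := Finset.univ) fun q _ =>
    (hN x a (Prod.fst q) (Prod.snd q) b).const_mul ((Complex.I • (gen c : Mat r)) q.1 q.2)
  refine h1.mono (Finset.single_le_sum (f := fun c : Coord r => ∑ q : Idx r × Idx r,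
    N * ‖(Complex.I • (gen c : Mat r)) q.1 q.2‖) (fun c _ => ?_) (Finset.mem_univ c))
  exact Finset.sum_nonneg fun q _ => mul_nonneg h0 (norm_nonneg _)

lemma Decays.continuous_jostInv (hu : Decays u) :
    Continuous fun p : ℝ × ℝ => jostInv u p.1 p.2 := by
  have h : Continuous fun p : ℝ × ℝ => phase r p.2 (-p.1) :=
    Continuous.matrix_diagonal (continuous_pi fun a => by fun_prop)
  exact hu.continuous_flowTop.mul h

lemma Decays.continuous_jostSol (hu : Decays u) :
    Continuous fun p : ℝ × ℝ => jostSol u p.1 p.2 := by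
  have h : Continuous fun p : ℝ × ℝ => phase r p.2 p.1 :=
    Continuous.matrix_diagonal (continuous_pi fun a => by fun_prop)
  exact h.mul hu.continuous_flowBot

/-- The integrand of the gradient. -/
def gradDensity (h : ℝ → ℂ) (u : Potential r) (a b : Idx r) (c : Coord r) (p : ℝ × ℝ) : ℂ :=
  h p.1 * (jostInv u p.1 p.2 * (Complex.I • gen c) * jostSol u p.1 p.2) a b

lemma Decays.continuous_gradDensity (hu : Decays u) {h : ℝ → ℂ} (hh : Continuous h) (a b : Idx r)
    (c : Coord r) : Continuous (gradDensity h u a b c) := by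
  have h1 : Continuous fun p : ℝ × ℝ =>
      jostInv u p.1 p.2 * (Complex.I • gen c) * jostSol u p.1 p.2 :=
    (hu.continuous_jostInv.mul continuous_const).mul hu.continuous_jostSol
  exact (hh.comp continuous_fst).mul (continuous_entry h1 a b)

lemma norm_gradDensity_le {h : ℝ → ℂ} {N : ℝ} {a b : Idx r}
    (hN : ∀ x c, IsTest N (gradAmplitude h u a b x c)) (c : Coord r) (t x : ℝ) :
    ‖gradDensity h u a b c (t, x)‖ ≤ N * (1 + t ^ 2)⁻¹ := by
  rw [gradDensity, smeared_integrand_eq, norm_mul, Complex.norm_exp]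
  have : (Complex.I * ((2 * genSign c * x : ℝ) * t)).re = 0 := by simp
  rw [this, Real.exp_zero, one_mul]
  exact (hN x c).bound t

lemma Decays.aestronglyMeasurable_smearedGrad (hu : Decays u) {h : ℝ → ℂ} (hh : Continuous h)
    (a b : Idx r) : AEStronglyMeasurable (smearedGrad h u a b) volume := by
  refine (measurable_pi_iff.2 fun c => ?_).aestronglyMeasurable
  exact ((hu.continuous_gradDensity hh a b
    c).comp continuous_swap).stronglyMeasurable.integral_prod_right'.measurable

/-- The gradient is a Fourier integral in t of frequency ±2x with an amplitude controlled uniformly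
in x, hence O(1/|x|). Smearing is what makes it square-integrable. -/
lemma norm_smearedGrad_le {h : ℝ → ℂ} {N : ℝ} {a b : Idx r}
    (hN : ∀ x c, IsTest N (gradAmplitude h u a b x c)) (x : ℝ) (c : Coord r) :
    ‖smearedGrad h u a b x c‖ ^ 2 ≤ (20 * N) ^ 2 * (1 + x ^ 2)⁻¹ := by
  have e : smearedGrad h u a b x c = ∫ t : ℝ,
      Complex.exp (Complex.I * ((2 * genSign c * x : ℝ) * t)) * gradAmplitude h u a b x c t :=
    integral_congr_ae (ae_of_all _ fun t => smeared_integrand_eq h u a b x c t)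
  have h1 := (hN x c).norm_integral_exp_sq_le (2 * genSign c * x)
  rw [← e] at h1
  rw [← div_eq_mul_inv, le_div_iff₀ (by positivity)]
  refine le_trans (mul_le_mul_of_nonneg_left ?_ (sq_nonneg _)) h1
  rcases c with p | p <;> simp only [genSign, Sum.elim_inl, Sum.elim_inr] <;>
    nlinarith [sq_nonneg x]

lemma Decays.memLp_smearedGrad (hu : Decays u) {h : ℝ → ℂ} {M : ℝ} (hh : IsTest M h) (a b : Idx r) :
    MemLp (smearedGrad h u a b) 2 volume := by
  obtain ⟨N, hN⟩ := hu.exists_isTest_gradAmplitude hh a b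
  have hm := hu.aestronglyMeasurable_smearedGrad hh.continuous a b
  rw [memLp_two_iff_integrable_sq_norm hm]
  refine (integrable_inv_one_add_sq.const_mul ((20 * N) ^ 2)).mono' (hm.norm.pow 2)
    (ae_of_all _ fun x => ?_)
  rw [norm_pow, norm_norm]
  have h0 : 0 ≤ (20 * N) ^ 2 * (1 + x ^ 2)⁻¹ := by positivity
  rw [← Real.sq_sqrt h0]
  refine pow_le_pow_left₀ (norm_nonneg _) ((pi_norm_le_iff_of_nonneg (Real.sqrt_nonneg _)).2
    fun c => Real.le_sqrt_of_sq_le (norm_smearedGrad_le hN x c)) 2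

lemma rotCoef_add_smul (u v : Potential r) (ε : ℂ) (t : ℝ) :
    rotCoef (u + ε • v) t = rotCoef u t + fun x => ε • rotCoef v t x := by
  funext x
  simp only [rotCoef, Pi.add_apply, Q_add_smul, smul_add, mul_add, add_mul, smul_comm Complex.I ε,
    Matrix.mul_smul, Matrix.smul_mul]

lemma Decays.add_smul {v : Potential r} (hu : Decays u) (hv : Decays v) (ε : ℂ) :
    Decays (u + ε • v) := by
  have hc := continuous_add_smul hu.continuous hv.continuous ε
  have hle : ∀ x, ‖Q (u + ε • v) x‖ ≤ ‖Q u x‖ + ‖ε‖ * ‖Q v x‖ := fun x => by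
    rw [Q_add_smul]
    exact (norm_add_le _ _).trans_eq (by rw [norm_smul])
  refine ⟨hc, lineIntegrable_of_norm_le (continuous_Q hc)
    (hu.integrable.norm.add (hv.integrable.norm.const_mul ‖ε‖)) hle, ?_⟩
  have h1 : Continuous fun x => |x| * ‖Q (u + ε • v) x‖ := continuous_abs.mul (continuous_Q hc).norm
  refine (hu.integrable_mul.add (hv.integrable_mul.const_mul ‖ε‖)).mono' h1.aestronglyMeasurable
    (ae_of_all _ fun x => ?_)
  rw [Real.norm_of_nonneg (by positivity)]
  refine (mul_le_mul_of_nonneg_left (hle x) (abs_nonneg x)).trans_eq ?_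
  simp only [Pi.add_apply]
  ring

lemma Decays.continuous_scattering (hu : Decays u) : Continuous fun t => scattering u t := by
  have h : (fun t => scattering u t) =
      fun t => flowTop (rotCoef u t) 0 * flowBot (rotCoef u t) 0 := by
    funext t; rw [scattering_eq hu, flowLine]
  rw [h]
  have h1 := hu.continuous_flowTop.comp (Continuous.prodMk_left (Y := ℝ) (0 : ℝ))
  have h2 := hu.continuous_flowBot.comp (Continuous.prodMk_left (Y := ℝ) (0 : ℝ))
  exact h1.mul h2

lemma Decays.exists_norm_scattering_le (hu : Decays u) : ∃ K, 0 ≤ K ∧ ∀ t, ‖scattering u t‖ ≤ K := by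
  obtain ⟨K, hK0, hK, -⟩ := hu.exists_bound_lipschitz
  refine ⟨K * K, mul_nonneg hK0 hK0, fun t => ?_⟩
  rw [scattering_eq hu, flowLine]
  exact (norm_mul_le _ _).trans (mul_le_mul (hK t 0).1 (hK t 0).2 (norm_nonneg _) hK0)

lemma Decays.integrable_smeared (hu : Decays u) {h : ℝ → ℂ} {M : ℝ} (hh : IsTest M h) (a b : Idx r) :
    Integrable fun t => h t * scattering u t a b := by
  obtain ⟨K, hK0, hK⟩ := hu.exists_norm_scattering_le
  refine (hh.integrable.norm.mul_const K).mono'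
    (hh.continuous.mul (continuous_entry hu.continuous_scattering a b)).aestronglyMeasurable
    (ae_of_all _ fun t => ?_)
  rw [norm_mul]
  exact mul_le_mul_of_nonneg_left ((norm_entry_le _ a b).trans (hK t)) (norm_nonneg _)

/-- The phases of the interaction picture are absorbed into the Jost solutions, and the variation
becomes linear in the field components. -/
lemma flowTop_rotCoef_flowBot (u v : Potential r) (t x : ℝ) (a b : Idx r) :
    (flowTop (rotCoef u t) x * rotCoef v t x * flowBot (rotCoef u t) x) a b =
      ∑ c, (jostInv u t x * (Complex.I • gen c) * jostSol u t x) a b * v x c := by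
  have e : flowTop (rotCoef u t) x * rotCoef v t x * flowBot (rotCoef u t) x =
      ∑ c, v x c • (jostInv u t x * (Complex.I • gen c) * jostSol u t x) := by
    calc _ = jostInv u t x * (Complex.I • Q v x) * jostSol u t x := by
          rw [rotCoef, jostInv, jostSol]
          simp only [mul_assoc]
      _ = _ := by
          rw [Q_eq_sum]
          simp only [Finset.smul_sum, Finset.mul_sum, Finset.sum_mul]
          refine Finset.sum_congr rfl fun c _ => ?_
          rw [smul_comm, Matrix.mul_smul, Matrix.smul_mul]
  rw [e, Matrix.sum_apply]
  exact Finset.sum_congr rfl fun c _ => by rw [Matrix.smul_apply, smul_eq_mul, mul_comm]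

lemma integral_entry {f : ℝ → Mat r} (hf : LineIntegrable f) (a b : Idx r) :
    (∫ s, f s) a b = ∫ s, f s a b :=
  (((Matrix.entryLinearMap ℝ ℂ a b).toContinuousLinearMap).integral_comp_comm hf).symm

lemma lineIntegrable_flowTop_mul {v : Potential r} (hu : Decays u) (hv : Decays v) (t : ℝ) :
    LineIntegrable fun x => flowTop (rotCoef u t) x * rotCoef v t x * flowBot (rotCoef u t) x := by
  obtain ⟨K, hK0, hK, -⟩ := hu.exists_bound_lipschitz
  have hc := continuous_rotCoef hu.continuous t
  have hi := hu.integrable_rotCoef t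
  refine lineIntegrable_of_norm_le (((continuous_flowTop hc hi).mul
    (continuous_rotCoef hv.continuous t)).mul (continuous_flowBot hc hi))
    ((hv.integrable.norm.const_mul K).mul_const K) fun x => ?_
  refine (norm_mul_le _ _).trans (mul_le_mul ((norm_mul_le _ _).trans ?_) (hK t x).2 (norm_nonneg _)
    (mul_nonneg hK0 (norm_nonneg _)))
  exact mul_le_mul (hK t x).1 (norm_rotCoef_le v t x) (norm_nonneg _) hK0

/-- The first variation of the scattering matrix. -/
lemma norm_scattering_sub_sub_le {v : Potential r} (hu : Decays u) (hv : Decays v) : ∃ C, 0 ≤ C ∧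
    ∀ (t : ℝ) (ε : ℂ), ‖ε‖ ≤ 1 → ∀ a b, ‖scattering (u + ε • v) t a b - scattering u t a b -
      ε * ∫ x, ∑ c, (jostInv u t x * (Complex.I • gen c) * jostSol u t x) a b * v x c‖ ≤
        C * ‖ε‖ ^ 2 := by
  set α := ∫ x, ‖Q u x‖ with hα
  set β := ∫ x, ‖Q v x‖ with hβ
  have hβ0 : 0 ≤ β := integral_nonneg fun _ => norm_nonneg _
  refine ⟨‖(1 : Mat r)‖ ^ 3 * Real.exp α ^ 2 * Real.exp (α + β) * β ^ 2,
    mul_nonneg (mul_nonneg (mul_nonneg (pow_nonneg (norm_nonneg _) 3) (sq_nonneg _))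
      (Real.exp_pos _).le) (sq_nonneg _),
    fun t ε hε a b => ?_⟩
  have hcu := continuous_rotCoef hu.continuous t
  have hcv : Continuous fun x => ε • rotCoef v t x :=
    (continuous_rotCoef hv.continuous t).const_smul ε
  have hiv : LineIntegrable fun x => ε • rotCoef v t x :=
    lineIntegrable_of_norm_le hcv ((hv.integrable_rotCoef t).norm.const_mul ‖ε‖)
      fun x => (norm_smul ε _).le
  have key := norm_flowLine_add_sub_sub_le hcu (hu.integrable_rotCoef t) hcv hiv
  rw [← rotCoef_add_smul, ← scattering_eq hu, ← scattering_eq (hu.add_smul hv ε)] at key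
  have e1 : ∫ s, flowTop (rotCoef u t) s * (ε • rotCoef v t s) * flowBot (rotCoef u t) s =
      ε • ∫ s, flowTop (rotCoef u t) s * rotCoef v t s * flowBot (rotCoef u t) s := by
    rw [← integral_smul]
    congr 1
    funext s
    rw [Matrix.mul_smul, Matrix.smul_mul]
  rw [e1] at key
  have e2 := integral_entry (lineIntegrable_flowTop_mul hu hv t) a b
  simp only [flowTop_rotCoef_flowBot] at e2
  rw [← e2]
  refine ((norm_entry_le (scattering (u + ε • v) t - scattering u t -
    ε • ∫ s, flowTop (rotCoef u t) s * rotCoef v t s * flowBot (rotCoef u t) s) a b).trans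
    key).trans ?_
  have h1 : ∫ x, ‖rotCoef u t x‖ ≤ α :=
    integral_mono (hu.integrable_rotCoef t).norm hu.integrable.norm fun x => norm_rotCoef_le u t x
  have h2 : ∫ x, ‖ε • rotCoef v t x‖ ≤ ‖ε‖ * β := by
    simp only [norm_smul]
    rw [integral_const_mul]
    exact mul_le_mul_of_nonneg_left (integral_mono (hv.integrable_rotCoef t).norm
      hv.integrable.norm fun x => norm_rotCoef_le v t x) (norm_nonneg _)
  have h3 : ‖ε‖ * β ≤ β := mul_le_of_le_one_left hβ0 hε
  have h4 : 0 ≤ ∫ x, ‖ε • rotCoef v t x‖ := integral_nonneg fun _ => norm_nonneg _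
  have h5 : Real.exp (∫ x, ‖rotCoef u t x‖) ^ 2 ≤ Real.exp α ^ 2 :=
    pow_le_pow_left₀ (Real.exp_pos _).le (Real.exp_le_exp.2 h1) 2
  have h6 : Real.exp ((∫ x, ‖rotCoef u t x‖) + ∫ x, ‖ε • rotCoef v t x‖) ≤ Real.exp (α + β) :=
    Real.exp_le_exp.2 (add_le_add h1 (h2.trans h3))
  have h7 : (∫ x, ‖ε • rotCoef v t x‖) ^ 2 ≤ (‖ε‖ * β) ^ 2 := pow_le_pow_left₀ h4 h2 2
  have h9 : 0 ≤ ‖(1 : Mat r)‖ ^ 3 := pow_nonneg (norm_nonneg (1 : Mat r)) 3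
  have h10 := mul_nonneg h9 (sq_nonneg (Real.exp α))
  refine (mul_le_mul (mul_le_mul (mul_le_mul_of_nonneg_left h5 h9) h6 (Real.exp_pos _).le h10) h7
    (sq_nonneg _) (mul_nonneg h10 (Real.exp_pos _).le)).trans_eq ?_
  rw [mul_pow]
  ring

lemma Decays.integrable_gradDensity_mul (hu : Decays u) {v : Potential r} (hv : v ∈ schwartzSpace r)
    {h : ℝ → ℂ} {M : ℝ} (hh : IsTest M h) (a b : Idx r) :
    Integrable (fun p : ℝ × ℝ => ∑ c, gradDensity h u a b c p * v p.2 c)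
      (volume.prod volume) := by
  obtain ⟨N, hN⟩ := hu.exists_isTest_gradAmplitude hh a b
  obtain ⟨s, hs⟩ := hv
  refine integrable_finsetSum _ fun c _ => ?_
  have hvc : Continuous fun x => v x c := by
    have : (fun x => v x c) = fun x => s x c := funext fun x => by rw [hs]
    rw [this]
    exact (continuous_apply c).comp s.continuous
  have hg := hu.continuous_gradDensity hh.continuous a b c
  refine ((integrable_inv_one_add_sq.const_mul N).mul_prod s.integrable.norm).mono'
    (hg.mul (hvc.comp continuous_snd)).aestronglyMeasurable (ae_of_all _ fun p => ?_)
  rw [norm_mul]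
  refine mul_le_mul (norm_gradDensity_le hN c p.1 p.2) ?_ (norm_nonneg _)
    ((norm_nonneg _).trans (norm_gradDensity_le hN c p.1 p.2))
  rw [hs]
  exact norm_le_pi_norm (s p.2) c

theorem hasVarDeriv_smeared {u : Potential r} (hu : u ∈ schwartzSpace r) (h : SchwartzMap ℝ ℂ)
    (a b : Idx r) :
    HasVarDeriv (schwartzSpace r) volume (smeared h a b) u (smearedGrad h u a b) := by
  obtain ⟨M, hM⟩ := exists_isTest_schwartz h
  have hud := decays_of_mem_schwartzSpace hu
  refine ⟨hud.memLp_smearedGrad hM a b, fun v hv => ?_⟩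
  have hvd := decays_of_mem_schwartzSpace hv
  obtain ⟨C, hC0, hC⟩ := norm_scattering_sub_sub_le hud hvd
  obtain ⟨N, hN⟩ := hud.exists_isTest_gradAmplitude hM a b
  have hint := hud.integrable_gradDensity_mul hv hM a b
  set Y : ℝ → ℂ := fun t =>
    ∫ x, ∑ c, (jostInv u t x * (Complex.I • gen c) * jostSol u t x) a b * v x c with hY
  have eY : ∀ t, h t * Y t = ∫ x, ∑ c, gradDensity h u a b c (t, x) * v x c := fun t => by
    simp only [hY]
    rw [← integral_const_mul]
    congr 1
    funext x
    rw [Finset.mul_sum]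
    exact Finset.sum_congr rfl fun c _ => (mul_assoc _ _ _).symm
  have hYi : Integrable fun t => h t * Y t := by
    simp only [eY]
    exact hint.integral_prod_left
  have eF : ∫ x, ∑ c, smearedGrad h u a b x c * v x c = ∫ t, h t * Y t := by
    simp only [eY]
    -- Fubini is legitimate because the gradient density is O(1/(1+t²)) uniformly in x and v is a
    -- Schwartz function.
    rw [integral_integral_swap hint]
    congr 1
    funext x
    rw [integral_finsetSum]
    · refine Finset.sum_congr rfl fun c _ => ?_
      rw [integral_mul_const]
      rfl
    · intro c _
      have hg := (hud.continuous_gradDensity hM.continuous a b c).comp (Continuous.prodMk_left x)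
      exact ((integrable_inv_one_add_sq.const_mul N).mono' hg.aestronglyMeasurable
        (ae_of_all _ fun t => norm_gradDensity_le hN c t x)).mul_const _
  rw [eF]
  -- The quadratic bound for the scattering matrix is uniform in t and can be integrated against h.
  refine hasDerivAt_of_quadratic (C := (∫ t, ‖h t‖) * C) fun ε hε => ?_
  have h1 := (hud.add_smul hvd ε).integrable_smeared hM a b
  have h2 := hud.integrable_smeared hM a b
  have e0 : smeared h a b (u + (0 : ℂ) • v) = smeared h a b u := by rw [zero_smul, add_zero]
  have h12 : Integrable fun t => h t * scattering (u + ε • v) t a b - h t * scattering u t a b :=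
    h1.sub h2
  rw [e0, smeared, smeared, ← integral_const_mul, ← integral_sub h1 h2,
    ← integral_sub h12 (hYi.const_mul ε), mul_assoc, ← integral_mul_const]
  refine norm_integral_le_of_norm_le (hM.integrable.norm.mul_const _) (ae_of_all _ fun t => ?_)
  have := hC t ε hε a b
  rw [show h t * scattering (u + ε • v) t a b - h t * scattering u t a b - ε * (h t * Y t) =
    h t * (scattering (u + ε • v) t a b - scattering u t a b - ε * Y t) by ring, norm_mul]
  exact mul_le_mul_of_nonneg_left this (norm_nonneg _)

end DIII
end

noncomputable section
set_option linter.unusedSectionVars false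
namespace DIII
open MeasureTheory Filter

/-! ### The Dirichlet integral -/

/-- The character `e^{imτ}`. -/
def wave (m τ : ℝ) : ℂ := Complex.exp (Complex.I * (m * τ))

lemma norm_wave (m τ : ℝ) : ‖wave m τ‖ = 1 := by rw [wave, Complex.norm_exp]; simp

lemma wave_zero_left (τ : ℝ) : wave 0 τ = 1 := by simp [wave]

lemma wave_neg_right (m τ : ℝ) : wave m (-τ) = wave (-m) τ := by
  rw [wave, wave]; push_cast; ring_nf

lemma continuous_wave (m : ℝ) : Continuous (wave m) := by unfold wave; fun_prop

/-- The Gaussian cutoff. -/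
def gauss (τ : ℝ) : ℂ := Complex.exp (-1 * (τ : ℂ) ^ 2)

lemma gauss_eq (τ : ℝ) : gauss τ = (Real.exp (-τ ^ 2) : ℝ) := by
  rw [gauss]; push_cast; ring_nf

lemma norm_gauss (τ : ℝ) : ‖gauss τ‖ = Real.exp (-τ ^ 2) := by
  rw [gauss_eq, Complex.norm_real, Real.norm_of_nonneg (Real.exp_pos _).le]

lemma norm_gauss_le (τ : ℝ) : ‖gauss τ‖ ≤ (1 + τ ^ 2)⁻¹ := by
  rw [norm_gauss, Real.exp_neg]
  gcongr
  linarith [Real.add_one_le_exp (τ ^ 2)]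

lemma norm_one_sub_gauss_le (τ : ℝ) : ‖1 - gauss τ‖ ≤ τ ^ 2 := by
  rw [gauss_eq, ← Complex.ofReal_one, ← Complex.ofReal_sub, Complex.norm_real, Real.norm_of_nonneg]
  · linarith [Real.add_one_le_exp (-τ ^ 2)]
  · rw [sub_nonneg, Real.exp_le_one_iff]
    linarith [sq_nonneg τ]

lemma continuous_gauss : Continuous gauss := by unfold gauss; fun_prop

lemma integrable_gauss : Integrable gauss :=
  integrable_cexp_neg_mul_sq (b := 1) (by simp)

lemma gauss_neg (τ : ℝ) : gauss (-τ) = gauss τ := by simp [gauss]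

/-- The kernel of the Dirichlet integral with the Gaussian cutoff. -/
def dirichletKernel (m τ : ℝ) : ℂ := (wave m τ - wave (-m) τ) / (2 * τ) * gauss τ

/-- The Dirichlet integral with the Gaussian cutoff. -/
def dirichlet (m : ℝ) : ℂ := ∫ τ, dirichletKernel m τ

lemma dirichletKernel_neg_left (m τ : ℝ) : dirichletKernel (-m) τ = -dirichletKernel m τ := by
  simp only [dirichletKernel, neg_neg]; ring

lemma dirichlet_neg (m : ℝ) : dirichlet (-m) = -dirichlet m := by
  simp only [dirichlet, dirichletKernel_neg_left, integral_neg]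

lemma dirichlet_zero : dirichlet 0 = 0 := by
  simp [dirichlet, dirichletKernel]

lemma integral_wave (m τ : ℝ) (hτ : τ ≠ 0) :
    ∫ μ in (-m)..m, wave μ τ = (wave m τ - wave (-m) τ) / (Complex.I * τ) := by
  have h := integral_exp_mul_complex (a := -m) (b := m) (c := Complex.I * τ)
    (mul_ne_zero Complex.I_ne_zero (by exact_mod_cast hτ))
  convert! h using 1
  · congr 1; funext μ; rw [wave]; ring_nf
  · congr 1; rw [wave, wave]; push_cast; ring_nf

/-- The quotient by τ is an integral over frequencies in [-m, m]; after exchanging integrals the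
Gaussian can be transformed exactly. -/
lemma dirichletKernel_eq (m τ : ℝ) (hτ : τ ≠ 0) :
    dirichletKernel m τ = Complex.I / 2 * ∫ μ in (-m)..m, wave μ τ * gauss τ := by
  rw [intervalIntegral.integral_mul_const, integral_wave m τ hτ, dirichletKernel]
  have : (τ : ℂ) ≠ 0 := by exact_mod_cast hτ
  field_simp [Complex.I_ne_zero]

lemma norm_dirichletKernel_le (m τ : ℝ) : ‖dirichletKernel m τ‖ ≤ |m| * ‖gauss τ‖ := by
  by_cases hτ : τ = 0
  · subst hτ; simp only [dirichletKernel, Complex.ofReal_zero, mul_zero, div_zero, zero_mul,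
      norm_zero]; positivity
  · rw [dirichletKernel_eq m τ hτ, norm_mul, norm_div, Complex.norm_I, Complex.norm_ofNat]
    have := intervalIntegral.norm_integral_le_of_norm_le_const (a := -m) (b := m)
      (f := fun μ => wave μ τ * gauss τ) (C := ‖gauss τ‖) fun μ _ => by
        rw [norm_mul, norm_wave, one_mul]
    rw [sub_neg_eq_add, ← two_mul, abs_mul, abs_two] at this
    linarith

lemma measurable_dirichletKernel (m : ℝ) : Measurable (dirichletKernel m) := by
  unfold dirichletKernel
  have h1 := (continuous_wave m).measurable
  have h2 := (continuous_wave (-m)).measurable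
  have h3 := continuous_gauss.measurable
  fun_prop

lemma integrable_dirichletKernel (m : ℝ) : Integrable (dirichletKernel m) :=
  (integrable_gauss.norm.const_mul |m|).mono' (measurable_dirichletKernel m).aestronglyMeasurable
    (ae_of_all _ fun τ => norm_dirichletKernel_le m τ)

lemma cpow_half {x : ℝ} (hx : 0 ≤ x) : (x : ℂ) ^ (1 / 2 : ℂ) = (√x : ℝ) := by
  rw [Real.sqrt_eq_rpow, Complex.ofReal_cpow hx]; norm_num

/-- Fubini and the Fourier transform of the Gaussian. The point τ = 0, where division gives the
value 0, is a null set. -/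
lemma dirichlet_eq (m : ℝ) : dirichlet m =
    Complex.I / 2 * ((√Real.pi : ℝ) * ∫ μ in (-m)..m, Complex.exp (-(1 / 4) * (μ : ℂ) ^ 2)) := by
  have h1 : dirichlet m = ∫ τ, Complex.I / 2 * ∫ μ in (-m)..m, wave μ τ * gauss τ := by
    refine integral_congr_ae ?_
    have : ∀ᵐ τ : ℝ, τ ≠ 0 := by simp [ae_iff]
    filter_upwards [this] with τ hτ using dirichletKernel_eq m τ hτ
  rw [h1, integral_const_mul, ← intervalIntegral_integral_swap]
  · congr 1
    rw [← intervalIntegral.integral_const_mul]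
    congr 1
    funext μ
    have := fourierIntegral_gaussian (b := 1) (by simp) μ
    simp only [wave, gauss]
    rw [← cpow_half Real.pi_pos.le]
    convert! this using 2
    · funext τ; rw [mul_assoc]
    · rw [div_one]
    · congr 1; ring
  · have hc : Continuous fun p : ℝ × ℝ => wave p.1 p.2 * gauss p.2 := by
      unfold wave gauss; fun_prop
    have : IsFiniteMeasure (volume.restrict (Set.uIoc (-m) m)) :=
      ⟨by rw [Measure.restrict_apply_univ]; exact measure_Ioc_lt_top⟩
    have hi : Integrable (fun p : ℝ × ℝ => (1 : ℂ) * gauss p.2)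
        ((volume.restrict (Set.uIoc (-m) m)).prod volume) :=
      (integrable_const (1 : ℂ)).mul_prod integrable_gauss
    refine hi.norm.mono' hc.aestronglyMeasurable (ae_of_all _ fun p => ?_)
    rw [Function.uncurry_def, norm_mul, norm_wave, norm_mul, norm_one]

/-- The Gaussian integral over the whole line is 2√π, so the limit is (i/2)·√π·2√π = πi. -/
lemma tendsto_dirichlet : Tendsto dirichlet atTop (𝓝 (Real.pi * Complex.I)) := by
  have hb : 0 < (1 / 4 : ℂ).re := by norm_num
  have h := intervalIntegral_tendsto_integral (integrable_cexp_neg_mul_sq hb)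
    tendsto_neg_atTop_atBot tendsto_id
  rw [integral_gaussian_complex hb] at h
  have e : (Real.pi / (1 / 4) : ℂ) ^ (1 / 2 : ℂ) = 2 * (√Real.pi : ℝ) := by
    have := cpow_half (x := Real.pi / (1 / 4)) (by positivity)
    push_cast at this
    rw [this, show Real.pi / (1 / 4) = 2 ^ 2 * Real.pi by ring, Real.sqrt_mul (by positivity),
      Real.sqrt_sq (by positivity)]
    push_cast
    ring
  rw [e] at h
  have h2 := (h.const_mul ((√Real.pi : ℝ) : ℂ)).const_mul (Complex.I / 2)
  have e2 : Complex.I / 2 * ((√Real.pi : ℝ) * (2 * (√Real.pi : ℝ))) = Real.pi * Complex.I := by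
    have : ((√Real.pi : ℝ) : ℂ) * (√Real.pi : ℝ) = Real.pi := by
      rw [← Complex.ofReal_mul, Real.mul_self_sqrt Real.pi_pos.le]
    linear_combination Complex.I * this
  rw [e2] at h2
  exact h2.congr fun m => (dirichlet_eq m).symm

/-! ### Principal values -/

/-- The part of the plane away from the diagonal. -/
def offDiag (ε : ℝ) : Set (ℝ × ℝ) := {w | ε < |w.1 - w.2|}

lemma measurableSet_offDiag (ε : ℝ) : MeasurableSet (offDiag ε) :=
  (isOpen_lt continuous_const (by fun_prop)).measurableSet

lemma ae_ne_diag : ∀ᵐ p : ℝ × ℝ, p.1 ≠ p.2 := by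
  have hm : MeasurableSet {p : ℝ × ℝ | p.1 = p.2} :=
    (isClosed_eq continuous_fst continuous_snd).measurableSet
  rw [ae_iff]
  simp only [ne_eq, not_not]
  rw [Measure.volume_eq_prod, Measure.measure_prod_null hm]
  refine ae_of_all _ fun x => ?_
  have : Prod.mk x ⁻¹' {p : ℝ × ℝ | p.1 = p.2} = {x} := by ext y; simp [eq_comm]
  change volume (Prod.mk x ⁻¹' {p : ℝ × ℝ | p.1 = p.2}) = 0
  rw [this]; simp

lemma tendsto_integral_offDiag {F : ℝ × ℝ → ℂ} (hF : Integrable F) :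
    Tendsto (fun ε => ∫ w in offDiag ε, F w) (𝓝[>] 0) (𝓝 (∫ w, F w)) := by
  simp only [← integral_indicator (measurableSet_offDiag _)]
  refine tendsto_integral_filter_of_dominated_convergence (fun p => ‖F p‖)
    (Eventually.of_forall fun ε => hF.aestronglyMeasurable.indicator (measurableSet_offDiag ε))
    (Eventually.of_forall fun ε => ae_of_all _ fun p => norm_indicator_le_norm_self _ p) hF.norm ?_
  filter_upwards [ae_ne_diag] with p hp
  refine tendsto_const_nhds.congr' ?_
  have h0 : 0 < |p.1 - p.2| := abs_pos.2 (sub_ne_zero.2 hp)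
  filter_upwards [Ioo_mem_nhdsGT h0] with ε hε
  exact (Set.indicator_of_mem (show p ∈ offDiag ε from hε.2) F).symm

/-- A function of the difference times a function of the second variable. -/
lemma integrable_diff_mul {f g : ℝ → ℂ} (hf : Integrable f) (hg : Integrable g) :
    Integrable fun p : ℝ × ℝ => f (p.1 - p.2) * g p.2 := by
  have := hg.convolution_integrand (ContinuousLinearMap.mul ℝ ℂ) hf
  rw [Measure.volume_eq_prod]
  simpa only [ContinuousLinearMap.mul_apply', mul_comm] using this

lemma integral_diff_mul {f g : ℝ → ℂ} (hf : Integrable f) (hg : Integrable g) :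
    ∫ p : ℝ × ℝ, f (p.1 - p.2) * g p.2 = (∫ τ, f τ) * ∫ t, g t := by
  have h := integrable_diff_mul hf hg
  rw [Measure.volume_eq_prod] at h ⊢
  rw [integral_prod_symm _ h, ← integral_const_mul]
  congr 1
  funext t
  simp only
  rw [integral_mul_const, integral_sub_right_eq_self f t]

/-- The truncated singular kernel. -/
def cutKernel (m ε τ : ℝ) : ℂ := Set.indicator {τ : ℝ | ε < |τ|} (fun τ => wave m τ * gauss τ / τ) τ

lemma measurableSet_cut (ε : ℝ) : MeasurableSet {τ : ℝ | ε < |τ|} :=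
  (isOpen_lt continuous_const continuous_abs).measurableSet

lemma integrable_cutKernel (m : ℝ) {ε : ℝ} (hε : 0 < ε) : Integrable (cutKernel m ε) := by
  have hm : Measurable (cutKernel m ε) := by
    refine Measurable.indicator ?_ (measurableSet_cut ε)
    have h1 := (continuous_wave m).measurable
    have h3 := continuous_gauss.measurable
    fun_prop
  refine (integrable_gauss.norm.const_mul ε⁻¹).mono' hm.aestronglyMeasurable
    (ae_of_all _ fun τ => ?_)
  by_cases h : ε < |τ|
  · rw [cutKernel, Set.indicator_of_mem (show τ ∈ {τ : ℝ | ε < |τ|} from h), norm_div, norm_mul,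
      norm_wave, one_mul, div_eq_inv_mul, Complex.norm_real, Real.norm_eq_abs]
    gcongr
  · rw [cutKernel, Set.indicator_of_notMem (show τ ∉ {τ : ℝ | ε < |τ|} from h), norm_zero]
    positivity

/-- The cut is symmetric under τ ↦ -τ, and averaging over the reflection replaces the singular
kernel by the bounded Dirichlet kernel. -/
lemma integral_cutKernel (m : ℝ) {ε : ℝ} (hε : 0 < ε) :
    ∫ τ, cutKernel m ε τ = ∫ τ in {τ : ℝ | ε < |τ|}, dirichletKernel m τ := by
  have h := integrable_cutKernel m hε
  have e1 : ∫ τ, cutKernel m ε τ = (1 / 2 : ℂ) * ∫ τ, (cutKernel m ε τ + cutKernel m ε (-τ)) := by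
    rw [integral_add h h.comp_neg, integral_neg_eq_self (cutKernel m ε)]
    ring
  rw [e1, ← integral_const_mul, ← integral_indicator (measurableSet_cut ε)]
  congr 1
  funext τ
  by_cases hτ : ε < |τ|
  · rw [cutKernel, cutKernel, Set.indicator_of_mem (show τ ∈ {τ : ℝ | ε < |τ|} from hτ),
      Set.indicator_of_mem (show -τ ∈ {τ : ℝ | ε < |τ|} by simpa using hτ),
      Set.indicator_of_mem (show τ ∈ {τ : ℝ | ε < |τ|} from hτ), wave_neg_right, gauss_neg,
      dirichletKernel]
    have h0 : (τ : ℂ) ≠ 0 := by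
      have : 0 < |τ| := hε.trans hτ
      exact_mod_cast abs_pos.1 this
    push_cast
    field_simp
    ring
  · rw [cutKernel, cutKernel, Set.indicator_of_notMem (show τ ∉ {τ : ℝ | ε < |τ|} from hτ),
      Set.indicator_of_notMem (show -τ ∉ {τ : ℝ | ε < |τ|} by simpa using hτ),
      Set.indicator_of_notMem (show τ ∉ {τ : ℝ | ε < |τ|} from hτ)]
    simp

lemma tendsto_integral_cutKernel (m : ℝ) :
    Tendsto (fun ε => ∫ τ, cutKernel m ε τ) (𝓝[>] 0) (𝓝 (dirichlet m)) := by
  have h : Tendsto (fun ε => ∫ τ in {τ : ℝ | ε < |τ|}, dirichletKernel m τ) (𝓝[>] 0)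
      (𝓝 (dirichlet m)) := by
    simp only [← integral_indicator (measurableSet_cut _)]
    have hi := integrable_dirichletKernel m
    refine tendsto_integral_filter_of_dominated_convergence (fun p => ‖dirichletKernel m p‖)
      (Eventually.of_forall fun ε => hi.aestronglyMeasurable.indicator (measurableSet_cut ε))
      (Eventually.of_forall fun ε => ae_of_all _ fun p => norm_indicator_le_norm_self _ p) hi.norm ?_
    have hne : ∀ᵐ τ : ℝ, τ ≠ 0 := by simp [ae_iff]
    filter_upwards [hne] with p hp
    refine tendsto_const_nhds.congr' ?_
    filter_upwards [Ioo_mem_nhdsGT (abs_pos.2 hp)] with ε hε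
    exact (Set.indicator_of_mem (show p ∈ {τ : ℝ | ε < |τ|} from hε.2) _).symm
  refine h.congr' ?_
  filter_upwards [self_mem_nhdsWithin] with ε hε using (integral_cutKernel m hε).symm

end DIII
end

/-! ### Singular kernels on the plane and limits of their principal values -/

noncomputable section
set_option linter.unusedSectionVars false
namespace DIII
open MeasureTheory Filter

/-- Continuous kernels on the plane with rapid decay and a Lipschitz bound at the diagonal. -/
structure IsKernel (M : ℝ) (G : ℝ × ℝ → ℂ) : Prop where
  continuous : Continuous G
  bound : ∀ p, ‖G p‖ ≤ M * ((1 + p.1 ^ 2)⁻¹ * (1 + p.2 ^ 2)⁻¹)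
  lip : ∀ p, |p.1 - p.2| ≤ 1 → ‖G p - G (p.2, p.2)‖ ≤ M * |p.1 - p.2| * (1 + p.2 ^ 2)⁻¹

lemma inv_one_add_sq_le_one (t : ℝ) : (1 + t ^ 2)⁻¹ ≤ 1 :=
  inv_le_one_of_one_le₀ (by linarith [sq_nonneg t])

lemma IsTest.mul_isKernel {M N : ℝ} {f g : ℝ → ℂ} (hf : IsTest M f) (hg : IsTest N g) :
    IsKernel (M * N) fun p => f p.1 * g p.2 where
  continuous := (hf.continuous.comp continuous_fst).mul (hg.continuous.comp continuous_snd)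
  bound p := by
    have := hf.nonneg
    rw [norm_mul]
    calc _ ≤ (M * (1 + p.1 ^ 2)⁻¹) * (N * (1 + p.2 ^ 2)⁻¹) := by
          gcongr
          exacts [hf.bound _, hg.bound _]
      _ = _ := by ring
  lip p hp := by
    have := hf.nonneg
    have := hg.nonneg
    rw [← sub_mul, norm_mul]
    calc _ ≤ (M * |p.1 - p.2| * (1 + p.2 ^ 2)⁻¹) * (N * 1) := by
          gcongr
          · exact hf.lip _ _ hp
          · exact (hg.bound _).trans (by gcongr; exact inv_one_add_sq_le_one _)
      _ = _ := by ring

namespace IsKernel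

variable {M N : ℝ} {G H : ℝ × ℝ → ℂ}

lemma nonneg (hG : IsKernel M G) : 0 ≤ M := by
  have := (norm_nonneg _).trans (hG.bound 0)
  simpa using this

lemma add (hG : IsKernel M G) (hH : IsKernel N H) : IsKernel (M + N) fun p => G p + H p where
  continuous := hG.continuous.add hH.continuous
  bound p := (norm_add_le _ _).trans ((add_le_add (hG.bound p) (hH.bound p)).trans_eq (by ring))
  lip p hp := by
    rw [add_sub_add_comm]
    exact (norm_add_le _ _).trans ((add_le_add (hG.lip p hp) (hH.lip p hp)).trans_eq (by ring))

lemma zero : IsKernel 0 fun _ => 0 where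
  continuous := continuous_const
  bound p := by simp
  lip p _ := by simp

lemma sum {ι : Type*} {s : Finset ι} {M : ι → ℝ} {G : ι → ℝ × ℝ → ℂ}
    (h : ∀ i ∈ s, IsKernel (M i) (G i)) : IsKernel (∑ i ∈ s, M i) fun p => ∑ i ∈ s, G i p := by
  classical
  induction s using Finset.induction_on with
  | empty => simpa using zero
  | insert i s hi ih =>
    simp only [Finset.sum_insert hi]
    exact (h i (Finset.mem_insert_self i s)).add
      (ih fun j hj => h j (Finset.mem_insert_of_mem hj))

lemma sub (hG : IsKernel M G) (hH : IsKernel N H) : IsKernel (M + N) fun p => G p - H p where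
  continuous := hG.continuous.sub hH.continuous
  bound p := (norm_sub_le _ _).trans ((add_le_add (hG.bound p) (hH.bound p)).trans_eq (by ring))
  lip p hp := by
    rw [sub_sub_sub_comm]
    exact (norm_sub_le _ _).trans ((add_le_add (hG.lip p hp) (hH.lip p hp)).trans_eq (by ring))

/-- Bounds with a common constant pass to pointwise limits; continuity does not and is required
separately. -/
lemma of_tendsto {Gn : ℕ → ℝ × ℝ → ℂ} (hn : ∀ n, IsKernel M (Gn n)) (hG : Continuous G)
    (hlim : ∀ p, Tendsto (fun n => Gn n p) atTop (𝓝 (G p))) : IsKernel M G where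
  continuous := hG
  bound p := le_of_tendsto (hlim p).norm (Eventually.of_forall fun n => (hn n).bound p)
  lip p hp := le_of_tendsto ((hlim p).sub (hlim (p.2, p.2))).norm
    (Eventually.of_forall fun n => (hn n).lip p hp)

lemma const_mul (hG : IsKernel M G) (c : ℂ) : IsKernel (‖c‖ * M) fun p => c * G p where
  continuous := continuous_const.mul hG.continuous
  bound p := by
    rw [norm_mul, mul_assoc]
    exact mul_le_mul_of_nonneg_left (hG.bound p) (norm_nonneg c)
  lip p hp := by
    rw [← mul_sub, norm_mul, mul_assoc, mul_assoc, ← mul_assoc M]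
    exact mul_le_mul_of_nonneg_left (hG.lip p hp) (norm_nonneg c)

lemma integrable_weight : Integrable fun p : ℝ × ℝ => (1 + p.1 ^ 2)⁻¹ * (1 + p.2 ^ 2)⁻¹ :=
  integrable_inv_one_add_sq.mul_prod integrable_inv_one_add_sq

lemma integrable (hG : IsKernel M G) : Integrable G :=
  (integrable_weight.const_mul M).mono' hG.continuous.aestronglyMeasurable (ae_of_all _ hG.bound)

lemma norm_diag_le (hG : IsKernel M G) (t : ℝ) : ‖G (t, t)‖ ≤ M * (1 + t ^ 2)⁻¹ := by
  have := hG.nonneg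
  refine (hG.bound (t, t)).trans ?_
  gcongr
  exact mul_le_of_le_one_left (by positivity) (inv_one_add_sq_le_one t)

lemma continuous_diag (hG : IsKernel M G) : Continuous fun t => G (t, t) :=
  hG.continuous.comp (by fun_prop)

lemma integrable_diag (hG : IsKernel M G) : Integrable fun t => G (t, t) :=
  (integrable_inv_one_add_sq.const_mul M).mono' hG.continuous_diag.aestronglyMeasurable
    (ae_of_all _ hG.norm_diag_le)

end IsKernel

/-- The regularised singular integrand without the oscillating factor. -/
def subKernel (G : ℝ × ℝ → ℂ) (p : ℝ × ℝ) : ℂ :=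
  (G p - G (p.2, p.2) * gauss (p.1 - p.2)) / ((p.1 : ℂ) - p.2)

/-- A bound of the regularised integrand. -/
def subBound (M : ℝ) (p : ℝ × ℝ) : ℝ :=
  M * ((1 + p.1 ^ 2)⁻¹ * (1 + p.2 ^ 2)⁻¹ + 4 * ((1 + (p.1 - p.2) ^ 2)⁻¹ * (1 + p.2 ^ 2)⁻¹))

lemma integrable_subBound (M : ℝ) : Integrable (subBound M) := by
  refine (IsKernel.integrable_weight.add (Integrable.const_mul ?_ 4)).const_mul M
  have := integrable_inv_one_add_sq.convolution_integrand (ContinuousLinearMap.mul ℝ ℝ)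
    integrable_inv_one_add_sq
  rw [Measure.volume_eq_prod]
  simpa only [ContinuousLinearMap.mul_apply', mul_comm] using this

section Kernel

variable {M : ℝ} {G : ℝ × ℝ → ℂ}

/-- Near the diagonal the Lipschitz bound and 1 - e^{-τ²} ≤ τ² cancel the singularity. Away from it
the denominator exceeds 1 and each term is integrable, the Gaussian providing decay in τ. -/
lemma IsKernel.norm_subKernel_le (hG : IsKernel M G) (p : ℝ × ℝ) :
    ‖subKernel G p‖ ≤ subBound M p := by
  have hM := hG.nonneg
  obtain ⟨s, t⟩ := p
  set τ := s - t with hτ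
  have hd := hG.norm_diag_le t
  have hnorm : ‖(s : ℂ) - t‖ = |τ| := by
    rw [← Complex.ofReal_sub, Complex.norm_real, Real.norm_eq_abs]
  have hb : subBound M (s, t) =
      M * ((1 + s ^ 2)⁻¹ * (1 + t ^ 2)⁻¹ + 4 * ((1 + τ ^ 2)⁻¹ * (1 + t ^ 2)⁻¹)) := rfl
  rw [hb, subKernel, norm_div, hnorm]
  have hA : 0 ≤ (1 + s ^ 2)⁻¹ * (1 + t ^ 2)⁻¹ := by positivity
  rcases le_or_gt |τ| 1 with h1 | h1
  · have e : G (s, t) - G (t, t) * gauss τ =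
        (G (s, t) - G (t, t)) + G (t, t) * (1 - gauss τ) := by ring
    have h2 : ‖G (s, t) - G (t, t) * gauss τ‖ ≤ 2 * M * (1 + t ^ 2)⁻¹ * |τ| := by
      rw [e]
      refine (norm_add_le _ _).trans ?_
      rw [norm_mul]
      have h3 : ‖1 - gauss τ‖ ≤ |τ| := by
        refine (norm_one_sub_gauss_le τ).trans ?_
        rw [← sq_abs]; nlinarith [abs_nonneg τ]
      calc _ ≤ M * |τ| * (1 + t ^ 2)⁻¹ + M * (1 + t ^ 2)⁻¹ * |τ| := by
            gcongr
            exact hG.lip (s, t) h1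
        _ = _ := by ring
    -- For |τ| ≤ 1 the weight (1+τ²)⁻¹ is at least 1/2, which is why `subBound` carries the factor
    -- 4.
    have h3 : 2 * M * (1 + t ^ 2)⁻¹ ≤
        M * ((1 + s ^ 2)⁻¹ * (1 + t ^ 2)⁻¹ + 4 * ((1 + τ ^ 2)⁻¹ * (1 + t ^ 2)⁻¹)) := by
      have h4 : (2 : ℝ)⁻¹ ≤ (1 + τ ^ 2)⁻¹ := by
        gcongr
        rw [← sq_abs]; nlinarith [abs_nonneg τ]
      have h5 : 0 ≤ (1 + t ^ 2)⁻¹ := by positivity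
      have h6 := mul_le_mul_of_nonneg_right h4 h5
      nlinarith [mul_nonneg hM hA, mul_le_mul_of_nonneg_left h6 hM]
    refine le_trans ?_ h3
    rcases eq_or_ne τ 0 with h0 | h0
    · rw [h0, abs_zero, div_zero]; positivity
    · rw [div_le_iff₀ (abs_pos.2 h0)]
      exact h2
  · have h2 : ‖G (s, t) - G (t, t) * gauss τ‖ ≤
        M * ((1 + s ^ 2)⁻¹ * (1 + t ^ 2)⁻¹) + M * (1 + t ^ 2)⁻¹ * (1 + τ ^ 2)⁻¹ := by
      refine (norm_sub_le _ _).trans ?_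
      rw [norm_mul]
      gcongr
      exacts [hG.bound (s, t), norm_gauss_le τ]
    have h3 : 0 ≤ M * (1 + t ^ 2)⁻¹ * (1 + τ ^ 2)⁻¹ := by positivity
    refine (div_le_self (norm_nonneg _) h1.le).trans (h2.trans ?_)
    linarith

lemma IsKernel.aestronglyMeasurable_subKernel (hG : IsKernel M G) :
    AEStronglyMeasurable (subKernel G) volume := by
  have h1 := hG.continuous.measurable
  have h2 := hG.continuous_diag.measurable
  have h3 := continuous_gauss.measurable
  have : Measurable (subKernel G) := by
    unfold subKernel
    exact (h1.sub ((h2.comp measurable_snd).mul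
      (h3.comp (measurable_fst.sub measurable_snd)))).div (by fun_prop)
  exact this.aestronglyMeasurable

lemma IsKernel.integrable_subKernel (hG : IsKernel M G) : Integrable (subKernel G) :=
  (integrable_subBound M).mono' hG.aestronglyMeasurable_subKernel
    (ae_of_all _ hG.norm_subKernel_le)

lemma aestronglyMeasurable_wave (m : ℝ) :
    AEStronglyMeasurable (fun p : ℝ × ℝ => wave m (p.1 - p.2)) volume :=
  ((continuous_wave m).comp (by fun_prop)).aestronglyMeasurable

lemma integrable_wave_mul {F : ℝ × ℝ → ℂ} (hF : Integrable F) (m : ℝ) :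
    Integrable fun p : ℝ × ℝ => wave m (p.1 - p.2) * F p :=
  hF.norm.mono' ((aestronglyMeasurable_wave m).mul hF.aestronglyMeasurable)
    (ae_of_all _ fun p => by rw [norm_mul, norm_wave, one_mul])

/-- The principal value of `e^{im(s-t)} G(s, t) / (s - t)`. -/
def reg (m : ℝ) (G : ℝ × ℝ → ℂ) : ℂ :=
  (∫ p : ℝ × ℝ, wave m (p.1 - p.2) * subKernel G p) + dirichlet m * ∫ t, G (t, t)

/-- Subtracting the diagonal value times a Gaussian in s - t leaves an integrable function; the
subtracted part factorises into the cut Dirichlet integral and the integral over the diagonal. -/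
lemma IsKernel.hasPV_wave (hG : IsKernel M G) (m : ℝ) :
    HasPV (fun s t => wave m (s - t) * G (s, t)) (reg m G) := by
  have h1 := integrable_wave_mul hG.integrable_subKernel m
  have h2 := (tendsto_integral_offDiag h1).add
    ((tendsto_integral_cutKernel m).mul_const (∫ t, G (t, t)))
  refine h2.congr' ?_
  filter_upwards [self_mem_nhdsWithin] with ε hε
  have h3 := integrable_diff_mul (integrable_cutKernel m hε) hG.integrable_diag
  rw [← integral_diff_mul (integrable_cutKernel m hε) hG.integrable_diag,
    ← integral_indicator (measurableSet_offDiag ε), ← integral_add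
      (h1.indicator (measurableSet_offDiag ε)) h3]
  change _ = ∫ w in offDiag ε, wave m (w.1 - w.2) * G (w.1, w.2) / ((w.1 : ℂ) - w.2)
  rw [← integral_indicator (measurableSet_offDiag ε)]
  congr 1
  funext p
  by_cases hp : p ∈ offDiag ε
  · rw [Set.indicator_of_mem hp, Set.indicator_of_mem hp, cutKernel,
      Set.indicator_of_mem (show p.1 - p.2 ∈ {τ : ℝ | ε < |τ|} from hp), subKernel]
    push_cast
    ring
  · rw [Set.indicator_of_notMem hp, Set.indicator_of_notMem hp, cutKernel,
      Set.indicator_of_notMem (show p.1 - p.2 ∉ {τ : ℝ | ε < |τ|} from hp)]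
    ring

lemma IsKernel.integrableOn_offDiag (hG : IsKernel M G) (m : ℝ) {ε : ℝ} (hε : 0 < ε) :
    IntegrableOn (fun w : ℝ × ℝ => wave m (w.1 - w.2) * G (w.1, w.2) / ((w.1 : ℂ) - w.2))
      (offDiag ε) := by
  have h1 := integrable_wave_mul hG.integrable m
  refine (h1.norm.const_mul ε⁻¹).integrableOn.mono' ?_ ?_
  · refine AEStronglyMeasurable.restrict ?_
    have h2 : Measurable fun w : ℝ × ℝ => (w.1 : ℂ) - w.2 := by fun_prop
    have h3 := ((continuous_wave m).comp (continuous_fst.sub continuous_snd)).mul hG.continuous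
    exact (h3.measurable.div h2).aestronglyMeasurable
  · refine (ae_restrict_iff' (measurableSet_offDiag ε)).2 (ae_of_all _ fun p hp => ?_)
    have hp' : ε < |p.1 - p.2| := hp
    rw [norm_div, div_eq_inv_mul, ← Complex.ofReal_sub, Complex.norm_real, Real.norm_eq_abs]
    gcongr

lemma hasPV_sum {ι : Type*} [Fintype ι] {m : ι → ℝ} {M : ι → ℝ} {G : ι → ℝ × ℝ → ℂ}
    (hG : ∀ i, IsKernel (M i) (G i)) :
    HasPV (fun s t => ∑ i, wave (m i) (s - t) * G i (s, t)) (∑ i, reg (m i) (G i)) := by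
  have h := tendsto_finsetSum Finset.univ fun i _ => (hG i).hasPV_wave (m i)
  refine h.congr' ?_
  filter_upwards [self_mem_nhdsWithin] with ε hε
  change ∑ i, ∫ w in offDiag ε, wave (m i) (w.1 - w.2) * G i (w.1, w.2) / ((w.1 : ℂ) - w.2) =
    ∫ w in offDiag ε, (∑ i, wave (m i) (w.1 - w.2) * G i (w.1, w.2)) / ((w.1 : ℂ) - w.2)
  rw [← integral_finsetSum _ fun i _ => (hG i).integrableOn_offDiag (m i) hε]
  simp only [Finset.sum_div]

lemma HasPV.const_mul {K : ℝ → ℝ → ℂ} {S : ℂ} (h : HasPV K S) (c : ℂ) :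
    HasPV (fun s t => c * K s t) (c * S) := by
  refine (Tendsto.const_mul c h).congr fun ε => ?_
  rw [← integral_const_mul]
  congr 1
  funext w
  rw [mul_div_assoc]

/-- When the quotient is integrable the principal value is the ordinary integral; equality off the
diagonal suffices. -/
lemma hasPV_of_integrable {K : ℝ → ℝ → ℂ} {F : ℝ × ℝ → ℂ} (hF : Integrable F)
    (h : ∀ s t, s ≠ t → K s t / ((s : ℂ) - t) = F (s, t)) : HasPV K (∫ p, F p) := by
  refine (tendsto_integral_offDiag hF).congr' ?_
  filter_upwards [self_mem_nhdsWithin] with ε hε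
  refine setIntegral_congr_fun (measurableSet_offDiag ε) fun p hp => ?_
  refine (h p.1 p.2 ?_).symm
  rintro he
  have hp' : ε < |p.1 - p.2| := hp
  rw [he, sub_self, abs_zero] at hp'
  exact lt_asymm hε hp'

/-! ### Limits of principal values -/

variable {Gn : ℕ → ℝ × ℝ → ℂ} {m : ℕ → ℝ}

lemma tendsto_integral_diag (hn : ∀ n, IsKernel M (Gn n))
    (hlim : ∀ p, Tendsto (fun n => Gn n p) atTop (𝓝 (G p))) :
    Tendsto (fun n => ∫ t, Gn n (t, t)) atTop (𝓝 (∫ t, G (t, t))) :=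
  tendsto_integral_of_dominated_convergence _
    (fun n => (hn n).continuous_diag.aestronglyMeasurable)
    (integrable_inv_one_add_sq.const_mul M) (fun n => ae_of_all _ (hn n).norm_diag_le)
    (ae_of_all _ fun t => hlim (t, t))

lemma tendsto_integral_norm_subKernel_sub (hG : IsKernel M G) (hn : ∀ n, IsKernel M (Gn n))
    (hlim : ∀ p, Tendsto (fun n => Gn n p) atTop (𝓝 (G p))) :
    Tendsto (fun n => ∫ p, ‖subKernel (Gn n) p - subKernel G p‖) atTop (𝓝 0) := by
  have h := tendsto_integral_of_dominated_convergence (μ := volume)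
    (F := fun n p => ‖subKernel (Gn n) p - subKernel G p‖) (f := fun _ => (0 : ℝ))
    (fun p => subBound M p + subBound M p)
    (fun n => ((hn n).aestronglyMeasurable_subKernel.sub hG.aestronglyMeasurable_subKernel).norm)
    ((integrable_subBound M).add (integrable_subBound M))
    (fun n => ae_of_all _ fun p => ?_) (ae_of_all _ fun p => ?_)
  · simpa using h
  · rw [norm_norm]
    exact (norm_sub_le _ _).trans (add_le_add ((hn n).norm_subKernel_le p) (hG.norm_subKernel_le p))
  · have h1 : Tendsto (fun n => subKernel (Gn n) p) atTop (𝓝 (subKernel G p)) :=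
      ((hlim p).sub ((hlim (p.2, p.2)).mul_const _)).div_const _
    have := (h1.sub_const (subKernel G p)).norm
    simpa using this

/-- Two oscillating integrals with close amplitudes are close. -/
lemma tendsto_integral_wave_sub (hG : IsKernel M G) (hn : ∀ n, IsKernel M (Gn n))
    (hlim : ∀ p, Tendsto (fun n => Gn n p) atTop (𝓝 (G p))) :
    Tendsto (fun n => (∫ p : ℝ × ℝ, wave (m n) (p.1 - p.2) * subKernel (Gn n) p) -
      ∫ p : ℝ × ℝ, wave (m n) (p.1 - p.2) * subKernel G p) atTop (𝓝 0) := by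
  refine squeeze_zero_norm (fun n => ?_) (tendsto_integral_norm_subKernel_sub hG hn hlim)
  have h1 := (hn n).integrable_subKernel
  have h2 := hG.integrable_subKernel
  rw [← integral_sub (integrable_wave_mul h1 _) (integrable_wave_mul h2 _)]
  refine norm_integral_le_of_norm_le (h1.sub h2).norm (ae_of_all _ fun p => ?_)
  rw [← mul_sub, norm_mul, norm_wave, one_mul]

/-- The Riemann-Lebesgue lemma for oscillation in the difference of the variables. -/
lemma tendsto_integral_wave_cobounded (F : ℝ × ℝ → ℂ)
    (hm : Tendsto (fun n => |m n|) atTop atTop) :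
    Tendsto (fun n => ∫ p : ℝ × ℝ, wave (m n) (p.1 - p.2) * F p) atTop (𝓝 0) := by
  set d : StrongDual ℝ (ℝ × ℝ) := ContinuousLinearMap.fst ℝ ℝ ℝ - ContinuousLinearMap.snd ℝ ℝ ℝ
    with hd
  have hd0 : 0 < ‖d‖ := by
    rw [norm_pos_iff]
    intro h
    have := congrArg (fun f : StrongDual ℝ (ℝ × ℝ) => f (1, 0)) h
    simp [hd] at this
  have h1 : Tendsto (fun n => (-(m n / (2 * Real.pi))) • d) atTop
      (cocompact (StrongDual ℝ (ℝ × ℝ))) := by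
    rw [← Metric.cobounded_eq_cocompact, ← tendsto_norm_atTop_iff_cobounded]
    have h2 := (hm.atTop_div_const (by positivity : 0 < 2 * Real.pi)).atTop_mul_const hd0
    refine h2.congr fun n => ?_
    rw [norm_smul, norm_neg, norm_div, Real.norm_eq_abs,
      Real.norm_of_nonneg (by positivity : 0 ≤ 2 * Real.pi)]
  have h3 := (tendsto_integral_exp_smul_cocompact F (volume : Measure (ℝ × ℝ))).comp h1
  refine h3.congr fun n => ?_
  refine integral_congr_ae (ae_of_all _ fun p => ?_)
  have e : (Real.fourierChar (-(((-(m n / (2 * Real.pi))) • d) p)) : ℂ) =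
      wave (m n) (p.1 - p.2) := by
    rw [Real.fourierChar_apply, wave]
    congr 1
    simp only [hd, _root_.smul_apply, _root_.sub_apply,
      ContinuousLinearMap.coe_fst', ContinuousLinearMap.coe_snd', smul_eq_mul]
    have := Real.pi_ne_zero
    rw [show 2 * Real.pi * -(-(m n / (2 * Real.pi)) * (p.1 - p.2)) = m n * (p.1 - p.2) by
      field_simp]
    push_cast
    ring
  simp only
  rw [Circle.smul_def, e, smul_eq_mul]

/-- Without oscillation the diagonal term vanishes by oddness, and the remainder converges by
domination. -/
lemma tendsto_reg_zero (hG : IsKernel M G) (hn : ∀ n, IsKernel M (Gn n))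
    (hlim : ∀ p, Tendsto (fun n => Gn n p) atTop (𝓝 (G p))) :
    Tendsto (fun n => reg 0 (Gn n)) atTop (𝓝 (reg 0 G)) := by
  have h := (tendsto_integral_wave_sub (m := fun _ => 0) hG hn hlim).add_const
    (∫ p : ℝ × ℝ, wave 0 (p.1 - p.2) * subKernel G p)
  simp only [sub_add_cancel, zero_add] at h
  simpa only [reg, dirichlet_zero, zero_mul, add_zero] using h

lemma tendsto_reg_of_dirichlet (hG : IsKernel M G) (hn : ∀ n, IsKernel M (Gn n))
    (hlim : ∀ p, Tendsto (fun n => Gn n p) atTop (𝓝 (G p)))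
    (hm : Tendsto (fun n => |m n|) atTop atTop) {c : ℂ}
    (hc : Tendsto (fun n => dirichlet (m n)) atTop (𝓝 c)) :
    Tendsto (fun n => reg (m n) (Gn n)) atTop (𝓝 (c * ∫ t, G (t, t))) := by
  have h1 := (tendsto_integral_wave_sub (m := m) hG hn hlim).add
    (tendsto_integral_wave_cobounded (subKernel G) hm)
  simp only [sub_add_cancel, zero_add] at h1
  have h2 := h1.add (hc.mul (tendsto_integral_diag hn hlim))
  rwa [zero_add] at h2

/-- The kernel e^{imτ}/τ tends to πi δ(τ): the integrable remainder dies by Riemann–Lebesgue,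
although the kernels vary with n, because they converge with a common bound. -/
lemma tendsto_reg_atTop (hG : IsKernel M G) (hn : ∀ n, IsKernel M (Gn n))
    (hlim : ∀ p, Tendsto (fun n => Gn n p) atTop (𝓝 (G p))) (hm : Tendsto m atTop atTop) :
    Tendsto (fun n => reg (m n) (Gn n)) atTop (𝓝 (Real.pi * Complex.I * ∫ t, G (t, t))) :=
  tendsto_reg_of_dirichlet hG hn hlim (tendsto_abs_atTop_atTop.comp hm) (tendsto_dirichlet.comp hm)

lemma tendsto_reg_neg_atTop (hG : IsKernel M G) (hn : ∀ n, IsKernel M (Gn n))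
    (hlim : ∀ p, Tendsto (fun n => Gn n p) atTop (𝓝 (G p))) (hm : Tendsto m atTop atTop) :
    Tendsto (fun n => reg (-m n) (Gn n)) atTop (𝓝 (-(Real.pi * Complex.I) * ∫ t, G (t, t))) := by
  refine tendsto_reg_of_dirichlet hG hn hlim ?_ ?_
  · simp only [abs_neg]
    exact tendsto_abs_atTop_atTop.comp hm
  · simp only [dirichlet_neg]
    exact (tendsto_dirichlet.comp hm).neg

end Kernel
end DIII
end

noncomputable section
set_option linter.unusedSectionVars false
namespace DIII
open MeasureTheory Filter
open scoped Matrix.Norms.Operator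

variable {r : ℕ} {u : Potential r}

/-! ### The bracket of the smeared scattering matrix -/

/-- A tensor between the inverse right and the left Jost solutions. -/
def jostForm (u : Potential r) (M : Mat2 r) (s t x : ℝ) : Mat2 r :=
  (jostInv u s x ⊗ₖ jostInv u t x) * M * (jostSol u s x ⊗ₖ jostSol u t x)

/-- A tensor between the propagators in the rotating frame. -/
def flowForm (u : Potential r) (M : Mat2 r) (s t x : ℝ) : Mat2 r :=
  (flowTop (rotCoef u s) x ⊗ₖ flowTop (rotCoef u t) x) * M *
    (flowBot (rotCoef u s) x ⊗ₖ flowBot (rotCoef u t) x)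

lemma Decays.hasDerivAt_jostInv (hu : Decays u) (t x : ℝ) :
    HasDerivAt (jostInv u t) (-(jostInv u t x * coef u t x)) x := by
  convert! (hasDerivAt_flowTop (continuous_rotCoef hu.continuous t) (hu.integrable_rotCoef t) x).mul
    (hasDerivAt_phase x (-t)) using 1
  have e : rotCoef u t x * phase r x (-t) = phase r x (-t) * (Complex.I • Q u x) := by
    rw [rotCoef, mul_assoc, phase_mul_phase_neg, mul_one]
  rw [neg_mul, mul_assoc (flowTop _ _), e, J_mul_phase, jostInv, coef, U]
  simp only [mul_assoc, smul_sub, mul_sub, smul_smul, Matrix.mul_smul, Complex.ofReal_neg, mul_neg,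
    neg_smul, neg_neg]
  abel

lemma Decays.hasDerivAt_jostSol (hu : Decays u) (t x : ℝ) :
    HasDerivAt (jostSol u t) (coef u t x * jostSol u t x) x := by
  convert! (hasDerivAt_phase x t).mul
    (hasDerivAt_flowBot (continuous_rotCoef hu.continuous t) (hu.integrable_rotCoef t) x) using 1
  have e : phase r x t * rotCoef u t x = (Complex.I • Q u x) * phase r x t := by
    rw [rotCoef, ← mul_assoc, ← mul_assoc, phase_mul_phase_neg, one_mul]
  rw [← mul_assoc (phase r x t), e, jostSol, coef, U]
  simp only [mul_assoc, smul_sub, sub_mul, smul_smul, Matrix.smul_mul, neg_mul]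
  abel

/-- The same computation as for the transition matrices, with Jost solutions in place of the
propagators to the end points. -/
lemma Decays.hasDerivAt_jostForm (hu : Decays u) {s t : ℝ} (h : s ≠ t) (x : ℝ) :
    HasDerivAt (jostForm u (rMatrix r (s - t)) s t)
      ((-Complex.I) • jostForm u (piZeroJ r) s t x) x := by
  convert! ((hasDerivAt_kronecker (hu.hasDerivAt_jostInv s x) (hu.hasDerivAt_jostInv t x)).mul_const
    (rMatrix r (s - t))).mul
    (hasDerivAt_kronecker (hu.hasDerivAt_jostSol s x) (hu.hasDerivAt_jostSol t x)) using 1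
  have e : coef u s x ⊗ₖ 1 + 1 ⊗ₖ coef u t x =
      Complex.I • (U u s x ⊗ₖ 1 + 1 ⊗ₖ U u t x) := by
    rw [coef, coef, Matrix.smul_kronecker, Matrix.kronecker_smul, smul_add]
  have e1 : (-(jostInv u s x * coef u s x)) ⊗ₖ jostInv u t x +
      jostInv u s x ⊗ₖ (-(jostInv u t x * coef u t x)) =
      -((jostInv u s x ⊗ₖ jostInv u t x) * (coef u s x ⊗ₖ 1 + 1 ⊗ₖ coef u t x)) := by
    rw [mul_add, ← Matrix.mul_kronecker_mul, ← Matrix.mul_kronecker_mul, mul_one, mul_one]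
    ext ⟨a, c⟩ ⟨b, d⟩
    simp only [Matrix.neg_apply, Matrix.add_apply, Matrix.kroneckerMap_apply]
    ring
  have e2 : (coef u s x * jostSol u s x) ⊗ₖ jostSol u t x +
      jostSol u s x ⊗ₖ (coef u t x * jostSol u t x) =
      (coef u s x ⊗ₖ 1 + 1 ⊗ₖ coef u t x) * (jostSol u s x ⊗ₖ jostSol u t x) := by
    rw [add_mul, ← Matrix.mul_kronecker_mul, ← Matrix.mul_kronecker_mul, one_mul, one_mul]
  have hc := rMatrix_comm_U u (z := s) (w := t) (by exact_mod_cast h) x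
  rw [e1, e2, jostForm, neg_eq_iff_eq_neg.1 hc.symm, e]
  simp only [Matrix.mul_smul, Matrix.smul_mul, neg_smul, mul_neg, neg_mul, smul_neg, mul_sub,
    sub_mul, smul_sub, mul_assoc]
  abel

lemma phase_kronecker_apply (M : Mat2 r) (s t x : ℝ) (a b c d : Idx r) :
    ((phase r x (-s) ⊗ₖ phase r x (-t)) * M * (phase r x s ⊗ₖ phase r x t)) (a, c) (b, d) =
      Complex.exp (Complex.I * x * (s * (sgn a - sgn b) + t * (sgn c - sgn d))) *
        M (a, c) (b, d) := by
  rw [phase, phase, phase, phase, Matrix.diagonal_kronecker_diagonal,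
    Matrix.diagonal_kronecker_diagonal, Matrix.mul_diagonal, Matrix.diagonal_mul, mul_right_comm,
    ← Complex.exp_add, ← Complex.exp_add, ← Complex.exp_add]
  congr 2
  push_cast
  ring

/-- The entries of `casimirZero` preserve the J-weight of each factor and do not oscillate. Those of
`piPlus` and `piMinus` shift the two weights in opposite directions, so the phase depends on s - t
only. -/
lemma phase_casimir_phase (s t x : ℝ) :
    (phase r x (-s) ⊗ₖ phase r x (-t)) * casimir r * (phase r x s ⊗ₖ phase r x t) =
      casimirZero r + (wave (2 * x) (s - t) • piPlus r + wave (-(2 * x)) (s - t) • piMinus r) := by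
  rw [casimir_eq, mul_add, mul_add, add_mul, add_mul]
  congr 1
  · ext ⟨a, c⟩ ⟨b, d⟩
    rw [phase_kronecker_apply]
    rcases casimirZero_apply a b c d with h | ⟨h1, h2⟩
    · rw [h, mul_zero]
    · simp [h1, h2]
  congr 1
  · ext ⟨a, c⟩ ⟨b, d⟩
    rw [phase_kronecker_apply, Matrix.smul_apply, smul_eq_mul, wave]
    rcases piPlus_apply a b c d with h | ⟨⟨h1, h2⟩, h3, h4⟩
    · rw [h, mul_zero, mul_zero]
    · rw [h1, h2, h3, h4]; congr 2; push_cast; ring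
  · ext ⟨a, c⟩ ⟨b, d⟩
    rw [phase_kronecker_apply, Matrix.smul_apply, smul_eq_mul, wave]
    rcases piMinus_apply a b c d with h | ⟨⟨h1, h2⟩, h3, h4⟩
    · rw [h, mul_zero, mul_zero]
    · rw [h1, h2, h3, h4]; congr 2; push_cast; ring

lemma jostForm_casimir (u : Potential r) (s t x : ℝ) :
    jostForm u (casimir r) s t x = flowForm u (casimirZero r) s t x +
      (wave (2 * x) (s - t) • flowForm u (piPlus r) s t x +
        wave (-(2 * x)) (s - t) • flowForm u (piMinus r) s t x) := by
  have h := phase_casimir_phase (r := r) s t x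
  calc _ = (flowTop (rotCoef u s) x ⊗ₖ flowTop (rotCoef u t) x) *
        ((phase r x (-s) ⊗ₖ phase r x (-t)) * casimir r * (phase r x s ⊗ₖ phase r x t)) *
        (flowBot (rotCoef u s) x ⊗ₖ flowBot (rotCoef u t) x) := by
        rw [jostForm, jostInv, jostInv, jostSol, jostSol, Matrix.mul_kronecker_mul,
          Matrix.mul_kronecker_mul]
        simp only [mul_assoc]
    _ = _ := by
        rw [h]
        simp only [flowForm, mul_add, add_mul, Matrix.mul_smul, Matrix.smul_mul]

/-- A matrix element of a tensor between the propagators, with test functions. -/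
def formKernel (h k : ℝ → ℂ) (u : Potential r) (M : Mat2 r) (a b c d : Idx r) (x : ℝ)
    (p : ℝ × ℝ) : ℂ := h p.1 * k p.2 * flowForm u M p.1 p.2 x (a, c) (b, d)

lemma Decays.exists_isKernel_formKernel (hu : Decays u) {h k : ℝ → ℂ} {M₁ M₂ : ℝ}
    (hh : IsTest M₁ h) (hk : IsTest M₂ k) (M : Mat2 r) (a b c d : Idx r) :
    ∃ C, ∀ x, IsKernel C (formKernel h k u M a b c d x) := by
  obtain ⟨N₁, h1⟩ := hu.exists_isTest_elemKernel hh
  obtain ⟨N₂, h2⟩ := hu.exists_isTest_elemKernel hk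
  refine ⟨∑ q : (Idx r × Idx r) × (Idx r × Idx r), ‖M q.1 q.2‖ * (N₁ * N₂), fun x => ?_⟩
  have e : formKernel h k u M a b c d x = fun p => ∑ q : (Idx r × Idx r) × (Idx r × Idx r),
      M q.1 q.2 * (elemKernel h u x a q.1.1 q.2.1 b p.1 * elemKernel k u x c q.1.2 q.2.2 d p.2) := by
    funext p
    rw [formKernel, flowForm, mul_mul_apply_eq_sum, Finset.mul_sum]
    refine Finset.sum_congr rfl fun q _ => ?_
    simp only [Matrix.kroneckerMap_apply, elemKernel]
    ring
  rw [e]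
  exact IsKernel.sum fun q _ => ((h1 x a q.1.1 q.2.1 b).mul_isKernel
    (h2 x c q.1.2 q.2.2 d)).const_mul (M q.1 q.2)

/-- The limit of `formKernel` at `+∞`. -/
def topKernel (h k : ℝ → ℂ) (u : Potential r) (M : Mat2 r) (a b c d : Idx r) (p : ℝ × ℝ) : ℂ :=
  h p.1 * k p.2 * (M * (scattering u p.1 ⊗ₖ scattering u p.2)) (a, c) (b, d)

/-- The limit of `formKernel` at `-∞`. -/
def botKernel (h k : ℝ → ℂ) (u : Potential r) (M : Mat2 r) (a b c d : Idx r) (p : ℝ × ℝ) : ℂ :=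
  h p.1 * k p.2 * ((scattering u p.1 ⊗ₖ scattering u p.2) * M) (a, c) (b, d)

lemma tendsto_kronecker {l : Filter ℝ} {A B : ℝ → Mat r} {A' B' : Mat r}
    (hA : Tendsto A l (𝓝 A')) (hB : Tendsto B l (𝓝 B')) :
    Tendsto (fun x => A x ⊗ₖ B x) l (𝓝 (A' ⊗ₖ B')) :=
  tendsto_pi_nhds.2 fun ⟨a, c⟩ => tendsto_pi_nhds.2 fun ⟨b, d⟩ =>
    (tendsto_pi_nhds.1 (tendsto_pi_nhds.1 hA a) b).mul
      (tendsto_pi_nhds.1 (tendsto_pi_nhds.1 hB c) d)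

lemma tendsto_formKernel {l : Filter ℝ} {s t : ℝ} {A B A' B' : Mat r}
    (hA : Tendsto (flowTop (rotCoef u s)) l (𝓝 A)) (hB : Tendsto (flowTop (rotCoef u t)) l (𝓝 B))
    (hA' : Tendsto (flowBot (rotCoef u s)) l (𝓝 A'))
    (hB' : Tendsto (flowBot (rotCoef u t)) l (𝓝 B')) (h k : ℝ → ℂ) (M : Mat2 r) (a b c d : Idx r) :
    Tendsto (fun x => formKernel h k u M a b c d x (s, t)) l
      (𝓝 (h s * k t * ((A ⊗ₖ B) * M * (A' ⊗ₖ B')) (a, c) (b, d))) :=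
  ((tendsto_pi_nhds.1 (tendsto_pi_nhds.1 (((tendsto_kronecker hA hB).mul_const M).mul
    (tendsto_kronecker hA' hB')) (a, c)) (b, d))).const_mul _

lemma Decays.tendsto_formKernel_atTop (hu : Decays u) (h k : ℝ → ℂ) (M : Mat2 r) (a b c d : Idx r)
    (p : ℝ × ℝ) : Tendsto (fun n : ℕ => formKernel h k u M a b c d n p) atTop
      (𝓝 (topKernel h k u M a b c d p)) := by
  have h1 := fun t => tendsto_flowTop_atTop (continuous_rotCoef hu.continuous t)
    (hu.integrable_rotCoef t)
  have h2 := fun t => tendsto_flowBot_atTop (continuous_rotCoef hu.continuous t)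
    (hu.integrable_rotCoef t)
  simp only [← scattering_eq hu] at h2
  have := tendsto_formKernel (h1 p.1) (h1 p.2) (h2 p.1) (h2 p.2) h k M a b c d
  rw [Matrix.one_kronecker_one, one_mul] at this
  exact this.comp tendsto_natCast_atTop_atTop

lemma Decays.tendsto_formKernel_atBot (hu : Decays u) (h k : ℝ → ℂ) (M : Mat2 r) (a b c d : Idx r)
    (p : ℝ × ℝ) : Tendsto (fun n : ℕ => formKernel h k u M a b c d (-n) p) atTop
      (𝓝 (botKernel h k u M a b c d p)) := by
  have h1 := fun t => tendsto_flowTop_atBot (continuous_rotCoef hu.continuous t)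
    (hu.integrable_rotCoef t)
  have h2 := fun t => tendsto_flowBot_atBot (continuous_rotCoef hu.continuous t)
    (hu.integrable_rotCoef t)
  simp only [← scattering_eq hu] at h1
  have := tendsto_formKernel (h1 p.1) (h1 p.2) (h2 p.1) (h2 p.2) h k M a b c d
  rw [Matrix.one_kronecker_one, mul_one] at this
  exact this.comp (tendsto_neg_atTop_atBot.comp tendsto_natCast_atTop_atTop)

lemma Decays.continuous_scattering_kronecker (hu : Decays u) :
    Continuous fun p : ℝ × ℝ => scattering u p.1 ⊗ₖ scattering u p.2 :=
  continuous_pi fun ⟨a, c⟩ => continuous_pi fun ⟨b, d⟩ =>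
    ((continuous_entry hu.continuous_scattering a b).comp continuous_fst).mul
      ((continuous_entry hu.continuous_scattering c d).comp continuous_snd)

lemma Decays.continuous_topKernel (hu : Decays u) {h k : ℝ → ℂ} (hh : Continuous h)
    (hk : Continuous k) (M : Mat2 r) (a b c d : Idx r) : Continuous (topKernel h k u M a b c d) :=
  ((hh.comp continuous_fst).mul (hk.comp continuous_snd)).mul
    (continuous_entry (continuous_const.mul hu.continuous_scattering_kronecker) _ _)

lemma Decays.continuous_botKernel (hu : Decays u) {h k : ℝ → ℂ} (hh : Continuous h)
    (hk : Continuous k) (M : Mat2 r) (a b c d : Idx r) : Continuous (botKernel h k u M a b c d) :=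
  ((hh.comp continuous_fst).mul (hk.comp continuous_snd)).mul
    (continuous_entry (hu.continuous_scattering_kronecker.mul continuous_const) _ _)

/-- The density of the bracket before the integration over the spectral parameters. -/
def bracketDensity (h k : ℝ → ℂ) (u : Potential r) (a b c d : Idx r) (x : ℝ) (p : ℝ × ℝ) : ℂ :=
  ∑ q : Pairs r, (gradDensity h u a b (Sum.inl q) (p.1, x) *
      gradDensity k u c d (Sum.inr q) (p.2, x) -
    gradDensity h u a b (Sum.inr q) (p.1, x) * gradDensity k u c d (Sum.inl q) (p.2, x))

lemma bracketDensity_eq (h k : ℝ → ℂ) (u : Potential r) (a b c d : Idx r) (x : ℝ) (p : ℝ × ℝ) :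
    bracketDensity h k u a b c d x p =
      -(h p.1 * k p.2 * jostForm u (piZeroJ r) p.1 p.2 x (a, c) (b, d)) := by
  have := sum_gen_mul_sub (jostInv u p.1 x) (jostInv u p.2 x) (jostSol u p.1 x) (jostSol u p.2 x)
    a b c d
  rw [jostForm, ← mul_neg, ← this, bracketDensity, Finset.mul_sum]
  refine Finset.sum_congr rfl fun q _ => ?_
  simp only [gradDensity]
  ring

section Bracket

variable {h k : ℝ → ℂ} {M₁ M₂ : ℝ}

lemma Decays.continuous_bracketDensity (hu : Decays u) (hh : Continuous h) (hk : Continuous k)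
    (a b c d : Idx r) :
    Continuous fun y : ℝ × (ℝ × ℝ) => bracketDensity h k u a b c d y.1 y.2 := by
  have c1 : Continuous fun y : ℝ × (ℝ × ℝ) => (y.2.1, y.1) := by fun_prop
  have c2 : Continuous fun y : ℝ × (ℝ × ℝ) => (y.2.2, y.1) := by fun_prop
  have h1 := fun e => (hu.continuous_gradDensity hh a b e).comp c1
  have h2 := fun e => (hu.continuous_gradDensity hk c d e).comp c2
  exact continuous_finsetSum _ fun q _ => ((h1 _).mul (h2 _)).sub ((h1 _).mul (h2 _))

lemma Decays.exists_norm_bracketDensity_le (hu : Decays u) (hh : IsTest M₁ h) (hk : IsTest M₂ k)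
    (a b c d : Idx r) : ∃ C, ∀ x p, ‖bracketDensity h k u a b c d x p‖ ≤
      C * ((1 + p.1 ^ 2)⁻¹ * (1 + p.2 ^ 2)⁻¹) := by
  obtain ⟨N₁, h1⟩ := hu.exists_isTest_gradAmplitude hh a b
  obtain ⟨N₂, h2⟩ := hu.exists_isTest_gradAmplitude hk c d
  refine ⟨∑ _q : Pairs r, 2 * (N₁ * N₂), fun x p => ?_⟩
  rw [bracketDensity, Finset.sum_mul]
  refine (norm_sum_le _ _).trans (Finset.sum_le_sum fun q _ => ?_)
  have h3 : ∀ e e', ‖gradDensity h u a b e (p.1, x) * gradDensity k u c d e' (p.2, x)‖ ≤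
      (N₁ * (1 + p.1 ^ 2)⁻¹) * (N₂ * (1 + p.2 ^ 2)⁻¹) := fun e e' => by
    rw [norm_mul]
    exact mul_le_mul (norm_gradDensity_le h1 e p.1 x) (norm_gradDensity_le h2 e' p.2 x)
      (norm_nonneg _) ((norm_nonneg _).trans (norm_gradDensity_le h1 e p.1 x))
  exact (norm_sub_le _ _).trans ((add_le_add (h3 _ _) (h3 _ _)).trans_eq (by ring))

/-- A product of integrals over the two spectral parameters is a double integral, by absolute
integrability of each gradient density. -/
lemma Decays.sum_smearedGrad_eq (hu : Decays u) (hh : IsTest M₁ h) (hk : IsTest M₂ k)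
    (a b c d : Idx r) (x : ℝ) :
    ∑ q : Pairs r, (smearedGrad h u a b x (Sum.inl q) * smearedGrad k u c d x (Sum.inr q) -
      smearedGrad h u a b x (Sum.inr q) * smearedGrad k u c d x (Sum.inl q)) =
      ∫ p, bracketDensity h k u a b c d x p := by
  obtain ⟨N₁, h1⟩ := hu.exists_isTest_gradAmplitude hh a b
  obtain ⟨N₂, h2⟩ := hu.exists_isTest_gradAmplitude hk c d
  have i1 : ∀ e, Integrable fun t => gradDensity h u a b e (t, x) := fun e =>
    (integrable_inv_one_add_sq.const_mul N₁).mono' ((hu.continuous_gradDensity hh.continuous a b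
      e).comp (Continuous.prodMk_left x)).aestronglyMeasurable
      (ae_of_all _ fun t => norm_gradDensity_le h1 e t x)
  have i2 : ∀ e, Integrable fun t => gradDensity k u c d e (t, x) := fun e =>
    (integrable_inv_one_add_sq.const_mul N₂).mono' ((hu.continuous_gradDensity hk.continuous c d
      e).comp (Continuous.prodMk_left x)).aestronglyMeasurable
      (ae_of_all _ fun t => norm_gradDensity_le h2 e t x)
  have i3 := fun e e' => (i1 e).mul_prod (i2 e')
  have e3 : ∀ e e', smearedGrad h u a b x e * smearedGrad k u c d x e' =
      ∫ p : ℝ × ℝ, gradDensity h u a b e (p.1, x) * gradDensity k u c d e' (p.2, x) :=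
    fun e e' => (integral_prod_mul (μ := volume) (ν := volume)
      (fun t => gradDensity h u a b e (t, x)) (fun t => gradDensity k u c d e' (t, x))).symm
  simp only [e3, bracketDensity]
  refine Eq.trans ?_ (integral_finsetSum _ fun q _ => (i3 (Sum.inl q) (Sum.inr q)).sub
    (i3 (Sum.inr q) (Sum.inl q))).symm
  exact Finset.sum_congr rfl fun q _ => (integral_sub (i3 _ _) (i3 _ _)).symm

lemma Decays.integrable_bracketDensity (hu : Decays u) (hh : IsTest M₁ h) (hk : IsTest M₂ k)
    (a b c d : Idx r) (N : ℝ) :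
    Integrable (Function.uncurry (bracketDensity h k u a b c d))
      ((volume.restrict (Set.uIoc (-N) N)).prod volume) := by
  obtain ⟨C, hC⟩ := hu.exists_norm_bracketDensity_le hh hk a b c d
  have h1 : Integrable (fun _ : ℝ => (1 : ℝ)) (volume.restrict (Set.uIoc (-N) N)) :=
    integrableOn_const (by simp [Set.uIoc])
  refine (h1.mul_prod (IsKernel.integrable_weight.const_mul C)).mono'
    (hu.continuous_bracketDensity hh.continuous hk.continuous a b c d).aestronglyMeasurable
    (ae_of_all _ fun y => ?_)
  rw [one_mul]
  exact hC y.1 y.2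

/-- The principal value of the boundary terms of the bracket. -/
def boundaryValue (h k : ℝ → ℂ) (u : Potential r) (a b c d : Idx r) (N : ℝ) : ℂ :=
  -- The terms are grouped by frequency. Since the phase changes sign with x, `piPlus` at N shares
  -- its frequency with `piMinus` at -N.
  reg 0 (fun p => formKernel h k u (casimirZero r) a b c d N p -
      formKernel h k u (casimirZero r) a b c d (-N) p) +
    reg (2 * N) (fun p => formKernel h k u (piPlus r) a b c d N p -
      formKernel h k u (piMinus r) a b c d (-N) p) +
    reg (-(2 * N)) (fun p => formKernel h k u (piMinus r) a b c d N p -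
      formKernel h k u (piPlus r) a b c d (-N) p)

lemma Decays.hasPV_boundaryValue (hu : Decays u) (hh : IsTest M₁ h) (hk : IsTest M₂ k)
    (a b c d : Idx r) (N : ℝ) : HasPV (fun s t => h s * k t *
      (jostForm u (casimir r) s t N - jostForm u (casimir r) s t (-N)) (a, c) (b, d))
      (boundaryValue h k u a b c d N) := by
  obtain ⟨C₀, h0⟩ := hu.exists_isKernel_formKernel hh hk (casimirZero r) a b c d
  obtain ⟨C₁, h1⟩ := hu.exists_isKernel_formKernel hh hk (piPlus r) a b c d
  obtain ⟨C₂, h2⟩ := hu.exists_isKernel_formKernel hh hk (piMinus r) a b c d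
  have := hasPV_sum (m := ![0, 2 * N, -(2 * N)]) (M := ![C₀ + C₀, C₁ + C₂, C₂ + C₁])
    (G := ![fun p => formKernel h k u (casimirZero r) a b c d N p -
      formKernel h k u (casimirZero r) a b c d (-N) p,
      fun p => formKernel h k u (piPlus r) a b c d N p -
      formKernel h k u (piMinus r) a b c d (-N) p,
      fun p => formKernel h k u (piMinus r) a b c d N p -
      formKernel h k u (piPlus r) a b c d (-N) p]) (Fin.forall_fin_succ.2
        ⟨(h0 N).sub (h0 (-N)), Fin.forall_fin_two.2 ⟨(h1 N).sub (h2 (-N)), (h2 N).sub (h1 (-N))⟩⟩)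
  simp only [Fin.sum_univ_three] at this
  refine Eq.subst (motive := fun K => HasPV K _) ?_ this
  funext s t
  symm
  change _ = wave 0 (s - t) * (_ - _) + wave (2 * N) (s - t) * (_ - _) +
    wave (-(2 * N)) (s - t) * (_ - _)
  rw [jostForm_casimir, jostForm_casimir, wave_zero_left]
  simp only [formKernel, Matrix.sub_apply, Matrix.add_apply, Matrix.smul_apply, smul_eq_mul,
    mul_neg, neg_neg]
  ring

lemma jostForm_rMatrix (u : Potential r) (z : ℂ) (s t x : ℝ) (a b : Idx r × Idx r) :
    jostForm u (rMatrix r z) s t x a b = -(1 / (2 * z)) * jostForm u (casimir r) s t x a b := by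
  rw [jostForm, jostForm, rMatrix, Matrix.mul_smul, Matrix.smul_mul, Matrix.smul_apply, smul_eq_mul]

lemma Decays.hasDerivAt_jostForm_apply (hu : Decays u) (h k : ℝ → ℂ) (a b c d : Idx r) {s t : ℝ}
    (hst : s ≠ t) (x : ℝ) : HasDerivAt (fun x => -(Complex.I * (h s * k t)) *
      (-(1 / (2 * ((s : ℂ) - t))) * jostForm u (casimir r) s t x (a, c) (b, d)))
      (bracketDensity h k u a b c d x (s, t)) x := by
  have h1 := (hasDerivAt_matrix.1 (hu.hasDerivAt_jostForm hst x) (a, c) (b, d)).const_mul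
    (-(Complex.I * (h s * k t)))
  simp only [jostForm_rMatrix] at h1
  refine h1.congr_deriv ?_
  rw [bracketDensity_eq, Matrix.smul_apply, smul_eq_mul]
  generalize jostForm u (piZeroJ r) s t x (a, c) (b, d) = X
  linear_combination (h s * k t * X) * Complex.I_mul_I

/-- For s ≠ t the density is the x-derivative of the r-matrix between Jost solutions. The quotient
of the boundary terms by s - t is thus an integral over x, which does not blow up on the diagonal.
-/
lemma Decays.integral_bracketDensity (hu : Decays u) (hh : Continuous h) (hk : Continuous k)
    (a b c d : Idx r) (N : ℝ) {s t : ℝ} (hst : s ≠ t) :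
    h s * k t * (jostForm u (casimir r) s t N - jostForm u (casimir r) s t (-N)) (a, c) (b, d) /
      ((s : ℂ) - t) =
      -(2 * Complex.I) * ∫ x in (-N)..N, bracketDensity h k u a b c d x (s, t) := by
  have hne : (s : ℂ) - t ≠ 0 := sub_ne_zero.2 (by exact_mod_cast hst)
  have hc : Continuous fun x : ℝ => (x, (s, t)) := by fun_prop
  have hcont := (hu.continuous_bracketDensity hh hk a b c d).comp hc
  simp only [Function.comp_def] at hcont
  rw [intervalIntegral.integral_eq_sub_of_hasDerivAt
    (fun x _ => hu.hasDerivAt_jostForm_apply h k a b c d hst x) (hcont.intervalIntegrable _ _),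
    Matrix.sub_apply]
  generalize jostForm u (casimir r) s t N (a, c) (b, d) = B
  generalize jostForm u (casimir r) s t (-N) (a, c) (b, d) = B'
  generalize (s : ℂ) - t = δ at *
  generalize h s * k t = H
  field_simp
  linear_combination (H * (B - B')) * Complex.I_sq

/-- The boundary terms divided by s - t are integrable as a whole, so their ordinary integral equals
the principal value. Only the latter can be computed summand by summand. -/
lemma Decays.intervalIntegral_bracket (hu : Decays u) (hh : IsTest M₁ h) (hk : IsTest M₂ k)
    (a b c d : Idx r) (N : ℝ) :
    Complex.I * ∫ x in (-N)..N, ∫ p, bracketDensity h k u a b c d x p =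
      -(1 / 2) * boundaryValue h k u a b c d N := by
  have hi := hu.integrable_bracketDensity hh hk a b c d N
  have hF : Integrable fun p => -(2 * Complex.I) *
      ∫ x in (-N)..N, bracketDensity h k u a b c d x p := by
    refine Integrable.const_mul ?_ _
    simp only [intervalIntegral.intervalIntegral_eq_integral_uIoc]
    exact hi.integral_prod_right.smul (_ : ℝ)
  have h1 := hasPV_of_integrable hF fun s t hst => hu.integral_bracketDensity hh.continuous
    hk.continuous a b c d N hst
  have h2 := tendsto_nhds_unique (hu.hasPV_boundaryValue hh hk a b c d N) h1
  rw [h2, integral_const_mul, intervalIntegral_integral_swap hi]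
  ring

/-- Supplies the common constant that the limit theorems for `reg` need: the kernel bounds are
uniform in x. -/
lemma Decays.exists_isKernel_limit (hu : Decays u) (hh : IsTest M₁ h) (hk : IsTest M₂ k)
    (M M' : Mat2 r) (a b c d : Idx r) : ∃ C,
      (∀ n : ℕ, IsKernel C fun p => formKernel h k u M a b c d n p -
        formKernel h k u M' a b c d (-n) p) ∧
      IsKernel C (fun p => topKernel h k u M a b c d p - botKernel h k u M' a b c d p) ∧
      ∀ p, Tendsto (fun n : ℕ => formKernel h k u M a b c d n p -
        formKernel h k u M' a b c d (-n) p) atTop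
        (𝓝 (topKernel h k u M a b c d p - botKernel h k u M' a b c d p)) := by
  obtain ⟨C, hC⟩ := hu.exists_isKernel_formKernel hh hk M a b c d
  obtain ⟨C', hC'⟩ := hu.exists_isKernel_formKernel hh hk M' a b c d
  have h1 : ∀ n : ℕ, IsKernel (C + C') fun p => formKernel h k u M a b c d n p -
      formKernel h k u M' a b c d (-n) p := fun n => (hC n).sub (hC' (-n))
  have h2 := fun p => (hu.tendsto_formKernel_atTop h k M a b c d p).sub
    (hu.tendsto_formKernel_atBot h k M' a b c d p)
  exact ⟨C + C', h1, .of_tendsto h1 ((hu.continuous_topKernel hh.continuous hk.continuous M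
    a b c d).sub (hu.continuous_botKernel hh.continuous hk.continuous M' a b c d)) h2, h2⟩

/-- The three frequencies 0, 2n and -2n give the principal value, πi δ and -πi δ respectively. -/
lemma Decays.tendsto_boundaryValue (hu : Decays u) (hh : IsTest M₁ h) (hk : IsTest M₂ k)
    (a b c d : Idx r) : Tendsto (fun n : ℕ => boundaryValue h k u a b c d n) atTop
      (𝓝 (reg 0 (fun p => topKernel h k u (casimirZero r) a b c d p -
          botKernel h k u (casimirZero r) a b c d p) +
        Real.pi * Complex.I * (∫ t, (topKernel h k u (piPlus r) a b c d (t, t) -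
          botKernel h k u (piMinus r) a b c d (t, t))) +
        -(Real.pi * Complex.I) * ∫ t, (topKernel h k u (piMinus r) a b c d (t, t) -
          botKernel h k u (piPlus r) a b c d (t, t)))) := by
  have hm : Tendsto (fun n : ℕ => 2 * (n : ℝ)) atTop atTop :=
    tendsto_natCast_atTop_atTop.const_mul_atTop two_pos
  obtain ⟨C₀, a0, b0, c0⟩ := hu.exists_isKernel_limit hh hk (casimirZero r) (casimirZero r) a b c d
  obtain ⟨C₁, a1, b1, c1⟩ := hu.exists_isKernel_limit hh hk (piPlus r) (piMinus r) a b c d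
  obtain ⟨C₂, a2, b2, c2⟩ := hu.exists_isKernel_limit hh hk (piMinus r) (piPlus r) a b c d
  exact ((tendsto_reg_zero b0 a0 c0).add (tendsto_reg_atTop b1 a1 c1 hm)).add
    (tendsto_reg_neg_atTop b2 a2 c2 hm)

end Bracket

end DIII
end

/-! ### The bracket of smeared scattering matrices -/

noncomputable section
set_option linter.unusedSectionVars false
namespace DIII
open MeasureTheory Filter

variable {r : ℕ} {u : Potential r}

/-- The bracket is the limit of its truncations to [-n, n], because the gradients are
square-integrable. The non-oscillating part of the limit is the pairing with `rPV`; the two delta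
terms combine into Π_{0J} acting on both sides of T⊗T. -/
theorem exists_hasRPairing_hasLineBracket (hu : u ∈ schwartzSpace r) (h k : SchwartzMap ℝ ℂ)
    (a b c d : Idx r) : ∃ S : ℂ, HasRPairing (scattering u) h k a b c d S ∧
      HasLineBracket (smeared h a b) (smeared k c d) u S := by
  obtain ⟨M₁, hh⟩ := exists_isTest_schwartz h
  obtain ⟨M₂, hk⟩ := exists_isTest_schwartz k
  have hd := decays_of_mem_schwartzSpace hu
  have hf := hasVarDeriv_smeared hu h a b
  have hg := hasVarDeriv_smeared hu k c d
  refine ⟨_, ?_, .of_pairing hf hg rfl⟩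
  have h1 := (intervalIntegral_tendsto_integral (integrable_pairing hf.1 hg.1)
    (tendsto_neg_atTop_atBot.comp tendsto_natCast_atTop_atTop)
    (tendsto_natCast_atTop_atTop (R := ℝ))).const_mul Complex.I
  simp only [hd.sum_smearedGrad_eq hh hk, Function.comp_apply,
    hd.intervalIntegral_bracket hh hk] at h1
  -- Both sides are limits of the same truncated brackets: one by integrability over the line, the
  -- other through the boundary terms.
  have h2 := tendsto_nhds_unique h1
    ((hd.tendsto_boundaryValue hh hk a b c d).const_mul (-(1 / 2)))
  simp only [← hd.sum_smearedGrad_eq hh hk] at h2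
  obtain ⟨C, hC⟩ := hd.exists_isKernel_limit hh hk (casimirZero r) (casimirZero r) a b c d
  refine ⟨-(1 / 2) * reg 0 (fun p => topKernel h k u (casimirZero r) a b c d p -
    botKernel h k u (casimirZero r) a b c d p), ?_, ?_⟩
  · convert (hC.2.1.hasPV_wave 0).const_mul (-(1 / 2)) using 1
    funext s t
    rw [wave_zero_left, topKernel, botKernel, rPV]
    simp only [Matrix.smul_mul, Matrix.mul_smul, Matrix.sub_apply, Matrix.smul_apply, smul_eq_mul]
    ring
  · obtain ⟨C₁, -, h3, -⟩ := hd.exists_isKernel_limit hh hk (piPlus r) (piMinus r) a b c d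
    obtain ⟨C₂, -, h4, -⟩ := hd.exists_isKernel_limit hh hk (piMinus r) (piPlus r) a b c d
    have e : ∀ t, h t * k t * (rDeltaPlus r * (scattering u t ⊗ₖ scattering u t) -
        (scattering u t ⊗ₖ scattering u t) * rDeltaMinus r) (a, c) (b, d) =
        -(Complex.I * Real.pi / 2) * ((topKernel h k u (piPlus r) a b c d (t, t) -
          botKernel h k u (piMinus r) a b c d (t, t)) -
          (topKernel h k u (piMinus r) a b c d (t, t) -
          botKernel h k u (piPlus r) a b c d (t, t))) := fun t => by
      rw [rDeltaPlus, rDeltaMinus, piZeroJ_eq, topKernel, topKernel, botKernel, botKernel]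
      simp only [Matrix.smul_mul, Matrix.mul_smul, Matrix.sub_apply, Matrix.smul_apply, smul_eq_mul,
        sub_mul, mul_sub]
      ring
    simp only [e]
    rw [integral_const_mul, integral_sub h3.integrable_diag h4.integrable_diag, pairing, h2]
    ring

end DIII
end

open DIII

theorem mainTheorem5 (r : ℕ) :
    -- the fundamental solution is what its name says
    (∀ u : Potential r, Continuous u → ∀ (z : ℂ) (y : ℝ),
      IsTransition u z y (fun x => transition u x y z)) ∧
    -- brackets of the matrix elements of `T(x, y, z)` and of `T_L(z)`, periodic potentials
    (∀ L : ℝ, 0 < L → ∀ u ∈ periodicSpace r L, ∀ z w : ℂ, z ≠ w →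
      (∀ x y : ℝ, -L ≤ y → y ≤ x → x ≤ L → ∀ a b c d : Idx r,
        HasPeriodicBracket L (fun v => transition v x y z a b) (fun v => transition v x y w c d) u
          ((rMatrix r (z - w) * (transition u x y z ⊗ₖ transition u x y w) -
            (transition u x y z ⊗ₖ transition u x y w) * rMatrix r (z - w)) (a, c) (b, d))) ∧
      (∀ a b c d : Idx r,
        HasPeriodicBracket L (fun v => monodromy L z v a b) (fun v => monodromy L w v c d) u
          ((rMatrix r (z - w) * (monodromy L z u ⊗ₖ monodromy L w u) -
            (monodromy L z u ⊗ₖ monodromy L w u) * rMatrix r (z - w)) (a, c) (b, d)))) ∧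
    -- the determinants of the diagonal blocks Poisson-commute
    (∀ L : ℝ, 0 < L → ∀ u ∈ periodicSpace r L, ∀ z w : ℂ,
      HasPeriodicBracket L (fun v => (aPlus (monodromy L z v)).det)
        (fun v => (aPlus (monodromy L w v)).det) u 0 ∧
      HasPeriodicBracket L (fun v => (cMinus (monodromy L z v)).det)
        (fun v => (cMinus (monodromy L w v)).det) u 0 ∧
      HasPeriodicBracket L (fun v => (aMinus (monodromy L z v)).det)
        (fun v => (aMinus (monodromy L w v)).det) u 0 ∧
      HasPeriodicBracket L (fun v => (cPlus (monodromy L z v)).det)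
        (fun v => (cPlus (monodromy L w v)).det) u 0) ∧
    -- the local integrals: `I_{L,k}` has density `ρ k`, `J_{L,k}` has density `σ k`, and
    -- `β k`, `γ k` are the contributions of the end points to the expansions
    (∃ ρ σ β γ : ℕ → DiffPoly r,
      (∀ k, MvPolynomial.constantCoeff (β k) = 0 ∧ MvPolynomial.constantCoeff (γ k) = 0) ∧
      (∀ L : ℝ, 0 < L → ∀ u ∈ periodicSpace r L,
        (∀ δ : ℝ, 0 < δ →
          HasExpansion (upperSector δ)
            (fun z => Complex.log
              (Complex.exp (2 * Complex.I * r * z * L) * (aPlus (monodromy L z u)).det))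
            (fun k => localIntegral (ρ k) L u + (β k).evalAt u L) ∧
          HasExpansion (lowerSector δ)
            (fun z => -Complex.log
              (Complex.exp (-(2 * Complex.I * r * z * L)) * (cMinus (monodromy L z u)).det))
            (fun k => localIntegral (ρ k) L u - (β k).evalAt u L) ∧
          HasExpansion (upperSector δ)
            (fun z => Complex.log
              (Complex.exp (2 * Complex.I * r * z * L) * (cPlus (monodromy L z u)).det))
            (fun k => localIntegral (σ k) L u + (γ k).evalAt u L) ∧
          HasExpansion (lowerSector δ)
            (fun z => -Complex.log
              (Complex.exp (-(2 * Complex.I * r * z * L)) * (aMinus (monodromy L z u)).det))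
            (fun k => localIntegral (σ k) L u - (γ k).evalAt u L)) ∧
        (∀ k p : ℕ, 1 ≤ k → 1 ≤ p →
          HasPeriodicBracket L (localIntegral (ρ k) L) (localIntegral (ρ p) L) u 0 ∧
          HasPeriodicBracket L (localIntegral (ρ k) L) (localIntegral (σ p) L) u 0 ∧
          HasPeriodicBracket L (localIntegral (σ k) L) (localIntegral (σ p) L) u 0)) ∧
      -- the limits of the local integrals on the line
      (∃ I J : ℕ → Potential r → ℂ,
        (∀ u ∈ schwartzSpace r, ∀ k : ℕ, 1 ≤ k →
          Filter.Tendsto (fun L : ℝ => localIntegral (ρ k) L u) Filter.atTop (𝓝 (I k u)) ∧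
          Filter.Tendsto (fun L : ℝ => localIntegral (σ k) L u) Filter.atTop (𝓝 (J k u))) ∧
        (∀ u ∈ schwartzSpace r, ∀ k p : ℕ, 1 ≤ k → 1 ≤ p →
          HasLineBracket (I k) (I p) u 0 ∧
          HasLineBracket (I k) (J p) u 0 ∧
          HasLineBracket (J k) (J p) u 0))) ∧
    -- the scattering matrix on the line is the limit of the transition matrices, and the brackets
    -- of its matrix elements
    (∀ u ∈ schwartzSpace r,
      (∀ t : ℝ, IsJostRight u t (jostRight u t) ∧ IsJostLeft u t (jostLeft u t) ∧
        (∀ x : ℝ, jostLeft u t x = jostRight u t x * scattering u t) ∧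
        Filter.Tendsto
          (fun xy : ℝ × ℝ => (E r xy.1 t)⁻¹ * transition u xy.1 xy.2 t * E r xy.2 t)
          (Filter.atTop ×ˢ Filter.atBot) (𝓝 (scattering u t))) ∧
      (∀ (h k : SchwartzMap ℝ ℂ) (a b c d : Idx r), ∃ S : ℂ,
        HasRPairing (scattering u) h k a b c d S ∧
        HasLineBracket (smeared h a b) (smeared k c d) u S)) := by
  refine ⟨fun u hu z y => isTransition_transition hu z y, ?_, ?_, ?_, ?_⟩
  · intro L hL u hu z w hzw
    have h := fun x y h1 h2 h3 a b c d =>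
      hasPeriodicBracket_transition (L := L) (x := x) (y := y) hu hzw h1 h2 h3 a b c d
    exact ⟨h, fun a b c d => h L (-L) le_rfl (by linarith) le_rfl a b c d⟩
  · intro L hL u hu z w
    exact hasPeriodicBracket_det hL hu z w
  -- One family of densities and one of end-point terms serve both pairs of blocks, by orthogonality
  -- of T_L.
  · refine ⟨rhoPoly r, rhoPoly r, betaPoly r, betaPoly r,
      fun k => ⟨constantCoeff_betaPoly r k, constantCoeff_betaPoly r k⟩,
      fun L hL u hu => ⟨fun δ hδ => ⟨hasExpansion_aPlus hL hu hδ, hasExpansion_cMinus hL hu hδ,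
        hasExpansion_cPlus hL hu hδ, hasExpansion_aMinus hL hu hδ⟩, fun k p _ _ => ?_⟩,
      lineIntegral r, lineIntegral r, fun u hu k _ => ?_, fun u hu k p _ _ => ?_⟩
    · have := hasPeriodicBracket_localIntegral hL hu k p
      exact ⟨this, this, this⟩
    · exact ⟨tendsto_localIntegral hu k, tendsto_localIntegral hu k⟩
    · have := hasLineBracket_lineIntegral hu k p
      exact ⟨this, this, this⟩
  · intro u hu
    have hd := decays_of_mem_schwartzSpace hu
    exact ⟨fun t => ⟨isJostRight_jostRight hd t, isJostLeft_jostLeft hd t, jostLeft_eq hd t,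
      tendsto_transition hd t⟩, exists_hasRPairing_hasLineBracket hu⟩
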